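/- **Setting.** Let $k$ be a field of characteristic $0$. Let $Q$ and $R$ be essentially smooth $k$-algebras (formally smooth and essentially of finite type), let $f\in Q$, $g\in R$, and let $Z\subseteq\operatorname{Spec}Q$, $W\subseteq\operatorname{Spec}R$ be closed. Write $f+g$ for $f\otimes1+1\otimes g\in Q\otimes_kR$, and let $Z\times W\subseteq\operatorname{Spec}(Q\otimes_kR)$ be the closed set of primes contracting into $Z$ and into $W$. All complexes are $\mathbb Z/2$-graded; $D(-)$ denotes the derived category of $\mathbb Z/2$-graded complexes of modules, i.e. the localization at the quasi-isomorphisms. **Matrix factorizations.** $mf(Q,f)$ is the differential $\mathbb Z/2$-graded category whose objects are pairs $P=(P,\delta)$ of a finitely generated projective $\mathbb Z/2$-graded $Q$-module $P$ and an odd $Q$-linear $\delta$ with $\delta^2=f$; morphisms are all $Q$-linear maps, with $\partial\alpha=\delta\alpha-(-1)^{|\alpha|}\alpha\delta$. The support of $P$ is the set of primes $\mathfrak p$ for which $P_{\mathfrak p}$ is not contractible, and $mf^Z(Q,f)$ is the full subcategory of the $P$ with support contained in $Z$. For $P\in mf(Q,f)$, $P'\in mf(R,g)$, the tensor product $P\otimes_kP'$,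 with $\delta\otimes1+1\otimes\delta'$ (Koszul signs), is an object of $mf(Q\otimes_kR,f+g)$; this gives a dg functor $mf^Z(Q,f)\otimes_kmf^W(R,g)\to mf^{Z\times W}(Q\otimes_kR,f+g)$. **Hochschild complex.** For a differential $\mathbb Z/2$-graded category $\mathcal C$, $HH(\mathcal C)$ is the direct sum, over $n\ge0$ and objects $X_0,\dots,X_n$, of the spaces spanned by $\alpha_0[\alpha_1|\cdots|\alpha_n]=\alpha_0\otimes s\alpha_1\otimes\cdots\otimes s\alpha_n$ with $\alpha_i\in\operatorname{Hom}(X_{i+1},X_i)$, $X_{n+1}=X_0$, of degree $|\alpha_0|+\sum_{i\ge1}(|\alpha_i|-1)$, with $b=b_2+b_1$, where $$b_1(\alpha_0[\alpha_1|\cdots|\alpha_n])=\partial\alpha_0[\alpha_1|\cdots|\alpha_n]+\sum_{j=1}^n(-1)^{|\alpha_0|+\cdots+|\alpha_{j-1}|-j}\alpha_0[\alpha_1|\cdots|\partial\alpha_j|\cdots|\alpha_n],$$ $$b_2(\alpha_0[\alpha_1|\cdots|\alpha_n])=(-1)^{|\alpha_0|}\alpha_0\alpha_1[\alpha_2|\cdots|\alpha_n]+\sum_{j=1}^{n-1}(-1)^{|\alpha_0|+\cdots+|\alpha_j|-j}\alpha_0[\alpha_1|\cdots|\alpha_j\alpha_{j+1}|\cdots|\alpha_n]-(-1)^{(|\alpha_n|-1)(|\alpha_0|+\cdots+|\alpha_{n-1}|-(n-1))}\alpha_n\alpha_0[\alpha_1|\cdots|\alpha_{n-1}]$$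 (and $b_2=0$ for $n=0$). For $\mathcal C=mf^Z(Q,f)$ it is a complex of $Q$-modules, $Q$ acting on $\alpha_0$. **The pairing $\tilde\star$.** The chain map $$-\,\tilde\star\,-:HH(mf^Z(Q,f))\otimes_kHH(mf^W(R,g))\to HH(mf^{Z\times W}(Q\otimes_kR,f+g))$$ is the Künneth map followed by the map induced by the tensor product of matrix factorizations: $\alpha_0[\alpha_1|\cdots|\alpha_n]\,\tilde\star\,\beta_0[\beta_1|\cdots|\beta_m]=\sum\pm(\alpha_0\otimes\beta_0)[\cdots]$, the sum being over all shuffles of the letters $\alpha_1\otimes1,\dots,\alpha_n\otimes1$ with the letters $1\otimes\beta_1,\dots,1\otimes\beta_m$, with the signs of the Koszul rule (letters inside the brackets having degree shifted by one). **Forms and local cohomology.** $(\Omega^\bullet_{Q/k},-df)$ is the exterior algebra on $\Omega^1_{Q/k}$, graded by the parity of the degree of forms, with differential $\omega\mapsto-df\wedge\omega$. For closed $V=V(s_1,\dots,s_m)\subseteq\operatorname{Spec}Q$ and a complex $M$ of $Q$-modules, $\mathbb R\Gamma_VM=\bigotimes_i(Q\to Q[1/s_i])\otimes_QM$ is the augmented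 Čech complex, with its canonical map $\mathbb R\Gamma_VM\to M$. **The HKR maps.** For every object $P$ of $mf(Q,f)$ choose a connection: a $k$-linear map $\nabla_P:P\to\Omega^1_{Q/k}\otimes_QP$, compatible with the $\mathbb Z/2$-grading of $P$ (hence odd for the total grading), with $\nabla_P(qp)=dq\otimes p+q\nabla_P(p)$. For $\alpha:P\to P'$ put $\alpha'=\nabla_{P'}\alpha-(-1)^{|\alpha|}\alpha\nabla_P$; for an object $P_j$ with differential $\delta_j$ put $\delta_j'=\nabla_{P_j}\delta_j+\delta_j\nabla_{P_j}$. For $\alpha_i\in\operatorname{Hom}(P_{i+1},P_i)$, $P_{n+1}=P_0$, $$\varepsilon(\alpha_0[\alpha_1|\cdots|\alpha_n])=\sum_{i_0,\dots,i_n\ge0}\frac{(-1)^{i_0+\cdots+i_n}}{(n+i_0+\cdots+i_n)!}\operatorname{str}\bigl(\alpha_0(\delta_1')^{i_0}\alpha_1'\cdots(\delta_n')^{i_{n-1}}\alpha_n'(\delta_0')^{i_n}\bigr)$$ is a chain map $\varepsilon:HH(mf^Z(Q,f))\to(\Omega^\bullet_{Q/k},-df)$. In $D(Q)$ it lifts uniquely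 along $\mathbb R\Gamma_Z(\Omega^\bullet_{Q/k},-df)\to(\Omega^\bullet_{Q/k},-df)$ to a morphism $$\varepsilon_{Q,f,Z}:HH(mf^Z(Q,f))\to\mathbb R\Gamma_Z(\Omega^\bullet_{Q/k},-df),$$ the HKR map with supports. Choosing connections likewise on the objects of $mf(R,g)$ and of $mf(Q\otimes_kR,f+g)$ (no compatibility between the three choices is required), one obtains $\varepsilon_{R,g,W}$ and $\varepsilon_{Q\otimes_kR,f+g,Z\times W}$. **The pairing $\wedge$.** In $D(Q\otimes_kR)$ the composite $$\mathbb R\Gamma_Z(\Omega^\bullet_{Q/k},-df)\otimes_k\mathbb R\Gamma_W(\Omega^\bullet_{R/k},-dg)\to(\Omega^\bullet_{Q/k},-df)\otimes_k(\Omega^\bullet_{R/k},-dg)\to(\Omega^\bullet_{Q\otimes_kR/k},-df-dg)$$ of the canonical maps and the multiplication of forms lifts uniquely to a morphism $$-\wedge-:\mathbb R\Gamma_Z(\Omega^\bullet_{Q/k},-df)\otimes_k\mathbb R\Gamma_W(\Omega^\bullet_{R/k},-dg)\to\mathbb R\Gamma_{Z\times W}(\Omega^\bullet_{Q\otimes_kR/k},-df-dg).$$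 **Proposition (multiplicativity of the HKR map).** The unique lifts $\varepsilon_{Q,f,Z}$, $\varepsilon_{R,g,W}$, $\varepsilon_{Q\otimes_kR,f+g,Z\times W}$ and $\wedge$ exist, for all choices of connections and of generators $s_i$ of ideals defining $Z$, $W$ and $Z\times W$, and the square $$\begin{array}{ccc}HH(mf^Z(Q,f))\otimes_kHH(mf^W(R,g))&\xrightarrow{\ \varepsilon_{Q,f,Z}\otimes\varepsilon_{R,g,W}\ }&\mathbb R\Gamma_Z(\Omega^\bullet_{Q/k},-df)\otimes_k\mathbb R\Gamma_W(\Omega^\bullet_{R/k},-dg)\\[2pt]{\scriptstyle\tilde\star}\big\downarrow&&\big\downarrow{\scriptstyle\wedge}\\[2pt]HH(mf^{Z\times W}(Q\otimes_kR,f+g))&\xrightarrow{\ \varepsilon_{Q\otimes_kR,f+g,Z\times W}\ }&\mathbb R\Gamma_{Z\times W}(\Omega^\bullet_{Q\otimes_kR/k},-df-dg)\end{array}$$ commutes in $D(Q\otimes_kR)$: $$\wedge\circ(\varepsilon_{Q,f,Z}\otimes\varepsilon_{R,g,W})=\varepsilon_{Q\otimes_kR,f+g,Z\times W}\circ\tilde\star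 .$$ -/

import Mathlib

open CategoryTheory TensorProduct

universe u

namespace MFHKR

/-! ### Modules over `Q ⊗ R` -/

section Ext

variable {k Q R : Type u} [Field k] [CommRing Q] [Algebra k Q] [CommRing R] [Algebra k R]

/-- The `Q ⊗ R`-module structure on `M ⊗ N`: `(q ⊗ r) • (m ⊗ n) = q m ⊗ r n`. -/
@[reducible] noncomputable def extModule (k Q R : Type u) [Field k] [CommRing Q] [Algebra k Q]
    [CommRing R] [Algebra k R] (M N : Type*) [AddCommGroup M] [Module k M] [Module Q M]
    [IsScalarTower k Q M] [AddCommGroup N] [Module k N] [Module R N] [IsScalarTower k R N] :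
    Module (Q ⊗[k] R) (M ⊗[k] N) :=
  Module.compHom (M ⊗[k] N)
    (((Module.endTensorEndAlgHom (R := k) (S := k) (A := k) (M := M) (N := N)).comp
      (Algebra.TensorProduct.map (Algebra.lsmul k k M : Q →ₐ[k] Module.End k M)
        (Algebra.lsmul k k N : R →ₐ[k] Module.End k N))).toRingHom)

attribute [local instance] extModule

variable {M N M' N' : Type*} [AddCommGroup M] [Module k M] [Module Q M]
    [IsScalarTower k Q M] [AddCommGroup N] [Module k N] [Module R N] [IsScalarTower k R N]
    [AddCommGroup M'] [Module k M'] [Module Q M']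
    [IsScalarTower k Q M'] [AddCommGroup N'] [Module k N'] [Module R N'] [IsScalarTower k R N']

theorem ext_smul_tmul (q : Q) (r : R) (m : M) (n : N) :
    (q ⊗ₜ[k] r) • (m ⊗ₜ[k] n) = (q • m) ⊗ₜ[k] (r • n) := rfl

theorem ext_tower : IsScalarTower k (Q ⊗[k] R) (M ⊗[k] N) := by
  refine IsScalarTower.of_algebraMap_smul fun c x => ?_
  induction x with
  | zero => simp
  | add x y hx hy => rw [smul_add, smul_add, hx, hy]
  | tmul m n =>
    rw [Algebra.TensorProduct.algebraMap_apply, ext_smul_tmul, one_smul, algebraMap_smul]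
    rfl

/-- The tensor product of a `Q`-linear and an `R`-linear map is `Q ⊗ R`-linear. -/
noncomputable def extMap (f : M →ₗ[Q] M') (g : N →ₗ[R] N') :
    (M ⊗[k] N) →ₗ[Q ⊗[k] R] (M' ⊗[k] N') where
  toFun := TensorProduct.map (f.restrictScalars k) (g.restrictScalars k)
  map_add' := map_add _
  map_smul' a x := by
    induction a with
    | zero => simp
    | add a b ha hb => simp only [add_smul, map_add, ha, hb]
    | tmul q r =>
      induction x with
      | zero => simp
      | add x y hx hy => simp only [smul_add, map_add, hx, hy]
      | tmul m n => simp [ext_smul_tmul]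

@[simp] theorem extMap_tmul (f : M →ₗ[Q] M') (g : N →ₗ[R] N') (m : M) (n : N) :
    extMap (k := k) f g (m ⊗ₜ n) = f m ⊗ₜ g n := rfl

end Ext

/-! ### `ℤ/2`-graded complexes and their derived category -/

section Complexes

/-- A `ℤ/2`-graded complex of `Q`-modules, where `Q` is an algebra over a field `k` in which `2` is
invertible.  A `ℤ/2`-grading `M = M₀ ⊕ M₁` on a module over such a ring is the same thing as an
involution `par` (acting by `(-1)^i` on `Mᵢ`), and we record it in this way: an element `x` has even
degree when `par x = x` and odd degree when `par x = -x`.  The differential has odd degree. -/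
structure SCpx (k Q : Type u) [Field k] [CommRing Q] [Algebra k Q] : Type (u + 2) where
  carrier : Type (u + 1)
  [acg : AddCommGroup carrier]
  [modk : Module k carrier]
  [modQ : Module Q carrier]
  [tower : IsScalarTower k Q carrier]
  par : carrier →ₗ[Q] carrier
  d : carrier →ₗ[Q] carrier
  par_par : ∀ x, par (par x) = x
  d_par : ∀ x, d (par x) = -par (d x)
  d_d : ∀ x, d (d x) = 0

attribute [instance] SCpx.acg SCpx.modk SCpx.modQ SCpx.tower
attribute [simp] SCpx.par_par SCpx.d_d

variable {k Q R : Type u} [Field k] [CommRing Q] [Algebra k Q] [CommRing R] [Algebra k R]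

/-- Morphisms of `ℤ/2`-graded complexes: `Q`-linear maps of degree `0` commuting with the
differentials. -/
@[ext] structure SCpx.Hom (M N : SCpx k Q) where
  toLin : M.carrier →ₗ[Q] N.carrier
  map_par : ∀ x, toLin (M.par x) = N.par (toLin x)
  map_d : ∀ x, toLin (M.d x) = N.d (toLin x)

instance : Category (SCpx k Q) where
  Hom M N := SCpx.Hom M N
  id M := ⟨LinearMap.id, fun _ => rfl, fun _ => rfl⟩
  comp f g := ⟨g.toLin ∘ₗ f.toLin,
    fun x => by simp [f.map_par, g.map_par], fun x => by simp [f.map_d, g.map_d]⟩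

/-- The underlying linear map of a morphism of complexes. -/
def SCpx.lin {M N : SCpx k Q} (f : M ⟶ N) : M.carrier →ₗ[Q] N.carrier := SCpx.Hom.toLin f

@[ext] theorem SCpx.hom_ext {M N : SCpx k Q} {f g : M ⟶ N}
    (h : ∀ x, SCpx.lin f x = SCpx.lin g x) : f = g :=
  SCpx.Hom.ext (LinearMap.ext h)

theorem SCpx.lin_par {M N : SCpx k Q} (f : M ⟶ N) (x : M.carrier) :
    SCpx.lin f (M.par x) = N.par (SCpx.lin f x) := SCpx.Hom.map_par f x

theorem SCpx.lin_d {M N : SCpx k Q} (f : M ⟶ N) (x : M.carrier) :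
    SCpx.lin f (M.d x) = N.d (SCpx.lin f x) := SCpx.Hom.map_d f x

@[simp] theorem SCpx.lin_id (M : SCpx k Q) (x : M.carrier) : SCpx.lin (𝟙 M) x = x := rfl

@[simp] theorem SCpx.lin_comp {M N P : SCpx k Q} (f : M ⟶ N) (g : N ⟶ P) (x : M.carrier) :
    SCpx.lin (f ≫ g) x = SCpx.lin g (SCpx.lin f x) := rfl

/-- Quasi-isomorphisms: morphisms inducing an injective and surjective map on homology
`ker d / im d`. -/
def quasiIso (k Q : Type u) [Field k] [CommRing Q] [Algebra k Q] :
    MorphismProperty (SCpx k Q) := fun M N f =>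
  (∀ x, M.d x = 0 → (∃ y, N.d y = SCpx.lin f x) → ∃ z, M.d z = x) ∧
  (∀ y, N.d y = 0 → ∃ x, M.d x = 0 ∧ ∃ z, N.d z = y - SCpx.lin f x)

instance : (quasiIso k Q).ContainsIdentities where
  id_mem M := ⟨fun _ _ h => h, fun y hy => ⟨y, hy, 0, by simp⟩⟩

/-- The derived category of `ℤ/2`-graded complexes of `Q`-modules. -/
abbrev DCat (k Q : Type u) [Field k] [CommRing Q] [Algebra k Q] := (quasiIso k Q).Localization

/-- The localization functor from complexes to the derived category. -/
abbrev toD (k Q : Type u) [Field k] [CommRing Q] [Algebra k Q] : SCpx k Q ⥤ DCat k Q :=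
  (quasiIso k Q).Q

/-- The complex `(Q → Q[1/g]) ⊗ M`, with `Q[1/g]` in odd degree: its elements are pairs
`(m, x)` with `m ∈ M` and `x ∈ Q[1/g] ⊗ M`. -/
noncomputable def cechOne (g : Q) (M : SCpx k Q) : SCpx k Q where
  carrier := M.carrier × (Localization.Away g ⊗[Q] M.carrier)
  par := M.par.prodMap (-(M.par.lTensor (Localization.Away g)))
  d := LinearMap.prod (M.d ∘ₗ LinearMap.fst Q _ _)
    ((TensorProduct.mk Q (Localization.Away g) M.carrier 1) ∘ₗ LinearMap.fst Q _ _ -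
      (M.d.lTensor (Localization.Away g)) ∘ₗ LinearMap.snd Q _ _)
  par_par x := by
    have h : M.par ∘ₗ M.par = LinearMap.id := LinearMap.ext M.par_par
    have h2 : ∀ y, M.par.lTensor (Localization.Away g) (M.par.lTensor (Localization.Away g) y) = y :=
      fun y => by rw [← LinearMap.lTensor_comp_apply, h, LinearMap.lTensor_id_apply]
    ext
    · simp
    · simp [h2]
  d_par x := by
    have h : M.d ∘ₗ M.par = -(M.par ∘ₗ M.d) := LinearMap.ext M.d_par
    have h2 : ∀ y, M.d.lTensor (Localization.Away g) (M.par.lTensor (Localization.Away g) y) =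
        -M.par.lTensor (Localization.Away g) (M.d.lTensor (Localization.Away g) y) := fun y => by
      rw [← LinearMap.lTensor_comp_apply, h, LinearMap.lTensor_neg, LinearMap.neg_apply,
        LinearMap.lTensor_comp_apply]
    ext
    · simp [M.d_par]
    · simp [h2]
  d_d x := by
    have h : M.d ∘ₗ M.d = 0 := LinearMap.ext M.d_d
    have h2 : ∀ y, M.d.lTensor (Localization.Away g) (M.d.lTensor (Localization.Away g) y) = 0 :=
      fun y => by rw [← LinearMap.lTensor_comp_apply, h]; simp
    ext
    · simp
    · simp [h2]

/-- The augmentation `(Q → Q[1/g]) ⊗ M → M`. -/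
noncomputable def cechOneAug (g : Q) (M : SCpx k Q) : cechOne g M ⟶ M where
  toLin := LinearMap.fst Q _ _
  map_par _ := rfl
  map_d _ := rfl

/-- The local cohomology complex `RΓ_Z M = C(g₁, …, g_m) ⊗ M` for `Z = V(g₁, …, g_m)`, where
`C(g₁, …, g_m) = (Q → Q[1/g₁]) ⊗ ⋯ ⊗ (Q → Q[1/g_m])` is the augmented Čech complex. -/
noncomputable def RGam : List Q → SCpx k Q → SCpx k Q
  | [], M => M
  | g :: gs, M => cechOne g (RGam gs M)

/-- The augmentation `RΓ_Z M → M`. -/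
noncomputable def RGamAug : (gs : List Q) → (M : SCpx k Q) → (RGam gs M ⟶ M)
  | [], M => 𝟙 M
  | g :: gs, M => cechOneAug g (RGam gs M) ≫ RGamAug gs M

attribute [local instance] extModule

/-- The tensor product over `k` of a complex of `Q`-modules and a complex of `R`-modules, a complex
of `Q ⊗ R`-modules with differential `d ⊗ 1 + 1 ⊗ d`, where
`(1 ⊗ d)(m ⊗ n) = (-1)^|m| m ⊗ d n`. -/
noncomputable def SCpx.tensor (M : SCpx k Q) (N : SCpx k R) : SCpx k (Q ⊗[k] R) where
  carrier := M.carrier ⊗[k] N.carrier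
  modQ := extModule k Q R M.carrier N.carrier
  tower := ext_tower
  par := extMap M.par N.par
  d := extMap M.d LinearMap.id + extMap M.par N.d
  par_par x := by
    induction x with
    | zero => simp
    | add x y hx hy => rw [map_add, map_add, hx, hy]
    | tmul m n => simp
  d_par x := by
    induction x with
    | zero => simp
    | add x y hx hy => rw [map_add, map_add, map_add, map_add, hx, hy]; abel
    | tmul m n => simp [M.d_par, N.d_par, neg_tmul, tmul_neg]; abel
  d_d x := by
    induction x with
    | zero => simp
    | add x y hx hy => rw [map_add, map_add, hx, hy, add_zero]
    | tmul m n => simp [M.d_par, neg_tmul]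

/-- The element `m ⊗ n` of the tensor product complex. -/
def SCpx.tmul (M : SCpx k Q) (N : SCpx k R) (m : M.carrier) (n : N.carrier) :
    (M.tensor N).carrier := m ⊗ₜ[k] n

theorem SCpx.tensor_induction (M : SCpx k Q) (N : SCpx k R) {p : (M.tensor N).carrier → Prop}
    (x : (M.tensor N).carrier) (zero : p 0) (tmul : ∀ m n, p (M.tmul N m n))
    (add : ∀ x y, p x → p y → p (x + y)) : p x :=
  TensorProduct.induction_on x zero tmul add

theorem SCpx.par_tmul (M : SCpx k Q) (N : SCpx k R) (m : M.carrier) (n : N.carrier) :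
    (M.tensor N).par (M.tmul N m n) = M.tmul N (M.par m) (N.par n) := rfl

theorem SCpx.d_tmul (M : SCpx k Q) (N : SCpx k R) (m : M.carrier) (n : N.carrier) :
    (M.tensor N).d (M.tmul N m n) = M.tmul N (M.d m) n + M.tmul N (M.par m) (N.d n) := rfl

/-- The tensor product of linear maps, on the tensor product of two complexes. -/
noncomputable def SCpx.tensorLin {M M' : SCpx k Q} {N N' : SCpx k R}
    (f : M.carrier →ₗ[Q] M'.carrier) (g : N.carrier →ₗ[R] N'.carrier) :
    (M.tensor N).carrier →ₗ[Q ⊗[k] R] (M'.tensor N').carrier := extMap f g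

theorem SCpx.tensorLin_tmul {M M' : SCpx k Q} {N N' : SCpx k R}
    (f : M.carrier →ₗ[Q] M'.carrier) (g : N.carrier →ₗ[R] N'.carrier)
    (m : M.carrier) (n : N.carrier) : SCpx.tensorLin f g (M.tmul N m n) =
      M'.tmul N' (f m) (g n) := rfl

/-- The tensor product of morphisms of complexes. -/
noncomputable def SCpx.tensorMap {M M' : SCpx k Q} {N N' : SCpx k R} (f : M ⟶ M') (g : N ⟶ N') :
    M.tensor N ⟶ M'.tensor N' where
  toLin := SCpx.tensorLin (SCpx.lin f) (SCpx.lin g)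
  map_par x := by
    induction x using SCpx.tensor_induction with
    | zero => simp
    | add x y hx hy => rw [map_add, map_add, map_add, map_add, hx, hy]
    | tmul m n => simp only [SCpx.par_tmul, SCpx.tensorLin_tmul, SCpx.lin_par]
  map_d x := by
    induction x using SCpx.tensor_induction with
    | zero => simp
    | add x y hx hy => rw [map_add, map_add, map_add, map_add, hx, hy]
    | tmul m n =>
      simp only [SCpx.d_tmul, SCpx.tensorLin_tmul, SCpx.lin_par, SCpx.lin_d, map_add]

theorem SCpx.tensorMap_tmul {M M' : SCpx k Q} {N N' : SCpx k R} (f : M ⟶ M') (g : N ⟶ N')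
    (m : M.carrier) (n : N.carrier) : SCpx.lin (SCpx.tensorMap f g) (M.tmul N m n) =
      M'.tmul N' (SCpx.lin f m) (SCpx.lin g n) := rfl

section Desc

variable {M : SCpx k Q} {N : SCpx k R} {P : SCpx k (Q ⊗[k] R)}

/-- Auxiliary definition for `SCpx.tensorDesc`. -/
noncomputable def SCpx.tensorDescAux (F : M.carrier →ₗ[k] N.carrier →ₗ[k] P.carrier) :
    (M.tensor N).carrier →+ P.carrier := (TensorProduct.lift F).toAddMonoidHom

theorem SCpx.tensorDescAux_tmul (F : M.carrier →ₗ[k] N.carrier →ₗ[k] P.carrier) (m : M.carrier)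
    (n : N.carrier) : SCpx.tensorDescAux F (M.tmul N m n) = F m n := rfl

theorem SCpx.smul_tmul (q : Q) (r : R) (m : M.carrier) (n : N.carrier) :
    (q ⊗ₜ[k] r) • M.tmul N m n = M.tmul N (q • m) (r • n) := rfl

/-- The morphism `M ⊗ N → P` of complexes determined by a bilinear map. -/
noncomputable def SCpx.tensorDesc (F : M.carrier →ₗ[k] N.carrier →ₗ[k] P.carrier)
    (h : ∀ (q : Q) (r : R) m n, F (q • m) (r • n) = (q ⊗ₜ[k] r) • F m n)
    (hp : ∀ m n, P.par (F m n) = F (M.par m) (N.par n))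
    (hd : ∀ m n, P.d (F m n) = F (M.d m) n + F (M.par m) (N.d n)) : M.tensor N ⟶ P where
  toLin :=
    { toFun := SCpx.tensorDescAux F
      map_add' := map_add _
      map_smul' := fun a x => by
        rw [RingHom.id_apply]
        induction a with
        | zero => rw [zero_smul, zero_smul, map_zero]
        | add a b ha hb => rw [add_smul, add_smul, map_add, ha, hb]
        | tmul q r =>
          induction x using SCpx.tensor_induction with
          | zero => rw [smul_zero, map_zero, smul_zero]
          | add x y hx hy => rw [smul_add, map_add, map_add, hx, hy, smul_add]
          | tmul m n =>
            rw [SCpx.smul_tmul, SCpx.tensorDescAux_tmul, SCpx.tensorDescAux_tmul, h] }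
  map_par x := by
    change SCpx.tensorDescAux F _ = P.par (SCpx.tensorDescAux F x)
    induction x using SCpx.tensor_induction with
    | zero => simp only [map_zero]
    | add x y hx hy => rw [map_add, map_add, map_add, map_add, hx, hy]
    | tmul m n =>
      rw [SCpx.par_tmul, SCpx.tensorDescAux_tmul, SCpx.tensorDescAux_tmul, hp]
  map_d x := by
    change SCpx.tensorDescAux F _ = P.d (SCpx.tensorDescAux F x)
    induction x using SCpx.tensor_induction with
    | zero => simp only [map_zero]
    | add x y hx hy => rw [map_add, map_add, map_add, map_add, hx, hy]
    | tmul m n =>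
      rw [SCpx.d_tmul, map_add, SCpx.tensorDescAux_tmul, SCpx.tensorDescAux_tmul,
        SCpx.tensorDescAux_tmul, hd]

end Desc

variable (k Q R) in
/-- The tensor product functor on complexes. -/
noncomputable def tensorFunctor : SCpx k Q × SCpx k R ⥤ SCpx k (Q ⊗[k] R) where
  obj X := X.1.tensor X.2
  map f := SCpx.tensorMap f.1 f.2
  map_id X := by
    ext x
    induction x using SCpx.tensor_induction with
    | zero => simp
    | add x y hx hy => rw [map_add, map_add, hx, hy]
    | tmul m n => rfl
  map_comp f g := by
    ext x
    induction x using SCpx.tensor_induction with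
    | zero => simp
    | add x y hx hy => rw [map_add, map_add, hx, hy]
    | tmul m n => rfl

/-- A contraction of an acyclic complex of vector spaces. -/
theorem exists_contraction [CharZero k] {A : Type*} [AddCommGroup A] [Module k A]
    (σ d : A →ₗ[k] A) (hσ : ∀ x, σ (σ x) = x) (hd : ∀ x, d (σ x) = -σ (d x))
    (hdd : ∀ x, d (d x) = 0) (hac : ∀ x, d x = 0 → ∃ y, d y = x) :
    ∃ h : A →ₗ[k] A, (∀ x, d (h x) + h (d x) = x) ∧ ∀ x, h (σ x) = -σ (h x) := by
  obtain ⟨s, hs⟩ := d.rangeRestrict.exists_rightInverse_of_surjective d.range_rangeRestrict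
  have hs' : ∀ y (hy : y ∈ LinearMap.range d), d (s ⟨y, hy⟩) = y := fun y hy =>
    congrArg Subtype.val (LinearMap.congr_fun hs ⟨y, hy⟩)
  let t : A →ₗ[k] A := s ∘ₗ d.rangeRestrict
  have ht : ∀ x, d (t x) = d x := fun x => hs' _ _
  have hk : ∀ x, x - t x ∈ LinearMap.range d := fun x =>
    (hac (x - t x) (by rw [map_sub, ht, sub_self]))
  let p : A →ₗ[k] LinearMap.range d := (LinearMap.id - t).codRestrict _ hk
  let h : A →ₗ[k] A := s ∘ₗ p
  have h1 : ∀ x, d (h x) = x - t x := fun x => hs' _ _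
  have h2 : ∀ x, h (d x) = t x := fun x => by
    have : p (d x) = d.rangeRestrict x := by
      apply Subtype.ext
      have : t (d x) = 0 := by
        have : d.rangeRestrict (d x) = 0 := Subtype.ext (hdd x)
        simp [t, this]
      change d x - t (d x) = d x
      rw [this, sub_zero]
    simp [h, t, this]
  have h3 : ∀ x, d (h x) + h (d x) = x := fun x => by rw [h1, h2]; abel
  have two : (2 : k) ≠ 0 := two_ne_zero
  refine ⟨(2 : k)⁻¹ • (h - σ ∘ₗ h ∘ₗ σ), fun x => ?_, fun x => ?_⟩
  · have e1 : d (σ (h (σ x))) = -σ (d (h (σ x))) := hd _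
    have e2 : σ (h (σ (d x))) = -σ (h (d (σ x))) := by rw [hd, map_neg, map_neg, neg_neg]
    simp only [LinearMap.smul_apply, LinearMap.sub_apply, LinearMap.comp_apply, map_smul, map_sub,
      e1, e2]
    rw [← smul_add, inv_smul_eq_iff₀ two, two_smul]
    have e3 : σ (d (h (σ x))) + σ (h (d (σ x))) = x := by rw [← map_add, h3, hσ]
    calc _ = (d (h x) + h (d x)) + (σ (d (h (σ x))) + σ (h (d (σ x)))) := by abel
      _ = x + x := by rw [h3, e3]
  · simp only [LinearMap.smul_apply, LinearMap.sub_apply, LinearMap.comp_apply, map_smul, map_sub,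
      hσ]
    rw [← smul_neg]
    congr 1
    abel

/-- Over a field, a quasi-isomorphism is a homotopy equivalence. -/
theorem exists_homotopy_inverse [CharZero k] {M N : SCpx k Q} (f : M ⟶ N)
    (hf : quasiIso k Q f) :
    ∃ (p : N.carrier →ₗ[k] M.carrier) (h : N.carrier →ₗ[k] N.carrier)
      (l : M.carrier →ₗ[k] M.carrier),
      (∀ x, p (N.d x) = M.d (p x)) ∧ (∀ x, p (N.par x) = M.par (p x)) ∧
      (∀ x, h (N.par x) = -N.par (h x)) ∧ (∀ x, l (M.par x) = -M.par (l x)) ∧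
      (∀ x, SCpx.lin f (p x) = x + N.d (h x) + h (N.d x)) ∧
      (∀ x, M.d (l x) + l (M.d x) + p (SCpx.lin f x) = x) := by
  let F := (SCpx.lin f).restrictScalars k
  let σ : (M.carrier × N.carrier) →ₗ[k] (M.carrier × N.carrier) :=
    (M.par.restrictScalars k).prodMap (-(N.par.restrictScalars k))
  let d : (M.carrier × N.carrier) →ₗ[k] (M.carrier × N.carrier) :=
    LinearMap.prod ((M.d.restrictScalars k) ∘ₗ LinearMap.fst k _ _)
      (F ∘ₗ LinearMap.fst k _ _ - (N.d.restrictScalars k) ∘ₗ LinearMap.snd k _ _)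
  have hd' : ∀ m n, d (m, n) = (M.d m, SCpx.lin f m - N.d n) := fun _ _ => rfl
  have hσ' : ∀ m n, σ (m, n) = (M.par m, -N.par n) := fun _ _ => rfl
  obtain ⟨K, hK, hKσ⟩ := exists_contraction (k := k) σ d
    (fun ⟨m, n⟩ => by simp [hσ'])
    (fun ⟨m, n⟩ => by
      simp only [hσ', hd', M.d_par, map_neg, N.d_par, SCpx.lin_par, Prod.neg_mk, map_sub]
      congr 1; abel)
    (fun ⟨m, n⟩ => by simp [hd', SCpx.lin_d])
    (fun ⟨m, n⟩ hmn => by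
      rw [hd', Prod.mk_eq_zero, sub_eq_zero] at hmn
      obtain ⟨z, hz⟩ := hf.1 m hmn.1 ⟨n, hmn.2.symm⟩
      obtain ⟨x, hx, w, hw⟩ := hf.2 (n - SCpx.lin f z)
        (by rw [map_sub, ← SCpx.lin_d, hz, hmn.2, sub_self])
      refine ⟨(z - -x, -w), ?_⟩
      rw [hd', map_sub, map_neg, hx, hz, map_neg, hw, map_sub, map_neg]
      congr 1
      · abel
      · abel)
  have hK2 : ∀ x, d (K (0, x)) + K (0, -N.d x) = (0, x) := fun x => by
    have h0 : d (0, x) = (0, -N.d x) := by rw [hd', map_zero, map_zero, zero_sub]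
    rw [← h0, hK]
  have hneg : ∀ x : N.carrier, K (0, -x) = -K (0, x) := fun x => by
    rw [← map_neg, Prod.neg_mk, neg_zero]
  refine ⟨LinearMap.fst k _ _ ∘ₗ K ∘ₗ LinearMap.inr k _ _,
    LinearMap.snd k _ _ ∘ₗ K ∘ₗ LinearMap.inr k _ _,
    LinearMap.fst k _ _ ∘ₗ K ∘ₗ LinearMap.inl k _ _, fun x => ?_, fun x => ?_, fun x => ?_,
    fun x => ?_, fun x => ?_, fun x => ?_⟩
  · have := congrArg Prod.fst (hK2 x)
    rw [hneg] at this
    exact (sub_eq_zero.mp ((sub_eq_add_neg _ _).trans this)).symm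
  · have := congrArg Prod.fst (hKσ (0, x))
    rw [hσ', map_zero, hneg] at this
    exact neg_injective this
  · have := congrArg Prod.snd (hKσ (0, x))
    rw [hσ', map_zero, hneg] at this
    change -(K (0, N.par x)).2 = - -N.par (K (0, x)).2 at this
    change (K (0, N.par x)).2 = -N.par (K (0, x)).2
    rw [← neg_inj, this]
  · have := congrArg Prod.fst (hKσ (x, 0))
    rw [hσ', map_zero, neg_zero] at this
    exact this
  · have := congrArg Prod.snd (hK2 x)
    rw [hneg] at this
    change (SCpx.lin f (K (0, x)).1 - N.d (K (0, x)).2) + -(K (0, N.d x)).2 = x at this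
    change SCpx.lin f (K (0, x)).1 = x + N.d (K (0, x)).2 + (K (0, N.d x)).2
    nth_rewrite 2 [← this]
    abel
  · have := congrArg Prod.fst (hK (x, 0))
    have h0 : d (x, 0) = (M.d x, SCpx.lin f x) := by rw [hd', map_zero, sub_zero]
    rw [h0] at this
    change M.d (K (x, 0)).1 + (K (M.d x, SCpx.lin f x)).1 = x at this
    have e : K (M.d x, SCpx.lin f x) = K (M.d x, 0) + K (0, SCpx.lin f x) := by
      rw [← map_add]; simp
    rw [e] at this
    change M.d (K (x, 0)).1 + (K (M.d x, 0)).1 + (K (0, SCpx.lin f x)).1 = x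
    rw [add_assoc]
    exact this

theorem tensorMap_quasiIso_left [CharZero k] {M M' : SCpx k Q} (f : M ⟶ M') (N : SCpx k R)
    (hf : quasiIso k Q f) : quasiIso k (Q ⊗[k] R) (SCpx.tensorMap f (𝟙 N)) := by
  obtain ⟨p, h, l, pd, pp, hp, lp, fp, pf⟩ := exists_homotopy_inverse f hf
  let P : (M'.tensor N).carrier →ₗ[k] (M.tensor N).carrier := TensorProduct.map p LinearMap.id
  let H : (M'.tensor N).carrier →ₗ[k] (M'.tensor N).carrier := TensorProduct.map h LinearMap.id
  let L : (M.tensor N).carrier →ₗ[k] (M.tensor N).carrier := TensorProduct.map l LinearMap.id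
  have hP : ∀ m n, P (M'.tmul N m n) = M.tmul N (p m) n := fun _ _ => rfl
  have hH : ∀ m n, H (M'.tmul N m n) = M'.tmul N (h m) n := fun _ _ => rfl
  have hL : ∀ m n, L (M.tmul N m n) = M.tmul N (l m) n := fun _ _ => rfl
  have ta : ∀ (A : SCpx k Q) (x y : A.carrier) (n : N.carrier),
    A.tmul N (x + y) n = A.tmul N x n + A.tmul N y n := fun A x y n => TensorProduct.add_tmul x y n
  have tn : ∀ (A : SCpx k Q) (x : A.carrier) (n : N.carrier),
    A.tmul N (-x) n = -A.tmul N x n := fun A x n => TensorProduct.neg_tmul x n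
  have PD : ∀ x, P ((M'.tensor N).d x) = (M.tensor N).d (P x) := fun x => by
    induction x using SCpx.tensor_induction with
    | zero => simp
    | add x y hx hy => simp only [map_add, hx, hy]
    | tmul m n => simp only [SCpx.d_tmul, map_add, hP, pd, pp]
  have FP : ∀ x, SCpx.lin (SCpx.tensorMap f (𝟙 N)) (P x) =
      x + (M'.tensor N).d (H x) + H ((M'.tensor N).d x) := fun x => by
    induction x using SCpx.tensor_induction with
    | zero => simp
    | add x y hx hy => simp only [map_add, hx, hy]; abel
    | tmul m n =>
      simp only [SCpx.d_tmul, map_add, hP, hH, hp, SCpx.tensorMap_tmul, fp, SCpx.lin_id, ta, tn]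
      have : M'.tmul N (M'.par (h m)) (N.d n) = -M'.tmul N (h (M'.par m)) (N.d n) := by
        rw [hp, tn, neg_neg]
      rw [this, hp, tn]
      abel
  have PF : ∀ x, (M.tensor N).d (L x) + L ((M.tensor N).d x) +
      P (SCpx.lin (SCpx.tensorMap f (𝟙 N)) x) = x := fun x => by
    induction x using SCpx.tensor_induction with
    | zero => simp
    | add x y hx hy =>
      simp only [map_add]
      refine Eq.trans ?_ (congrArg₂ (· + ·) hx hy)
      abel
    | tmul m n =>
      simp only [SCpx.d_tmul, map_add, hP, hL, lp, SCpx.tensorMap_tmul, SCpx.lin_id, tn]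
      nth_rewrite 6 [← pf m]
      rw [ta, ta]
      abel
  constructor
  · rintro x hx ⟨y, hy⟩
    refine ⟨L x + P y, ?_⟩
    nth_rewrite 2 [← PF x]
    rw [hx, map_zero, add_zero, map_add, ← hy, PD]
  · intro y hy
    refine ⟨P y, by rw [← PD, hy, map_zero], -H y, ?_⟩
    rw [FP, hy, map_zero, map_neg]
    abel

theorem tensorMap_quasiIso_right [CharZero k] (M : SCpx k Q) {N N' : SCpx k R} (f : N ⟶ N')
    (hf : quasiIso k R f) : quasiIso k (Q ⊗[k] R) (SCpx.tensorMap (𝟙 M) f) := by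
  obtain ⟨p, h, l, pd, pp, hp, lp, fp, pf⟩ := exists_homotopy_inverse f hf
  let S : M.carrier →ₗ[k] M.carrier := M.par.restrictScalars k
  let P : (M.tensor N').carrier →ₗ[k] (M.tensor N).carrier := TensorProduct.map LinearMap.id p
  let H : (M.tensor N').carrier →ₗ[k] (M.tensor N').carrier := TensorProduct.map S h
  let L : (M.tensor N).carrier →ₗ[k] (M.tensor N).carrier := TensorProduct.map S l
  have hP : ∀ m n, P (M.tmul N' m n) = M.tmul N m (p n) := fun _ _ => rfl
  have hH : ∀ m n, H (M.tmul N' m n) = M.tmul N' (M.par m) (h n) := fun _ _ => rfl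
  have hL : ∀ m n, L (M.tmul N m n) = M.tmul N (M.par m) (l n) := fun _ _ => rfl
  have ta : ∀ (A : SCpx k R) (m : M.carrier) (x y : A.carrier),
    M.tmul A m (x + y) = M.tmul A m x + M.tmul A m y := fun A m x y => TensorProduct.tmul_add m x y
  have tn : ∀ (A : SCpx k R) (m : M.carrier) (n : A.carrier),
    M.tmul A (-m) n = -M.tmul A m n := fun A x n => TensorProduct.neg_tmul x n
  have PD : ∀ x, P ((M.tensor N').d x) = (M.tensor N).d (P x) := fun x => by
    induction x using SCpx.tensor_induction with
    | zero => simp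
    | add x y hx hy => simp only [map_add, hx, hy]
    | tmul m n => simp only [SCpx.d_tmul, map_add, hP, pd]
  have FP : ∀ x, SCpx.lin (SCpx.tensorMap (𝟙 M) f) (P x) =
      x + (M.tensor N').d (H x) + H ((M.tensor N').d x) := fun x => by
    induction x using SCpx.tensor_induction with
    | zero => simp
    | add x y hx hy => simp only [map_add, hx, hy]; abel
    | tmul m n =>
      simp only [SCpx.d_tmul, map_add, hP, hH, SCpx.tensorMap_tmul, fp, SCpx.lin_id, ta, tn,
        M.d_par, M.par_par]
      abel
  have PF : ∀ x, (M.tensor N).d (L x) + L ((M.tensor N).d x) +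
      P (SCpx.lin (SCpx.tensorMap (𝟙 M) f) x) = x := fun x => by
    induction x using SCpx.tensor_induction with
    | zero => simp
    | add x y hx hy =>
      simp only [map_add]
      refine Eq.trans ?_ (congrArg₂ (· + ·) hx hy)
      abel
    | tmul m n =>
      simp only [SCpx.d_tmul, map_add, hP, hL, SCpx.tensorMap_tmul, SCpx.lin_id, tn, M.d_par,
        M.par_par]
      nth_rewrite 6 [← pf n]
      rw [ta, ta]
      abel
  constructor
  · rintro x hx ⟨y, hy⟩
    refine ⟨L x + P y, ?_⟩
    nth_rewrite 2 [← PF x]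
    rw [hx, map_zero, add_zero, map_add, ← hy, PD]
  · intro y hy
    refine ⟨P y, by rw [← PD, hy, map_zero], -H y, ?_⟩
    rw [FP, hy, map_zero, map_neg]
    abel

theorem tensorFunctor_inverts [CharZero k] :
    ((quasiIso k Q).prod (quasiIso k R)).IsInvertedBy
      (tensorFunctor k Q R ⋙ toD k (Q ⊗[k] R)) := by
  rintro ⟨M, N⟩ ⟨M', N'⟩ ⟨f, g⟩ ⟨hf, hg⟩
  change M ⟶ M' at f
  change N ⟶ N' at g
  have e : SCpx.tensorMap f g = SCpx.tensorMap f (𝟙 N) ≫ SCpx.tensorMap (𝟙 M') g := by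
    ext x
    induction x using SCpx.tensor_induction with
    | zero => rw [map_zero, map_zero]
    | add x y hx hy => rw [map_add, map_add, hx, hy]
    | tmul m n => rfl
  have := Localization.inverts (toD k (Q ⊗[k] R)) (quasiIso k (Q ⊗[k] R)) _
    (tensorMap_quasiIso_left f N hf)
  have := Localization.inverts (toD k (Q ⊗[k] R)) (quasiIso k (Q ⊗[k] R)) _
    (tensorMap_quasiIso_right M' g hg)
  change IsIso ((toD k (Q ⊗[k] R)).map (SCpx.tensorMap f g))
  rw [e, Functor.map_comp]
  infer_instance

variable (k Q R) in
/-- The tensor product functor `D(Q) × D(R) → D(Q ⊗ R)`, `(M, N) ↦ M ⊗ N`, induced by the (exact)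
tensor product of complexes over the field `k`. -/
noncomputable def derivedTensor [CharZero k] : DCat k Q × DCat k R ⥤ DCat k (Q ⊗[k] R) :=
  Localization.lift (tensorFunctor k Q R ⋙ toD k (Q ⊗[k] R)) tensorFunctor_inverts
    ((toD k Q).prod (toD k R))

/-- The tensor product in the derived category is computed by the tensor product of complexes. -/
noncomputable def derivedTensorIso [CharZero k] (M : SCpx k Q) (N : SCpx k R) :
    (derivedTensor k Q R).obj ((toD k Q).obj M, (toD k R).obj N) ≅
      (toD k (Q ⊗[k] R)).obj (M.tensor N) :=
  (Localization.fac (tensorFunctor k Q R ⋙ toD k (Q ⊗[k] R)) tensorFunctor_inverts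
    ((toD k Q).prod (toD k R))).app (M, N)

end Complexes

/-! ### The Hochschild complex of a differential `ℤ/2`-graded category -/

section Hochschild

/-- A differential `ℤ/2`-graded category over `k` whose morphism complexes are `Q`-linear and whose
composition is `Q`-bilinear.  `Hom X Y` is the complex of morphisms from `X` to `Y`; as before its
grading is recorded by the involution `par`. -/
structure DGCat (k Q : Type u) [Field k] [CommRing Q] [Algebra k Q] : Type (u + 2) where
  Obj : Type (u + 1)
  Hom : Obj → Obj → Type u
  [acg : ∀ X Y, AddCommGroup (Hom X Y)]
  [modk : ∀ X Y, Module k (Hom X Y)]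
  [modQ : ∀ X Y, Module Q (Hom X Y)]
  [tower : ∀ X Y, IsScalarTower k Q (Hom X Y)]
  one : ∀ X, Hom X X
  comp : ∀ {X Y Z}, Hom Y Z →ₗ[Q] Hom X Y →ₗ[Q] Hom X Z
  par : ∀ {X Y}, Hom X Y →ₗ[Q] Hom X Y
  d : ∀ {X Y}, Hom X Y →ₗ[Q] Hom X Y
  one_comp : ∀ {X Y} (a : Hom X Y), comp (one Y) a = a
  comp_one : ∀ {X Y} (a : Hom X Y), comp a (one X) = a
  comp_assoc : ∀ {X Y Z W} (a : Hom Z W) (b : Hom Y Z) (c : Hom X Y),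
    comp (comp a b) c = comp a (comp b c)
  par_par : ∀ {X Y} (a : Hom X Y), par (par a) = a
  par_one : ∀ X, par (one X) = one X
  par_comp : ∀ {X Y Z} (a : Hom Y Z) (b : Hom X Y), par (comp a b) = comp (par a) (par b)
  d_par : ∀ {X Y} (a : Hom X Y), d (par a) = -par (d a)
  d_d : ∀ {X Y} (a : Hom X Y), d (d a) = 0
  d_comp : ∀ {X Y Z} (a : Hom Y Z) (b : Hom X Y),
    d (comp a b) = comp (d a) b + comp (par a) (d b)

attribute [instance] DGCat.acg DGCat.modk DGCat.modQ DGCat.tower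
attribute [simp] DGCat.one_comp DGCat.comp_one DGCat.par_par DGCat.par_one DGCat.d_d

variable {k Q : Type u} [Field k] [CommRing Q] [Algebra k Q]

namespace DGCat

/-- The even component of a morphism. -/
noncomputable def ev (C : DGCat k Q) {X Y : C.Obj} : C.Hom X Y →ₗ[Q] C.Hom X Y :=
  (algebraMap k Q 2⁻¹) • (LinearMap.id + C.par)

/-- The odd component of a morphism. -/
noncomputable def od (C : DGCat k Q) {X Y : C.Obj} : C.Hom X Y →ₗ[Q] C.Hom X Y :=
  (algebraMap k Q 2⁻¹) • (LinearMap.id - C.par)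

/-- A `Q`-module with its underlying `k`-vector space. -/
structure KMod (k Q : Type u) [Field k] [CommRing Q] [Algebra k Q] : Type (u + 2) where
  carrier : Type (u + 1)
  [acg : AddCommGroup carrier]
  [modk : Module k carrier]
  [modQ : Module Q carrier]
  [tower : IsScalarTower k Q carrier]

attribute [instance] KMod.acg KMod.modk KMod.modQ KMod.tower

variable (C : DGCat k Q)

/-- `C.bar n X Y` is the direct sum over `X₁, …, Xₙ` of the spaces
`Hom(X₁, X) ⊗ Hom(X₂, X₁) ⊗ ⋯ ⊗ Hom(Y, Xₙ)`, with `n + 1` tensor factors. -/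
noncomputable def bar : ℕ → C.Obj → C.Obj → KMod k Q
  | 0, X, Y => { carrier := (ULift.{u + 1, u} (C.Hom Y X) : Type (u + 1)) }
  | n + 1, X, Y =>
    { carrier := DirectSum C.Obj fun Z => (bar n X Z).carrier ⊗[k] C.Hom Y Z
      tower := inferInstanceAs (IsScalarTower k Q
        (Π₀ Z, (bar n X Z).carrier ⊗[k] C.Hom Y Z)) }

/-- The space of all words `α₀[α₁|…|αₙ]` of composable morphisms from `Y` to `X`, for all `n`. -/
def Word (X Y : C.Obj) : Type (u + 1) := DirectSum ℕ fun n => (C.bar n X Y).carrier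

noncomputable instance (X Y : C.Obj) : AddCommGroup (C.Word X Y) :=
  inferInstanceAs (AddCommGroup (DirectSum ℕ fun n => (C.bar n X Y).carrier))
noncomputable instance (X Y : C.Obj) : Module k (C.Word X Y) :=
  inferInstanceAs (Module k (DirectSum ℕ fun n => (C.bar n X Y).carrier))
noncomputable instance (X Y : C.Obj) : Module Q (C.Word X Y) :=
  inferInstanceAs (Module Q (DirectSum ℕ fun n => (C.bar n X Y).carrier))
instance (X Y : C.Obj) : IsScalarTower k Q (C.Word X Y) :=
  inferInstanceAs (IsScalarTower k Q (Π₀ n, (C.bar n X Y).carrier))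

variable {C}

/-- The identification of `bar 0` with the space of morphisms. -/
noncomputable def barZero (X Y : C.Obj) : C.Hom Y X ≃ₗ[Q] (C.bar 0 X Y).carrier :=
  (ULift.moduleEquiv.{u, u, u + 1} (R := Q) (M := C.Hom Y X)).symm

open Classical in
/-- The map `bar n ⊗ Hom → bar (n + 1)`. -/
noncomputable def barSucc (n : ℕ) (X Y Z : C.Obj) :
    ((C.bar n X Z).carrier ⊗[k] C.Hom Y Z) →ₗ[Q] (C.bar (n + 1) X Y).carrier :=
  DirectSum.lof Q C.Obj (fun Z => (C.bar n X Z).carrier ⊗[k] C.Hom Y Z) Z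

/-- The inclusion of the words with `n + 1` letters. -/
noncomputable def barIncl (n : ℕ) (X Y : C.Obj) : (C.bar n X Y).carrier →ₗ[Q] C.Word X Y :=
  DirectSum.lof Q ℕ (fun n => (C.bar n X Y).carrier) n

/-- Linear maps out of the space of words. -/
noncomputable def wordLift {X Y : C.Obj} {N : Type*} [AddCommGroup N] [Module Q N]
    (F : ∀ n, (C.bar n X Y).carrier →ₗ[Q] N) : C.Word X Y →ₗ[Q] N :=
  DirectSum.toModule Q ℕ N F

@[simp] theorem wordLift_barIncl {X Y : C.Obj} {N : Type*} [AddCommGroup N] [Module Q N]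
    (F : ∀ n, (C.bar n X Y).carrier →ₗ[Q] N) (n : ℕ) (x : (C.bar n X Y).carrier) :
    wordLift F (barIncl n X Y x) = F n x :=
  DirectSum.toModule_lof (M := fun n => (C.bar n X Y).carrier) (φ := F) Q n x

open Classical in
/-- Linear maps out of `bar (n + 1)`. -/
noncomputable def barLift {n : ℕ} {X Y : C.Obj} {N : Type*} [AddCommGroup N] [Module Q N]
    (F : ∀ Z, ((C.bar n X Z).carrier ⊗[k] C.Hom Y Z) →ₗ[Q] N) :
    (C.bar (n + 1) X Y).carrier →ₗ[Q] N :=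
  DirectSum.toModule Q C.Obj N F

@[simp] theorem barLift_barSucc {n : ℕ} {X Y : C.Obj} {N : Type*} [AddCommGroup N] [Module Q N]
    (F : ∀ Z, ((C.bar n X Z).carrier ⊗[k] C.Hom Y Z) →ₗ[Q] N) (Z : C.Obj)
    (x : (C.bar n X Z).carrier ⊗[k] C.Hom Y Z) : barLift F (barSucc n X Y Z x) = F Z x := by
  classical
  exact DirectSum.toModule_lof (M := fun Z => (C.bar n X Z).carrier ⊗[k] C.Hom Y Z) (φ := F) Q Z x

/-- The word `α[]`. -/
noncomputable def base {X Y : C.Obj} : C.Hom Y X →ₗ[Q] C.Word X Y :=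
  barIncl 0 X Y ∘ₗ (barZero X Y).toLinearMap

/-- Appending a letter: `α₀[α₁|…|αₙ], α ↦ α₀[α₁|…|αₙ|α]`. -/
noncomputable def snoc {X Y Z : C.Obj} : C.Word X Z →ₗ[Q] C.Hom Y Z →ₗ[k] C.Word X Y :=
  wordLift fun n => TensorProduct.AlgebraTensorModule.curry
    (barIncl (n + 1) X Y ∘ₗ barSucc n X Y Z)

theorem snoc_barIncl {X Y Z : C.Obj} (n : ℕ) (x : (C.bar n X Z).carrier) (a : C.Hom Y Z) :
    snoc (barIncl n X Z x) a = barIncl (n + 1) X Y (barSucc n X Y Z (x ⊗ₜ a)) := by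
  unfold snoc
  rw [wordLift_barIncl]
  rfl

section Elim

variable {X : C.Obj} {N : C.Obj → Type*} [∀ Y, AddCommGroup (N Y)] [∀ Y, Module k (N Y)]
  [∀ Y, Module Q (N Y)] [∀ Y, IsScalarTower k Q (N Y)]

/-- Auxiliary definition for `DGCat.elim`. -/
noncomputable def elimAux (β : ∀ Y, C.Hom Y X →ₗ[Q] N Y)
    (s : ∀ Y Z, (C.Word X Z × N Z) →ₗ[Q] C.Hom Y Z →ₗ[k] N Y) :
    ∀ (n : ℕ) (Y : C.Obj), (C.bar n X Y).carrier →ₗ[Q] N Y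
  | 0, Y => β Y ∘ₗ (barZero X Y).symm.toLinearMap
  | n + 1, Y => barLift fun Z => TensorProduct.AlgebraTensorModule.lift (s Y Z ∘ₗ
        LinearMap.prod (barIncl n X Z) (elimAux β s n Z))

/-- Recursion on words: the linear map `F` with `F(α[]) = β(α)` and
`F(α₀[α₁|…|αₙ|α]) = s(w, F(w))(α)`, where `w = α₀[α₁|…|αₙ]`. -/
noncomputable def elim (β : ∀ Y, C.Hom Y X →ₗ[Q] N Y)
    (s : ∀ Y Z, (C.Word X Z × N Z) →ₗ[Q] C.Hom Y Z →ₗ[k] N Y) (Y : C.Obj) :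
    C.Word X Y →ₗ[Q] N Y :=
  wordLift fun n => elimAux β s n Y

theorem word_induction_incl {Y : C.Obj} {p : C.Word X Y → Prop} (x : C.Word X Y)
    (h : ∀ n x, p (barIncl n X Y x)) (h0 : p 0) (ha : ∀ x y, p x → p y → p (x + y)) : p x := by
  classical
  exact DirectSum.induction_on (motive := p) x h0 h ha

theorem bar_induction {n : ℕ} {Y : C.Obj} {p : (C.bar (n + 1) X Y).carrier → Prop}
    (x : (C.bar (n + 1) X Y).carrier) (h : ∀ Z x a, p (barSucc n X Y Z (x ⊗ₜ a))) (h0 : p 0)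
    (ha : ∀ x y, p x → p y → p (x + y)) : p x := by
  classical
  refine DirectSum.induction_on (motive := p) x h0 (fun Z t => ?_) ha
  change p (barSucc n X Y Z t)
  induction t using TensorProduct.induction_on with
  | zero => rw [map_zero]; exact h0
  | add x y hx hy => rw [map_add]; exact ha _ _ hx hy
  | tmul x a => exact h Z x a

theorem word_induction {p : ∀ Y, C.Word X Y → Prop} {Y : C.Obj} (x : C.Word X Y)
    (hb : ∀ Y (a : C.Hom Y X), p Y (base a))
    (hs : ∀ Y Z (x : C.Word X Z) (a : C.Hom Y Z), p Z x → p Y (snoc x a)) (h0 : ∀ Y, p Y 0)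
    (ha : ∀ Y x y, p Y x → p Y y → p Y (x + y)) : p Y x := by
  have key : ∀ n Y (x : (C.bar n X Y).carrier), p Y (barIncl n X Y x) := by
    intro n
    induction n with
    | zero =>
      intro Y x
      have := hb Y ((barZero X Y).symm x)
      simpa [base] using this
    | succ n ih =>
      intro Y x
      refine bar_induction (p := fun x => p Y (barIncl (n + 1) X Y x)) x (fun Z x a => ?_) (by simp only [map_zero]; exact h0 Y)
        (fun x y hx hy => by simp only [map_add]; exact ha _ _ _ hx hy)
      rw [← snoc_barIncl]
      exact hs Y Z _ a (ih Z x)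
  exact word_induction_incl x (fun n x => key n Y x) (h0 Y) (ha Y)

variable (β : ∀ Y, C.Hom Y X →ₗ[Q] N Y)
    (s : ∀ Y Z, (C.Word X Z × N Z) →ₗ[Q] C.Hom Y Z →ₗ[k] N Y)

@[simp] theorem elim_base {Y : C.Obj} (a : C.Hom Y X) : elim β s Y (base a) = β Y a := by
  unfold elim base
  rw [LinearMap.comp_apply, wordLift_barIncl]
  simp [elimAux]

@[simp] theorem elim_snoc {Y Z : C.Obj} (x : C.Word X Z) (a : C.Hom Y Z) :
    elim β s Y (snoc x a) = s Y Z (x, elim β s Z x) a := by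
  refine word_induction_incl (p := fun x => elim β s Y (snoc x a) = s Y Z (x, elim β s Z x) a)
    x (fun n x => ?_) ?_ (fun x y hx hy => ?_)
  · rw [snoc_barIncl]
    unfold elim
    rw [wordLift_barIncl, wordLift_barIncl, elimAux, barLift_barSucc]
    rfl
  · have e : ((0, 0) : C.Word X Z × N Z) = 0 := rfl
    rw [map_zero, map_zero, LinearMap.zero_apply, map_zero, e, map_zero, LinearMap.zero_apply]
  · have e : ((x + y, elim β s Z x + elim β s Z y) : C.Word X Z × N Z) =
      (x, elim β s Z x) + (y, elim β s Z y) := rfl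
    rw [map_add, LinearMap.add_apply, map_add, hx, hy, map_add, e, map_add, LinearMap.add_apply]

end Elim

end DGCat

end Hochschild

set_option linter.unusedSectionVars false

section Hochschild

variable {k Q : Type u} [Field k] [CommRing Q] [Algebra k Q]

namespace DGCat

variable {C : DGCat k Q}

section Parity

variable [CharZero k] {X Y Z : C.Obj}

theorem two_smul_inv (c : k) (hc : c * 2 = 1) (a : C.Hom X Y) :
    algebraMap k Q c • a + algebraMap k Q c • a = a := by
  rw [← add_smul, ← map_add, ← mul_two, hc, map_one, one_smul]

theorem inv_two : (2 : k)⁻¹ * 2 = 1 := inv_mul_cancel₀ two_ne_zero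

theorem ev_add_od (a : C.Hom X Y) : C.ev a + C.od a = a := by
  simp only [ev, od, LinearMap.smul_apply, LinearMap.add_apply, LinearMap.sub_apply,
    LinearMap.id_apply, smul_add, smul_sub]
  have := two_smul_inv (2 : k)⁻¹ inv_two a
  rw [add_add_sub_cancel, this]

theorem ev_sub_od (a : C.Hom X Y) : C.ev a - C.od a = C.par a := by
  simp only [ev, od, LinearMap.smul_apply, LinearMap.add_apply, LinearMap.sub_apply,
    LinearMap.id_apply, smul_add, smul_sub]
  have := two_smul_inv (2 : k)⁻¹ inv_two (C.par a)
  rw [add_sub_sub_cancel, this]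

theorem par_ev (a : C.Hom X Y) : C.par (C.ev a) = C.ev a := by
  simp [ev, add_comm]

theorem par_od (a : C.Hom X Y) : C.par (C.od a) = -C.od a := by
  simp [od, ← smul_neg]

theorem ev_par (a : C.Hom X Y) : C.ev (C.par a) = C.ev a := by
  simp [ev, add_comm]

theorem od_par (a : C.Hom X Y) : C.od (C.par a) = -C.od a := by
  simp [od, ← smul_neg]

theorem d_ev (a : C.Hom X Y) : C.d (C.ev a) = C.od (C.d a) := by
  simp [ev, od, C.d_par, sub_eq_add_neg]

theorem d_od (a : C.Hom X Y) : C.d (C.od a) = C.ev (C.d a) := by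
  simp [ev, od, C.d_par]

theorem ev_of_par {a : C.Hom X Y} (h : C.par a = a) : C.ev a = a := by
  simp only [ev, LinearMap.smul_apply, LinearMap.add_apply, LinearMap.id_apply, h, smul_add]
  exact two_smul_inv (2 : k)⁻¹ inv_two a

theorem od_of_par {a : C.Hom X Y} (h : C.par a = a) : C.od a = 0 := by
  simp [od, h]

theorem ev_of_par_neg {a : C.Hom X Y} (h : C.par a = -a) : C.ev a = 0 := by
  simp [ev, h]

theorem od_of_par_neg {a : C.Hom X Y} (h : C.par a = -a) : C.od a = a := by
  simp only [od, LinearMap.smul_apply, LinearMap.sub_apply, LinearMap.id_apply, h, smul_sub,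
    smul_neg, sub_neg_eq_add]
  exact two_smul_inv (2 : k)⁻¹ inv_two a

theorem ev_comp (a : C.Hom Y Z) (b : C.Hom X Y) :
    C.ev (C.comp a b) = C.comp (C.ev a) (C.ev b) + C.comp (C.od a) (C.od b) := by
  have h1 : C.par (C.comp (C.ev a) (C.ev b)) = C.comp (C.ev a) (C.ev b) := by
    rw [C.par_comp, par_ev, par_ev]
  have h2 : C.par (C.comp (C.od a) (C.od b)) = C.comp (C.od a) (C.od b) := by
    rw [C.par_comp, par_od, par_od]; simp
  have h3 : C.par (C.comp (C.ev a) (C.od b)) = -C.comp (C.ev a) (C.od b) := by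
    rw [C.par_comp, par_ev, par_od]; simp
  have h4 : C.par (C.comp (C.od a) (C.ev b)) = -C.comp (C.od a) (C.ev b) := by
    rw [C.par_comp, par_ev, par_od]; simp
  nth_rewrite 1 [← ev_add_od a, ← ev_add_od b]
  simp only [map_add, LinearMap.add_apply, ev_of_par h1, ev_of_par h2, ev_of_par_neg h3,
    ev_of_par_neg h4, add_zero, zero_add]

theorem od_comp (a : C.Hom Y Z) (b : C.Hom X Y) :
    C.od (C.comp a b) = C.comp (C.ev a) (C.od b) + C.comp (C.od a) (C.ev b) := by
  have h1 : C.par (C.comp (C.ev a) (C.ev b)) = C.comp (C.ev a) (C.ev b) := by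
    rw [C.par_comp, par_ev, par_ev]
  have h2 : C.par (C.comp (C.od a) (C.od b)) = C.comp (C.od a) (C.od b) := by
    rw [C.par_comp, par_od, par_od]; simp
  have h3 : C.par (C.comp (C.ev a) (C.od b)) = -C.comp (C.ev a) (C.od b) := by
    rw [C.par_comp, par_ev, par_od]; simp
  have h4 : C.par (C.comp (C.od a) (C.ev b)) = -C.comp (C.od a) (C.ev b) := by
    rw [C.par_comp, par_ev, par_od]; simp
  nth_rewrite 1 [← ev_add_od a, ← ev_add_od b]
  simp only [map_add, LinearMap.add_apply, od_of_par h1, od_of_par h2, od_of_par_neg h3,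
    od_of_par_neg h4, add_zero, zero_add]
  rw [add_comm]

end Parity

/-- The sign operator on words: `α₀[α₁|…|αₙ]` has degree `|α₀| + (|α₁| - 1) + ⋯ + (|αₙ| - 1)`. -/
noncomputable def wpar {X : C.Obj} (Y : C.Obj) : C.Word X Y →ₗ[Q] C.Word X Y :=
  elim (fun _ => base ∘ₗ C.par)
    (fun _ _ => LinearMap.mk₂' Q k (fun p a => -snoc p.2 (C.par a))
      (fun p q a => by simp [neg_add_rev, add_comm]) (fun c p a => by simp)
      (fun p a b => by simp [neg_add_rev, add_comm])
      (fun c p a => by simp [LinearMap.map_smul_of_tower])) Y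

@[simp] theorem wpar_base {X Y : C.Obj} (a : C.Hom Y X) : wpar Y (base a) = base (C.par a) := by
  simp [wpar]

@[simp] theorem wpar_snoc {X Y Z : C.Obj} (x : C.Word X Z) (a : C.Hom Y Z) :
    wpar Y (snoc x a) = -snoc (wpar Z x) (C.par a) := by
  simp [wpar]

/-- Composing the last letter with a morphism: `α₀[α₁|…|αₙ], α ↦ α₀[α₁|…|αₙ α]`. -/
noncomputable def merge {X Y : C.Obj} (Z : C.Obj) :
    C.Word X Z →ₗ[Q] C.Hom Y Z →ₗ[k] C.Word X Y :=
  elim (N := fun Z => C.Hom Y Z →ₗ[k] C.Word X Y)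
    (fun _ => LinearMap.mk₂' Q k (fun a b => base (C.comp a b))
      (fun _ _ _ => by simp) (fun _ _ _ => by simp) (fun _ _ _ => by simp)
      (fun c _ _ => by simp [LinearMap.map_smul_of_tower]))
    (fun _ _ => LinearMap.mk₂' Q k
      (fun p a =>
        { toFun := fun b => snoc p.1 (C.comp a b)
          map_add' := fun b b' => by simp
          map_smul' := fun c b => by simp [LinearMap.map_smul_of_tower] })
      (fun _ _ _ => by ext; simp) (fun _ _ _ => by ext; simp) (fun _ _ _ => by ext; simp)
      (fun c _ _ => by ext; simp [LinearMap.map_smul_of_tower])) Z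

@[simp] theorem merge_base {X Y Z : C.Obj} (a : C.Hom Z X) (b : C.Hom Y Z) :
    merge Z (base a) b = base (C.comp a b) := by
  simp [merge]

@[simp] theorem merge_snoc {X Y Z W : C.Obj} (x : C.Word X W) (a : C.Hom Z W) (b : C.Hom Y Z) :
    merge Z (snoc x a) b = snoc x (C.comp a b) := by
  simp [merge]

/-- Composing the first letter with a morphism: `α, α₀[α₁|…|αₙ] ↦ αα₀[α₁|…|αₙ]`. -/
noncomputable def lmul {X W : C.Obj} (a : C.Hom X W) (Y : C.Obj) :
    C.Word X Y →ₗ[Q] C.Word W Y :=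
  elim (N := fun Y => C.Word W Y) (fun _ => base ∘ₗ C.comp a)
    (fun _ _ => snoc ∘ₗ LinearMap.snd Q _ _) Y

@[simp] theorem lmul_base {X Y W : C.Obj} (a : C.Hom X W) (b : C.Hom Y X) :
    lmul a Y (base b) = base (C.comp a b) := by
  simp [lmul]

@[simp] theorem lmul_snoc {X Y Z W : C.Obj} (a : C.Hom X W) (x : C.Word X Z) (b : C.Hom Y Z) :
    lmul a Y (snoc x b) = snoc (lmul a Z x) b := by
  simp [lmul]

theorem lmul_add {X Y W : C.Obj} (a b : C.Hom X W) (x : C.Word X Y) :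
    lmul (a + b) Y x = lmul a Y x + lmul b Y x := by
  refine word_induction (p := fun Y x => lmul (a + b) Y x = lmul a Y x + lmul b Y x) x
    (fun _ _ => by simp) (fun _ _ x c h => by simp [h]) (fun _ => by simp) fun _ x y hx hy => ?_
  simp only [map_add, hx, hy]; abel

theorem lmul_smul {X Y W : C.Obj} (c : Q) (a : C.Hom X W) (x : C.Word X Y) :
    lmul (c • a) Y x = c • lmul a Y x := by
  refine word_induction (p := fun Y x => lmul (c • a) Y x = c • lmul a Y x) x
    (fun _ _ => by simp) (fun _ _ x c h => by simp [h]) (fun _ => by simp) fun _ x y hx hy => ?_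
  simp only [map_add, hx, hy, smul_add]

theorem lmul_neg {X Y W : C.Obj} (a : C.Hom X W) (x : C.Word X Y) :
    lmul (-a) Y x = -lmul a Y x := by
  have := lmul_smul (-1 : Q) a x
  simpa using this

/-- Moving the last letter to the front: `α₀[α₁|…|αₙ], α ↦ (-1)^((|α| - 1) e) αα₀[α₁|…|αₙ]`,
where `e` is the degree of the word `α₀[α₁|…|αₙ]`. -/
noncomputable def cyc {X Y W : C.Obj} : C.Word X Y →ₗ[Q] C.Hom X W →ₗ[k] C.Word W Y :=
  LinearMap.mk₂' Q k (fun x a => lmul (C.od a) Y x + lmul (C.ev a) Y (wpar Y x))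
    (fun _ _ _ => by simp only [map_add]; abel) (fun _ _ _ => by simp)
    (fun _ _ _ => by simp only [map_add, lmul_add]; abel)
    (fun c _ _ => by
      simp only [← algebraMap_smul Q c, LinearMap.map_smul, lmul_smul, smul_add])

theorem cyc_apply {X Y W : C.Obj} (x : C.Word X Y) (a : C.Hom X W) :
    cyc x a = lmul (C.od a) Y x + lmul (C.ev a) Y (wpar Y x) := rfl

/-- The sum of `b₁` and of all the terms of `b₂` but the last one:
`α₀[α₁|…|αₙ] ↦ ∂α₀[α₁|…|αₙ] + ∑_{1 ≤ j ≤ n} (-1)^(|α₀| + ⋯ + |αⱼ₋₁| - j) α₀[α₁|…|∂αⱼ|…|αₙ]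
  + ∑_{0 ≤ j < n} (-1)^(|α₀| + ⋯ + |αⱼ| - j) α₀[α₁|…|αⱼ αⱼ₊₁|…|αₙ]`
(with `α₀ α₁[α₂|…|αₙ]` for `j = 0`). -/
noncomputable def wd {X : C.Obj} (Y : C.Obj) : C.Word X Y →ₗ[Q] C.Word X Y :=
  elim (fun _ => base ∘ₗ C.d)
    (fun _ Z => LinearMap.mk₂' Q k
      (fun p a => snoc p.2 a + merge Z (wpar Z p.1) a - snoc (wpar Z p.1) (C.d a))
      (fun _ _ _ => by simp only [map_add, Prod.fst_add, Prod.snd_add, LinearMap.add_apply]; abel)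
      (fun _ _ _ => by simp [smul_add, smul_sub])
      (fun _ _ _ => by simp only [map_add]; abel)
      (fun c _ _ => by simp [LinearMap.map_smul_of_tower, smul_add, smul_sub])) Y

@[simp] theorem wd_base {X Y : C.Obj} (a : C.Hom Y X) : wd Y (base a) = base (C.d a) := by
  simp [wd]

@[simp] theorem wd_snoc {X Y Z : C.Obj} (x : C.Word X Z) (a : C.Hom Y Z) :
    wd Y (snoc x a) = snoc (wd Z x) a + merge Z (wpar Z x) a - snoc (wpar Z x) (C.d a) := by
  simp [wd]

variable (C) in
/-- The graded vector space underlying the Hochschild complex: the direct sum over `n ≥ 0` and over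
objects `X₀, …, Xₙ` of `Hom(X₁, X₀) ⊗ Hom(X₂, X₁) ⊗ ⋯ ⊗ Hom(X₀, Xₙ)`. -/
def HHSpace : Type (u + 1) := DirectSum C.Obj fun X => C.Word X X

noncomputable instance : AddCommGroup C.HHSpace :=
  inferInstanceAs (AddCommGroup (DirectSum C.Obj fun X => C.Word X X))
noncomputable instance : Module k C.HHSpace :=
  inferInstanceAs (Module k (DirectSum C.Obj fun X => C.Word X X))
noncomputable instance : Module Q C.HHSpace :=
  inferInstanceAs (Module Q (DirectSum C.Obj fun X => C.Word X X))
instance : IsScalarTower k Q C.HHSpace :=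
  inferInstanceAs (IsScalarTower k Q (Π₀ X, C.Word X X))

open Classical in
/-- The inclusion of the closed words starting and ending at `X`. -/
noncomputable def close (X : C.Obj) : C.Word X X →ₗ[Q] C.HHSpace :=
  DirectSum.lof Q C.Obj (fun X => C.Word X X) X

open Classical in
/-- Linear maps out of the Hochschild space. -/
noncomputable def hhLift {N : Type*} [AddCommGroup N] [Module Q N]
    (F : ∀ X, C.Word X X →ₗ[Q] N) : C.HHSpace →ₗ[Q] N :=
  DirectSum.toModule Q C.Obj N F

@[simp] theorem hhLift_close {N : Type*} [AddCommGroup N] [Module Q N]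
    (F : ∀ X, C.Word X X →ₗ[Q] N) (X : C.Obj) (x : C.Word X X) :
    hhLift F (close X x) = F X x := by
  classical
  exact DirectSum.toModule_lof (M := fun X => C.Word X X) (φ := F) Q X x

theorem hh_induction {p : C.HHSpace → Prop} (x : C.HHSpace) (h : ∀ X x, p (close X x))
    (h0 : p 0) (ha : ∀ x y, p x → p y → p (x + y)) : p x := by
  classical
  exact DirectSum.induction_on (motive := p) x h0 h ha

/-- Auxiliary definition for the last term of `b₂`. -/
noncomputable def wrapAux {X : C.Obj} (Y : C.Obj) :
    C.Word X Y →ₗ[Q] C.Hom X Y →ₗ[k] C.HHSpace :=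
  elim (N := fun Y => C.Hom X Y →ₗ[k] C.HHSpace) (fun _ => 0)
    (fun _ Z => LinearMap.mk₂' Q k
      (fun p a =>
        { toFun := fun c => -close Z (cyc p.1 (C.comp a c))
          map_add' := fun b b' => by simp only [map_add]; abel
          map_smul' := fun c b => by simp [LinearMap.map_smul_of_tower] })
      (fun _ _ _ => by
        ext
        simp only [map_add, Prod.fst_add, LinearMap.add_apply, LinearMap.coe_mk, AddHom.coe_mk]
        abel)
      (fun _ _ _ => by ext; simp)
      (fun _ _ _ => by
        ext
        simp only [map_add, LinearMap.add_apply, LinearMap.coe_mk, AddHom.coe_mk]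
        abel)
      (fun c _ _ => by ext; simp [LinearMap.map_smul_of_tower])) Y

/-- The last term of `b₂`:
`α₀[α₁|…|αₙ] ↦ -(-1)^((|αₙ| - 1)(|α₀| + ⋯ + |αₙ₋₁| - (n - 1))) αₙα₀[α₁|…|αₙ₋₁]` if `n ≥ 1`,
and `α₀[] ↦ 0`. -/
noncomputable def wrap (X : C.Obj) : C.Word X X →ₗ[Q] C.HHSpace :=
  (LinearMap.applyₗ' Q (C.one X) : (C.Hom X X →ₗ[k] C.HHSpace) →ₗ[Q] C.HHSpace) ∘ₗ wrapAux X

end DGCat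
end Hochschild

set_option linter.unusedSectionVars false

section Hochschild

variable {k Q : Type u} [Field k] [CommRing Q] [Algebra k Q]

namespace DGCat

variable {C : DGCat k Q}

theorem word_cases {X Y : C.Obj} {p : C.Word X Y → Prop} (x : C.Word X Y)
    (hb : ∀ a : C.Hom Y X, p (base a)) (hs : ∀ Z (x : C.Word X Z) (a : C.Hom Y Z), p (snoc x a))
    (h0 : p 0) (ha : ∀ x y, p x → p y → p (x + y)) : p x := by
  refine word_induction_incl x (fun n x => ?_) h0 ha
  cases n with
  | zero =>
    have := hb ((barZero X Y).symm x)
    simpa [base] using this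
  | succ n =>
    refine bar_induction (p := fun x => p (barIncl (n + 1) X Y x)) x (fun Z x a => ?_)
      (by simp only [map_zero]; exact h0) (fun x y hx hy => by simp only [map_add]; exact ha _ _ hx hy)
    rw [← snoc_barIncl]
    exact hs Z _ a

theorem wrapAux_base {X Y : C.Obj} (a : C.Hom Y X) : wrapAux Y (base a) = 0 := by
  simp [wrapAux]

theorem wrapAux_snoc {X Y Z : C.Obj} (x : C.Word X Z) (a : C.Hom Y Z) (c : C.Hom X Y) :
    wrapAux Y (snoc x a) c = -close Z (cyc x (C.comp a c)) := by
  simp [wrapAux]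

@[simp] theorem wrap_base {X : C.Obj} (a : C.Hom X X) : wrap X (base a) = 0 := by
  change wrapAux X (base a) (C.one X) = 0
  rw [wrapAux_base]; rfl

@[simp] theorem wrap_snoc {X Z : C.Obj} (x : C.Word X Z) (a : C.Hom X Z) :
    wrap X (snoc x a) = -close Z (cyc x a) := by
  change wrapAux X (snoc x a) (C.one X) = _
  rw [wrapAux_snoc, C.comp_one]

section

variable {X Y Z : C.Obj}

@[simp] theorem wpar_wpar (x : C.Word X Y) : wpar Y (wpar Y x) = x := by
  refine word_induction (p := fun Y x => wpar Y (wpar Y x) = x) x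
    (fun _ _ => by simp) (fun _ _ x c h => by simp [h]) (fun _ => by simp) fun _ x y hx hy => ?_
  simp only [map_add, hx, hy]

theorem merge_wpar (x : C.Word X Z) (a : C.Hom Y Z) :
    wpar Y (merge Z x a) = merge Z (wpar Z x) (C.par a) := by
  refine word_induction (p := fun Z x => ∀ a : C.Hom Y Z,
    wpar Y (merge Z x a) = merge Z (wpar Z x) (C.par a)) x
    (fun _ _ => by simp [C.par_comp]) (fun _ _ x c h => by simp [C.par_comp]) (fun _ => by simp)
    (fun _ x y hx hy a => ?_) a
  simp only [map_add, LinearMap.add_apply, hx, hy]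

theorem lmul_wpar {W : C.Obj} (a : C.Hom X W) (x : C.Word X Y) :
    wpar Y (lmul a Y x) = lmul (C.par a) Y (wpar Y x) := by
  refine word_induction (p := fun Y x => wpar Y (lmul a Y x) = lmul (C.par a) Y (wpar Y x)) x
    (fun _ _ => by simp [C.par_comp]) (fun _ _ x c h => by simp [h]) (fun _ => by simp)
    (fun _ x y hx hy => ?_)
  simp only [map_add, hx, hy]

theorem lmul_lmul {W V : C.Obj} (a : C.Hom W V) (b : C.Hom X W) (x : C.Word X Y) :
    lmul a Y (lmul b Y x) = lmul (C.comp a b) Y x := by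
  refine word_induction (p := fun Y x => lmul a Y (lmul b Y x) = lmul (C.comp a b) Y x) x
    (fun _ _ => by simp [C.comp_assoc]) (fun _ _ x c h => by simp [h]) (fun _ => by simp)
    (fun _ x y hx hy => ?_)
  simp only [map_add, hx, hy]

theorem merge_merge {W : C.Obj} (x : C.Word X Z) (a : C.Hom Y Z) (b : C.Hom W Y) :
    merge Y (merge Z x a) b = merge Z x (C.comp a b) := by
  refine word_induction (p := fun Z x => ∀ a : C.Hom Y Z,
    merge Y (merge Z x a) b = merge Z x (C.comp a b)) x
    (fun _ _ => by simp [C.comp_assoc]) (fun _ _ x c h => by simp [C.comp_assoc])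
    (fun _ => by simp) (fun _ x y hx hy a => ?_) a
  simp only [map_add, LinearMap.add_apply, hx, hy]

theorem lmul_merge {W : C.Obj} (b : C.Hom X W) (x : C.Word X Z) (a : C.Hom Y Z) :
    lmul b Y (merge Z x a) = merge Z (lmul b Z x) a := by
  refine word_induction (p := fun Z x => ∀ a : C.Hom Y Z,
    lmul b Y (merge Z x a) = merge Z (lmul b Z x) a) x
    (fun _ _ => by simp [C.comp_assoc]) (fun _ _ x c h => by simp)
    (fun _ => by simp) (fun _ x y hx hy a => ?_) a
  simp only [map_add, LinearMap.add_apply, hx, hy]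

theorem wd_wpar (x : C.Word X Y) : wd Y (wpar Y x) = -wpar Y (wd Y x) := by
  refine word_induction (p := fun Y x => wd Y (wpar Y x) = -wpar Y (wd Y x)) x
    (fun _ _ => by simp [C.d_par]) (fun _ _ x c h => ?_) (fun _ => by simp)
    (fun _ x y hx hy => ?_)
  · simp only [wpar_snoc, map_neg, wd_snoc, h, map_sub, map_add, merge_wpar, wpar_wpar, C.d_par,
      LinearMap.neg_apply]
  · simp only [map_add, hx, hy]; abel

theorem wd_merge (x : C.Word X Z) (a : C.Hom Y Z) :
    wd Y (merge Z x a) = merge Z (wd Z x) a + merge Z (wpar Z x) (C.d a) := by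
  refine word_induction (p := fun Z x => ∀ a : C.Hom Y Z,
    wd Y (merge Z x a) = merge Z (wd Z x) a + merge Z (wpar Z x) (C.d a)) x
    (fun _ _ => by simp [C.d_comp]) (fun _ _ x c h a => ?_)
    (fun _ => by simp) (fun _ x y hx hy a => ?_) a
  · simp only [merge_snoc, wd_snoc, C.d_comp, map_add, map_sub, LinearMap.sub_apply,
      LinearMap.add_apply, merge_merge, wpar_snoc, LinearMap.neg_apply, map_neg]
    abel
  · simp only [map_add, LinearMap.add_apply, hx, hy]; abel

theorem wd_lmul {W : C.Obj} (a : C.Hom X W) (x : C.Word X Y) :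
    wd Y (lmul a Y x) = lmul (C.d a) Y x + lmul (C.par a) Y (wd Y x) := by
  refine word_induction (p := fun Y x =>
    wd Y (lmul a Y x) = lmul (C.d a) Y x + lmul (C.par a) Y (wd Y x)) x
    (fun _ _ => by simp [C.d_comp]) (fun _ _ x c h => ?_)
    (fun _ => by simp) (fun _ x y hx hy => ?_)
  · simp only [lmul_snoc, wd_snoc, h, map_add, map_sub, LinearMap.add_apply, lmul_merge, lmul_wpar]
    abel
  · simp only [map_add, hx, hy]; abel

theorem wd_wd (x : C.Word X Y) : wd Y (wd Y x) = 0 := by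
  refine word_induction (p := fun Y x => wd Y (wd Y x) = 0) x
    (fun _ _ => by simp) (fun _ _ x c h => ?_) (fun _ => by simp) (fun _ x y hx hy => ?_)
  · simp only [wd_snoc, map_add, map_sub, h, wd_merge, wd_wpar, wpar_wpar, LinearMap.zero_apply,
      map_zero, map_neg, LinearMap.neg_apply, C.d_d]
    abel
  · simp only [map_add, hx, hy, add_zero]

variable [CharZero k]

theorem wd_cyc {W : C.Obj} (x : C.Word X Y) (a : C.Hom X W) :
    wd Y (cyc x a) = -cyc (wd Y x) a + cyc (wpar Y x) (C.d a) := by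
  simp only [cyc_apply, map_add, wd_lmul, par_ev, par_od, wd_wpar, d_ev, d_od, lmul_neg, map_neg,
    wpar_wpar]
  abel

theorem wrap_merge_cyc (x : C.Word X Y) (a : C.Hom X Y) :
    wrap X (merge Y (wpar Y x) a) = wrap Y (cyc x a) := by
  refine word_induction (p := fun Y x => ∀ a : C.Hom X Y,
    wrap X (merge Y (wpar Y x) a) = wrap Y (cyc x a)) x
    (fun _ _ _ => by simp [cyc_apply]) (fun Y Z x c h a => ?_)
    (fun _ => by simp) (fun _ x y hx hy a => ?_) a
  · simp only [cyc_apply, wpar_snoc, map_neg, LinearMap.neg_apply, merge_snoc, wrap_snoc, lmul_snoc,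
      map_add, neg_neg, wpar_wpar, ev_comp, od_comp, lmul_add, lmul_lmul, lmul_wpar, od_par, ev_par,
      par_od, par_ev, lmul_neg]
    abel
  · simp only [map_add, LinearMap.add_apply, hx, hy]

end

/-- The sign operator on the Hochschild space. -/
noncomputable def hhPar (C : DGCat k Q) : C.HHSpace →ₗ[Q] C.HHSpace :=
  hhLift fun X => close X ∘ₗ wpar X

/-- The Hochschild differential `b = b₂ + b₁`. -/
noncomputable def hhD (C : DGCat k Q) : C.HHSpace →ₗ[Q] C.HHSpace :=
  hhLift fun X => close X ∘ₗ wd X + wrap X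

@[simp] theorem hhPar_close {X : C.Obj} (x : C.Word X X) :
    hhPar C (close X x) = close X (wpar X x) := by simp [hhPar]

@[simp] theorem hhD_close {X : C.Obj} (x : C.Word X X) :
    hhD C (close X x) = close X (wd X x) + wrap X x := by simp [hhD]

theorem hhPar_wrap [CharZero k] {X : C.Obj} (x : C.Word X X) :
    hhPar C (wrap X x) = -wrap X (wpar X x) := by
  refine word_cases (p := fun x => hhPar C (wrap X x) = -wrap X (wpar X x)) x (fun a => by simp)
    (fun Z x a => ?_) (by simp) (fun x y hx hy => ?_)
  · simp only [wrap_snoc, map_neg, hhPar_close, wpar_snoc, neg_neg,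
      cyc_apply, map_add, lmul_wpar, wpar_wpar, par_od, par_ev, lmul_neg, od_par, ev_par]
  · simp only [map_add, hx, hy]; abel

theorem hhD_wrap [CharZero k] {X : C.Obj} (x : C.Word X X) :
    hhD C (wrap X x) = -wrap X (wd X x) := by
  refine word_cases (p := fun x => hhD C (wrap X x) = -wrap X (wd X x)) x (fun a => by simp)
    (fun Z x a => ?_) (by simp) (fun x y hx hy => ?_)
  · simp only [wrap_snoc, map_neg, hhD_close, wd_cyc, wd_snoc, map_add, map_sub, wrap_merge_cyc]
    abel
  · simp only [map_add, hx, hy]; abel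

theorem hhD_hhD [CharZero k] (x : C.HHSpace) : hhD C (hhD C x) = 0 := by
  refine hh_induction (p := fun x => hhD C (hhD C x) = 0) x (fun X x => ?_) (by simp)
    (fun x y hx hy => by simp only [map_add, hx, hy, add_zero])
  simp [wd_wd, hhD_wrap]

/-- The Hochschild complex `HH(C)`, with the action of `Q` on the first tensor factors. -/
noncomputable def HH [CharZero k] (C : DGCat k Q) : SCpx k Q where
  carrier := C.HHSpace
  par := hhPar C
  d := hhD C
  par_par x := by
    refine hh_induction (p := fun x => hhPar C (hhPar C x) = x) x (fun X x => ?_) (by simp)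
      (fun x y hx hy => by simp only [map_add, hx, hy])
    simp
  d_par x := by
    refine hh_induction (p := fun x => hhD C (hhPar C x) = -hhPar C (hhD C x)) x (fun X x => ?_)
      (by simp) (fun x y hx hy => by simp only [map_add, hx, hy]; abel)
    simp [wd_wpar, hhPar_wrap, add_comm]
  d_d := hhD_hhD

end DGCat
end Hochschild

section MF

/-- A matrix factorization of `f ∈ Q`: a finitely generated projective `ℤ/2`-graded `Q`-module with
an odd `Q`-linear endomorphism `δ` such that `δ² = f`. -/
structure MF (k Q : Type u) [Field k] [CommRing Q] [Algebra k Q] (f : Q) : Type (u + 1) where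
  P : Type u
  [acg : AddCommGroup P]
  [modk : Module k P]
  [modQ : Module Q P]
  [tower : IsScalarTower k Q P]
  [fin : Module.Finite Q P]
  [proj : Module.Projective Q P]
  par : P →ₗ[Q] P
  δ : P →ₗ[Q] P
  par_par : ∀ x, par (par x) = x
  δ_par : ∀ x, δ (par x) = -par (δ x)
  δ_δ : ∀ x, δ (δ x) = f • x

attribute [instance] MF.acg MF.modk MF.modQ MF.tower MF.fin MF.proj
attribute [simp] MF.par_par MF.δ_δ

variable {k Q R : Type u} [Field k] [CommRing Q] [Algebra k Q] [CommRing R] [Algebra k R]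
  {f : Q} {g : R}

namespace MF

/-- The localization of `X` at the prime `p` is contractible: its identity is the boundary of an odd
endomorphism. -/
def ContractibleAt (X : MF k Q f) (p : PrimeSpectrum Q) : Prop :=
  ∃ h : LocalizedModule p.asIdeal.primeCompl X.P →ₗ[Localization.AtPrime p.asIdeal]
      LocalizedModule p.asIdeal.primeCompl X.P,
    (∀ x, h (LocalizedModule.map p.asIdeal.primeCompl X.par x) =
      -LocalizedModule.map p.asIdeal.primeCompl X.par (h x)) ∧
    (∀ x, LocalizedModule.map p.asIdeal.primeCompl X.δ (h x) +
      h (LocalizedModule.map p.asIdeal.primeCompl X.δ x) = x)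

/-- The support of a matrix factorization. -/
def supp (X : MF k Q f) : Set (PrimeSpectrum Q) := {p | ¬ X.ContractibleAt p}

theorem contractibleAt_of (X : MF k Q f) (p : PrimeSpectrum Q) (s : Q) (hs : s ∉ p.asIdeal)
    (h : X.P →ₗ[Q] X.P) (h1 : ∀ x, h (X.par x) = -X.par (h x))
    (h2 : ∀ x, X.δ (h x) + h (X.δ x) = s • x) : X.ContractibleAt p := by
  let S := p.asIdeal.primeCompl
  let t : Localization.AtPrime p.asIdeal := Localization.mk 1 ⟨s, hs⟩
  refine ⟨t • LocalizedModule.map S h, fun x => ?_, fun x => ?_⟩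
  · induction x using LocalizedModule.induction_on with
    | h m a =>
      simp only [LinearMap.smul_apply, LocalizedModule.map_mk, h1, map_smul]
      rw [← smul_neg, ← LocalizedModule.mk_neg]
  · induction x using LocalizedModule.induction_on with
    | h m a =>
      simp only [LinearMap.smul_apply, LocalizedModule.map_mk, map_smul, ← smul_add]
      rw [LocalizedModule.mk_add_mk, ← smul_add, h2, LocalizedModule.mk_cancel_common_left]
      simp only [t, LocalizedModule.mk_smul_mk, one_smul]
      exact LocalizedModule.mk_cancel_common_left ⟨s, hs⟩ a m

theorem exists_of_contractibleAt (X : MF k Q f) (p : PrimeSpectrum Q) (hp : X.ContractibleAt p) :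
    ∃ s ∉ p.asIdeal, ∃ h : X.P →ₗ[Q] X.P, (∀ x, h (X.par x) = -X.par (h x)) ∧
      ∀ x, X.δ (h x) + h (X.δ x) = s • x := by
  obtain ⟨h, h1, h2⟩ := hp
  let S := p.asIdeal.primeCompl
  let mk := LocalizedModule.mkLinearMap S X.P
  have : Module.FinitePresentation Q X.P := Module.finitePresentation_of_projective Q X.P
  obtain ⟨h', s, hh⟩ := Module.FinitePresentation.exists_lift_of_isLocalizedModule S mk
    (h.restrictScalars Q ∘ₗ mk)
  have hh' : ∀ x, mk (h' x) = s.1 • h (mk x) := fun x => LinearMap.congr_fun hh x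
  have hmap : ∀ (e : X.P →ₗ[Q] X.P) (x : X.P), LocalizedModule.map S e (mk x) = mk (e x) :=
    fun e x => LocalizedModule.map_mk S e x 1
  have kill : ∀ e : X.P →ₗ[Q] X.P, (∀ x, mk (e x) = 0) → ∃ t : S, ∀ x, t.1 • e x = 0 := by
    intro e he
    have := Module.Finite.exists_smul_of_comp_eq_of_isLocalizedModule S mk e 0
      (LinearMap.ext fun x => by simp [he])
    obtain ⟨t, ht⟩ := this
    exact ⟨t, fun x => (LinearMap.congr_fun ht x).trans (smul_zero _)⟩
  obtain ⟨t, ht⟩ := kill (h' ∘ₗ X.par + X.par ∘ₗ h') fun x => by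
    simp only [LinearMap.add_apply, LinearMap.comp_apply, map_add, ← hmap X.par (h' x), hh',
      ← hmap X.par x]
    rw [h1, LinearMap.map_smul_of_tower, smul_neg, neg_add_cancel]
  obtain ⟨t', ht'⟩ := kill (X.δ ∘ₗ h' + h' ∘ₗ X.δ - s.1 • LinearMap.id) fun x => by
    have h3 := h2 (mk x)
    simp only [LinearMap.add_apply, LinearMap.sub_apply, LinearMap.smul_apply, LinearMap.id_apply,
      LinearMap.comp_apply, map_add, map_sub, ← hmap X.δ (h' x), hh', map_smul]
    rw [LinearMap.map_smul_of_tower, ← smul_add, ← hmap X.δ x, h3, sub_self]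
  refine ⟨t.1 * t'.1 * s.1, (t * t' * s).2, (t.1 * t'.1) • h', fun x => ?_, fun x => ?_⟩
  · have := ht x
    simp only [LinearMap.add_apply, LinearMap.comp_apply] at this
    simp only [LinearMap.smul_apply, map_smul]
    rw [← add_eq_zero_iff_eq_neg, ← smul_add, mul_comm, mul_smul, this, smul_zero]
  · have := ht' x
    simp only [LinearMap.add_apply, LinearMap.sub_apply, LinearMap.smul_apply, LinearMap.id_apply,
      LinearMap.comp_apply, smul_sub, sub_eq_zero] at this
    simp only [LinearMap.smul_apply, map_smul]
    rw [← smul_add, mul_smul, this, smul_smul, smul_smul, mul_assoc]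

/-- The sign operator on morphisms: `α ↦ (-1)^|α| α`. -/
noncomputable def hpar (X Y : MF k Q f) : (X.P →ₗ[Q] Y.P) →ₗ[Q] (X.P →ₗ[Q] Y.P) :=
  LinearMap.lcomp Q Y.P X.par ∘ₗ LinearMap.llcomp Q X.P Y.P Y.P Y.par

/-- The differential on morphisms: `∂α = δα - (-1)^|α| αδ`. -/
noncomputable def hd (X Y : MF k Q f) : (X.P →ₗ[Q] Y.P) →ₗ[Q] (X.P →ₗ[Q] Y.P) :=
  LinearMap.llcomp Q X.P Y.P Y.P Y.δ - LinearMap.lcomp Q Y.P X.δ ∘ₗ hpar X Y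

@[simp] theorem hpar_apply {X Y : MF k Q f} (a : X.P →ₗ[Q] Y.P) (x : X.P) :
    hpar X Y a x = Y.par (a (X.par x)) := rfl

@[simp] theorem hd_apply {X Y : MF k Q f} (a : X.P →ₗ[Q] Y.P) (x : X.P) :
    hd X Y a x = Y.δ (a x) - hpar X Y a (X.δ x) := rfl

variable (k Q f) in
/-- The dg-category `mf^Z(Q, f)` of matrix factorizations of `f` supported in `Z`.  Morphisms are all
`Q`-linear maps, with the differential `∂α = δα - (-1)^|α| αδ`. -/
noncomputable def dg (Z : Set (PrimeSpectrum Q)) : DGCat k Q where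
  Obj := {X : MF k Q f // X.supp ⊆ Z}
  Hom X Y := X.1.P →ₗ[Q] Y.1.P
  one X := LinearMap.id
  comp {X Y Z} := LinearMap.llcomp Q X.1.P Y.1.P Z.1.P
  par {X Y} := hpar X.1 Y.1
  d {X Y} := hd X.1 Y.1
  one_comp _ := rfl
  comp_one _ := rfl
  comp_assoc _ _ _ := rfl
  par_par a := by ext; simp
  par_one X := by ext; simp
  par_comp a b := by ext; simp
  d_par a := by ext; simp [MF.δ_par]; abel
  d_d a := by ext; simp [MF.δ_par]; abel
  d_comp a b := by ext; simp

attribute [local instance] extModule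

theorem exists_dualBasis {A M : Type u} [CommRing A] [AddCommGroup M] [Module A M]
    [Module.Finite A M] [Module.Projective A M] :
    ∃ (n : ℕ) (e : Fin n → M) (φ : Fin n → (M →ₗ[A] A)), ∀ x, ∑ i, φ i x • e i = x := by
  obtain ⟨n, s, i, hs, hi, h⟩ := Module.Finite.exists_comp_eq_id_of_projective A M
  refine ⟨n, fun j => s (Pi.single j 1), fun j => LinearMap.proj j ∘ₗ i, fun x => ?_⟩
  have : s (i x) = x := LinearMap.congr_fun h x
  nth_rewrite 2 [← this]
  rw [pi_eq_sum_univ' (i x), map_sum]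
  refine Finset.sum_congr rfl fun j _ => ?_
  simp

section

variable {M N : Type u} [AddCommGroup M] [Module k M] [Module Q M]
    [IsScalarTower k Q M] [AddCommGroup N] [Module k N] [Module R N] [IsScalarTower k R N]

/-- The tensor product of linear forms. -/
noncomputable def extForm (φ : M →ₗ[Q] Q) (ψ : N →ₗ[R] R) : (M ⊗[k] N) →ₗ[Q ⊗[k] R] (Q ⊗[k] R) where
  toFun := TensorProduct.map (φ.restrictScalars k) (ψ.restrictScalars k)
  map_add' := map_add _
  map_smul' a x := by
    induction a with
    | zero => simp
    | add a b ha hb => simp only [add_smul, map_add, ha, hb]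
    | tmul q r =>
      induction x with
      | zero => simp
      | add x y hx hy => simp only [smul_add, map_add, hx, hy]
      | tmul m n => simp [ext_smul_tmul]

@[simp] theorem extForm_tmul (φ : M →ₗ[Q] Q) (ψ : N →ₗ[R] R) (m : M) (n : N) :
    extForm (k := k) φ ψ (m ⊗ₜ n) = φ m ⊗ₜ ψ n := rfl

theorem ext_dualBasis {n m : ℕ} (e : Fin n → M) (φ : Fin n → (M →ₗ[Q] Q))
    (he : ∀ x, ∑ i, φ i x • e i = x) (e' : Fin m → N) (φ' : Fin m → (N →ₗ[R] R))
    (he' : ∀ x, ∑ i, φ' i x • e' i = x) (x : M ⊗[k] N) :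
    ∑ ij : Fin n × Fin m, (extForm (k := k) (φ ij.1) (φ' ij.2) x) • (e ij.1 ⊗ₜ[k] e' ij.2) = x := by
  induction x with
  | zero => simp
  | add x y hx hy => simp only [map_add, add_smul, Finset.sum_add_distrib, hx, hy]
  | tmul x y =>
    simp only [extForm_tmul, ext_smul_tmul]
    rw [Fintype.sum_prod_type]
    simp only [← TensorProduct.tmul_sum, he', ← TensorProduct.sum_tmul, he]

variable (k Q R M N) in
theorem ext_finite_projective [Module.Finite Q M] [Module.Projective Q M] [Module.Finite R N]
    [Module.Projective R N] :
    Module.Finite (Q ⊗[k] R) (M ⊗[k] N) ∧ Module.Projective (Q ⊗[k] R) (M ⊗[k] N) := by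
  obtain ⟨n, e, φ, he⟩ := exists_dualBasis (A := Q) (M := M)
  obtain ⟨m, e', φ', he'⟩ := exists_dualBasis (A := R) (M := N)
  let F : (M ⊗[k] N) →ₗ[Q ⊗[k] R] (Fin n × Fin m → Q ⊗[k] R) :=
    LinearMap.pi fun ij => extForm (φ ij.1) (φ' ij.2)
  let G : (Fin n × Fin m → Q ⊗[k] R) →ₗ[Q ⊗[k] R] (M ⊗[k] N) :=
    Fintype.linearCombination (Q ⊗[k] R) fun ij => e ij.1 ⊗ₜ[k] e' ij.2
  have h : G ∘ₗ F = LinearMap.id := LinearMap.ext fun x => by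
    simp only [G, F, LinearMap.comp_apply, Fintype.linearCombination_apply, LinearMap.pi_apply]
    exact ext_dualBasis e φ he e' φ' he' x
  exact ⟨Module.Finite.of_surjective G fun x => ⟨F x, LinearMap.congr_fun h x⟩,
    Module.Projective.of_split F G h⟩

end

/-- The tensor product of matrix factorizations, a matrix factorization of `f ⊗ 1 + 1 ⊗ g`, with
`δ ⊗ 1 + 1 ⊗ δ'`. -/
noncomputable def tensor (X : MF k Q f) (Y : MF k R g) :
    MF k (Q ⊗[k] R) (f ⊗ₜ[k] 1 + 1 ⊗ₜ[k] g) where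
  P := X.P ⊗[k] Y.P
  modQ := extModule k Q R X.P Y.P
  tower := ext_tower
  fin := (ext_finite_projective k Q R X.P Y.P).1
  proj := (ext_finite_projective k Q R X.P Y.P).2
  par := extMap X.par Y.par
  δ := extMap X.δ LinearMap.id + extMap X.par Y.δ
  par_par x := by
    induction x with
    | zero => simp
    | add x y hx hy => rw [map_add, map_add, hx, hy]
    | tmul m n => simp
  δ_par x := by
    induction x with
    | zero => simp
    | add x y hx hy => rw [map_add, map_add, map_add, map_add, hx, hy]; abel
    | tmul m n => simp [X.δ_par, Y.δ_par, TensorProduct.neg_tmul, TensorProduct.tmul_neg]; abel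
  δ_δ x := by
    induction x with
    | zero => simp
    | add x y hx hy => rw [map_add, map_add, hx, hy, smul_add]
    | tmul m n =>
      simp [X.δ_par, TensorProduct.neg_tmul, add_smul, ext_smul_tmul]

/-- The element `x ⊗ y` of the tensor product of two matrix factorizations. -/
def tmul (X : MF k Q f) (Y : MF k R g) (x : X.P) (y : Y.P) : (X.tensor Y).P := x ⊗ₜ[k] y

theorem tensor_induction (X : MF k Q f) (Y : MF k R g) {p : (X.tensor Y).P → Prop}
    (x : (X.tensor Y).P) (zero : p 0) (tmul : ∀ m n, p (X.tmul Y m n))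
    (add : ∀ x y, p x → p y → p (x + y)) : p x :=
  TensorProduct.induction_on x zero tmul add

section

variable (X X' : MF k Q f) (Y Y' : MF k R g)

theorem par_tmul (x : X.P) (y : Y.P) :
    (X.tensor Y).par (X.tmul Y x y) = X.tmul Y (X.par x) (Y.par y) := rfl

theorem δ_tmul (x : X.P) (y : Y.P) :
    (X.tensor Y).δ (X.tmul Y x y) = X.tmul Y (X.δ x) y + X.tmul Y (X.par x) (Y.δ y) := rfl

theorem smul_tmul (q : Q) (r : R) (x : X.P) (y : Y.P) :
    (q ⊗ₜ[k] r) • (X.tmul Y x y) = X.tmul Y (q • x) (r • y) := rfl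

theorem csmul_tmul (c : k) (x : X.P) (y : Y.P) :
    c • (X.tmul Y x y) = X.tmul Y (c • x) y := rfl

theorem csmul_tmul_right (c : k) (x : X.P) (y : Y.P) :
    c • (X.tmul Y x y) = X.tmul Y x (c • y) := (TensorProduct.tmul_smul c x y).symm

@[simp] theorem neg_tmul (x : X.P) (y : Y.P) : X.tmul Y (-x) y = -X.tmul Y x y :=
  TensorProduct.neg_tmul x y

@[simp] theorem tmul_neg (x : X.P) (y : Y.P) : X.tmul Y x (-y) = -X.tmul Y x y :=
  TensorProduct.tmul_neg x y

@[simp] theorem add_tmul (x x' : X.P) (y : Y.P) :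
    X.tmul Y (x + x') y = X.tmul Y x y + X.tmul Y x' y :=
  TensorProduct.add_tmul x x' y

@[simp] theorem tmul_add (x : X.P) (y y' : Y.P) :
    X.tmul Y x (y + y') = X.tmul Y x y + X.tmul Y x y' :=
  TensorProduct.tmul_add x y y'

variable {X X' Y Y'}

/-- The tensor product of linear maps, on tensor products of matrix factorizations. -/
noncomputable def tensorLin (a : X.P →ₗ[Q] X'.P) (b : Y.P →ₗ[R] Y'.P) :
    (X.tensor Y).P →ₗ[Q ⊗[k] R] (X'.tensor Y').P := extMap a b

@[simp] theorem tensorLin_tmul (a : X.P →ₗ[Q] X'.P) (b : Y.P →ₗ[R] Y'.P) (x : X.P) (y : Y.P) :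
    tensorLin a b (X.tmul Y x y) = X'.tmul Y' (a x) (b y) := rfl

theorem tensor_hom_ext {M : Type*} [AddCommGroup M] [Module (Q ⊗[k] R) M]
    {F G : (X.tensor Y).P →ₗ[Q ⊗[k] R] M} (h : ∀ x y, F (X.tmul Y x y) = G (X.tmul Y x y)) :
    F = G := by
  ext x
  induction x using tensor_induction with
  | zero => rw [map_zero, map_zero]
  | add x y hx hy => rw [map_add, map_add, hx, hy]
  | tmul m n => exact h m n

end

theorem tensor_supp (X : MF k Q f) (Y : MF k R g) {q : PrimeSpectrum (Q ⊗[k] R)}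
    (hq : q ∈ (X.tensor Y).supp) :
    q.comap (Algebra.TensorProduct.includeLeft : Q →ₐ[k] Q ⊗[k] R).toRingHom ∈ X.supp ∧
      q.comap (Algebra.TensorProduct.includeRight : R →ₐ[k] Q ⊗[k] R).toRingHom ∈ Y.supp := by
  constructor
  · intro hX
    obtain ⟨s, hs, h, h1, h2⟩ := X.exists_of_contractibleAt _ hX
    have e1 : tensorLin h LinearMap.id ∘ₗ (X.tensor Y).par =
        -((X.tensor Y).par ∘ₗ tensorLin h LinearMap.id) := tensor_hom_ext fun x y => by
      simp [par_tmul, h1]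
    have e2 : (X.tensor Y).δ ∘ₗ tensorLin h LinearMap.id + tensorLin h LinearMap.id ∘ₗ
        (X.tensor Y).δ = (s ⊗ₜ[k] (1 : R)) • LinearMap.id := tensor_hom_ext fun x y => by
      simp only [LinearMap.add_apply, LinearMap.comp_apply, tensorLin_tmul, δ_tmul, map_add, h1,
        LinearMap.id_apply, LinearMap.smul_apply, smul_tmul, ← h2, add_tmul, neg_tmul, one_smul]
      abel
    exact hq ((X.tensor Y).contractibleAt_of q (s ⊗ₜ 1) hs _ (LinearMap.congr_fun e1)
      (LinearMap.congr_fun e2))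
  · intro hX
    obtain ⟨s, hs, h, h1, h2⟩ := Y.exists_of_contractibleAt _ hX
    have e1 : tensorLin X.par h ∘ₗ (X.tensor Y).par =
        -((X.tensor Y).par ∘ₗ tensorLin X.par h) := tensor_hom_ext fun x y => by
      simp [par_tmul, h1]
    have e2 : (X.tensor Y).δ ∘ₗ tensorLin X.par h + tensorLin X.par h ∘ₗ
        (X.tensor Y).δ = ((1 : Q) ⊗ₜ[k] s) • LinearMap.id := tensor_hom_ext fun x y => by
      simp only [LinearMap.add_apply, LinearMap.comp_apply, tensorLin_tmul, δ_tmul, map_add,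
        LinearMap.id_apply, LinearMap.smul_apply, smul_tmul, ← h2, tmul_add, neg_tmul, one_smul,
        X.δ_par, X.par_par]
      abel
    exact hq ((X.tensor Y).contractibleAt_of q (1 ⊗ₜ s) hs _ (LinearMap.congr_fun e1)
      (LinearMap.congr_fun e2))

end MF

/-- The closed subset `Z × W` of `Spec (Q ⊗ R)`. -/
def prodSet (k : Type u) {Q R : Type u} [Field k] [CommRing Q] [Algebra k Q] [CommRing R]
    [Algebra k R] (Z : Set (PrimeSpectrum Q)) (W : Set (PrimeSpectrum R)) :
    Set (PrimeSpectrum (Q ⊗[k] R)) :=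
  {q | q.comap (Algebra.TensorProduct.includeLeft : Q →ₐ[k] Q ⊗[k] R).toRingHom ∈ Z ∧
    q.comap (Algebra.TensorProduct.includeRight : R →ₐ[k] Q ⊗[k] R).toRingHom ∈ W}

end MF

section Kunneth

variable {k Q R : Type u} [Field k] [CommRing Q] [Algebra k Q] [CommRing R] [Algebra k R]

namespace DGCat

section ElimK

variable {C : DGCat k Q}

open Classical in
/-- Auxiliary definition for `DGCat.elimK`. -/
noncomputable def elimKAux {X : C.Obj} {N : C.Obj → Type*} [∀ Y, AddCommGroup (N Y)]
    [∀ Y, Module k (N Y)] (β : ∀ Y, C.Hom Y X →ₗ[k] N Y)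
    (s : ∀ Y Z, (C.Word X Z × N Z) →ₗ[k] C.Hom Y Z →ₗ[k] N Y) :
    ∀ (n : ℕ) (Y : C.Obj), (C.bar n X Y).carrier →ₗ[k] N Y
  | 0, Y => β Y ∘ₗ ((barZero X Y).restrictScalars k).symm.toLinearMap
  | n + 1, Y => DirectSum.toModule k C.Obj (N Y) fun Z => TensorProduct.lift (s Y Z ∘ₗ
        LinearMap.prod ((barIncl n X Z).restrictScalars k) (elimKAux β s n Z))

/-- Recursion on words, for maps which are linear over `k`: the map `F` with `F(α[]) = β(α)` and
`F(α₀[α₁|…|αₙ|α]) = s(w, F(w))(α)`, where `w = α₀[α₁|…|αₙ]`. -/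
noncomputable def elimK {X : C.Obj} {N : C.Obj → Type*} [∀ Y, AddCommGroup (N Y)]
    [∀ Y, Module k (N Y)] (β : ∀ Y, C.Hom Y X →ₗ[k] N Y)
    (s : ∀ Y Z, (C.Word X Z × N Z) →ₗ[k] C.Hom Y Z →ₗ[k] N Y) (Y : C.Obj) :
    C.Word X Y →ₗ[k] N Y :=
  DirectSum.toModule k ℕ (N Y) fun n => elimKAux β s n Y

variable {X : C.Obj} {N : C.Obj → Type*} [∀ Y, AddCommGroup (N Y)]
    [∀ Y, Module k (N Y)] (β : ∀ Y, C.Hom Y X →ₗ[k] N Y)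
    (s : ∀ Y Z, (C.Word X Z × N Z) →ₗ[k] C.Hom Y Z →ₗ[k] N Y)

theorem elimK_barIncl (n : ℕ) (Y : C.Obj) (x : (C.bar n X Y).carrier) :
    elimK β s Y (barIncl n X Y x) = elimKAux β s n Y x :=
  DirectSum.toModule_lof (M := fun n => (C.bar n X Y).carrier)
    (φ := fun n => elimKAux β s n Y) k n x

@[simp] theorem elimK_base {Y : C.Obj} (a : C.Hom Y X) : elimK β s Y (base a) = β Y a := by
  unfold base
  rw [LinearMap.comp_apply, elimK_barIncl]
  change β Y ((barZero X Y).symm ((barZero X Y) a)) = _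
  rw [LinearEquiv.symm_apply_apply]

@[simp] theorem elimK_snoc {Y Z : C.Obj} (x : C.Word X Z) (a : C.Hom Y Z) :
    elimK β s Y (snoc x a) = s Y Z (x, elimK β s Z x) a := by
  classical
  refine word_induction_incl (p := fun x => elimK β s Y (snoc x a) = s Y Z (x, elimK β s Z x) a)
    x (fun n x => ?_) ?_ (fun x y hx hy => ?_)
  · rw [snoc_barIncl, elimK_barIncl, elimK_barIncl, elimKAux]
    exact DirectSum.toModule_lof (M := fun Z => (C.bar n X Z).carrier ⊗[k] C.Hom Y Z)
      (φ := fun Z => TensorProduct.lift (s Y Z ∘ₗ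
        LinearMap.prod ((barIncl n X Z).restrictScalars k) (elimKAux β s n Z))) k Z (x ⊗ₜ a)
  · have e : ((0, 0) : C.Word X Z × N Z) = 0 := rfl
    rw [map_zero, map_zero, LinearMap.zero_apply, map_zero, e, map_zero, LinearMap.zero_apply]
  · have e : ((x + y, elimK β s Z x + elimK β s Z y) : C.Word X Z × N Z) =
      (x, elimK β s Z x) + (y, elimK β s Z y) := rfl
    rw [map_add, LinearMap.add_apply, map_add, hx, hy, map_add, e, map_add, LinearMap.add_apply]

end ElimK

/-- A dg-bifunctor `C × D → E`, bilinear with respect to the actions of `Q`, `R` and `Q ⊗ R`: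
`(a ⊗ b) (a' ⊗ b') = (-1)^(|b| |a'|) a a' ⊗ b b'` and
`d (a ⊗ b) = d a ⊗ b + (-1)^|a| a ⊗ d b`. -/
structure Pairing (C : DGCat k Q) (D : DGCat k R) (E : DGCat k (Q ⊗[k] R)) where
  obj : C.Obj → D.Obj → E.Obj
  map : ∀ {X X' Y Y'}, C.Hom X X' →ₗ[k] D.Hom Y Y' →ₗ[k] E.Hom (obj X Y) (obj X' Y')
  map_one : ∀ X Y, map (C.one X) (D.one Y) = E.one (obj X Y)
  smul_map : ∀ {X X' Y Y'} (q : Q) (r : R) (a : C.Hom X X') (b : D.Hom Y Y'),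
    map (q • a) (r • b) = (q ⊗ₜ[k] r) • map a b
  par_map : ∀ {X X' Y Y'} (a : C.Hom X X') (b : D.Hom Y Y'),
    E.par (map a b) = map (C.par a) (D.par b)
  d_map : ∀ {X X' Y Y'} (a : C.Hom X X') (b : D.Hom Y Y'),
    E.d (map a b) = map (C.d a) b + map (C.par a) (D.d b)
  comp_map : ∀ {X X' X'' Y Y' Y''} (a : C.Hom X' X'') (b : D.Hom Y' Y'') (a' : C.Hom X X')
    (b' : D.Hom Y Y'), E.comp (map a b) (map a' b') =
      map (C.comp a a') (D.comp (D.ev b) b') + map (C.comp a (C.par a')) (D.comp (D.od b) b')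

namespace Pairing

variable {C : DGCat k Q} {D : DGCat k R} {E : DGCat k (Q ⊗[k] R)} (Φ : Pairing C D E)

/-- `shBase c d (β₀[β₁|…|βₙ]) = (c ⊗ β₀)[1 ⊗ β₁|…|1 ⊗ βₙ]`. -/
noncomputable def shBase {X X' : C.Obj} {Y : D.Obj} (c : C.Hom X' X) (Y' : D.Obj) :
    D.Word Y Y' →ₗ[k] E.Word (Φ.obj X Y) (Φ.obj X' Y') :=
  elimK (N := fun Y' => E.Word (Φ.obj X Y) (Φ.obj X' Y'))
    (fun _ => base.restrictScalars k ∘ₗ Φ.map c)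
    (fun _ _ => LinearMap.compl₂ ((snoc.restrictScalars k) ∘ₗ LinearMap.snd k _ _)
      (Φ.map (C.one X'))) Y'

@[simp] theorem shBase_base {X X' : C.Obj} {Y Y' : D.Obj} (c : C.Hom X' X) (d : D.Hom Y' Y) :
    Φ.shBase c Y' (base d) = base (Φ.map c d) := by simp [shBase]

@[simp] theorem shBase_snoc {X X' : C.Obj} {Y Y' V : D.Obj} (c : C.Hom X' X) (y : D.Word Y V)
    (d : D.Hom Y' V) :
    Φ.shBase c Y' (snoc y d) = snoc (Φ.shBase c V y) (Φ.map (C.one X') d) := by simp [shBase]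

/-- Given the map `G = (β₀[…] ↦ α₀[α₁|…|αₙ] ⋆ β₀[…])`, the part of the map
`(β₀[…] ↦ α₀[α₁|…|αₙ|c] ⋆ β₀[…])` consisting of the shuffles in which `c` is the last letter. -/
noncomputable def shLast {X Z X' : C.Obj} {Y : D.Obj}
    (G : ∀ Y', D.Word Y Y' →ₗ[k] E.Word (Φ.obj X Y) (Φ.obj Z Y')) (c : C.Hom X' Z) (Y' : D.Obj) :
    D.Word Y Y' →ₗ[k] E.Word (Φ.obj X Y) (Φ.obj X' Y') :=
  (snoc.restrictScalars k).flip (Φ.map (C.od c) (D.one Y')) ∘ₗ G Y' +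
    (snoc.restrictScalars k).flip (Φ.map (C.ev c) (D.one Y')) ∘ₗ G Y' ∘ₗ
      (wpar Y').restrictScalars k

theorem shLast_apply {X Z X' : C.Obj} {Y : D.Obj}
    (G : ∀ Y', D.Word Y Y' →ₗ[k] E.Word (Φ.obj X Y) (Φ.obj Z Y')) (c : C.Hom X' Z) (Y' : D.Obj)
    (y : D.Word Y Y') : Φ.shLast G c Y' y = snoc (G Y' y) (Φ.map (C.od c) (D.one Y')) +
      snoc (G Y' (wpar Y' y)) (Φ.map (C.ev c) (D.one Y')) := rfl

/-- The sum over all splittings of `β₀[β₁|…|βₙ]` of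
`H(β₀[β₁|…|βᵢ])` followed by the letters `1 ⊗ βᵢ₊₁, …, 1 ⊗ βₙ`. -/
noncomputable def shRest {X X' : C.Obj} {Y : D.Obj}
    (H : ∀ Y', D.Word Y Y' →ₗ[k] E.Word (Φ.obj X Y) (Φ.obj X' Y')) (Y' : D.Obj) :
    D.Word Y Y' →ₗ[k] E.Word (Φ.obj X Y) (Φ.obj X' Y') :=
  elimK (N := fun Y' => E.Word (Φ.obj X Y) (Φ.obj X' Y'))
    (fun Y' => H Y' ∘ₗ base.restrictScalars k)
    (fun Y' _ => LinearMap.compl₂ ((snoc.restrictScalars k) ∘ₗ LinearMap.snd k _ _)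
      (Φ.map (C.one X')) + LinearMap.compr₂ ((snoc.restrictScalars k) ∘ₗ LinearMap.fst k _ _)
        (H Y')) Y'

@[simp] theorem shRest_base {X X' : C.Obj} {Y Y' : D.Obj}
    (H : ∀ Y', D.Word Y Y' →ₗ[k] E.Word (Φ.obj X Y) (Φ.obj X' Y')) (d : D.Hom Y' Y) :
    Φ.shRest H Y' (base d) = H Y' (base d) := by simp [shRest]

@[simp] theorem shRest_snoc {X X' : C.Obj} {Y Y' V : D.Obj}
    (H : ∀ Y', D.Word Y Y' →ₗ[k] E.Word (Φ.obj X Y) (Φ.obj X' Y')) (y : D.Word Y V)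
    (d : D.Hom Y' V) : Φ.shRest H Y' (snoc y d) =
      snoc (Φ.shRest H V y) (Φ.map (C.one X') d) + H Y' (snoc y d) := by simp [shRest]

theorem shRest_congr_add {X X' : C.Obj} {Y Y' : D.Obj}
    (H H' H'' : ∀ Y', D.Word Y Y' →ₗ[k] E.Word (Φ.obj X Y) (Φ.obj X' Y'))
    (h : ∀ Y' y, H'' Y' y = H Y' y + H' Y' y) (y : D.Word Y Y') :
    Φ.shRest H'' Y' y = Φ.shRest H Y' y + Φ.shRest H' Y' y := by
  refine word_induction (p := fun Y' y => Φ.shRest H'' Y' y = Φ.shRest H Y' y + Φ.shRest H' Y' y) y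
    (fun _ _ => by simp [h]) (fun _ _ y d ih => ?_) (fun _ => by simp) (fun _ x y hx hy => ?_)
  · simp only [shRest_snoc, ih, h, map_add, LinearMap.add_apply]; abel
  · simp only [map_add, hx, hy]; abel

theorem shRest_congr_smul {X X' : C.Obj} {Y Y' : D.Obj} (c : k)
    (H H'' : ∀ Y', D.Word Y Y' →ₗ[k] E.Word (Φ.obj X Y) (Φ.obj X' Y'))
    (h : ∀ Y' y, H'' Y' y = c • H Y' y) (y : D.Word Y Y') :
    Φ.shRest H'' Y' y = c • Φ.shRest H Y' y := by
  refine word_induction (p := fun Y' y => Φ.shRest H'' Y' y = c • Φ.shRest H Y' y) y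
    (fun _ _ => by simp [h]) (fun _ _ y d ih => ?_) (fun _ => by simp) (fun _ x y hx hy => ?_)
  · simp only [shRest_snoc, ih, h, smul_add, LinearMap.map_smul_of_tower, LinearMap.smul_apply]
  · simp only [map_add, hx, hy, smul_add]

/-- The shuffle product of words,
`α₀[α₁|…|αₙ] ⋆ β₀[β₁|…|βₘ] = ∑ ± (α₀ ⊗ β₀)[…]`, the sum being over all shuffles of the letters
`α₁ ⊗ 1, …, αₙ ⊗ 1` and `1 ⊗ β₁, …, 1 ⊗ βₘ`, with the sign given by the rule of signs, where `α₀`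
and `β₀` have their own degrees and the other letters have the degrees `|αᵢ| - 1` and `|βⱼ| - 1`. -/
noncomputable def sh {X : C.Obj} {Y : D.Obj} (X' : C.Obj) :
    C.Word X X' →ₗ[k] ∀ Y', D.Word Y Y' →ₗ[k] E.Word (Φ.obj X Y) (Φ.obj X' Y') :=
  elimK (N := fun X' => ∀ Y', D.Word Y Y' →ₗ[k] E.Word (Φ.obj X Y) (Φ.obj X' Y'))
    (fun X' =>
      { toFun := fun c => Φ.shBase c
        map_add' := fun c c' => by
          funext Y'
          ext y
          refine word_induction (p := fun Y' y => Φ.shBase (c + c') Y' y =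
            Φ.shBase c Y' y + Φ.shBase c' Y' y) y
            (fun _ _ => by simp) (fun _ _ y d ih => ?_) (fun _ => by simp) (fun _ x y hx hy => ?_)
          · simp [ih]
          · simp only [map_add, hx, hy]; abel
        map_smul' := fun t c => by
          funext Y'
          ext y
          refine word_induction (p := fun Y' y => Φ.shBase (t • c) Y' y = t • Φ.shBase c Y' y) y
            (fun _ _ => by simp [LinearMap.map_smul_of_tower]) (fun _ _ y d ih => ?_)
            (fun _ => by simp) (fun _ x y hx hy => ?_)
          · simp [ih, LinearMap.map_smul_of_tower]
          · simp only [map_add, hx, hy, smul_add] })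
    (fun X' Z => LinearMap.mk₂ k (fun p c => Φ.shRest (Φ.shLast p.2 c))
      (fun p q c => funext fun Y' => LinearMap.ext fun y => Φ.shRest_congr_add _ _ _
        (fun Y' y => by simp [shLast_apply]; abel) y)
      (fun t p c => funext fun Y' => LinearMap.ext fun y => Φ.shRest_congr_smul t _ _
        (fun Y' y => by simp [shLast_apply, LinearMap.map_smul_of_tower]) y)
      (fun p c c' => funext fun Y' => LinearMap.ext fun y => Φ.shRest_congr_add _ _ _
        (fun Y' y => by simp [shLast_apply]; abel) y)
      (fun t p c => funext fun Y' => LinearMap.ext fun y => Φ.shRest_congr_smul t _ _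
        (fun Y' y => by simp [shLast_apply, LinearMap.map_smul_of_tower]) y)) X'

end Pairing

end DGCat

end Kunneth

section Kunneth

variable {k Q R : Type u} [Field k] [CommRing Q] [Algebra k Q] [CommRing R] [Algebra k R]

namespace DGCat

theorem lmul_zero {C : DGCat k Q} {X Y W : C.Obj} (z : C.Word X Y) :
    lmul (0 : C.Hom X W) Y z = 0 := by
  have := lmul_smul (0 : Q) (0 : C.Hom X W) z
  simpa using this

theorem d_one {C : DGCat k Q} (X : C.Obj) : C.d (C.one X) = 0 := by
  have h := C.d_comp (C.one X) (C.one X)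
  simpa using h

namespace Pairing

variable {C : DGCat k Q} {D : DGCat k R} {E : DGCat k (Q ⊗[k] R)} (Φ : Pairing C D E)

@[simp] theorem sh_base {X X' : C.Obj} {Y Y' : D.Obj} (c : C.Hom X' X) (y : D.Word Y Y') :
    Φ.sh X' (base c) Y' y = Φ.shBase c Y' y := by
  unfold sh
  rw [elimK_base]
  rfl

theorem sh_snoc {X X' Z : C.Obj} {Y : D.Obj} (x : C.Word X Z) (c : C.Hom X' Z) :
    Φ.sh (Y := Y) X' (snoc x c) = Φ.shRest (Φ.shLast (Φ.sh Z x) c) := by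
  unfold sh
  rw [elimK_snoc]
  rfl

@[simp] theorem sh_snoc_base {X X' Z : C.Obj} {Y Y' : D.Obj} (x : C.Word X Z) (c : C.Hom X' Z)
    (d : D.Hom Y' Y) : Φ.sh X' (snoc x c) Y' (base d) =
      snoc (Φ.sh Z x Y' (base d)) (Φ.map (C.od c) (D.one Y')) +
      snoc (Φ.sh Z x Y' (base (D.par d))) (Φ.map (C.ev c) (D.one Y')) := by
  rw [sh_snoc, shRest_base, shLast_apply, wpar_base]

@[simp] theorem sh_snoc_snoc {X X' Z : C.Obj} {Y Y' V : D.Obj} (x : C.Word X Z) (c : C.Hom X' Z)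
    (y : D.Word Y V) (d : D.Hom Y' V) : Φ.sh X' (snoc x c) Y' (snoc y d) =
      snoc (Φ.sh X' (snoc x c) V y) (Φ.map (C.one X') d) +
      (snoc (Φ.sh Z x Y' (snoc y d)) (Φ.map (C.od c) (D.one Y')) +
        snoc (Φ.sh Z x Y' (wpar Y' (snoc y d))) (Φ.map (C.ev c) (D.one Y'))) := by
  rw [sh_snoc, shRest_snoc, shLast_apply]

variable [CharZero k]

theorem comp_one_left {X X' X'' Y Y'} (a : C.Hom X' X'') (a' : C.Hom X X') (b' : D.Hom Y Y') :
    E.comp (Φ.map a (D.one Y')) (Φ.map a' b') = Φ.map (C.comp a a') b' := by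
  rw [Φ.comp_map, ev_of_par (D.par_one _), od_of_par (D.par_one _)]
  simp

theorem comp_one_right {X X' X'' Y Y'} (a : C.Hom X' X'') (b : D.Hom Y Y') (a' : C.Hom X X') :
    E.comp (Φ.map a b) (Φ.map a' (D.one Y)) =
      Φ.map (C.comp a a') (D.ev b) + Φ.map (C.comp a (C.par a')) (D.od b) := by
  rw [Φ.comp_map, D.comp_one, D.comp_one]

theorem comp_one_one {X Y Y' Y''} (b : D.Hom Y' Y'') (b' : D.Hom Y Y') :
    E.comp (Φ.map (C.one X) b) (Φ.map (C.one X) b') = Φ.map (C.one X) (D.comp b b') := by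
  rw [Φ.comp_map, C.par_one, C.comp_one, ← map_add, ← LinearMap.add_apply, ← map_add, ev_add_od]

theorem wpar_sh {X X' : C.Obj} {Y Y' : D.Obj} (x : C.Word X X') (y : D.Word Y Y') :
    wpar _ (Φ.sh X' x Y' y) = Φ.sh X' (wpar X' x) Y' (wpar Y' y) := by
  refine word_induction (p := fun X' x => ∀ Y' (y : D.Word Y Y'),
    wpar _ (Φ.sh X' x Y' y) = Φ.sh X' (wpar X' x) Y' (wpar Y' y)) x ?_ ?_ ?_ ?_ Y' y
  · intro X' c Y' y
    refine word_induction (p := fun Y' y =>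
      wpar _ (Φ.sh X' (base c) Y' y) = Φ.sh X' (wpar X' (base c)) Y' (wpar Y' y)) y ?_ ?_ ?_ ?_
    · intro Y' d
      simp [Φ.par_map]
    · intro Y' V y d ih
      simp only [sh_base, wpar_base] at ih
      simp [Φ.par_map, ih]
    · intro Y'; simp
    · intro Y' y y' h h'
      simp only [map_add, h, h']
  · intro X' Z x c ih Y' y
    refine word_induction (p := fun Y' y =>
      wpar _ (Φ.sh X' (snoc x c) Y' y) = Φ.sh X' (wpar X' (snoc x c)) Y' (wpar Y' y)) y ?_ ?_ ?_ ?_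
    · intro Y' d
      simp [Φ.par_map, ih, ev_par, od_par, par_ev, par_od, Pi.neg_apply]
      try abel
    · intro Y' V y d ih2
      simp only [wpar_snoc, map_neg, Pi.neg_apply, LinearMap.neg_apply] at ih2
      simp [Φ.par_map, ih, ih2, ev_par, od_par, par_ev, par_od, Pi.neg_apply]
      try abel
    · intro Y'; simp
    · intro Y' y y' h h'
      simp only [map_add, h, h']
  · intro X' Y' y; simp
  · intro X' x x' h h' Y' y
    simp only [map_add, Pi.add_apply, LinearMap.add_apply, h, h']

theorem merge_left {X X' Z : C.Obj} {Y Y' : D.Obj} (x : C.Word X Z) (c : C.Hom X' Z)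
    (d : D.Hom Y' Y) :
    merge _ (Φ.sh Z x Y' (base d)) (Φ.map (C.od c) (D.one Y')) =
        Φ.sh X' (merge Z x (C.od c)) Y' (base (D.par d)) ∧
    merge _ (Φ.sh Z x Y' (base d)) (Φ.map (C.ev c) (D.one Y')) =
        Φ.sh X' (merge Z x (C.ev c)) Y' (base d) := by
  have e : D.ev d - D.od d = D.par d := ev_sub_od d
  have e' : D.ev d + D.od d = d := ev_add_od d
  induction x using word_cases with
  | hb a =>
    constructor
    · simp only [sh_base, shBase_base, merge_base, comp_one_right, par_od, map_neg,
        LinearMap.neg_apply, ← e, map_sub, map_add]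
      abel
    · simp only [sh_base, shBase_base, merge_base, comp_one_right, par_ev, ← map_add, e']
  | hs W x a =>
    constructor
    · simp only [sh_snoc_base, merge_snoc, map_add, LinearMap.add_apply, comp_one_left, D.par_par,
        ev_comp, od_comp, ev_of_par_neg (par_od c), od_of_par_neg (par_od c), map_zero, add_zero,
        zero_add]
      abel
    · simp only [sh_snoc_base, merge_snoc, map_add, LinearMap.add_apply, comp_one_left, D.par_par,
        ev_comp, od_comp, ev_of_par (par_ev c), od_of_par (par_ev c), map_zero, add_zero,
        zero_add]
  | h0 => simp
  | ha x x' h h' =>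
    simp only [map_add, Pi.add_apply, LinearMap.add_apply, h, h', and_self]

theorem merge_left_snoc {X X' Z : C.Obj} {Y V Y' : D.Obj} (x : C.Word X Z) (c : C.Hom X' Z)
    (y : D.Word Y V) (d : D.Hom Y' V) :
    merge _ (Φ.sh Z x Y' (snoc y d)) (Φ.map (C.od c) (D.one Y')) =
        snoc (Φ.sh Z x V y) (Φ.map (C.od c) (D.par d)) +
        Φ.sh X' (merge Z x (C.od c)) Y' (wpar Y' (snoc y d)) +
        snoc (Φ.sh X' (merge Z x (C.od c)) V (wpar V y)) (Φ.map (C.one X') (D.par d)) ∧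
    merge _ (Φ.sh Z x Y' (snoc y d)) (Φ.map (C.ev c) (D.one Y')) =
        snoc (Φ.sh Z x V y) (Φ.map (C.ev c) d) +
        Φ.sh X' (merge Z x (C.ev c)) Y' (snoc y d) -
        snoc (Φ.sh X' (merge Z x (C.ev c)) V y) (Φ.map (C.one X') d) := by
  have e1 : E.comp (Φ.map (C.one Z) d) (Φ.map (C.od c) (D.one Y')) = Φ.map (C.od c) (D.par d) := by
    rw [comp_one_right, par_od, C.one_comp, C.one_comp, map_neg, LinearMap.neg_apply,
      ← sub_eq_add_neg, ← map_sub, ev_sub_od]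
  have e2 : E.comp (Φ.map (C.one Z) d) (Φ.map (C.ev c) (D.one Y')) = Φ.map (C.ev c) d := by
    rw [comp_one_right, par_ev, C.one_comp, ← map_add, ev_add_od]
  induction x using word_cases with
  | hb a =>
    constructor
    · simp only [sh_base, shBase_snoc, merge_snoc, merge_base, e1, wpar_snoc, map_neg]
      abel
    · simp only [sh_base, shBase_snoc, merge_snoc, merge_base, e2]
      abel
  | hs W x a =>
    constructor
    · simp only [sh_snoc_snoc, merge_snoc, map_add, LinearMap.add_apply, comp_one_left, e1,
        ev_comp, od_comp, ev_of_par_neg (par_od c), od_of_par_neg (par_od c), map_zero, add_zero,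
        zero_add, wpar_snoc, map_neg, D.par_par, wpar_wpar, LinearMap.neg_apply]
      abel
    · simp only [sh_snoc_snoc, merge_snoc, map_add, LinearMap.add_apply, comp_one_left, e2,
        ev_comp, od_comp, ev_of_par (par_ev c), od_of_par (par_ev c), map_zero, add_zero,
        zero_add]
      abel
  | h0 => simp
  | ha x x' h h' =>
    simp only [map_add, Pi.add_apply, LinearMap.add_apply, h, h']
    constructor <;> abel

theorem merge_right_base {X X' : C.Obj} {Y V Y' : D.Obj} (c : C.Hom X' X)
    (y : D.Word Y V) (d : D.Hom Y' V) :
    merge _ (Φ.shBase c V y) (Φ.map (C.one X') d) = Φ.shBase c Y' (merge V y d) := by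
  refine word_cases (p := fun y => merge _ (Φ.shBase c V y) (Φ.map (C.one X') d) =
    Φ.shBase c Y' (merge V y d)) y ?_ ?_ ?_ ?_
  · intro a
    simp only [shBase_base, merge_base, Φ.comp_map, C.par_one, C.comp_one]
    rw [← map_add, ← LinearMap.add_apply, ← map_add, ev_add_od]
  · intro W y a
    simp only [shBase_snoc, merge_snoc, comp_one_one]
  · simp
  · intro x x' h h'
    simp only [map_add, LinearMap.add_apply, h, h']

theorem merge_right_snoc {X X' Z : C.Obj} {Y V Y' : D.Obj} (x : C.Word X Z) (c : C.Hom X' Z)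
    (y : D.Word Y V) (d : D.Hom Y' V) :
    merge _ (Φ.sh X' (snoc x c) V y) (Φ.map (C.one X') d) =
      Φ.sh X' (snoc x c) Y' (merge V y d) - Φ.shLast (Φ.sh Z x) c Y' (merge V y d) +
      snoc (Φ.sh Z x V y) (Φ.map (C.od c) d) + snoc (Φ.sh Z x V (wpar V y)) (Φ.map (C.ev c) d) := by
  refine word_cases (p := fun y => merge _ (Φ.sh X' (snoc x c) V y) (Φ.map (C.one X') d) =
      Φ.sh X' (snoc x c) Y' (merge V y d) - Φ.shLast (Φ.sh Z x) c Y' (merge V y d) +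
      snoc (Φ.sh Z x V y) (Φ.map (C.od c) d) + snoc (Φ.sh Z x V (wpar V y)) (Φ.map (C.ev c) d))
    y ?_ ?_ ?_ ?_
  · intro a
    simp only [sh_snoc, shRest_base, shLast_apply, merge_base, merge_snoc, map_add,
      LinearMap.add_apply, comp_one_left, C.comp_one]
    abel
  · intro W y a
    simp only [sh_snoc, shRest_snoc, shLast_apply, merge_snoc, map_add,
      LinearMap.add_apply, comp_one_left, C.comp_one, comp_one_one]
    abel
  · simp
  · intro x x' h h'
    simp only [map_add, LinearMap.add_apply, h, h']
    abel

theorem wd_sh {X X' : C.Obj} {Y Y' : D.Obj} (x : C.Word X X') (y : D.Word Y Y') :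
    wd _ (Φ.sh X' x Y' y) = Φ.sh X' (wd X' x) Y' y + Φ.sh X' (wpar X' x) Y' (wd Y' y) := by
  refine word_induction (p := fun X' x => ∀ Y' (y : D.Word Y Y'),
    wd _ (Φ.sh X' x Y' y) = Φ.sh X' (wd X' x) Y' y + Φ.sh X' (wpar X' x) Y' (wd Y' y))
    x ?_ ?_ ?_ ?_ Y' y
  · intro X' c Y' y
    simp only [sh_base, wd_base, wpar_base]
    have hw := fun Y' (y : D.Word Y Y') => Φ.wpar_sh (base c) y
    simp only [sh_base, wpar_base] at hw
    refine word_induction (p := fun Y' y => wd _ (Φ.shBase c Y' y) =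
      Φ.shBase (C.d c) Y' y + Φ.shBase (C.par c) Y' (wd Y' y)) y ?_ ?_ ?_ ?_
    · intro Y' d
      simp [Φ.d_map]
    · intro Y' V y d ih
      simp only [shBase_snoc, wd_snoc, ih, hw, Φ.d_map, merge_right_base, d_one, map_add, map_sub,
        map_zero, LinearMap.zero_apply, zero_add, C.par_one, LinearMap.add_apply]
      abel
    · intro Y'; simp
    · intro Y' y y' h h'
      simp only [map_add, h, h']
      abel
  · intro X' Z x c ih Y' y
    have hc : ∀ Y' (y : D.Word Y Y'), Φ.sh X' (merge Z (wpar Z x) c) Y' y =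
        Φ.sh X' (merge Z (wpar Z x) (C.ev c)) Y' y +
        Φ.sh X' (merge Z (wpar Z x) (C.od c)) Y' y := fun Y' y => by
      rw [← LinearMap.add_apply, ← Pi.add_apply, ← map_add, ← map_add, ev_add_od]
    refine word_induction (p := fun Y' y => wd _ (Φ.sh X' (snoc x c) Y' y) =
      Φ.sh X' (wd X' (snoc x c)) Y' y + Φ.sh X' (wpar X' (snoc x c)) Y' (wd Y' y)) y ?_ ?_ ?_ ?_
    · intro Y' d
      simp only [wd_base, wd_snoc, sh_snoc_base, wpar_snoc, map_add, map_sub, map_neg, ih,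
        Pi.add_apply, Pi.sub_apply, Pi.neg_apply, LinearMap.add_apply, LinearMap.sub_apply,
        LinearMap.neg_apply, wpar_base, D.par_par, wpar_sh, merge_left, Φ.d_map, d_one, map_zero,
        add_zero, D.d_par, ev_par, od_par, d_ev, d_od, (Φ.merge_left _ c _).1,
        (Φ.merge_left _ c _).2]
      simp only [hc, map_add, LinearMap.add_apply]
      abel
    · intro Y' V y d ih2
      simp only [wpar_snoc, wd_snoc, map_add, map_sub, map_neg, Pi.add_apply, Pi.sub_apply,
        Pi.neg_apply, LinearMap.add_apply, LinearMap.sub_apply, LinearMap.neg_apply] at ih2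
      simp only [wd_snoc, sh_snoc_snoc, wpar_snoc, map_add, map_sub, map_neg, ih, ih2,
        Pi.add_apply, Pi.sub_apply, Pi.neg_apply, LinearMap.add_apply, LinearMap.sub_apply,
        LinearMap.neg_apply, D.par_par, wpar_sh, merge_left_snoc, merge_right_snoc, Φ.d_map,
        d_one, map_zero, LinearMap.zero_apply,
        add_zero, zero_add, D.d_par, ev_par, od_par, par_ev, par_od, d_ev, d_od, wpar_wpar,
        C.par_one, merge_wpar, wd_wpar, shLast_apply]
      simp only [hc, map_add, LinearMap.add_apply]
      abel
    · intro Y'; simp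
    · intro Y' y y' h h'
      simp only [map_add, h, h']
      abel
  · intro X' Y' y; simp
  · intro X' x x' h h' Y' y
    simp only [map_add, Pi.add_apply, LinearMap.add_apply, h, h']
    abel

theorem sh_smul {X X' : C.Obj} {Y Y' : D.Obj} (q : Q) (r : R) (x : C.Word X X')
    (y : D.Word Y Y') : Φ.sh X' (q • x) Y' (r • y) = (q ⊗ₜ[k] r) • Φ.sh X' x Y' y := by
  refine word_induction (p := fun X' x => ∀ Y' (y : D.Word Y Y'),
    Φ.sh X' (q • x) Y' (r • y) = (q ⊗ₜ[k] r) • Φ.sh X' x Y' y) x ?_ ?_ ?_ ?_ Y' y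
  · intro X' c Y' y
    refine word_induction (p := fun Y' y => Φ.sh X' (q • base c) Y' (r • y) =
      (q ⊗ₜ[k] r) • Φ.sh X' (base c) Y' y) y ?_ ?_ ?_ ?_
    · intro Y' d
      simp only [← map_smul, sh_base, shBase_base, Φ.smul_map]
    · intro Y' V y d ih
      simp only [← map_smul, sh_base] at ih
      have e' : r • snoc y d = snoc (r • y) d := by rw [map_smul, LinearMap.smul_apply]
      rw [← map_smul, e', sh_base, sh_base, shBase_snoc, shBase_snoc, ih, map_smul,
        LinearMap.smul_apply]
    · intro Y'; simp
    · intro Y' y y' h h'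
      simp only [smul_add, map_add, h, h']
  · intro X' Z x c ih Y' y
    have e : q • snoc x c = snoc (q • x) c := by rw [map_smul, LinearMap.smul_apply]
    refine word_induction (p := fun Y' y => Φ.sh X' (q • snoc x c) Y' (r • y) =
      (q ⊗ₜ[k] r) • Φ.sh X' (snoc x c) Y' y) y ?_ ?_ ?_ ?_
    · intro Y' d
      rw [e, ← map_smul, sh_snoc_base, sh_snoc_base, map_smul D.par, LinearMap.map_smul base,
        LinearMap.map_smul base, ih, ih, map_smul, map_smul, LinearMap.smul_apply, LinearMap.smul_apply, smul_add]
    · intro Y' V y d ih2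
      have e' : r • snoc y d = snoc (r • y) d := by rw [map_smul, LinearMap.smul_apply]
      rw [e] at ih2
      rw [e, e', sh_snoc_snoc, ih2, ← e', map_smul (wpar Y'), ih, ih, sh_snoc_snoc]
      simp only [map_smul, LinearMap.smul_apply, smul_add]
    · intro Y'; simp
    · intro Y' y y' h h'
      simp only [smul_add, map_add, h, h']
  · intro X' Y' y; simp
  · intro X' x x' h h' Y' y
    simp only [smul_add, map_add, Pi.add_apply, LinearMap.add_apply, h, h']

theorem lmul_left {X X' W : C.Obj} {Y Y' : D.Obj} (a : C.Hom X W) (x : C.Word X X')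
    (y : D.Word Y Y') : lmul (Φ.map a (D.one Y)) _ (Φ.sh X' x Y' y) =
      Φ.sh X' (lmul a X' x) Y' y := by
  refine word_induction (p := fun X' x => ∀ Y' (y : D.Word Y Y'),
    lmul (Φ.map a (D.one Y)) _ (Φ.sh X' x Y' y) = Φ.sh X' (lmul a X' x) Y' y) x ?_ ?_ ?_ ?_ Y' y
  · intro X' c Y' y
    simp only [sh_base, lmul_base]
    refine word_induction (p := fun Y' y => lmul (Φ.map a (D.one Y)) _ (Φ.shBase c Y' y) =
      Φ.shBase (C.comp a c) Y' y) y ?_ ?_ ?_ ?_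
    · intro Y' d
      simp only [shBase_base, lmul_base, comp_one_left]
    · intro Y' V y d ih
      simp only [shBase_snoc, lmul_snoc, ih]
    · intro Y'; simp
    · intro Y' y y' h h'
      simp only [map_add, h, h']
  · intro X' Z x c ih Y' y
    refine word_induction (p := fun Y' y => lmul (Φ.map a (D.one Y)) _ (Φ.sh X' (snoc x c) Y' y) =
      Φ.sh X' (lmul a X' (snoc x c)) Y' y) y ?_ ?_ ?_ ?_
    · intro Y' d
      simp only [sh_snoc_base, map_add, lmul_snoc, ih]
    · intro Y' V y d ih2
      simp only [lmul_snoc] at ih2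
      simp only [sh_snoc_snoc, map_add, lmul_snoc, ih, ih2]
    · intro Y'; simp
    · intro Y' y y' h h'
      simp only [map_add, h, h']
  · intro X' Y' y; simp
  · intro X' x x' h h' Y' y
    simp only [map_add, Pi.add_apply, LinearMap.add_apply, h, h']

theorem lmul_right {X X' : C.Obj} {Y Y' V : D.Obj} (b : D.Hom Y V) (x : C.Word X X')
    (y : D.Word Y Y') : lmul (Φ.map (C.one X) b) _ (Φ.sh X' x Y' y) =
      Φ.sh X' x Y' (lmul (D.ev b) Y' y) + Φ.sh X' (wpar X' x) Y' (lmul (D.od b) Y' y) := by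
  refine word_induction (p := fun X' x => ∀ Y' (y : D.Word Y Y'),
    lmul (Φ.map (C.one X) b) _ (Φ.sh X' x Y' y) =
      Φ.sh X' x Y' (lmul (D.ev b) Y' y) + Φ.sh X' (wpar X' x) Y' (lmul (D.od b) Y' y))
    x ?_ ?_ ?_ ?_ Y' y
  · intro X' c Y' y
    simp only [sh_base, wpar_base]
    refine word_induction (p := fun Y' y => lmul (Φ.map (C.one X) b) _ (Φ.shBase c Y' y) =
      Φ.shBase c Y' (lmul (D.ev b) Y' y) + Φ.shBase (C.par c) Y' (lmul (D.od b) Y' y)) y ?_ ?_ ?_ ?_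
    · intro Y' d
      simp only [shBase_base, lmul_base, Φ.comp_map, map_add, C.one_comp]
    · intro Y' W y d ih
      simp only [shBase_snoc, lmul_snoc, ih, map_add, LinearMap.add_apply]
    · intro Y'; simp
    · intro Y' y y' h h'
      simp only [map_add, h, h']
      abel
  · intro X' Z x c ih Y' y
    refine word_induction (p := fun Y' y =>
      lmul (Φ.map (C.one X) b) _ (Φ.sh X' (snoc x c) Y' y) =
      Φ.sh X' (snoc x c) Y' (lmul (D.ev b) Y' y) +
        Φ.sh X' (wpar X' (snoc x c)) Y' (lmul (D.od b) Y' y)) y ?_ ?_ ?_ ?_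
    · intro Y' d
      simp only [sh_snoc_base, map_add, lmul_snoc, ih, lmul_base, wpar_snoc, map_neg, Pi.neg_apply,
        LinearMap.neg_apply, LinearMap.add_apply, D.par_comp, par_ev, par_od, ev_par, od_par]
      abel
    · intro Y' W y d ih2
      simp only [wpar_snoc, map_neg, Pi.neg_apply, LinearMap.neg_apply] at ih2
      simp only [sh_snoc_snoc, map_add, lmul_snoc, ih, ih2, wpar_snoc, map_neg, Pi.neg_apply,
        LinearMap.neg_apply, LinearMap.add_apply, lmul_wpar, par_ev, par_od, ev_par, od_par,
        lmul_neg]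
      abel
    · intro Y'; simp
    · intro Y' y y' h h'
      simp only [map_add, h, h']
      abel
  · intro X' Y' y; simp
  · intro X' x x' h h' Y' y
    simp only [map_add, Pi.add_apply, LinearMap.add_apply, h, h']
    abel

theorem cyc_left {X X' W : C.Obj} {Y Y' : D.Obj} (x : C.Word X X') (y : D.Word Y Y')
    (c : C.Hom X W) : cyc (Φ.sh X' x Y' y) (Φ.map (C.od c) (D.one Y)) +
      cyc (Φ.sh X' x Y' (wpar Y' y)) (Φ.map (C.ev c) (D.one Y)) = Φ.sh X' (cyc x c) Y' y := by
  have h1 : E.par (Φ.map (C.od c) (D.one Y)) = -Φ.map (C.od c) (D.one Y) := by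
    rw [Φ.par_map, par_od, D.par_one, map_neg, LinearMap.neg_apply]
  have h2 : E.par (Φ.map (C.ev c) (D.one Y)) = Φ.map (C.ev c) (D.one Y) := by
    rw [Φ.par_map, par_ev, D.par_one]
  simp only [cyc_apply, ev_of_par h2, od_of_par h2, ev_of_par_neg h1, od_of_par_neg h1, lmul_zero,
    wpar_sh, wpar_wpar, lmul_left, map_add, Pi.add_apply, LinearMap.add_apply, add_zero, zero_add]

theorem cyc_right {X X' : C.Obj} {Y Y' V : D.Obj} (x : C.Word X X') (y : D.Word Y Y')
    (d : D.Hom Y V) : cyc (Φ.sh X' x Y' y) (Φ.map (C.one X) d) =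
      Φ.sh X' (wpar X' x) Y' (cyc y d) := by
  have h1 : E.par (Φ.map (C.one X) (D.od d)) = -Φ.map (C.one X) (D.od d) := by
    rw [Φ.par_map, par_od, C.par_one, map_neg]
  have h2 : E.par (Φ.map (C.one X) (D.ev d)) = Φ.map (C.one X) (D.ev d) := by
    rw [Φ.par_map, par_ev, C.par_one]
  have e : Φ.map (C.one X) d = Φ.map (C.one X) (D.ev d) + Φ.map (C.one X) (D.od d) := by
    rw [← map_add, ev_add_od]
  simp only [cyc_apply]
  rw [e, map_add, map_add, ev_of_par h2, od_of_par h2, ev_of_par_neg h1, od_of_par_neg h1,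
    zero_add, add_zero]
  simp only [wpar_sh, lmul_right, map_add, ev_of_par (par_ev d), od_of_par (par_ev d),
    ev_of_par_neg (par_od d), od_of_par_neg (par_od d), lmul_zero, map_zero, add_zero, zero_add]

open Classical in
/-- The map `HH(C) × HH(D) → HH(E)` given by the shuffle product of closed words, as a bilinear map
over `k`. -/
noncomputable def kun : C.HHSpace →ₗ[k] D.HHSpace →ₗ[k] E.HHSpace :=
  DirectSum.toModule k C.Obj _ fun X => LinearMap.flip <| DirectSum.toModule k D.Obj _
    fun Y => LinearMap.flip <| LinearMap.compr₂ (LinearMap.proj Y ∘ₗ Φ.sh (Y := Y) X)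
      ((close (Φ.obj X Y)).restrictScalars k)

@[simp] theorem kun_close {X : C.Obj} {Y : D.Obj} (x : C.Word X X) (y : D.Word Y Y) :
    Φ.kun (close X x) (close Y y) = close (Φ.obj X Y) (Φ.sh X x Y y) := by
  classical
  have h : Φ.kun (close X x) = (LinearMap.flip <| DirectSum.toModule k D.Obj _
    fun Y => LinearMap.flip <| LinearMap.compr₂ (LinearMap.proj Y ∘ₗ Φ.sh (Y := Y) X)
      ((close (Φ.obj X Y)).restrictScalars k)) x := DirectSum.toModule_lof
        (M := fun X => C.Word X X) k X x
  refine (LinearMap.congr_fun h _).trans ?_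
  have h' := DirectSum.toModule_lof (M := fun Y => D.Word Y Y)
    (φ := fun Y => LinearMap.flip <| LinearMap.compr₂ (LinearMap.proj Y ∘ₗ Φ.sh (Y := Y) X)
      ((close (Φ.obj X Y)).restrictScalars k)) k Y y
  exact LinearMap.congr_fun h' x

theorem hh_induction₂ {p : C.HHSpace → D.HHSpace → Prop} (x : C.HHSpace) (y : D.HHSpace)
    (h : ∀ X x Y y, p (close X x) (close Y y)) (h0 : ∀ y, p 0 y) (h0' : ∀ x, p x 0)
    (ha : ∀ x x' y, p x y → p x' y → p (x + x') y)
    (ha' : ∀ x y y', p x y → p x y' → p x (y + y')) : p x y :=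
  hh_induction (p := fun x => p x y) x (fun X x => hh_induction (p := fun y => p (close X x) y) y
    (fun Y y => h X x Y y) (h0' _) fun _ _ hy hy' => ha' _ _ _ hy hy') (h0 y)
    fun _ _ hx hx' => ha _ _ _ hx hx'

theorem wrap_sh {X : C.Obj} {Y : D.Obj} (x : C.Word X X) (y : D.Word Y Y) :
    wrap _ (Φ.sh X x Y y) = Φ.kun (wrap X x) (close Y y) + Φ.kun (close X (wpar X x)) (wrap Y y) := by
  induction x using word_cases with
  | hb c =>
    induction y using word_cases with
    | hb d => simp
    | hs V y d =>
      rw [sh_base, shBase_snoc, wrap_snoc, ← sh_base, cyc_right, wrap_base, wrap_snoc, map_zero,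
        LinearMap.zero_apply, zero_add, map_neg, kun_close]
    | h0 => simp
    | ha y y' h h' => simp only [map_add, h, h']; abel
  | hs Z x c =>
    induction y using word_cases with
    | hb d =>
      rw [sh_snoc_base, map_add, wrap_snoc, wrap_snoc, ← neg_add, ← map_add, ← wpar_base, cyc_left,
        wrap_base, wrap_snoc, map_zero, add_zero, map_neg, LinearMap.neg_apply, kun_close]
    | hs V y d =>
      rw [sh_snoc_snoc, map_add, map_add, wrap_snoc, wrap_snoc, wrap_snoc, ← neg_add, ← map_add,
        cyc_left, cyc_right, wrap_snoc, wrap_snoc, map_neg, map_neg, LinearMap.neg_apply, kun_close,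
        kun_close, add_comm]
    | h0 => simp
    | ha y y' h h' => simp only [map_add, h, h']; abel
  | h0 => simp
  | ha x x' h h' =>
    simp only [map_add, Pi.add_apply, LinearMap.add_apply, h, h']; abel

theorem hhPar_kun (x : C.HHSpace) (y : D.HHSpace) :
    hhPar E (Φ.kun x y) = Φ.kun (hhPar C x) (hhPar D y) := by
  refine hh_induction₂ (p := fun x y => hhPar E (Φ.kun x y) = Φ.kun (hhPar C x) (hhPar D y)) x y
    (fun X x Y y => by simp [wpar_sh]) (fun _ => by simp) (fun _ => by simp)
    (fun x x' y h h' => ?_) (fun x y y' h h' => ?_)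
  · simp only [map_add, LinearMap.add_apply, h, h']
  · simp only [map_add, h, h']

theorem hhD_kun (x : C.HHSpace) (y : D.HHSpace) :
    hhD E (Φ.kun x y) = Φ.kun (hhD C x) y + Φ.kun (hhPar C x) (hhD D y) := by
  refine hh_induction₂ (p := fun x y => hhD E (Φ.kun x y) =
    Φ.kun (hhD C x) y + Φ.kun (hhPar C x) (hhD D y)) x y
    (fun X x Y y => ?_) (fun _ => by simp) (fun _ => by simp)
    (fun x x' y h h' => ?_) (fun x y y' h h' => ?_)
  · simp only [kun_close, hhD_close, hhPar_close, wd_sh, wrap_sh, map_add, LinearMap.add_apply]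
    abel
  · simp only [map_add, LinearMap.add_apply, h, h']; abel
  · simp only [map_add, h, h']; abel

theorem kun_smul (q : Q) (r : R) (x : C.HHSpace) (y : D.HHSpace) :
    Φ.kun (q • x) (r • y) = (q ⊗ₜ[k] r) • Φ.kun x y := by
  refine hh_induction₂ (p := fun x y => Φ.kun (q • x) (r • y) = (q ⊗ₜ[k] r) • Φ.kun x y) x y
    (fun X x Y y => ?_) (fun _ => by simp) (fun _ => by simp)
    (fun x x' y h h' => ?_) (fun x y y' h h' => ?_)
  · rw [← map_smul, ← map_smul, kun_close, kun_close, sh_smul, map_smul]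
  · simp only [map_add, smul_add, LinearMap.add_apply, h, h']
  · simp only [map_add, smul_add, h, h']

/-- The Künneth map `HH(C) ⊗ HH(D) → HH(E)`: the shuffle product
`α₀[α₁|…|αₙ] ⊗ β₀[β₁|…|βₘ] ↦ ∑ ± (α₀ ⊗ β₀)[…]` followed by the map induced by the bifunctor. -/
noncomputable def kunneth : (HH C).tensor (HH D) ⟶ HH E :=
  SCpx.tensorDesc (P := HH E) Φ.kun Φ.kun_smul Φ.hhPar_kun Φ.hhD_kun

end Pairing
end DGCat
end Kunneth

section MFPairing

variable {k Q R : Type u} [Field k] [CommRing Q] [Algebra k Q] [CommRing R] [Algebra k R]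
  {f : Q} {g : R}

namespace MF

section

variable {X X' : MF k Q f} {Y Y' : MF k R g}

theorem tensorLin_add (a a' : X.P →ₗ[Q] X'.P) (b : Y.P →ₗ[R] Y'.P) :
    tensorLin (k := k) (a + a') b = tensorLin a b + tensorLin a' b :=
  tensor_hom_ext fun x y => by simp

theorem tensorLin_add_right (a : X.P →ₗ[Q] X'.P) (b b' : Y.P →ₗ[R] Y'.P) :
    tensorLin (k := k) a (b + b') = tensorLin a b + tensorLin a b' :=
  tensor_hom_ext fun x y => by simp

theorem tensorLin_smul (q : Q) (r : R) (a : X.P →ₗ[Q] X'.P) (b : Y.P →ₗ[R] Y'.P) :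
    tensorLin (k := k) (q • a) (r • b) = (q ⊗ₜ[k] r) • tensorLin a b :=
  tensor_hom_ext fun x y => by simp [smul_tmul]

theorem tensorLin_csmul (c : k) (a : X.P →ₗ[Q] X'.P) (b : Y.P →ₗ[R] Y'.P) :
    tensorLin (k := k) (c • a) b = c • tensorLin a b :=
  tensor_hom_ext fun x y => by simp [csmul_tmul]

theorem tensorLin_csmul_right (c : k) (a : X.P →ₗ[Q] X'.P) (b : Y.P →ₗ[R] Y'.P) :
    tensorLin (k := k) a (c • b) = c • tensorLin a b :=
  tensor_hom_ext fun x y => by simp [csmul_tmul_right]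

end

section

/-- The even component of a morphism. -/
noncomputable def hev (X Y : MF k Q f) : (X.P →ₗ[Q] Y.P) →ₗ[Q] (X.P →ₗ[Q] Y.P) :=
  (algebraMap k Q 2⁻¹) • (LinearMap.id + hpar X Y)

/-- The odd component of a morphism. -/
noncomputable def hod (X Y : MF k Q f) : (X.P →ₗ[Q] Y.P) →ₗ[Q] (X.P →ₗ[Q] Y.P) :=
  (algebraMap k Q 2⁻¹) • (LinearMap.id - hpar X Y)

/-- The tensor product of morphisms of matrix factorizations:
`(a ⊗ b)(x ⊗ y) = (-1)^(|b| |x|) a x ⊗ b y`. -/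
noncomputable def tmap (X X' : MF k Q f) (Y Y' : MF k R g) :
    (X.P →ₗ[Q] X'.P) →ₗ[k] (Y.P →ₗ[R] Y'.P) →ₗ[k]
      ((X.tensor Y).P →ₗ[Q ⊗[k] R] (X'.tensor Y').P) := LinearMap.mk₂ k
    (fun a b => tensorLin a (hev Y Y' b) + tensorLin (a ∘ₗ X.par) (hod Y Y' b))
    (fun a a' b => by rw [LinearMap.add_comp, tensorLin_add, tensorLin_add]; abel)
    (fun c a b => by rw [LinearMap.smul_comp, tensorLin_csmul, tensorLin_csmul, smul_add])
    (fun a b b' => by rw [map_add, map_add, tensorLin_add_right, tensorLin_add_right]; abel)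
    (fun c a b => by
      rw [LinearMap.map_smul_of_tower, LinearMap.map_smul_of_tower, tensorLin_csmul_right,
        tensorLin_csmul_right, smul_add])

variable {X X' X'' : MF k Q f} {Y Y' Y'' : MF k R g}

theorem tmap_tmul (a : X.P →ₗ[Q] X'.P) (b : Y.P →ₗ[R] Y'.P) (x : X.P) (y : Y.P) :
    tmap X X' Y Y' a b (X.tmul Y x y) =
      X'.tmul Y' (a x) (hev Y Y' b y) + X'.tmul Y' (a (X.par x)) (hod Y Y' b y) := rfl

variable [CharZero k]

theorem hev_one : hev X X LinearMap.id = LinearMap.id :=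
  DGCat.ev_of_par (C := dg k Q f Set.univ) (X := ⟨X, Set.subset_univ _⟩)
    (Y := ⟨X, Set.subset_univ _⟩) (DGCat.par_one _ _)

theorem hod_one : hod X X LinearMap.id = 0 :=
  DGCat.od_of_par (C := dg k Q f Set.univ) (X := ⟨X, Set.subset_univ _⟩)
    (Y := ⟨X, Set.subset_univ _⟩) (DGCat.par_one _ _)

theorem hpar_hev (a : X.P →ₗ[Q] X'.P) : hpar X X' (hev X X' a) = hev X X' a :=
  DGCat.par_ev (C := dg k Q f Set.univ) (X := ⟨X, Set.subset_univ _⟩)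
    (Y := ⟨X', Set.subset_univ _⟩) a

theorem hpar_hod (a : X.P →ₗ[Q] X'.P) : hpar X X' (hod X X' a) = -hod X X' a :=
  DGCat.par_od (C := dg k Q f Set.univ) (X := ⟨X, Set.subset_univ _⟩)
    (Y := ⟨X', Set.subset_univ _⟩) a

theorem hev_hpar (a : X.P →ₗ[Q] X'.P) : hev X X' (hpar X X' a) = hev X X' a :=
  DGCat.ev_par (C := dg k Q f Set.univ) (X := ⟨X, Set.subset_univ _⟩)
    (Y := ⟨X', Set.subset_univ _⟩) a

theorem hod_hpar (a : X.P →ₗ[Q] X'.P) : hod X X' (hpar X X' a) = -hod X X' a :=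
  DGCat.od_par (C := dg k Q f Set.univ) (X := ⟨X, Set.subset_univ _⟩)
    (Y := ⟨X', Set.subset_univ _⟩) a

theorem hev_hd (a : X.P →ₗ[Q] X'.P) : hev X X' (hd X X' a) = hd X X' (hod X X' a) :=
  (DGCat.d_od (C := dg k Q f Set.univ) (X := ⟨X, Set.subset_univ _⟩)
    (Y := ⟨X', Set.subset_univ _⟩) a).symm

theorem hod_hd (a : X.P →ₗ[Q] X'.P) : hod X X' (hd X X' a) = hd X X' (hev X X' a) :=
  (DGCat.d_ev (C := dg k Q f Set.univ) (X := ⟨X, Set.subset_univ _⟩)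
    (Y := ⟨X', Set.subset_univ _⟩) a).symm

theorem hev_comp (a : X'.P →ₗ[Q] X''.P) (b : X.P →ₗ[Q] X'.P) : hev X X'' (a ∘ₗ b) =
    hev X' X'' a ∘ₗ hev X X' b + hod X' X'' a ∘ₗ hod X X' b :=
  DGCat.ev_comp (C := dg k Q f Set.univ) (X := ⟨X, Set.subset_univ _⟩)
    (Y := ⟨X', Set.subset_univ _⟩) (Z := ⟨X'', Set.subset_univ _⟩) a b

theorem hod_comp (a : X'.P →ₗ[Q] X''.P) (b : X.P →ₗ[Q] X'.P) : hod X X'' (a ∘ₗ b) =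
    hev X' X'' a ∘ₗ hod X X' b + hod X' X'' a ∘ₗ hev X X' b :=
  DGCat.od_comp (C := dg k Q f Set.univ) (X := ⟨X, Set.subset_univ _⟩)
    (Y := ⟨X', Set.subset_univ _⟩) (Z := ⟨X'', Set.subset_univ _⟩) a b

theorem hev_hev (a : X.P →ₗ[Q] X'.P) : hev X X' (hev X X' a) = hev X X' a :=
  DGCat.ev_of_par (C := dg k Q f Set.univ) (X := ⟨X, Set.subset_univ _⟩)
    (Y := ⟨X', Set.subset_univ _⟩) (hpar_hev a)

theorem hev_hod (a : X.P →ₗ[Q] X'.P) : hev X X' (hod X X' a) = 0 :=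
  DGCat.ev_of_par_neg (C := dg k Q f Set.univ) (X := ⟨X, Set.subset_univ _⟩)
    (Y := ⟨X', Set.subset_univ _⟩) (hpar_hod a)

theorem hod_hev (a : X.P →ₗ[Q] X'.P) : hod X X' (hev X X' a) = 0 :=
  DGCat.od_of_par (C := dg k Q f Set.univ) (X := ⟨X, Set.subset_univ _⟩)
    (Y := ⟨X', Set.subset_univ _⟩) (hpar_hev a)

theorem hod_hod (a : X.P →ₗ[Q] X'.P) : hod X X' (hod X X' a) = hod X X' a :=
  DGCat.od_of_par_neg (C := dg k Q f Set.univ) (X := ⟨X, Set.subset_univ _⟩)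
    (Y := ⟨X', Set.subset_univ _⟩) (hpar_hod a)

theorem par_hev (a : X.P →ₗ[Q] X'.P) (x : X.P) : X'.par (hev X X' a x) = hev X X' a (X.par x) := by
  nth_rewrite 1 [← hpar_hev]; simp

theorem par_hod (a : X.P →ₗ[Q] X'.P) (x : X.P) : X'.par (hod X X' a x) = -hod X X' a (X.par x) := by
  have h := hpar_hod a
  rw [← neg_eq_iff_eq_neg] at h
  nth_rewrite 1 [← h]; simp

theorem tmap_one : tmap X X Y Y LinearMap.id LinearMap.id = LinearMap.id :=
  tensor_hom_ext fun x y => by simp [tmap_tmul, hev_one, hod_one]; exact TensorProduct.tmul_zero _ _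

theorem tmap_smul (q : Q) (r : R) (a : X.P →ₗ[Q] X'.P) (b : Y.P →ₗ[R] Y'.P) :
    tmap X X' Y Y' (q • a) (r • b) = (q ⊗ₜ[k] r) • tmap X X' Y Y' a b :=
  tensor_hom_ext fun x y => by simp [tmap_tmul, smul_tmul]

theorem hpar_tmap (a : X.P →ₗ[Q] X'.P) (b : Y.P →ₗ[R] Y'.P) :
    hpar (X.tensor Y) (X'.tensor Y') (tmap X X' Y Y' a b) =
      tmap X X' Y Y' (hpar X X' a) (hpar Y Y' b) :=
  tensor_hom_ext fun x y => by
    simp [tmap_tmul, par_tmul, hev_hpar, hod_hpar, par_hev, par_hod]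

theorem hd_tmap (a : X.P →ₗ[Q] X'.P) (b : Y.P →ₗ[R] Y'.P) :
    hd (X.tensor Y) (X'.tensor Y') (tmap X X' Y Y' a b) =
      tmap X X' Y Y' (hd X X' a) b + tmap X X' Y Y' (hpar X X' a) (hd Y Y' b) :=
  tensor_hom_ext fun x y => by
    simp [tmap_tmul, par_tmul, δ_tmul, hpar_tmap, hev_hpar, hod_hpar, par_hev, par_hod, hev_hd,
      hod_hd, X.δ_par, sub_eq_add_neg]
    abel

theorem tmap_comp (a : X'.P →ₗ[Q] X''.P) (b : Y'.P →ₗ[R] Y''.P) (a' : X.P →ₗ[Q] X'.P)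
    (b' : Y.P →ₗ[R] Y'.P) : tmap X' X'' Y' Y'' a b ∘ₗ tmap X X' Y Y' a' b' =
      tmap X X'' Y Y'' (a ∘ₗ a') (hev Y' Y'' b ∘ₗ b') +
        tmap X X'' Y Y'' (a ∘ₗ hpar X X' a') (hod Y' Y'' b ∘ₗ b') :=
  tensor_hom_ext fun x y => by
    simp [tmap_tmul, hev_comp, hod_comp, hev_hev, hev_hod, hod_hev, hod_hod]
    abel

end

variable (Z : Set (PrimeSpectrum Q)) (W : Set (PrimeSpectrum R))

/-- The bifunctor `mf^Z(Q, f) × mf^W(R, g) → mf^(Z × W)(Q ⊗ R, f ⊗ 1 + 1 ⊗ g)` given by the tensor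
product of matrix factorizations. -/
noncomputable def pairing [CharZero k] : DGCat.Pairing (dg k Q f Z) (dg k R g W)
    (dg k (Q ⊗[k] R) (f ⊗ₜ[k] 1 + 1 ⊗ₜ[k] g) (prodSet k Z W)) where
  obj X Y := ⟨X.1.tensor Y.1, fun _ hq => ⟨X.2 (tensor_supp X.1 Y.1 hq).1,
    Y.2 (tensor_supp X.1 Y.1 hq).2⟩⟩
  map {X X' Y Y'} := tmap X.1 X'.1 Y.1 Y'.1
  map_one _ _ := tmap_one
  smul_map q r a b := tmap_smul q r a b
  par_map a b := hpar_tmap a b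
  d_map a b := hd_tmap a b
  comp_map a b a' b' := tmap_comp a b a' b'

end MF
end MFPairing

section Forms

open KaehlerDifferential

variable {k Q : Type u} [Field k] [CommRing Q] [Algebra k Q] {f : Q}

/-- The exterior algebra `Ω^• = ⨁ⱼ Λʲ Ω¹` of differential forms. -/
abbrev Forms (k Q : Type u) [Field k] [CommRing Q] [Algebra k Q] : Type u :=
  ExteriorAlgebra Q Ω[Q⁄k]

namespace Forms

/-- The inclusion of the forms of degree one. -/
noncomputable abbrev one : Ω[Q⁄k] →ₗ[Q] Forms k Q := ExteriorAlgebra.ι Q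

/-- The sign operator: multiplication by `(-1)^j` on forms of degree `j`. -/
noncomputable def sgn : Forms k Q →ₗ[Q] Forms k Q :=
  (CliffordAlgebra.involute : Forms k Q →ₐ[Q] Forms k Q).toLinearMap

theorem sgn_mul (x y : Forms k Q) : sgn (x * y) = sgn x * sgn y :=
  map_mul (CliffordAlgebra.involute : Forms k Q →ₐ[Q] Forms k Q) x y

@[simp] theorem sgn_one_eq : sgn (1 : Forms k Q) = 1 :=
  map_one (CliffordAlgebra.involute : Forms k Q →ₐ[Q] Forms k Q)

@[simp] theorem sgn_sgn (x : Forms k Q) : sgn (sgn x) = x :=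
  CliffordAlgebra.involute_involutive x

@[simp] theorem sgn_one (η : Ω[Q⁄k]) : sgn (one η) = -one η :=
  CliffordAlgebra.involute_ι η

theorem one_mul_one (η : Ω[Q⁄k]) : one η * one η = 0 := ExteriorAlgebra.ι_sq_zero η

theorem one_mul_one_add (η η' : Ω[Q⁄k]) : one η * one η' = -(one η' * one η) :=
  eq_neg_of_add_eq_zero_left (ExteriorAlgebra.ι_add_mul_swap η η')

/-- Induction on forms. -/
theorem induction_left {p : Forms k Q → Prop} (x : Forms k Q) (h1 : ∀ q : Q, p (algebraMap Q _ q))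
    (hm : ∀ η x, p x → p (one η * x)) (ha : ∀ x y, p x → p y → p (x + y)) : p x :=
  CliffordAlgebra.left_induction (P := p) _ h1 ha (fun x m hx => hm m x hx) x

variable (k) in
/-- The complex `(Ω^•, -df)`, with the differential `ω ↦ -df ∧ ω`. -/
noncomputable def cpx (f : Q) : SCpx k Q where
  carrier := (ULift.{u + 1, u} (Forms k Q) : Type (u + 1))
  par := ULift.moduleEquiv.symm.toLinearMap ∘ₗ sgn ∘ₗ ULift.moduleEquiv.toLinearMap
  d := ULift.moduleEquiv.symm.toLinearMap ∘ₗ (-(LinearMap.mulLeft Q (one (D k Q f)))) ∘ₗ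
    ULift.moduleEquiv.toLinearMap
  par_par x := by ext; simp
  d_par x := by ext; simp [sgn_mul]
  d_d x := by ext; simp [← mul_assoc, one_mul_one]

end Forms

end Forms

section Operators

open KaehlerDifferential

variable {k Q : Type u} [Field k] [CommRing Q] [Algebra k Q] {f : Q}

namespace MF

/-- A connection on (the module underlying) a matrix factorization, preserving the grading. -/
structure Connection (X : MF k Q f) where
  nab : X.P →ₗ[k] Ω[Q⁄k] ⊗[Q] X.P
  leibniz : ∀ (q : Q) (p : X.P), nab (q • p) = D k Q q ⊗ₜ[Q] p + q • nab p
  nab_par : ∀ p, nab (X.par p) = X.par.lTensor Ω[Q⁄k] (nab p)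

/-- The module `Ω^• ⊗ P`. -/
abbrev V (X : MF k Q f) : Type u := Forms k Q ⊗[Q] X.P

/-- The sign operator on `Ω^• ⊗ P`. -/
noncomputable def vpar (X : MF k Q f) : X.V →ₗ[Q] X.V := TensorProduct.map Forms.sgn X.par

/-- Left multiplication by forms on `Ω^• ⊗ P`. -/
noncomputable def lw (X : MF k Q f) : Forms k Q →ₗ[Q] X.V →ₗ[Q] X.V :=
  LinearMap.rTensorHom X.P ∘ₗ LinearMap.mul Q (Forms k Q)

/-- The inclusion `P → Ω^• ⊗ P`. -/
noncomputable def incl (X : MF k Q f) : X.P →ₗ[Q] X.V := TensorProduct.mk Q (Forms k Q) X.P 1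

variable {X Y Z : MF k Q f}

@[simp] theorem vpar_tmul (ω : Forms k Q) (p : X.P) :
    X.vpar (ω ⊗ₜ p) = Forms.sgn ω ⊗ₜ X.par p := rfl

@[simp] theorem lw_tmul (ω η : Forms k Q) (p : X.P) : X.lw ω (η ⊗ₜ p) = (ω * η) ⊗ₜ p := rfl

theorem incl_apply (p : X.P) : X.incl p = 1 ⊗ₜ p := rfl

theorem vpar_vpar (v : X.V) : X.vpar (X.vpar v) = v := by
  induction v using TensorProduct.induction_on with
  | zero => simp
  | add x y hx hy => simp only [map_add, hx, hy]
  | tmul ω p => simp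

theorem vpar_lw (ω : Forms k Q) (v : X.V) : X.vpar (X.lw ω v) = X.lw (Forms.sgn ω) (X.vpar v) := by
  induction v using TensorProduct.induction_on with
  | zero => simp
  | add x y hx hy => simp only [map_add, hx, hy]
  | tmul η p => simp [Forms.sgn_mul]

theorem lw_lw (ω η : Forms k Q) (v : X.V) : X.lw ω (X.lw η v) = X.lw (ω * η) v := by
  induction v using TensorProduct.induction_on with
  | zero => simp
  | add x y hx hy => simp only [map_add, hx, hy]
  | tmul ζ p => simp [mul_assoc]

variable (X Y) in
/-- The sign operator on operators: `Φ ↦ (-1)^|Φ| Φ`. -/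
noncomputable def opar : (X.V →ₗ[Q] Y.V) →ₗ[Q] (X.V →ₗ[Q] Y.V) :=
  LinearMap.lcomp Q Y.V X.vpar ∘ₗ LinearMap.llcomp Q X.V Y.V Y.V Y.vpar

@[simp] theorem opar_apply (Φ : X.V →ₗ[Q] Y.V) (v : X.V) :
    opar X Y Φ v = Y.vpar (Φ (X.vpar v)) := rfl

theorem opar_opar (Φ : X.V →ₗ[Q] Y.V) : opar X Y (opar X Y Φ) = Φ :=
  LinearMap.ext fun v => by simp [vpar_vpar]

theorem opar_comp (Φ : Y.V →ₗ[Q] Z.V) (Ψ : X.V →ₗ[Q] Y.V) :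
    opar X Z (Φ ∘ₗ Ψ) = opar Y Z Φ ∘ₗ opar X Y Ψ :=
  LinearMap.ext fun v => by simp [vpar_vpar]

/-- The operator `ω ⊗ p ↦ ω ∧ φ(p)`. -/
noncomputable def ext0 (φ : X.P →ₗ[Q] Y.V) : X.V →ₗ[Q] Y.V :=
  TensorProduct.lift (LinearMap.compl₂ Y.lw φ)

@[simp] theorem ext0_tmul (φ : X.P →ₗ[Q] Y.V) (ω : Forms k Q) (p : X.P) :
    ext0 φ (ω ⊗ₜ p) = Y.lw ω (φ p) := rfl

variable (X Y) in
/-- The action of a morphism on `Ω^• ⊗ P`: `ω ⊗ p ↦ (-1)^(|α| |ω|) ω ⊗ α p`. -/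
noncomputable def hat : (X.P →ₗ[Q] Y.P) →ₗ[Q] (X.V →ₗ[Q] Y.V) :=
  LinearMap.lTensorHom (Forms k Q) ∘ₗ hev X Y +
    (TensorProduct.mapBilinear (RingHom.id Q) (Forms k Q) X.P (Forms k Q) Y.P Forms.sgn) ∘ₗ hod X Y

theorem hat_tmul (a : X.P →ₗ[Q] Y.P) (ω : Forms k Q) (p : X.P) :
    hat X Y a (ω ⊗ₜ p) = ω ⊗ₜ hev X Y a p + Forms.sgn ω ⊗ₜ hod X Y a p := rfl

variable (cX : X.Connection) (cY : Y.Connection) (cZ : Z.Connection)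

/-- The map `α' = ∇α - (-1)^|α| α∇ : P → Ω¹ ⊗ P'`, `α` acting on `Ω¹ ⊗ P` by
`η ⊗ p ↦ (-1)^|α| η ⊗ α p`. -/
noncomputable def deriv1 (a : X.P →ₗ[Q] Y.P) : X.P →ₗ[Q] Ω[Q⁄k] ⊗[Q] Y.P where
  toFun p := cY.nab (a p) - a.lTensor Ω[Q⁄k] (cX.nab p)
  map_add' p p' := by simp only [map_add]; abel
  map_smul' q p := by
    simp only [map_smul, cY.leibniz, cX.leibniz, map_add, LinearMap.lTensor_tmul, smul_sub,
      RingHom.id_apply]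
    abel

theorem deriv1_apply (a : X.P →ₗ[Q] Y.P) (p : X.P) :
    deriv1 cX cY a p = cY.nab (a p) - a.lTensor Ω[Q⁄k] (cX.nab p) := rfl

/-- The map `α'`, as a map `P → Ω^• ⊗ P'`. -/
noncomputable def deriv : (X.P →ₗ[Q] Y.P) →ₗ[k] (X.P →ₗ[Q] Y.V) where
  toFun a := Forms.one.rTensor Y.P ∘ₗ deriv1 cX cY a
  map_add' a b := LinearMap.ext fun p => by
    have : deriv1 cX cY (a + b) p = deriv1 cX cY a p + deriv1 cX cY b p := by
      simp only [deriv1_apply, LinearMap.add_apply, LinearMap.lTensor_add, map_add]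
      abel
    simp only [LinearMap.comp_apply, LinearMap.add_apply, this, map_add]
  map_smul' c a := LinearMap.ext fun p => by
    have : (c • a).lTensor Ω[Q⁄k] (cX.nab p) = c • a.lTensor Ω[Q⁄k] (cX.nab p) := by
      rw [← algebraMap_smul Q c a, LinearMap.lTensor_smul, LinearMap.smul_apply, algebraMap_smul]
    simp only [LinearMap.comp_apply, LinearMap.smul_apply, deriv1_apply, map_smul, this,
      RingHom.id_apply, ← smul_sub, LinearMap.map_smul_of_tower]

/-- The extension of `α'` to `Ω^• ⊗ P`: `ω ⊗ p ↦ (-1)^((|α| + 1) |ω|) ω ∧ α'(p)`. -/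
noncomputable def prime : (X.P →ₗ[Q] Y.P) →ₗ[k] (X.V →ₗ[Q] Y.V) where
  toFun a := ext0 (deriv cX cY (hod X Y a)) +
    ext0 (deriv cX cY (hev X Y a)) ∘ₗ Forms.sgn.rTensor X.P
  map_add' a b := by
    ext ω p
    simp
    abel
  map_smul' c a := by
    ext ω p
    simp [LinearMap.map_smul_of_tower]

theorem prime_tmul (a : X.P →ₗ[Q] Y.P) (ω : Forms k Q) (p : X.P) :
    prime cX cY a (ω ⊗ₜ p) = Y.lw ω (deriv cX cY (hod X Y a) p) +
      Y.lw (Forms.sgn ω) (deriv cX cY (hev X Y a) p) := rfl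

end MF

end Operators

set_option linter.unusedSectionVars false

section Operators

open KaehlerDifferential

variable {k Q : Type u} [Field k] [CommRing Q] [Algebra k Q] {f : Q}

namespace MF

variable {X Y Z : MF k Q f}

theorem opar_neg (Φ : X.V →ₗ[Q] Y.V) : opar X Y (-Φ) = -opar X Y Φ :=
  LinearMap.ext fun v => by simp

/-- Linearity over the differential forms, up to signs. -/
def OmLin (Φ : X.V →ₗ[Q] Y.V) : Prop :=
  ∀ η v, Φ (X.lw (Forms.one η) v) = Y.lw (Forms.one η) (opar X Y Φ v)

theorem gl_ext {Φ Ψ : X.V →ₗ[Q] Y.V} (hΦ : OmLin Φ) (hΨ : OmLin Ψ)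
    (h : ∀ p, Φ (1 ⊗ₜ p) = Ψ (1 ⊗ₜ p)) : Φ = Ψ := by
  have step : ∀ (η : Ω[Q⁄k]) (ω : Forms k Q), (∀ p, Φ (Forms.sgn ω ⊗ₜ p) = Ψ (Forms.sgn ω ⊗ₜ p)) →
      ∀ p, Φ ((Forms.one η * ω) ⊗ₜ p) = Ψ ((Forms.one η * ω) ⊗ₜ p) := fun η ω H p => by
    rw [← lw_tmul, hΦ, hΨ]
    simp only [opar_apply, vpar_tmul, H]
  have key : ∀ ω : Forms k Q, (∀ p, Φ (ω ⊗ₜ p) = Ψ (ω ⊗ₜ p)) ∧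
      ∀ p, Φ (Forms.sgn ω ⊗ₜ p) = Ψ (Forms.sgn ω ⊗ₜ p) := by
    intro ω
    induction ω using Forms.induction_left with
    | h1 q =>
      have e : Forms.sgn (algebraMap Q (Forms k Q) q) = algebraMap Q (Forms k Q) q := by
        rw [Algebra.algebraMap_eq_smul_one, map_smul, Forms.sgn_one_eq]
      rw [e, and_self]
      intro p
      rw [Algebra.algebraMap_eq_smul_one, ← TensorProduct.smul_tmul', map_smul, map_smul, h]
    | hm η ω H =>
      refine ⟨step η ω H.2, fun p => ?_⟩
      rw [Forms.sgn_mul, Forms.sgn_one, neg_mul, TensorProduct.neg_tmul, map_neg, map_neg,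
        step η (Forms.sgn ω) (by simpa using H.1)]
    | ha x y hx hy =>
      simp only [TensorProduct.add_tmul, map_add, hx.1, hy.1, hx.2, hy.2, implies_true, and_self]
  ext ω p
  exact (key ω).1 p

theorem OmLin.comp {Φ : Y.V →ₗ[Q] Z.V} {Ψ : X.V →ₗ[Q] Y.V} (hΦ : OmLin Φ) (hΨ : OmLin Ψ) :
    OmLin (Φ ∘ₗ Ψ) := fun η v => by
  rw [LinearMap.comp_apply, hΨ, hΦ, opar_comp]; rfl

theorem OmLin.add {Φ Ψ : X.V →ₗ[Q] Y.V} (hΦ : OmLin Φ) (hΨ : OmLin Ψ) : OmLin (Φ + Ψ) := fun η v => by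
  rw [LinearMap.add_apply, hΦ, hΨ, map_add, LinearMap.add_apply, map_add]

theorem OmLin.zero : OmLin (0 : X.V →ₗ[Q] Y.V) := fun η v => by simp

theorem OmLin.neg {Φ : X.V →ₗ[Q] Y.V} (hΦ : OmLin Φ) : OmLin (-Φ) := fun η v => by
  rw [LinearMap.neg_apply, hΦ, opar_neg, LinearMap.neg_apply, map_neg]

theorem OmLin.opar {Φ : X.V →ₗ[Q] Y.V} (hΦ : OmLin Φ) : OmLin (opar X Y Φ) := fun η v => by
  rw [opar_apply, vpar_lw, Forms.sgn_one, map_neg, LinearMap.neg_apply, map_neg, hΦ, map_neg,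
    vpar_lw, Forms.sgn_one, map_neg, LinearMap.neg_apply, neg_neg]
  rfl

theorem OmLin.opar_lw {Φ : X.V →ₗ[Q] Y.V} (hΦ : OmLin Φ) (η : Ω[Q⁄k]) :
    MF.opar X Y Φ ∘ₗ X.lw (Forms.one η) = Y.lw (Forms.one η) ∘ₗ Φ := LinearMap.ext fun v => by
  rw [LinearMap.comp_apply, hΦ.opar, opar_opar]; rfl

theorem OmLin.id : OmLin (LinearMap.id : X.V →ₗ[Q] X.V) := fun η v => by
  simp [vpar_vpar]

theorem opar_lw (ω : Forms k Q) : opar X X (X.lw ω) = X.lw (Forms.sgn ω) := LinearMap.ext fun v => by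
  rw [opar_apply, vpar_lw, vpar_vpar]

theorem OmLin.lw (η : Ω[Q⁄k]) : OmLin (X.lw (Forms.one η)) := fun ζ v => by
  rw [MF.opar_lw, lw_lw, Forms.sgn_one, lw_lw, mul_neg, ← Forms.one_mul_one_add]

variable (cX : X.Connection) (cY : Y.Connection) (cZ : Z.Connection)

theorem lw_one (v : X.V) : X.lw 1 v = v := by
  induction v using TensorProduct.induction_on with
  | zero => simp
  | add x y hx hy => rw [map_add, hx, hy]
  | tmul ω p => simp

theorem vpar_deriv (a : X.P →ₗ[Q] Y.P) (p : X.P) :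
    Y.vpar (deriv cX cY a (X.par p)) = -deriv cX cY (hpar X Y a) p := by
  have h1 : ∀ t : Ω[Q⁄k] ⊗[Q] Y.P, Y.vpar (Forms.one.rTensor Y.P t) =
      -Forms.one.rTensor Y.P (Y.par.lTensor _ t) := fun t => by
    induction t using TensorProduct.induction_on with
    | zero => simp
    | add x y hx hy => simp only [map_add, hx, hy, neg_add]
    | tmul ω p => simp [TensorProduct.neg_tmul]
  change Y.vpar (Forms.one.rTensor Y.P (deriv1 cX cY a (X.par p))) =
    -Forms.one.rTensor Y.P (deriv1 cX cY (hpar X Y a) p)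
  rw [h1]
  congr 2
  have h2 : hpar X Y a = Y.par ∘ₗ a ∘ₗ X.par := rfl
  rw [deriv1_apply, deriv1_apply, map_sub, ← cY.nab_par, cX.nab_par, hpar_apply, h2]
  simp only [LinearMap.lTensor_comp_apply]

variable [CharZero k]

theorem hev_add_hod (a : X.P →ₗ[Q] Y.P) : hev X Y a + hod X Y a = a :=
  DGCat.ev_add_od (C := dg k Q f Set.univ) (X := ⟨X, Set.subset_univ _⟩)
    (Y := ⟨Y, Set.subset_univ _⟩) a

theorem opar_hat (a : X.P →ₗ[Q] Y.P) : opar X Y (hat X Y a) = hat X Y (hpar X Y a) := by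
  ext ω p
  simp [hat_tmul, par_hev, par_hod, hev_hpar, hod_hpar]

theorem hat_one_tmul (a : X.P →ₗ[Q] Y.P) (p : X.P) : hat X Y a (1 ⊗ₜ p) = 1 ⊗ₜ a p := by
  rw [hat_tmul, Forms.sgn_one_eq, ← TensorProduct.tmul_add, ← LinearMap.add_apply, hev_add_hod]

theorem OmLin.hat (a : X.P →ₗ[Q] Y.P) : OmLin (hat X Y a) := fun η v => by
  rw [opar_hat]
  induction v using TensorProduct.induction_on with
  | zero => simp
  | add x y hx hy => simp only [map_add, hx, hy]
  | tmul ω p =>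
    simp [hat_tmul, hev_hpar, hod_hpar, Forms.sgn_mul, TensorProduct.neg_tmul,
      TensorProduct.tmul_neg]

theorem hat_comp (a : Y.P →ₗ[Q] Z.P) (b : X.P →ₗ[Q] Y.P) :
    hat X Z (a ∘ₗ b) = hat Y Z a ∘ₗ hat X Y b :=
  gl_ext (OmLin.hat _) ((OmLin.hat _).comp (OmLin.hat _)) fun p => by simp [hat_one_tmul]

theorem hat_id : hat X X LinearMap.id = LinearMap.id :=
  gl_ext (OmLin.hat _) OmLin.id fun p => by simp [hat_one_tmul]

theorem opar_prime (a : X.P →ₗ[Q] Y.P) :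
    opar X Y (prime cX cY a) = -prime cX cY (hpar X Y a) := by
  ext ω p
  simp [prime_tmul, vpar_lw, vpar_deriv, hpar_hod, hpar_hev, hev_hpar, hod_hpar]
  abel

theorem OmLin.prime (a : X.P →ₗ[Q] Y.P) : OmLin (prime cX cY a) := fun η v => by
  rw [opar_prime]
  induction v using TensorProduct.induction_on with
  | zero => simp
  | add x y hx hy => simp only [map_add, hx, hy]
  | tmul ω p =>
    simp [prime_tmul, hev_hpar, hod_hpar, Forms.sgn_mul, ← lw_lw]
    abel

theorem prime_one_tmul (a : X.P →ₗ[Q] Y.P) (p : X.P) :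
    prime cX cY a (1 ⊗ₜ p) = deriv cX cY a p := by
  rw [prime_tmul, Forms.sgn_one_eq, lw_one, lw_one, ← LinearMap.add_apply, ← map_add, add_comm,
    hev_add_hod]

theorem hat_rTensor (a : X.P →ₗ[Q] Y.P) (t : Ω[Q⁄k] ⊗[Q] X.P) :
    hat X Y (hpar X Y a) (Forms.one.rTensor X.P t) = Forms.one.rTensor Y.P (a.lTensor _ t) := by
  induction t using TensorProduct.induction_on with
  | zero => simp
  | add x y hx hy => simp only [map_add, hx, hy]
  | tmul ω p =>
    rw [LinearMap.rTensor_tmul, hat_tmul, hev_hpar, hod_hpar, Forms.sgn_one, LinearMap.neg_apply,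
      TensorProduct.neg_tmul, TensorProduct.tmul_neg, neg_neg, ← TensorProduct.tmul_add,
      ← LinearMap.add_apply, hev_add_hod]
    rfl

theorem prime_comp (a : Y.P →ₗ[Q] Z.P) (b : X.P →ₗ[Q] Y.P) : prime cX cZ (a ∘ₗ b) =
    prime cY cZ a ∘ₗ hat X Y b + hat Y Z (hpar Y Z a) ∘ₗ prime cX cY b :=
  gl_ext (OmLin.prime _ _ _) (((OmLin.prime _ _ _).comp (OmLin.hat _)).add ((OmLin.hat _).comp (OmLin.prime _ _ _)))
    fun p => by
    simp only [LinearMap.add_apply, LinearMap.comp_apply, hat_one_tmul, prime_one_tmul]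
    change Forms.one.rTensor Z.P (deriv1 cX cZ (a ∘ₗ b) p) =
      Forms.one.rTensor Z.P (deriv1 cY cZ a (b p)) +
        hat Y Z (hpar Y Z a) (Forms.one.rTensor Y.P (deriv1 cX cY b p))
    rw [hat_rTensor, ← map_add]
    simp only [deriv1_apply, map_sub, map_add, LinearMap.lTensor_comp_apply, LinearMap.comp_apply]
    abel

theorem prime_smul_id (q : Q) :
    prime cX cX (q • LinearMap.id) = X.lw (Forms.one (D k Q q)) :=
  gl_ext (OmLin.prime _ _ _) (OmLin.lw _) fun p => by
    rw [prime_one_tmul]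
    change Forms.one.rTensor X.P (deriv1 cX cX (q • LinearMap.id) p) = _
    simp [deriv1_apply, cX.leibniz, LinearMap.lTensor_smul]

/-- The operator `-δ'` on `Ω^• ⊗ P`. -/
noncomputable def S (cX : X.Connection) : X.V →ₗ[Q] X.V := -prime cX cX X.δ

theorem hpar_δ (X : MF k Q f) : hpar X X X.δ = -X.δ := by
  ext p; simp [X.δ_par]

theorem OmLin.S : OmLin (S cX) := (OmLin.prime cX cX X.δ).neg

theorem opar_S : opar X X (S cX) = S cX := by
  have h : prime cX cX (-X.δ) = -prime cX cX X.δ := map_neg (prime cX cX) X.δ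
  rw [S, opar_neg, opar_prime, hpar_δ, h]
  exact congrArg Neg.neg (neg_neg (prime cX cX X.δ))

theorem S_δ : S cX ∘ₗ hat X X X.δ =
    hat X X X.δ ∘ₗ S cX - X.lw (Forms.one (D k Q f)) := by
  have h : X.δ ∘ₗ X.δ = f • LinearMap.id := LinearMap.ext X.δ_δ
  rw [← prime_smul_id cX, ← h, prime_comp cX cX cX, hpar_δ, S, map_neg, LinearMap.neg_comp,
    LinearMap.neg_comp, LinearMap.comp_neg]
  abel

theorem prime_hd (a : X.P →ₗ[Q] Y.P) : prime cX cY (hd X Y a) =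
    -(hat Y Y Y.δ ∘ₗ prime cX cY a) - prime cX cY (hpar X Y a) ∘ₗ hat X X X.δ
      - S cY ∘ₗ hat X Y a + hat X Y a ∘ₗ S cX := by
  have h : hd X Y a = Y.δ ∘ₗ a - hpar X Y a ∘ₗ X.δ := rfl
  have h2 : hpar X Y (hpar X Y a) = a := by ext; simp
  rw [h, map_sub, prime_comp cX cY cY, prime_comp cX cX cY, hpar_δ, h2, S, S, map_neg]
  simp only [LinearMap.neg_comp, LinearMap.comp_neg]
  abel

theorem hat_hd (a : X.P →ₗ[Q] Y.P) : hat X Y (hd X Y a) =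
    hat Y Y Y.δ ∘ₗ hat X Y a - hat X Y (hpar X Y a) ∘ₗ hat X X X.δ := by
  have h : hd X Y a = Y.δ ∘ₗ a - hpar X Y a ∘ₗ X.δ := rfl
  rw [h, map_sub, hat_comp, hat_comp]

end MF

end Operators

section Series

open KaehlerDifferential DGCat

variable {k Q : Type u} [Field k] [CommRing Q] [Algebra k Q] {f : Q}

namespace MF

/-- The sequence of operators `N ↦ ∑_{i + j = N} Gᵢ T Sʲ`. -/
noncomputable def conv {X Y Z : MF k Q f} (S : Y.V →ₗ[Q] Y.V) :
    (ℕ → (Z.V →ₗ[Q] X.V)) →ₗ[Q] (Y.V →ₗ[Q] Z.V) →ₗ[k] (ℕ → (Y.V →ₗ[Q] X.V)) :=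
  LinearMap.mk₂' Q k
    (fun G T N => ∑ ij ∈ Finset.HasAntidiagonal.antidiagonal N, G ij.1 ∘ₗ T ∘ₗ (S ^ ij.2 : Module.End Q Y.V))
    (fun G G' T => by
      funext N
      simp only [Pi.add_apply, LinearMap.add_comp, Finset.sum_add_distrib])
    (fun q G T => by
      funext N
      simp only [Pi.smul_apply, LinearMap.smul_comp, Finset.smul_sum])
    (fun G T T' => by
      funext N
      simp only [Pi.add_apply, LinearMap.add_comp, LinearMap.comp_add, Finset.sum_add_distrib])
    (fun c G T => by
      funext N
      simp only [Pi.smul_apply, Finset.smul_sum]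
      refine Finset.sum_congr rfl fun ij _ => LinearMap.ext fun v => ?_
      simp only [LinearMap.comp_apply, LinearMap.smul_apply, LinearMap.map_smul_of_tower])

theorem conv_apply {X Y Z : MF k Q f} (S : Y.V →ₗ[Q] Y.V) (G : ℕ → (Z.V →ₗ[Q] X.V))
    (T : Y.V →ₗ[Q] Z.V) (N : ℕ) : conv S G T N =
      ∑ ij ∈ Finset.HasAntidiagonal.antidiagonal N, G ij.1 ∘ₗ T ∘ₗ (S ^ ij.2 : Module.End Q Y.V) := rfl

theorem conv_zero {X Y Z : MF k Q f} (S : Y.V →ₗ[Q] Y.V) (G : ℕ → (Z.V →ₗ[Q] X.V))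
    (T : Y.V →ₗ[Q] Z.V) : conv S G T 0 = G 0 ∘ₗ T := by
  simp [conv_apply, Module.End.one_eq_id]

theorem conv_succ {X Y Z : MF k Q f} (S : Y.V →ₗ[Q] Y.V) (G : ℕ → (Z.V →ₗ[Q] X.V))
    (T : Y.V →ₗ[Q] Z.V) (N : ℕ) :
    conv S G T (N + 1) = G (N + 1) ∘ₗ T + conv S G T N ∘ₗ S := by
  rw [conv_apply, Finset.Nat.sum_antidiagonal_succ', conv_apply]
  ext v
  simp [pow_succ, LinearMap.sum_apply, Module.End.one_eq_id]

/-- The sequence `0, G₀, G₁, …`. -/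
def shift {Q M : Type*} [CommRing Q] [AddCommGroup M] [Module Q M] : (ℕ → M) →ₗ[Q] (ℕ → M) where
  toFun G N := match N with
    | 0 => 0
    | N + 1 => G N
  map_add' G G' := by funext N; cases N <;> simp
  map_smul' q G := by funext N; cases N <;> simp

variable (Z : Set (PrimeSpectrum Q)) (c : ∀ X : MF k Q f, X.Connection)

/-- Appending a letter `α`: the sequence `N ↦ ∑_{i + j + 1 = N} Gᵢ α' Sʲ`. -/
noncomputable def app {X Y Z : MF k Q f} (cY : Y.Connection) (cZ : Z.Connection) :
    (ℕ → (Z.V →ₗ[Q] X.V)) →ₗ[Q] (Y.P →ₗ[Q] Z.P) →ₗ[k] (ℕ → (Y.V →ₗ[Q] X.V)) :=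
  LinearMap.mk₂' Q k (fun G a => shift (conv (S cY) G (prime cY cZ a)))
    (fun p p' a => by rw [map_add, LinearMap.add_apply, map_add])
    (fun q p a => by rw [map_smul, LinearMap.smul_apply, map_smul])
    (fun p a a' => by rw [map_add, map_add, map_add])
    (fun r p a => by rw [map_smul, map_smul, LinearMap.map_smul_of_tower])

variable {Z} in
/-- The terms of the HKR map before applying the supertrace: `word c Y (α₀[α₁|…|αₙ])` is the sequence
`N ↦ ∑_{n + i₀ + ⋯ + iₙ = N} (-1)^(i₀ + ⋯ + iₙ) α₀ (δ₁')^i₀ α₁' ⋯ (δₙ')^iₙ₋₁ αₙ' (δ_Y')^iₙ`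
of operators on differential forms with coefficients. -/
noncomputable def word {X : (dg k Q f Z).Obj} (Y : (dg k Q f Z).Obj) :
    (dg k Q f Z).Word X Y →ₗ[Q] (ℕ → (Y.1.V →ₗ[Q] X.1.V)) :=
  elim (N := fun Y : (dg k Q f Z).Obj => ℕ → (Y.1.V →ₗ[Q] X.1.V))
    (fun (Y : (dg k Q f Z).Obj) => LinearMap.pi fun N =>
      LinearMap.lcomp Q X.1.V (S (c Y.1) ^ N : Module.End Q Y.1.V) ∘ₗ hat Y.1 X.1)
    (fun (Y Z' : (dg k Q f Z).Obj) => app (c Y.1) (c Z'.1) ∘ₗ LinearMap.snd Q _ _) Y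

section

variable {Z} {X Y Z' : (dg k Q f Z).Obj}

theorem word_base (a : Y.1.P →ₗ[Q] X.1.P) (N : ℕ) :
    word c Y (base (C := dg k Q f Z) a) N =
      hat Y.1 X.1 a ∘ₗ (S (c Y.1) ^ N : Module.End Q Y.1.V) :=
  congrFun (elim_base (C := dg k Q f Z) (N := fun Y : (dg k Q f Z).Obj => ℕ → (Y.1.V →ₗ[Q] X.1.V))
    _ _ a) N

theorem word_base_zero (a : Y.1.P →ₗ[Q] X.1.P) :
    word c Y (base (C := dg k Q f Z) a) 0 = hat Y.1 X.1 a := word_base c a 0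

theorem word_base_succ (a : Y.1.P →ₗ[Q] X.1.P) (N : ℕ) :
    word c Y (base (C := dg k Q f Z) a) (N + 1) =
      word c Y (base (C := dg k Q f Z) a) N ∘ₗ S (c Y.1) := by
  refine (word_base c a (N + 1)).trans (Eq.trans ?_ (congrArg (fun T => T ∘ₗ S (c Y.1))
    (word_base c a N)).symm)
  exact congrArg (fun T => hat Y.1 X.1 a ∘ₗ T) (pow_succ (M := Module.End Q Y.1.V) _ _)

theorem word_snoc (x : (dg k Q f Z).Word X Z') (a : Y.1.P →ₗ[Q] Z'.1.P) :
    word c Y (snoc (C := dg k Q f Z) x a) = app (c Y.1) (c Z'.1) (word c Z' x) a :=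
  elim_snoc (C := dg k Q f Z) (N := fun Y : (dg k Q f Z).Obj => ℕ → (Y.1.V →ₗ[Q] X.1.V)) _ _ x a

theorem app_zero {X Y Z : MF k Q f} (cY : Y.Connection) (cZ : Z.Connection)
    (G : ℕ → (Z.V →ₗ[Q] X.V)) (a : Y.P →ₗ[Q] Z.P) : app cY cZ G a 0 = 0 := rfl

theorem app_succ {X Y Z : MF k Q f} (cY : Y.Connection) (cZ : Z.Connection)
    (G : ℕ → (Z.V →ₗ[Q] X.V)) (a : Y.P →ₗ[Q] Z.P) (N : ℕ) : app cY cZ G a (N + 1) =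
      G N ∘ₗ prime cY cZ a + app cY cZ G a N ∘ₗ S cY := by
  cases N with
  | zero =>
    rw [app_zero, LinearMap.zero_comp, add_zero]
    exact conv_zero _ _ _
  | succ N => exact conv_succ _ _ _ _

end

end MF
end Series

section Identity

open KaehlerDifferential DGCat

variable {k Q : Type u} [Field k] [CharZero k] [CommRing Q] [Algebra k Q] {f : Q}

namespace MF

section Seq

variable {X Y Z : MF k Q f} (cX : X.Connection) (cY : Y.Connection) (cZ : Z.Connection)

theorem app_opar {G G' : ℕ → (Z.V →ₗ[Q] X.V)} (h : ∀ N, G' N = opar Z X (G N))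
    (a : Y.P →ₗ[Q] Z.P) (N : ℕ) :
    -app cY cZ G' (hpar Y Z a) N = opar Y X (app cY cZ G a N) := by
  induction N with
  | zero =>
    rw [app_zero, app_zero, map_zero]
    module
  | succ N ih =>
    rw [app_succ, app_succ, map_add, opar_comp, opar_comp, ← ih, opar_S, opar_prime, h]
    simp only [LinearMap.comp_neg, LinearMap.neg_comp]
    abel

theorem app_omLin {G : ℕ → (Z.V →ₗ[Q] X.V)} (h : ∀ N, OmLin (G N))
    (a : Y.P →ₗ[Q] Z.P) (N : ℕ) : OmLin (app cY cZ G a N) := by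
  induction N with
  | zero => exact OmLin.zero
  | succ N ih =>
    rw [app_succ]
    exact ((h N).comp (OmLin.prime _ _ _)).add (ih.comp (OmLin.S _))

/-- The compatibility of a sequence of operators with the differentials, with error term `R`. -/
def Idn (B dB R : ℕ → (Y.V →ₗ[Q] X.V)) : Prop := ∀ N, dB N =
  hat X X X.δ ∘ₗ B N - opar Y X (B N) ∘ₗ hat Y Y Y.δ -
    (N : Q) • (X.lw (Forms.one (D k Q f)) ∘ₗ B (N - 1)) + R N

theorem idn_base (B dB : ℕ → (Y.V →ₗ[Q] X.V)) (a : Y.P →ₗ[Q] X.P)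
    (h0 : B 0 = hat Y X a) (hs : ∀ N, B (N + 1) = B N ∘ₗ S cY) (hB : ∀ N, OmLin (B N))
    (h0' : dB 0 = hat Y X (hd Y X a)) (hs' : ∀ N, dB (N + 1) = dB N ∘ₗ S cY) :
    Idn B dB 0 := by
  intro N
  induction N with
  | zero =>
    rw [h0', h0, hat_hd, opar_hat]
    simp only [Nat.cast_zero, Pi.zero_apply]
    module
  | succ N ih =>
    have e : (N : Q) • (X.lw (Forms.one (D k Q f)) ∘ₗ B (N - 1)) ∘ₗ S cY =
        (N : Q) • (X.lw (Forms.one (D k Q f)) ∘ₗ B N) := by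
      cases N with
      | zero => simp
      | succ N => rw [LinearMap.comp_assoc, hs N]; rfl
    have e2 := (hB N).opar_lw (D k Q f)
    have e3 : opar Y X (B N ∘ₗ S cY) ∘ₗ hat Y Y Y.δ = opar Y X (B N) ∘ₗ hat Y Y Y.δ ∘ₗ S cY -
        X.lw (Forms.one (D k Q f)) ∘ₗ B N := by
      rw [opar_comp, opar_S, LinearMap.comp_assoc, S_δ, LinearMap.comp_sub, e2]
    rw [hs', ih, hs, e3, Nat.add_sub_cancel, Nat.cast_succ, add_smul, one_smul, ← e]
    simp only [LinearMap.add_comp, LinearMap.sub_comp, LinearMap.smul_comp, LinearMap.comp_assoc,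
      Pi.zero_apply, LinearMap.zero_comp]
    module

theorem idn_snoc (A A' dA R M B dB : ℕ → _) (B1 B2 : ℕ → (Y.V →ₗ[Q] X.V)) (a : Y.P →ₗ[Q] Z.P)
    (hA : ∀ N, A' N = opar Z X (A N)) (hAl : ∀ N, OmLin (A N)) (hA' : Idn A dA R)
    (hB : B = app cY cZ A a) (hB1 : B1 = app cY cZ dA a) (hB2 : B2 = app cY cZ A' (hd Y Z a))
    (hdB : ∀ N, dB N = B1 N + M N - B2 N)
    (hM0 : M 0 = A' 0 ∘ₗ hat Y Z a)
    (hM : ∀ N, M (N + 1) + R N ∘ₗ prime cY cZ a + A' N ∘ₗ S cZ ∘ₗ hat Y Z a =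
      M N ∘ₗ S cY + A' (N + 1) ∘ₗ hat Y Z a) :
    Idn B dB (fun N => A' N ∘ₗ hat Y Z a) := by
  have h0 : B 0 = 0 := by rw [hB]; rfl
  have hs : ∀ N, B (N + 1) = A N ∘ₗ prime cY cZ a + B N ∘ₗ S cY := fun N => by
    rw [hB, app_succ]
  have hBl : ∀ N, OmLin (B N) := fun N => by rw [hB]; exact app_omLin _ _ hAl _ _
  intro N
  induction N with
  | zero =>
    rw [hdB, hB1, hB2, app_zero, app_zero, hM0, h0, map_zero]
    simp only [Nat.cast_zero, LinearMap.comp_zero, LinearMap.zero_comp]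
    module
  | succ N ih =>
    have hsd : dB (N + 1) = dB N ∘ₗ S cY - M N ∘ₗ S cY + M (N + 1) + dA N ∘ₗ prime cY cZ a -
        A' N ∘ₗ prime cY cZ (hd Y Z a) := by
      rw [hdB, hdB, hB1, hB2, app_succ, app_succ]
      simp only [LinearMap.add_comp, LinearMap.sub_comp]
      abel
    have e : (N : Q) • (X.lw (Forms.one (D k Q f)) ∘ₗ B (N - 1)) ∘ₗ S cY =
        (N : Q) • (X.lw (Forms.one (D k Q f)) ∘ₗ B N) -
          (N : Q) • (X.lw (Forms.one (D k Q f)) ∘ₗ A (N - 1)) ∘ₗ prime cY cZ a := by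
      cases N with
      | zero =>
        simp only [Nat.cast_zero]
        module
      | succ N =>
        rw [hs N]
        simp only [LinearMap.comp_assoc, LinearMap.comp_add, Nat.add_sub_cancel]
        module
    have e2 := (hBl N).opar_lw (D k Q f)
    have e3 : opar Y X (B (N + 1)) ∘ₗ hat Y Y Y.δ =
        -(A' N ∘ₗ prime cY cZ (hpar Y Z a) ∘ₗ hat Y Y Y.δ) +
          opar Y X (B N) ∘ₗ hat Y Y Y.δ ∘ₗ S cY - X.lw (Forms.one (D k Q f)) ∘ₗ B N := by
      rw [hs, map_add, opar_comp, opar_comp, opar_S, opar_prime, LinearMap.add_comp,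
        LinearMap.comp_assoc, LinearMap.comp_assoc, S_δ, LinearMap.comp_sub, e2, ← hA]
      simp only [LinearMap.comp_neg, LinearMap.neg_comp]
      abel
    have h1 : M (N + 1) = M N ∘ₗ S cY + A' (N + 1) ∘ₗ hat Y Z a - A' N ∘ₗ S cZ ∘ₗ hat Y Z a -
        R N ∘ₗ prime cY cZ a := by
      rw [← hM N]
      abel
    rw [hsd, ih, e3, h1, Nat.add_sub_cancel, Nat.cast_succ, add_smul, one_smul, prime_hd, hA' N, hs,
      ← hA]
    simp only [LinearMap.add_comp, LinearMap.sub_comp, LinearMap.smul_comp, LinearMap.comp_assoc,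
      LinearMap.neg_comp, LinearMap.comp_neg, LinearMap.comp_add, LinearMap.comp_sub] at e ⊢
    rw [e]
    module

end Seq

end MF
end Identity

section WordIdentity

open KaehlerDifferential DGCat

variable {k Q : Type u} [Field k] [CharZero k] [CommRing Q] [Algebra k Q] {f : Q}

namespace MF

variable {Z : Set (PrimeSpectrum Q)} (c : ∀ X : MF k Q f, X.Connection)

variable {X Y Z' : (dg k Q f Z).Obj}

theorem word_wpar (x : (dg k Q f Z).Word X Y) (N : ℕ) :
    word c Y (wpar Y x) N = opar Y.1 X.1 (word c Y x N) := by
  refine word_induction (p := fun (Y : (dg k Q f Z).Obj) x => ∀ N,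
    word c Y (wpar Y x) N = opar Y.1 X.1 (word c Y x N)) x (fun Y a N => ?_)
    (fun Y Z' x a h N => ?_) (fun Y N => ?_) (fun Y x y hx hy N => ?_) N
  · rw [wpar_base]
    change word c Y (base (C := dg k Q f Z) (hpar Y.1 X.1 a)) N = _
    induction N with
    | zero => exact (word_base_zero c _).trans ((congrArg _ (word_base_zero c a)).trans
        (opar_hat a)).symm
    | succ N ih =>
      refine (word_base_succ c _ N).trans (Eq.trans ?_ (congrArg _ (word_base_succ c a N)).symm)
      rw [opar_comp, opar_S, ← ih]
  · rw [wpar_snoc, map_neg]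
    refine Eq.trans (congrArg (fun G => -G) (congrFun (word_snoc c _ _) N))
      (Eq.trans ?_ (congrArg _ (congrFun (word_snoc c x a) N)).symm)
    exact app_opar (c Y.1) (c Z'.1) h a N
  · rw [map_zero, map_zero]; exact (map_zero (opar Y.1 X.1)).symm
  · rw [map_add, map_add, map_add, Pi.add_apply, hx, hy]
    exact (map_add (opar Y.1 X.1) _ _).symm

theorem word_omLin (x : (dg k Q f Z).Word X Y) (N : ℕ) : OmLin (word c Y x N) := by
  refine word_induction (p := fun (Y : (dg k Q f Z).Obj) x => ∀ N, OmLin (word c Y x N)) x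
    (fun Y a N => ?_) (fun Y Z' x a h N => ?_) (fun Y N => ?_) (fun Y x y hx hy N => ?_) N
  · induction N with
    | zero => exact (word_base_zero c a).symm ▸ OmLin.hat a
    | succ N ih => exact (word_base_succ c a N).symm ▸ ih.comp (OmLin.S _)
  · exact (congrFun (word_snoc c x a) N).symm ▸ app_omLin _ _ h _ _
  · rw [map_zero]; exact OmLin.zero
  · rw [map_add]; exact (hx N).add (hy N)

/-- Auxiliary definition for the error term in the compatibility with differentials. -/
noncomputable def remStep {X Y Z : MF k Q f} :
    (ℕ → (Z.V →ₗ[Q] X.V)) →ₗ[Q] (Y.P →ₗ[Q] Z.P) →ₗ[k] (ℕ → (Y.V →ₗ[Q] X.V)) :=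
  LinearMap.mk₂' Q k (fun G a N => opar Z X (G N) ∘ₗ hat Y Z a)
    (fun G G' a => by funext N; simp only [Pi.add_apply, map_add, LinearMap.add_comp])
    (fun q G a => by funext N; simp only [Pi.smul_apply, map_smul, LinearMap.smul_comp])
    (fun G a a' => by funext N; simp only [Pi.add_apply, map_add, LinearMap.comp_add])
    (fun r G a => by
      funext N
      refine LinearMap.ext fun v => ?_
      simp only [Pi.smul_apply, LinearMap.map_smul_of_tower, LinearMap.comp_apply,
        LinearMap.smul_apply])

/-- The error term in the compatibility of `word` with the differentials. -/
noncomputable def rem {X : (dg k Q f Z).Obj} (Y : (dg k Q f Z).Obj) :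
    (dg k Q f Z).Word X Y →ₗ[Q] (ℕ → (Y.1.V →ₗ[Q] X.1.V)) :=
  elim (N := fun Y : (dg k Q f Z).Obj => ℕ → (Y.1.V →ₗ[Q] X.1.V)) (fun _ => 0)
    (fun (Y Z' : (dg k Q f Z).Obj) => remStep (X := X.1) (Y := Y.1) (Z := Z'.1) ∘ₗ word c Z' ∘ₗ
      LinearMap.fst Q _ _) Y

theorem rem_base (a : Y.1.P →ₗ[Q] X.1.P) : rem c Y (base (C := dg k Q f Z) a) = 0 :=
  elim_base (C := dg k Q f Z) (N := fun Y : (dg k Q f Z).Obj => ℕ → (Y.1.V →ₗ[Q] X.1.V)) _ _ a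

theorem rem_snoc (x : (dg k Q f Z).Word X Z') (a : Y.1.P →ₗ[Q] Z'.1.P) :
    rem c Y (snoc (C := dg k Q f Z) x a) =
      fun N => opar Z'.1 X.1 (word c Z' x N) ∘ₗ hat Y.1 Z'.1 a :=
  elim_snoc (C := dg k Q f Z) (N := fun Y : (dg k Q f Z).Obj => ℕ → (Y.1.V →ₗ[Q] X.1.V)) _ _ x a

theorem word_merge_zero (x : (dg k Q f Z).Word X Z') (a : (dg k Q f Z).Hom Y Z') :
    word c Y (merge (C := dg k Q f Z) Z' x a) 0 = word c Z' x 0 ∘ₗ hat Y.1 Z'.1 a := by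
  refine word_cases (p := fun x => word c Y (merge (C := dg k Q f Z) Z' x a) 0 =
    word c Z' x 0 ∘ₗ hat Y.1 Z'.1 a) x (fun b => ?_) (fun W x b => ?_) ?_ (fun x y hx hy => ?_)
  · rw [merge_base]
    refine (word_base_zero c _).trans (Eq.trans (hat_comp b a) ?_)
    exact congrArg (fun T => T ∘ₗ hat Y.1 Z'.1 a) (word_base_zero c b).symm
  · rw [merge_snoc]
    refine (congrFun (word_snoc c x _) 0).trans (Eq.trans ?_
      (congrArg (fun T => T ∘ₗ hat Y.1 Z'.1 a) (congrFun (word_snoc c x b) 0)).symm)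
    exact (LinearMap.zero_comp _).symm
  · rw [map_zero, map_zero]; exact (LinearMap.zero_comp _).symm
  · rw [map_add, map_add, LinearMap.add_apply, map_add, Pi.add_apply, hx, hy]
    exact (LinearMap.add_comp _ _ _).symm

theorem merge_seq {X Y Z W : MF k Q f} (cY : Y.Connection) (cZ : Z.Connection) (cW : W.Connection)
    (G : ℕ → (W.V →ₗ[Q] X.V)) (b : Z.P →ₗ[Q] W.P) (a : Y.P →ₗ[Q] Z.P) (N : ℕ) :
    -app cY cW G (hpar Z W b ∘ₗ a) (N + 1) + (G N ∘ₗ hat Z W b) ∘ₗ prime cY cZ a +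
        (-app cZ cW G (hpar Z W b) N) ∘ₗ S cZ ∘ₗ hat Y Z a =
      (-app cY cW G (hpar Z W b ∘ₗ a) N) ∘ₗ S cY +
        (-app cZ cW G (hpar Z W b) (N + 1)) ∘ₗ hat Y Z a := by
  have h : hpar Z W (hpar Z W b) = b := by ext; simp
  rw [app_succ, app_succ, prime_comp cY cZ cW, h]
  simp only [LinearMap.add_comp, LinearMap.comp_add, LinearMap.neg_comp, LinearMap.comp_assoc]
  abel

theorem word_merge_succ (y : (dg k Q f Z).Word X Z') (a : (dg k Q f Z).Hom Y Z') (N : ℕ) :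
    word c Y (merge Z' (wpar Z' y) a) (N + 1) + rem c Z' y N ∘ₗ prime (c Y.1) (c Z'.1) a +
        word c Z' (wpar Z' y) N ∘ₗ S (c Z'.1) ∘ₗ hat Y.1 Z'.1 a =
      word c Y (merge Z' (wpar Z' y) a) N ∘ₗ S (c Y.1) +
        word c Z' (wpar Z' y) (N + 1) ∘ₗ hat Y.1 Z'.1 a := by
  refine word_cases (p := fun y =>
    word c Y (merge Z' (wpar Z' y) a) (N + 1) + rem c Z' y N ∘ₗ prime (c Y.1) (c Z'.1) a +
        word c Z' (wpar Z' y) N ∘ₗ S (c Z'.1) ∘ₗ hat Y.1 Z'.1 a =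
      word c Y (merge Z' (wpar Z' y) a) N ∘ₗ S (c Y.1) +
        word c Z' (wpar Z' y) (N + 1) ∘ₗ hat Y.1 Z'.1 a) y (fun b => ?_) (fun W z b => ?_) ?_
    (fun x y hx hy => ?_)
  · have e1 := word_base_succ c (X := X) (Y := Y) ((dg k Q f Z).comp ((dg k Q f Z).par b) a) N
    have e2 := word_base_succ c (X := X) (Y := Z') ((dg k Q f Z).par b) N
    have e3 := congrFun (rem_base c b) N
    rw [wpar_base, merge_base, e1, e2, e3]
    simp only [Pi.zero_apply, LinearMap.zero_comp, LinearMap.comp_assoc]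
    module
  · have e1 := congrFun (word_snoc c (wpar W z) ((dg k Q f Z).comp ((dg k Q f Z).par b) a))
    have e2 := congrFun (word_snoc c (wpar W z) ((dg k Q f Z).par b))
    have e3 : ∀ N, rem c Z' (snoc z b) N = _ := congrFun (rem_snoc c z b)
    have e4 : ∀ N, word c Y (merge Z' (wpar Z' (snoc z b)) a) N = 
        -app (c Y.1) (c W.1) (word c W (wpar W z)) (hpar Z'.1 W.1 b ∘ₗ a) N := fun N => by
      rw [wpar_snoc, map_neg, LinearMap.neg_apply, merge_snoc, map_neg, Pi.neg_apply, e1]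
      rfl
    have e5 : ∀ N, word c Z' (wpar Z' (snoc z b)) N = 
        -app (c Z'.1) (c W.1) (word c W (wpar W z)) (hpar Z'.1 W.1 b) N := fun N => by
      rw [wpar_snoc, map_neg, Pi.neg_apply, e2]
      rfl
    rw [e4, e4, e5, e5, e3, ← word_wpar]
    exact merge_seq (c Y.1) (c Z'.1) (c W.1) _ b a N
  · simp only [map_zero, LinearMap.zero_apply, Pi.zero_apply, LinearMap.zero_comp]
    module
  · simp only [map_add, LinearMap.add_apply, Pi.add_apply, LinearMap.add_comp]
    refine Eq.trans ?_ ((congrArg₂ (fun s t => s + t) hx hy).trans ?_)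
    · abel
    · abel

theorem word_wd (x : (dg k Q f Z).Word X Y) : Idn (word c Y x) (word c Y (wd Y x)) (rem c Y x) := by
  refine word_induction (p := fun (Y : (dg k Q f Z).Obj) x =>
    Idn (word c Y x) (word c Y (wd Y x)) (rem c Y x)) x (fun Y a => ?_)
    (fun Y Z' x a h => ?_) (fun Y => ?_) (fun Y x y hx hy => ?_)
  · rw [wd_base]
    refine (rem_base c a).symm ▸ ?_
    exact idn_base (c Y.1) _ _ a (word_base_zero c a) (word_base_succ c a)
      (word_omLin c (base (C := dg k Q f Z) a)) (word_base_zero c _) (word_base_succ c _)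
  · have e : rem c Y (snoc x a) = fun N => word c Z' (wpar Z' x) N ∘ₗ hat Y.1 Z'.1 a := by
      funext N
      rw [word_wpar]
      exact congrFun (rem_snoc c x a) N
    rw [e]
    refine idn_snoc (c Y.1) (c Z'.1) (word c Z' x) (word c Z' (wpar Z' x)) (word c Z' (wd Z' x))
      (rem c Z' x) (word c Y (merge Z' (wpar Z' x) a)) _ _ (word c Y (snoc (wd Z' x) a))
      (word c Y (snoc (wpar Z' x) ((dg k Q f Z).d a))) a (word_wpar c x) (word_omLin c x) h
      (word_snoc c x a) (word_snoc c _ a) (word_snoc c _ _) (fun N => ?_) (word_merge_zero c _ a)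
      (word_merge_succ c x a)
    rw [wd_snoc, map_sub, map_add]
    rfl
  · intro N
    simp only [map_zero, Pi.zero_apply, LinearMap.comp_zero, LinearMap.zero_comp, smul_zero]
    module
  · intro N
    simp only [map_add, Pi.add_apply, LinearMap.comp_add, LinearMap.add_comp]
    rw [hx N, hy N]
    module

end MF
end WordIdentity

section Supertrace

open KaehlerDifferential DGCat

variable {k Q : Type u} [Field k] [CommRing Q] [Algebra k Q] {f : Q}

namespace Forms

theorem sgn_mem {N : ℕ} {ω : Forms k Q} (h : ω ∈ ⋀[Q]^N Ω[Q⁄k]) : sgn ω ∈ ⋀[Q]^N Ω[Q⁄k] := by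
  have e : Submodule.map (CliffordAlgebra.involute : Forms k Q →ₐ[Q] Forms k Q).toLinearMap
      (LinearMap.range (one (k := k) (Q := Q))) ≤ LinearMap.range one := by
    rintro _ ⟨_, ⟨η, rfl⟩, rfl⟩
    exact ⟨-η, by rw [map_neg]; exact (sgn_one η).symm⟩
  have e2 := Submodule.map_pow (LinearMap.range (one (k := k) (Q := Q)))
    (CliffordAlgebra.involute : Forms k Q →ₐ[Q] Forms k Q) N
  exact pow_le_pow_left' e N (e2 ▸ Submodule.mem_map_of_mem h)

theorem mul_mem {M N : ℕ} {ω η : Forms k Q} (h : ω ∈ ⋀[Q]^M Ω[Q⁄k]) (h' : η ∈ ⋀[Q]^N Ω[Q⁄k]) :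
    ω * η ∈ ⋀[Q]^(M + N) Ω[Q⁄k] := by
  rw [ExteriorAlgebra.exteriorPower, pow_add]; exact Submodule.mul_mem_mul h h'

theorem one_mem (η : Ω[Q⁄k]) : one η ∈ ⋀[Q]^1 Ω[Q⁄k] := by
  rw [ExteriorAlgebra.exteriorPower, pow_one]; exact ⟨η, rfl⟩

variable (k Q) in
theorem exists_bound [Module.Finite Q Ω[Q⁄k]] : ∃ m, ∀ N ≥ m, ⋀[Q]^N Ω[Q⁄k] = ⊥ := by
  classical
  obtain ⟨s, hs⟩ := Module.Finite.fg_top (R := Q) (M := Ω[Q⁄k])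
  refine ⟨s.card + 1, fun N hN => ?_⟩
  rw [← exteriorPower.ιMulti_span_fixedDegree_of_span_eq_top Q N Ω[Q⁄k] hs, Submodule.span_eq_bot]
  rintro _ ⟨a, ha, rfl⟩
  refine ExteriorAlgebra.ιMulti_eq_zero_of_not_inj fun hi => ?_
  have : N ≤ s.card := by
    have h1 := Finset.card_image_of_injective Finset.univ hi
    rw [Finset.card_univ, Fintype.card_fin] at h1
    rw [← h1]
    exact Finset.card_le_card fun x hx => by
      obtain ⟨i, -, rfl⟩ := Finset.mem_image.1 hx
      exact ha ⟨i, rfl⟩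
  omega

variable (k Q) in
/-- An integer such that all the differential forms of larger or equal degree vanish. -/
noncomputable def bound [Module.Finite Q Ω[Q⁄k]] : ℕ := (exists_bound k Q).choose

theorem eq_zero [Module.Finite Q Ω[Q⁄k]] {N : ℕ} (hN : bound k Q ≤ N) {ω : Forms k Q}
    (h : ω ∈ ⋀[Q]^N Ω[Q⁄k]) : ω = 0 := by
  rwa [(exists_bound k Q).choose_spec N hN, Submodule.mem_bot] at h

end Forms

namespace MF

variable {X Y Z : MF k Q f}

/-- The map `Ω^• ⊗ P → Ω^•` given by a linear form on `P`. -/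
noncomputable def ctr (φ : X.P →ₗ[Q] Q) : X.V →ₗ[Q] Forms k Q :=
  (TensorProduct.rid Q (Forms k Q)).toLinearMap ∘ₗ φ.lTensor (Forms k Q)

theorem ctr_tmul (φ : X.P →ₗ[Q] Q) (ω : Forms k Q) (p : X.P) : ctr φ (ω ⊗ₜ p) = φ p • ω := by
  simp [ctr]

theorem ctr_lw (φ : X.P →ₗ[Q] Q) (ω : Forms k Q) (v : X.V) : ctr φ (X.lw ω v) = ω * ctr φ v := by
  induction v using TensorProduct.induction_on with
  | zero => simp
  | add x y hx hy => simp only [map_add, hx, hy, mul_add]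
  | tmul η p => rw [lw_tmul, ctr_tmul, ctr_tmul, mul_smul_comm]

theorem ctr_lTensor (φ : Y.P →ₗ[Q] Q) (a : X.P →ₗ[Q] Y.P) (v : X.V) :
    ctr φ (a.lTensor (Forms k Q) v) = ctr (φ ∘ₗ a) v := by
  induction v using TensorProduct.induction_on with
  | zero => simp
  | add x y hx hy => simp only [map_add, hx, hy]
  | tmul η p => rw [LinearMap.lTensor_tmul, ctr_tmul, ctr_tmul]; rfl

theorem ctr_sum_smul {ι : Type*} (s : Finset ι) (q : ι → Q) (φ : ι → (X.P →ₗ[Q] Q)) (v : X.V) :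
    ctr (∑ i ∈ s, q i • φ i) v = ∑ i ∈ s, q i • ctr (φ i) v := by
  induction v using TensorProduct.induction_on with
  | zero => simp
  | add x y hx hy => simp only [map_add, hx, hy, smul_add, Finset.sum_add_distrib]
  | tmul η p =>
    simp only [ctr_tmul, LinearMap.sum_apply, LinearMap.smul_apply, Finset.sum_smul, smul_smul,
      smul_eq_mul]

variable (X) in
/-- The size of a chosen dual basis of `P`. -/
noncomputable def dualN : ℕ := (exists_dualBasis (A := Q) (M := X.P)).choose

variable (X) in
/-- The generators in a chosen dual basis of `P`. -/
noncomputable def dualE : Fin X.dualN → X.P :=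
  (exists_dualBasis (A := Q) (M := X.P)).choose_spec.choose

variable (X) in
/-- The linear forms in a chosen dual basis of `P`. -/
noncomputable def dualF : Fin X.dualN → (X.P →ₗ[Q] Q) :=
  (exists_dualBasis (A := Q) (M := X.P)).choose_spec.choose_spec.choose

theorem dual_sum (x : X.P) : ∑ i, X.dualF i x • X.dualE i = x :=
  (exists_dualBasis (A := Q) (M := X.P)).choose_spec.choose_spec.choose_spec x

/-- The trace `Hom(P, Ω^• ⊗ P) ≅ Ω^• ⊗ P ⊗ P^* → Ω^•`. -/
noncomputable def tr (Ψ : X.P →ₗ[Q] X.V) : Forms k Q := ∑ i, ctr (X.dualF i) (Ψ (X.dualE i))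

theorem tr_comm (Ψ : Y.P →ₗ[Q] X.V) (a : X.P →ₗ[Q] Y.P) :
    tr (Ψ ∘ₗ a) = tr (a.lTensor (Forms k Q) ∘ₗ Ψ) := by
  have h1 : ∀ i, ctr (X.dualF i) ((Ψ ∘ₗ a) (X.dualE i)) =
      ∑ j, Y.dualF j (a (X.dualE i)) • ctr (X.dualF i) (Ψ (Y.dualE j)) := fun i => by
    rw [LinearMap.comp_apply]
    nth_rewrite 1 [← dual_sum (a (X.dualE i))]
    rw [map_sum, map_sum]
    simp only [map_smul]
  have h2 : ∀ j, ctr (Y.dualF j) ((a.lTensor (Forms k Q) ∘ₗ Ψ) (Y.dualE j)) =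
      ∑ i, Y.dualF j (a (X.dualE i)) • ctr (X.dualF i) (Ψ (Y.dualE j)) := fun j => by
    have e : Y.dualF j ∘ₗ a = ∑ i, Y.dualF j (a (X.dualE i)) • X.dualF i := LinearMap.ext fun x => by
      rw [LinearMap.comp_apply]
      nth_rewrite 1 [← dual_sum x]
      rw [map_sum, map_sum, LinearMap.sum_apply]
      simp only [map_smul, LinearMap.smul_apply, smul_eq_mul, mul_comm]
    rw [LinearMap.comp_apply, ctr_lTensor, e, ctr_sum_smul]
  unfold tr
  simp only [h1, h2]
  exact Finset.sum_comm

variable (X) in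
/-- The supertrace of an operator on `Ω^• ⊗ P`. -/
noncomputable def str : (X.V →ₗ[Q] X.V) →ₗ[Q] Forms k Q where
  toFun Φ := tr (Φ ∘ₗ X.incl ∘ₗ X.par)
  map_add' Φ Ψ := by
    simp only [tr, LinearMap.comp_apply, LinearMap.add_apply, map_add, Finset.sum_add_distrib]
  map_smul' q Φ := by
    simp only [tr, LinearMap.comp_apply, LinearMap.smul_apply, map_smul, Finset.smul_sum,
      RingHom.id_apply]

theorem str_apply (Φ : X.V →ₗ[Q] X.V) : X.str Φ = tr (Φ ∘ₗ X.incl ∘ₗ X.par) := rfl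

theorem str_lw (ω : Forms k Q) (Φ : X.V →ₗ[Q] X.V) : X.str (X.lw ω ∘ₗ Φ) = ω * X.str Φ := by
  simp only [str_apply, tr, LinearMap.comp_apply, ctr_lw, Finset.mul_sum]

theorem vpar_incl (p : X.P) : X.vpar (X.incl p) = X.incl (X.par p) := by
  rw [incl_apply, incl_apply, vpar_tmul, Forms.sgn_one_eq]

theorem ctr_sgn (φ : X.P →ₗ[Q] Q) (v : X.V) :
    ctr φ (Forms.sgn.rTensor X.P v) = Forms.sgn (ctr φ v) := by
  induction v using TensorProduct.induction_on with
  | zero => simp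
  | add x y hx hy => simp only [map_add, hx, hy]
  | tmul η p => rw [LinearMap.rTensor_tmul, ctr_tmul, ctr_tmul, map_smul]

theorem vpar_eq (v : X.V) : X.vpar v = Forms.sgn.rTensor X.P (X.par.lTensor (Forms k Q) v) := by
  induction v using TensorProduct.induction_on with
  | zero => simp
  | add x y hx hy => simp only [map_add, hx, hy]
  | tmul η p => rfl

theorem tr_sgn (Ψ : X.P →ₗ[Q] X.V) : tr (Forms.sgn.rTensor X.P ∘ₗ Ψ) = Forms.sgn (tr Ψ) := by
  simp only [tr, LinearMap.comp_apply, ctr_sgn, map_sum]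

theorem str_opar (Φ : X.V →ₗ[Q] X.V) : X.str (opar X X Φ) = Forms.sgn (X.str Φ) := by
  have h : opar X X Φ ∘ₗ X.incl ∘ₗ X.par = Forms.sgn.rTensor X.P ∘ₗ
      X.par.lTensor (Forms k Q) ∘ₗ Φ ∘ₗ X.incl := LinearMap.ext fun p => by
    simp only [LinearMap.comp_apply, opar_apply, vpar_incl, X.par_par]
    exact vpar_eq _
  rw [str_apply, h, tr_sgn, ← tr_comm]
  rfl

section

variable [CharZero k]

/-- The supertrace of a supercommutator vanishes. -/
theorem str_comm (Φ : Y.V →ₗ[Q] X.V) (b : X.P →ₗ[Q] Y.P) : X.str (Φ ∘ₗ hat X Y b) =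
    Y.str (hat X Y (hod X Y b) ∘ₗ opar Y X Φ + hat X Y (hev X Y b) ∘ₗ Φ) := by
  have h1 : (Φ ∘ₗ hat X Y b) ∘ₗ X.incl ∘ₗ X.par = (Φ ∘ₗ Y.incl) ∘ₗ b ∘ₗ X.par :=
    LinearMap.ext fun p => by
      simp only [LinearMap.comp_apply, incl_apply, hat_one_tmul]
  have hpc : ∀ x, Y.par (hev X Y b x) = hev X Y b (X.par x) := par_hev b
  have h2 : (hat X Y (hod X Y b) ∘ₗ opar Y X Φ) ∘ₗ Y.incl ∘ₗ Y.par =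
      (hod X Y b ∘ₗ X.par).lTensor (Forms k Q) ∘ₗ Φ ∘ₗ Y.incl := LinearMap.ext fun p => by
    simp only [LinearMap.comp_apply, opar_apply, vpar_incl, Y.par_par]
    generalize Φ (Y.incl p) = v
    induction v using TensorProduct.induction_on with
    | zero => simp
    | add x y hx hy => simp only [map_add, hx, hy]
    | tmul η p => simp [hat_tmul, hev_hod, hod_hod]
  have h3 : (hat X Y (hev X Y b) ∘ₗ Φ) ∘ₗ Y.incl ∘ₗ Y.par =
      ((hev X Y b).lTensor (Forms k Q) ∘ₗ Φ ∘ₗ Y.incl) ∘ₗ Y.par := LinearMap.ext fun p => by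
    simp only [LinearMap.comp_apply]
    generalize Φ (Y.incl (Y.par p)) = v
    induction v using TensorProduct.induction_on with
    | zero => simp
    | add x y hx hy => simp only [map_add, hx, hy]
    | tmul η p => simp [hat_tmul, hev_hev, hod_hev]
  have h4 : Y.par ∘ₗ hev X Y b = hev X Y b ∘ₗ X.par := LinearMap.ext hpc
  have h5 : b ∘ₗ X.par = hod X Y b ∘ₗ X.par + hev X Y b ∘ₗ X.par := by
    rw [← LinearMap.add_comp, add_comm, hev_add_hod]
  have h6 : Y.par.lTensor (Forms k Q) ∘ₗ (hev X Y b).lTensor (Forms k Q) ∘ₗ Φ ∘ₗ Y.incl =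
      (Y.par ∘ₗ hev X Y b).lTensor (Forms k Q) ∘ₗ Φ ∘ₗ Y.incl := by
    rw [LinearMap.lTensor_comp]; rfl
  have tr_add : ∀ Ψ Ψ' : X.P →ₗ[Q] X.V, tr (Ψ + Ψ') = tr Ψ + tr Ψ' := fun Ψ Ψ' => by
    simp only [tr, LinearMap.add_apply, map_add, Finset.sum_add_distrib]
  rw [map_add, str_apply, str_apply, str_apply, h1, h2, h3, tr_comm (X := Y) (Y := Y),
    h6, h4, h5, LinearMap.comp_add, tr_add, tr_comm, tr_comm]

end

end MF

end Supertrace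

section HKR

open KaehlerDifferential DGCat

variable {k Q : Type u} [Field k] [CharZero k] [CommRing Q] [Algebra k Q] {f : Q}

namespace MF

section Degree

variable {X Y Z : MF k Q f}

variable (X) in
/-- The forms of degree `N` with coefficients in `P`. -/
noncomputable def degV (N : ℕ) : Submodule Q X.V :=
  Submodule.span Q {v | ∃ ω ∈ ⋀[Q]^N Ω[Q⁄k], ∃ p : X.P, ω ⊗ₜ[Q] p = v}

/-- The operator `Φ` raises the degree of forms by `n`. -/
def Raises (n : ℕ) (Φ : X.V →ₗ[Q] Y.V) : Prop := ∀ M, ∀ v ∈ X.degV M, Φ v ∈ Y.degV (M + n)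

theorem raises_of {n : ℕ} {Φ : X.V →ₗ[Q] Y.V}
    (h : ∀ M, ∀ ω ∈ ⋀[Q]^M Ω[Q⁄k], ∀ p : X.P, Φ (ω ⊗ₜ p) ∈ Y.degV (M + n)) : Raises n Φ := by
  intro M v hv
  induction hv using Submodule.span_induction with
  | mem x hx => obtain ⟨ω, hω, p, rfl⟩ := hx; exact h M ω hω p
  | zero => rw [map_zero]; exact Submodule.zero_mem _
  | add x y _ _ hx hy => rw [map_add]; exact Submodule.add_mem _ hx hy
  | smul q x _ hx => rw [map_smul]; exact Submodule.smul_mem _ _ hx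

theorem tmul_mem {N : ℕ} {ω : Forms k Q} (h : ω ∈ ⋀[Q]^N Ω[Q⁄k]) (p : X.P) :
    (ω ⊗ₜ[Q] p : X.V) ∈ X.degV N := Submodule.subset_span ⟨ω, h, p, rfl⟩

theorem Raises.comp {m n : ℕ} {Φ : Y.V →ₗ[Q] Z.V} {Ψ : X.V →ₗ[Q] Y.V} (h : Raises m Φ)
    (h' : Raises n Ψ) : Raises (n + m) (Φ ∘ₗ Ψ) := fun M v hv => by
  rw [← add_assoc]; exact h _ _ (h' _ _ hv)

theorem Raises.add {n : ℕ} {Φ Ψ : X.V →ₗ[Q] Y.V} (h : Raises n Φ)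
    (h' : Raises n Ψ) : Raises n (Φ + Ψ) := fun _ _ hv => Submodule.add_mem _ (h _ _ hv) (h' _ _ hv)

theorem Raises.zero {n : ℕ} : Raises n (0 : X.V →ₗ[Q] Y.V) := fun _ _ _ => Submodule.zero_mem _

theorem raises_hat (a : X.P →ₗ[Q] Y.P) : Raises 0 (hat X Y a) := raises_of fun _ _ hω _ =>
  Submodule.add_mem _ (tmul_mem hω _) (tmul_mem (Forms.sgn_mem hω) _)

theorem lw_mem {M N : ℕ} {ω : Forms k Q} (hω : ω ∈ ⋀[Q]^M Ω[Q⁄k]) {v : X.V} (hv : v ∈ X.degV N) :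
    X.lw ω v ∈ X.degV (M + N) := by
  induction hv using Submodule.span_induction with
  | mem x hx => obtain ⟨η, hη, p, rfl⟩ := hx; exact tmul_mem (Forms.mul_mem hω hη) p
  | zero => rw [map_zero]; exact Submodule.zero_mem _
  | add x y _ _ hx hy => rw [map_add]; exact Submodule.add_mem _ hx hy
  | smul q x _ hx => rw [map_smul]; exact Submodule.smul_mem _ _ hx

variable (cX : X.Connection) (cY : Y.Connection) (cZ : Z.Connection)

theorem deriv_mem (a : X.P →ₗ[Q] Y.P) (p : X.P) : deriv cX cY a p ∈ Y.degV 1 := by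
  change Forms.one.rTensor Y.P (deriv1 cX cY a p) ∈ _
  generalize deriv1 cX cY a p = t
  induction t using TensorProduct.induction_on with
  | zero => rw [map_zero]; exact Submodule.zero_mem _
  | add x y hx hy => rw [map_add]; exact Submodule.add_mem _ hx hy
  | tmul η p => exact tmul_mem (Forms.one_mem η) p

theorem raises_prime (a : X.P →ₗ[Q] Y.P) : Raises 1 (prime cX cY a) := raises_of fun _ _ hω _ =>
  Submodule.add_mem _ (lw_mem hω (deriv_mem _ _ _ _)) (lw_mem (Forms.sgn_mem hω) (deriv_mem _ _ _ _))

theorem raises_S : Raises 1 (S cX) := fun M v hv =>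
  Submodule.neg_mem _ (raises_prime cX cX X.δ M v hv)

theorem raises_app {G : ℕ → (Z.V →ₗ[Q] X.V)} (h : ∀ N, Raises N (G N)) (a : Y.P →ₗ[Q] Z.P) (N : ℕ) :
    Raises N (app cY cZ G a N) := by
  induction N with
  | zero => exact Raises.zero
  | succ N ih =>
    rw [app_succ]
    exact Raises.add (add_comm N 1 ▸ (h N).comp (raises_prime _ _ _))
      (add_comm N 1 ▸ ih.comp (raises_S _))

theorem ctr_mem (φ : X.P →ₗ[Q] Q) {N : ℕ} {v : X.V} (hv : v ∈ X.degV N) :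
    ctr φ v ∈ ⋀[Q]^N Ω[Q⁄k] := by
  induction hv using Submodule.span_induction with
  | mem x hx => obtain ⟨η, hη, p, rfl⟩ := hx; rw [ctr_tmul]; exact Submodule.smul_mem _ _ hη
  | zero => rw [map_zero]; exact Submodule.zero_mem _
  | add x y _ _ hx hy => rw [map_add]; exact Submodule.add_mem _ hx hy
  | smul q x _ hx => rw [map_smul]; exact Submodule.smul_mem _ _ hx

theorem str_mem {N : ℕ} {Φ : X.V →ₗ[Q] X.V} (h : Raises N Φ) : X.str Φ ∈ ⋀[Q]^N Ω[Q⁄k] := by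
  rw [str_apply, tr]
  refine Submodule.sum_mem _ fun i _ => ctr_mem (X.dualF i) ?_
  have h1 : (1 : Forms k Q) ∈ ⋀[Q]^0 Ω[Q⁄k] := by
    rw [ExteriorAlgebra.exteriorPower, pow_zero]; exact Submodule.one_le.mp le_rfl
  have := h 0 _ (tmul_mem (X := X) h1 (X.par (X.dualE i)))
  rwa [zero_add] at this

end Degree

variable {Z : Set (PrimeSpectrum Q)} (c : ∀ X : MF k Q f, X.Connection)

variable {X Y : (dg k Q f Z).Obj}

theorem raises_word (x : (dg k Q f Z).Word X Y) (N : ℕ) : Raises N (word c Y x N) := by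
  refine word_induction (p := fun (Y : (dg k Q f Z).Obj) x => ∀ N, Raises N (word c Y x N)) x
    (fun Y a N => ?_) (fun Y Z' x a h N => ?_) (fun Y N => ?_) (fun Y x y hx hy N => ?_) N
  · induction N with
    | zero => exact (word_base_zero c a).symm ▸ raises_hat a
    | succ N ih =>
      exact (word_base_succ c a N).symm ▸ (add_comm N 1 ▸ ih.comp (raises_S _) :
        Raises (N + 1) (word c Y (base (C := dg k Q f Z) a) N ∘ₗ S (c Y.1)))
  · exact (congrFun (word_snoc c x a) N).symm ▸ raises_app _ _ h _ _
  · rw [map_zero]; exact Raises.zero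
  · rw [map_add]; exact (hx N).add (hy N)

/-- The term of degree `N` of the HKR map. -/
noncomputable def hkrTerm (N : ℕ) (X : (dg k Q f Z).Obj) :
    (dg k Q f Z).Word X X →ₗ[Q] Forms k Q :=
  algebraMap k Q ((N.factorial : k)⁻¹) • (X.1.str ∘ₗ LinearMap.proj N ∘ₗ word c X)

theorem hkrTerm_apply (N : ℕ) (x : (dg k Q f Z).Word X X) :
    hkrTerm c N X x = algebraMap k Q ((N.factorial : k)⁻¹) • X.1.str (word c X x N) := rfl

variable [Module.Finite Q Ω[Q⁄k]]

theorem str_word_eq_zero (N : ℕ) (hN : Forms.bound k Q ≤ N) (x : (dg k Q f Z).Word X X) :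
    X.1.str (word c X x N) = 0 := Forms.eq_zero hN (str_mem (raises_word c x N))

/-- The terms of large degree of the HKR map vanish. -/
theorem hkrTerm_eq_zero (N : ℕ) (hN : Forms.bound k Q ≤ N) (x : (dg k Q f Z).Word X X) :
    hkrTerm c N X x = 0 := by
  rw [hkrTerm_apply, str_word_eq_zero c N hN, smul_zero]

variable (Z) in
/-- The linear map underlying the HKR map:
`α₀[α₁|…|αₙ] ↦ ∑_{i₀, …, iₙ} (-1)^(i₀ + ⋯ + iₙ) / (n + i₀ + ⋯ + iₙ)!
  str (α₀ (δ₁')^i₀ α₁' ⋯ (δₙ')^iₙ₋₁ αₙ' (δ₀')^iₙ)`. -/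
noncomputable def hkrLin : (dg k Q f Z).HHSpace →ₗ[Q] Forms k Q :=
  hhLift fun X => ∑ N ∈ Finset.range (Forms.bound k Q), hkrTerm c N X

theorem hkrLin_close (x : (dg k Q f Z).Word X X) : hkrLin Z c (close X x) =
    ∑ N ∈ Finset.range (Forms.bound k Q), hkrTerm c N X x := by
  unfold hkrLin
  rw [hhLift_close, LinearMap.sum_apply]

theorem hkrLin_par (x : (dg k Q f Z).HHSpace) :
    hkrLin Z c (hhPar _ x) = Forms.sgn (hkrLin Z c x) := by
  refine hh_induction (p := fun x => hkrLin Z c (hhPar _ x) = Forms.sgn (hkrLin Z c x)) x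
    (fun X x => ?_) (by simp) (fun x y hx hy => by simp only [map_add, hx, hy])
  rw [hhPar_close, hkrLin_close, hkrLin_close, map_sum]
  refine Finset.sum_congr rfl fun N _ => ?_
  rw [hkrTerm_apply, hkrTerm_apply, word_wpar, str_opar, map_smul]

theorem word_lmul {W : (dg k Q f Z).Obj} (a : (dg k Q f Z).Hom X W) (x : (dg k Q f Z).Word X Y)
    (N : ℕ) : word c Y (lmul a Y x) N = hat X.1 W.1 a ∘ₗ word c Y x N := by
  refine word_induction (p := fun (Y : (dg k Q f Z).Obj) x => ∀ N,
    word c Y (lmul a Y x) N = hat X.1 W.1 a ∘ₗ word c Y x N) x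
    (fun Y b N => ?_) (fun Y Z' x b h N => ?_) (fun Y N => ?_) (fun Y x y hx hy N => ?_) N
  · rw [lmul_base]
    induction N with
    | zero => exact (word_base_zero c _).trans ((hat_comp a b).trans
        (congrArg (fun T => hat X.1 W.1 a ∘ₗ T) (word_base_zero c b).symm))
    | succ N ih =>
      refine (word_base_succ c _ N).trans (Eq.trans ?_
        (congrArg (fun T => hat X.1 W.1 a ∘ₗ T) (word_base_succ c b N).symm))
      exact (congrArg (fun T => T ∘ₗ S (c Y.1)) ih).trans (LinearMap.comp_assoc _ _ _)
  · rw [lmul_snoc]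
    refine (congrFun (word_snoc c _ b) N).trans (Eq.trans ?_
        (congrArg (fun T => hat X.1 W.1 a ∘ₗ T) (congrFun (word_snoc c x b) N).symm))
    induction N with
    | zero => exact (LinearMap.comp_zero _).symm
    | succ N ih =>
      refine (app_succ (c Y.1) (c Z'.1) _ b N).trans (Eq.trans ?_
        (congrArg (fun T => hat X.1 W.1 a ∘ₗ T) (app_succ (c Y.1) (c Z'.1) _ b N).symm))
      refine (congrArg₂ (fun T T' => T ∘ₗ prime (c Y.1) (c Z'.1) b + T' ∘ₗ S (c Y.1)) (h N)
        ih).trans ?_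
      rw [LinearMap.comp_add]; rfl
  · rw [map_zero, map_zero]; exact (LinearMap.comp_zero _).symm
  · rw [map_add, map_add, map_add, Pi.add_apply, hx, hy]
    exact (LinearMap.comp_add _ _ _).symm

theorem str_δ {X : MF k Q f} (B : X.V →ₗ[Q] X.V) :
    X.str (hat X X X.δ ∘ₗ B) = X.str (opar X X B ∘ₗ hat X X X.δ) := by
  have h1 : hod X X X.δ = X.δ := DGCat.od_of_par_neg (C := dg k Q f Set.univ)
    (X := ⟨X, Set.subset_univ _⟩) (Y := ⟨X, Set.subset_univ _⟩) (hpar_δ X)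
  have h2 : hev X X X.δ = 0 := DGCat.ev_of_par_neg (C := dg k Q f Set.univ)
    (X := ⟨X, Set.subset_univ _⟩) (Y := ⟨X, Set.subset_univ _⟩) (hpar_δ X)
  rw [str_comm, h1, h2, opar_opar, map_zero, LinearMap.zero_comp]
  congr 1
  module

theorem str_sub {X : MF k Q f} (Φ Ψ : X.V →ₗ[Q] X.V) : X.str (Φ - Ψ) = X.str Φ - X.str Ψ := by
  simp only [str_apply, tr, LinearMap.comp_apply, LinearMap.sub_apply, map_sub,
    Finset.sum_sub_distrib]

theorem str_idn {X : MF k Q f} {B dB R : ℕ → (X.V →ₗ[Q] X.V)} (h : Idn B dB R) (N : ℕ) :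
    X.str (dB N) = -((N : Q) • (Forms.one (D k Q f) * X.str (B (N - 1)))) + X.str (R N) := by
  rw [h N, map_add, str_sub, str_sub, str_δ, map_smul, str_lw]
  abel

theorem hkrTerm_cyc (x : (dg k Q f Z).Word X Y) (a : (dg k Q f Z).Hom X Y) (N : ℕ) :
    hkrTerm c N Y (cyc x a) =
      algebraMap k Q ((N.factorial : k)⁻¹) • X.1.str (rem c X (snoc x a) N) := by
  have e : word c Y (cyc x a) N = hat X.1 Y.1 (hod X.1 Y.1 a) ∘ₗ opar Y.1 X.1
      (opar Y.1 X.1 (word c Y x N)) + hat X.1 Y.1 (hev X.1 Y.1 a) ∘ₗ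
        (opar Y.1 X.1 (word c Y x N)) := by
    rw [cyc_apply, map_add, Pi.add_apply, word_lmul, word_lmul, word_wpar, opar_opar]
    rfl
  have e2 : rem c X (snoc x a) N = opar Y.1 X.1 (word c Y x N) ∘ₗ hat X.1 Y.1 a :=
    congrFun (rem_snoc c x a) N
  rw [hkrTerm_apply, e, e2]
  exact congrArg _ (str_comm _ _).symm

theorem hkrLin_wrap (x : (dg k Q f Z).Word X X) : hkrLin Z c (wrap X x) =
    -∑ N ∈ Finset.range (Forms.bound k Q),
      algebraMap k Q ((N.factorial : k)⁻¹) • X.1.str (rem c X x N) := by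
  refine word_cases (p := fun x => hkrLin Z c (wrap X x) =
    -∑ N ∈ Finset.range (Forms.bound k Q),
      algebraMap k Q ((N.factorial : k)⁻¹) • X.1.str (rem c X x N)) x (fun a => ?_)
    (fun Z' x a => ?_) ?_ (fun x y hx hy => ?_)
  · have e : rem c X (base a) = 0 := rem_base c a
    rw [wrap_base, map_zero, e]
    simp
  · rw [wrap_snoc, map_neg, hkrLin_close]
    simp only [hkrTerm_cyc]
  · simp
  · simp only [map_add, hx, hy, Pi.add_apply, smul_add, Finset.sum_add_distrib]
    abel

theorem hkrTerm_wd (x : (dg k Q f Z).Word X X) (N : ℕ) : hkrTerm c N X (wd X x) =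
    -(if N = 0 then 0 else Forms.one (D k Q f) * hkrTerm c (N - 1) X x) +
      algebraMap k Q ((N.factorial : k)⁻¹) • X.1.str (rem c X x N) := by
  rw [hkrTerm_apply, str_idn (word_wd c x), smul_add, smul_neg]
  congr 2
  cases N with
  | zero => simp
  | succ N =>
    have e : algebraMap k Q (((N + 1).factorial : k)⁻¹) * ((N + 1 : ℕ) : Q) =
        algebraMap k Q ((N.factorial : k)⁻¹) := by
      rw [← map_natCast (algebraMap k Q), ← map_mul, Nat.factorial_succ]
      congr 1
      have h1 : ((N + 1 : ℕ) : k) ≠ 0 := Nat.cast_ne_zero.2 (Nat.succ_ne_zero N)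
      have h2 : (N.factorial : k) ≠ 0 := Nat.cast_ne_zero.2 (Nat.factorial_ne_zero N)
      rw [Nat.cast_mul]
      field_simp
    rw [smul_smul, e, if_neg (Nat.succ_ne_zero N), Nat.add_sub_cancel, hkrTerm_apply,
      mul_smul_comm]

theorem hkrLin_d (x : (dg k Q f Z).HHSpace) :
    hkrLin Z c (hhD _ x) = -(Forms.one (D k Q f) * hkrLin Z c x) := by
  refine hh_induction (p := fun x => hkrLin Z c (hhD _ x) =
    -(Forms.one (D k Q f) * hkrLin Z c x)) x (fun X x => ?_) (by simp)
    (fun x y hx hy => by simp only [map_add, hx, hy, mul_add]; abel)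
  have key : ∀ m, ∑ N ∈ Finset.range m, (if N = 0 then 0 else
      Forms.one (D k Q f) * hkrTerm c (N - 1) X x) =
      ∑ N ∈ Finset.range (m - 1), Forms.one (D k Q f) * hkrTerm c N X x := by
    intro m
    cases m with
    | zero => simp
    | succ m => rw [Finset.sum_range_succ']; simp
  have key2 : ∑ N ∈ Finset.range (Forms.bound k Q - 1), Forms.one (D k Q f) * hkrTerm c N X x =
      ∑ N ∈ Finset.range (Forms.bound k Q), Forms.one (D k Q f) * hkrTerm c N X x := by
    generalize hm : Forms.bound k Q = m
    cases m with
    | zero => simp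
    | succ m =>
      rw [Nat.add_sub_cancel, Finset.sum_range_succ]
      have h : Forms.one (D k Q f) * X.1.str (word c X x m) = 0 :=
        Forms.eq_zero (N := 1 + m) (by omega)
          (Forms.mul_mem (Forms.one_mem _) (str_mem (raises_word c x m)))
      rw [hkrTerm_apply, mul_smul_comm, h, smul_zero, add_zero]
  rw [hhD_close, map_add, hkrLin_wrap, hkrLin_close, hkrLin_close, Finset.mul_sum, ← key2, ← key]
  simp only [hkrTerm_wd, Finset.sum_add_distrib, Finset.sum_neg_distrib]
  abel

/-- The HKR map `HH(mf^Z(Q, f)) → (Ω^•, -df)`, for a choice of connections. -/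
noncomputable def hkr (Z : Set (PrimeSpectrum Q)) (c : ∀ X : MF k Q f, X.Connection) :
    HH (dg k Q f Z) ⟶ Forms.cpx k f where
  toLin := ULift.moduleEquiv.symm.toLinearMap ∘ₗ hkrLin Z c
  map_par x := congrArg ULift.up (hkrLin_par c x)
  map_d x := congrArg ULift.up ((hkrLin_d c x).trans rfl)

end MF
end HKR

section Wedge

open KaehlerDifferential

variable {k Q R T : Type u} [Field k] [CommRing Q] [Algebra k Q] [CommRing R] [Algebra k R]
  [CommRing T] [Algebra k T]

namespace Forms

/-- The map on differential forms induced by a homomorphism of algebras. -/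
noncomputable def map (φ : Q →ₐ[k] T) : Forms k Q →ₐ[k] Forms k T :=
  letI := φ.toRingHom.toAlgebra
  haveI : IsScalarTower k Q T := .of_algebraMap_eq' φ.comp_algebraMap.symm
  (ExteriorAlgebra.lift Q ⟨(one (k := k) (Q := T)).restrictScalars Q ∘ₗ KaehlerDifferential.map k k Q T,
    fun _ => one_mul_one _⟩).restrictScalars k

theorem map_algebraMap (φ : Q →ₐ[k] T) (q : Q) :
    map φ (algebraMap Q (Forms k Q) q) = algebraMap T (Forms k T) (φ q) := by
  let _ := φ.toRingHom.toAlgebra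
  have : IsScalarTower k Q T := .of_algebraMap_eq' φ.comp_algebraMap.symm
  exact AlgHom.commutes (ExteriorAlgebra.lift Q
    ⟨(one (k := k) (Q := T)).restrictScalars Q ∘ₗ KaehlerDifferential.map k k Q T,
    fun _ => one_mul_one _⟩) q

theorem map_smul (φ : Q →ₐ[k] T) (q : Q) (ω : Forms k Q) : map φ (q • ω) = φ q • map φ ω := by
  rw [Algebra.smul_def, map_mul, map_algebraMap, ← Algebra.smul_def]

theorem map_one_eq (φ : Q →ₐ[k] T) (η : Ω[Q⁄k]) : ∃ ζ : Ω[T⁄k], map φ (one η) = one ζ := by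
  let _ := φ.toRingHom.toAlgebra
  have : IsScalarTower k Q T := .of_algebraMap_eq' φ.comp_algebraMap.symm
  exact ⟨KaehlerDifferential.map k k Q T η, ExteriorAlgebra.lift_ι_apply Q _ _ η⟩

theorem map_D (φ : Q →ₐ[k] T) (q : Q) : map φ (one (D k Q q)) = one (D k T (φ q)) := by
  let _ := φ.toRingHom.toAlgebra
  have : IsScalarTower k Q T := .of_algebraMap_eq' φ.comp_algebraMap.symm
  refine (ExteriorAlgebra.lift_ι_apply Q _ _ (D k Q q)).trans ?_
  exact congrArg one (KaehlerDifferential.map_D k k Q T q)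

theorem map_sgn (φ : Q →ₐ[k] T) (ω : Forms k Q) : map φ (sgn ω) = sgn (map φ ω) := by
  induction ω using induction_left with
  | h1 q =>
    have h : ∀ {A : Type u} [CommRing A] [Algebra k A] (a : A),
        sgn (algebraMap A (Forms k A) a) = algebraMap A (Forms k A) a := fun a =>
      AlgHom.commutes CliffordAlgebra.involute a
    rw [h, map_algebraMap, h]
  | hm η x hx =>
    obtain ⟨ζ, hζ⟩ := map_one_eq φ η
    rw [sgn_mul, map_mul, map_mul, sgn_mul, hx, sgn_one, map_neg, hζ, sgn_one]
  | ha x y hx hy => simp only [map_add, hx, hy]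

theorem one_mul_comm (η : Ω[Q⁄k]) (ω : Forms k Q) : one η * ω = sgn ω * one η := by
  induction ω using induction_left with
  | h1 q =>
    have h : sgn (algebraMap Q (Forms k Q) q) = algebraMap Q (Forms k Q) q :=
      AlgHom.commutes CliffordAlgebra.involute q
    rw [h, Algebra.commutes]
  | hm ζ x hx =>
    rw [sgn_mul, sgn_one, mul_assoc, ← hx, ← mul_assoc, one_mul_one_add, neg_mul, neg_mul, mul_assoc]
  | ha x y hx hy => simp only [map_add, hx, hy, add_mul, mul_add]

/-- The exterior product `ω ⊗ η ↦ ω ∧ η` of the forms on `Q` and on `R`. -/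
noncomputable def mulLin (k Q R : Type u) [Field k] [CommRing Q] [Algebra k Q] [CommRing R]
    [Algebra k R] : ULift.{u + 1, u} (Forms k Q) →ₗ[k] ULift.{u + 1, u} (Forms k R) →ₗ[k]
      ULift.{u + 1, u} (Forms k (Q ⊗[k] R)) :=
  LinearMap.mk₂ k (fun ω η => ULift.up
      (map Algebra.TensorProduct.includeLeft ω.down * map Algebra.TensorProduct.includeRight η.down))
    (fun _ _ _ => by ext; simp [add_mul])
    (fun _ _ _ => by ext; simp)
    (fun _ _ _ => by ext; simp [mul_add])
    (fun _ _ _ => by ext; simp)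

theorem mul_d (f : Q) (g : R) (ω : Forms k Q) (η : Forms k R) :
    -(one (D k (Q ⊗[k] R) (f ⊗ₜ[k] (1 : R) + (1 : Q) ⊗ₜ[k] g)) *
      (map Algebra.TensorProduct.includeLeft ω * map Algebra.TensorProduct.includeRight η)) =
    map Algebra.TensorProduct.includeLeft (-(one (D k Q f) * ω)) *
        map Algebra.TensorProduct.includeRight η +
      map Algebra.TensorProduct.includeLeft (sgn ω) *
        map Algebra.TensorProduct.includeRight (-(one (D k R g) * η)) := by
  rw [map_neg, map_neg, map_mul, map_mul, map_D, map_D, map_sgn, map_add, map_add, add_mul,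
    Algebra.TensorProduct.includeLeft_apply, Algebra.TensorProduct.includeRight_apply, mul_neg,
    ← mul_assoc (sgn _), ← one_mul_comm, neg_mul, neg_add, ← mul_assoc, ← mul_assoc]

variable (k) in
/-- The multiplication of forms, as a map of complexes
`(Ω^•_Q, -df) ⊗ (Ω^•_R, -dg) → (Ω^•_{Q ⊗ R}, -df - dg)`. -/
noncomputable def wedge (f : Q) (g : R) :
    (cpx k f).tensor (cpx k g) ⟶ cpx k (f ⊗ₜ[k] (1 : R) + (1 : Q) ⊗ₜ[k] g) :=
  SCpx.tensorDesc (mulLin k Q R)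
    (fun q r ω η => congrArg ULift.up (by
      change map _ (q • ω.down) * map _ (r • η.down) = (q ⊗ₜ[k] r) • (map _ ω.down * map _ η.down)
      rw [map_smul, map_smul, smul_mul_smul_comm, Algebra.TensorProduct.includeLeft_apply,
        Algebra.TensorProduct.includeRight_apply, Algebra.TensorProduct.tmul_mul_tmul, one_mul,
        mul_one]))
    (fun ω η => congrArg ULift.up (by
      change sgn (map _ ω.down * map _ η.down) = map _ (sgn ω.down) * map _ (sgn η.down)
      rw [map_sgn, map_sgn, sgn_mul]))
    (fun ω η => congrArg ULift.up (mul_d f g ω.down η.down))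

end Forms

end Wedge

section Lift

variable {k Q R : Type u} [Field k] [CommRing Q] [Algebra k Q] [CommRing R] [Algebra k R]

/-- The morphism `e : N → RΓ_Z M` of the derived category is the unique lift of `φ : N → M` along
the augmentation `RΓ_Z M → M`, where `Z = V(gs)`. -/
def IsUniqueLift (gs : List Q) {N M : SCpx k Q} (φ : (toD k Q).obj N ⟶ (toD k Q).obj M)
    (e : (toD k Q).obj N ⟶ (toD k Q).obj (RGam gs M)) : Prop :=
  e ≫ (toD k Q).map (RGamAug gs M) = φ ∧
    ∀ e' : (toD k Q).obj N ⟶ (toD k Q).obj (RGam gs M),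
      e' ≫ (toD k Q).map (RGamAug gs M) = φ → e' = e

/-- The tensor product of algebras essentially of finite type is essentially of finite type. -/
instance [Algebra.EssFiniteType k Q] [Algebra.EssFiniteType k R] :
    Algebra.EssFiniteType k (Q ⊗[k] R) :=
  Algebra.EssFiniteType.comp k Q (Q ⊗[k] R)

/-- The map `RΓ_Z (Ω^•_Q, -df) ⊗ RΓ_W (Ω^•_R, -dg) → (Ω^•_{Q ⊗ R}, -df - dg)` given by the
augmentations and the multiplication of forms. -/
noncomputable def wedgeGam (s : List Q) (t : List R) (f : Q) (g : R) :
    (RGam s (Forms.cpx k f)).tensor (RGam t (Forms.cpx k g)) ⟶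
      Forms.cpx k (f ⊗ₜ[k] (1 : R) + (1 : Q) ⊗ₜ[k] g) :=
  SCpx.tensorMap (RGamAug s (Forms.cpx k f)) (RGamAug t (Forms.cpx k g)) ≫ Forms.wedge k f g

/-- The map `HH(mf^Z(Q, f)) ⊗ HH(mf^W(R, g)) → HH(mf^(Z × W)(Q ⊗ R, f ⊗ 1 + 1 ⊗ g))`: the Künneth
map followed by the map induced by the tensor product of matrix factorizations. -/
noncomputable def starTilde [CharZero k] (f : Q) (g : R) (Z : Set (PrimeSpectrum Q))
    (W : Set (PrimeSpectrum R)) :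
    (DGCat.HH (MF.dg k Q f Z)).tensor (DGCat.HH (MF.dg k R g W)) ⟶
      DGCat.HH (MF.dg k (Q ⊗[k] R) (f ⊗ₜ[k] (1 : R) + (1 : Q) ⊗ₜ[k] g) (prodSet k Z W)) :=
  (MF.pairing Z W).kunneth

end Lift

end MFHKR

/-! Both ways round the square are morphisms of D(Q ⊗ R) from HH(mf^Z) ⊗ HH(mf^W) to a local
cohomology complex RΓ_{Z×W}. Two independent facts settle the matter: such morphisms are determined
by their composites with the augmentation, and after the augmentation the square becomes the
multiplicativity of the HKR maps without supports, which holds in the derived category.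

Supports. For one element g, the operation M ↦ (Q → Q[1/g]) ⊗ M is an endofunctor Γ of D(Q) with an
augmentation α : Γ → id, and α at ΓM agrees with Γ(α at M), by an explicit homotopy
(`toD_map_cechOneAug_cechOne`). If g acts locally nilpotently on the homology of N, then α is
invertible at N, and every N → M lifts uniquely to ΓM (`existsUnique_lift_cechOne`). Running through
the generators gives `exists_isUniqueLift`. What remains is that the sources are torsion. The
elements acting locally nilpotently on homology form a radical ideal, so only the closed set matters
and not its generators. On HH(mf^Z(Q, f)), a power of each a vanishing on Z is null-homotopic on
each object. Multiplying α₀ by such a null-homotopy contracts a power of a up to words with fewer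
letters, and the length filtration finishes the argument (`DGCat.mem_torsionIdeal_HH`). Tensor
products follow from a Künneth argument over the field k (`mem_torsionIdeal_tensor`).

Multiplicativity for product connections. Let X ⊗ Y carry the connection ∇ ⊗ 1 + 1 ⊗ ∇. Then the
derivative of its differential is the sum of δ' ⊗ 1 and 1 ⊗ δ', which commute, and (α ⊗ 1)' = α' ⊗
1, (1 ⊗ β)' = 1 ⊗ β'. Let G_N and H_N be the sums of the operators of form degree N attached to two
words x and y. The operators attached to the shuffle product x ⋆ y and the sums over i + j = N of
binom(N, i) G_i ⊗ H_j satisfy the same recursion in N. Pascal's rule distributes the rightmost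
factor between the two sides, just as the last letter of a shuffle comes from one word or the other;
hence they agree (`wordConn_sh`). The supertrace is multiplicative (`str_box`), and dividing by N!
turns binomials into 1/(i! j!), so the HKR series multiply. For these connections the square
commutes strictly, at the level of complexes.

Change of connection. The given connection on X ⊗ Y need not be the product connection, and it
depends on the object X ⊗ Y alone, whereas the product connection depends on X and Y. The remedy is
the dg-category `dgConn` of pairs (matrix factorization, connection), with one tautological HKR map;
tensor products with product connections form a bifunctor into it. The endofunctor which replaces
every connection by a chosen one is isomorphic to the identity through identity maps, and an
endofunctor isomorphic to the identity acts as the identity on Hochschild complexes in the derived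
category (`DGCat.toD_map_hhMap_eq_id`). This removes the dependence on the connections
(`MF.toD_map_starTilde_hkr`). -/

namespace MFHKR

/-! ### Homotopies, torsion in homology and the Čech functor on the derived category. -/

section Derived

variable {k Q : Type u} [Field k] [CommRing Q] [Algebra k Q]

/-! ### Homotopic morphisms -/

/-- The path complex of `N`: triples `(a, b, c)` with `d(a, b, c) = (da, db, a - b - dc)`. -/
noncomputable def SCpx.path (N : SCpx k Q) : SCpx k Q where
  carrier := N.carrier × N.carrier × N.carrier
  par := N.par.prodMap (N.par.prodMap (-N.par))
  d := LinearMap.prod (N.d ∘ₗ LinearMap.fst Q _ _)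
    (LinearMap.prod (N.d ∘ₗ LinearMap.fst Q _ _ ∘ₗ LinearMap.snd Q _ _)
      (LinearMap.fst Q _ _ - LinearMap.fst Q _ _ ∘ₗ LinearMap.snd Q _ _ -
        N.d ∘ₗ LinearMap.snd Q _ _ ∘ₗ LinearMap.snd Q _ _))
  par_par x := by simp
  d_par x := by
    change (N.d (N.par x.1), N.d (N.par x.2.1), N.par x.1 - N.par x.2.1 - N.d (-N.par x.2.2)) =
      (-N.par (N.d x.1), -N.par (N.d x.2.1), - -N.par (x.1 - x.2.1 - N.d x.2.2))
    rw [map_neg, N.d_par, N.d_par, N.d_par, map_sub, map_sub, neg_neg, neg_neg]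
  d_d x := by simp

/-- An odd homotopy `h` from `f` to `g` is the same as a morphism into the path complex whose two
end points are `f` and `g`. The constant paths `i` form a quasi-isomorphism which both end point
maps `p` and `q` split, so `p` and `q` become equal once `i` is inverted. -/
theorem toD_map_eq_of_homotopy {M N : SCpx k Q} (f g : M ⟶ N)
    (h : M.carrier →ₗ[Q] N.carrier) (hp : ∀ x, h (M.par x) = -N.par (h x))
    (hd : ∀ x, N.d (h x) + h (M.d x) = SCpx.lin f x - SCpx.lin g x) :
    (toD k Q).map f = (toD k Q).map g := by
  let H : M ⟶ N.path :=
    { toLin := LinearMap.prod (SCpx.lin f) (LinearMap.prod (SCpx.lin g) h)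
      map_par := fun x => by
        change (SCpx.lin f (M.par x), SCpx.lin g (M.par x), h (M.par x)) =
          (N.par (SCpx.lin f x), N.par (SCpx.lin g x), -N.par (h x))
        rw [SCpx.lin_par, SCpx.lin_par, hp]
      map_d := fun x => by
        change (SCpx.lin f (M.d x), SCpx.lin g (M.d x), h (M.d x)) =
          (N.d (SCpx.lin f x), N.d (SCpx.lin g x), SCpx.lin f x - SCpx.lin g x - N.d (h x))
        rw [SCpx.lin_d, SCpx.lin_d, ← hd, add_sub_cancel_left] }
  let p : N.path ⟶ N := ⟨LinearMap.fst Q _ _, fun _ => rfl, fun _ => rfl⟩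
  let q : N.path ⟶ N := ⟨LinearMap.fst Q _ _ ∘ₗ LinearMap.snd Q _ _, fun _ => rfl, fun _ => rfl⟩
  let i : N ⟶ N.path :=
    { toLin := LinearMap.prod LinearMap.id (LinearMap.prod LinearMap.id 0)
      map_par := fun x => by
        change (N.par x, N.par x, (0 : N.carrier)) = (N.par x, N.par x, -N.par 0)
        rw [map_zero, neg_zero]
      map_d := fun x => by
        change (N.d x, N.d x, (0 : N.carrier)) = (N.d x, N.d x, x - x - N.d 0)
        rw [map_zero, sub_self, sub_zero] }
  -- A cycle (a, b, c) has a - b = dc, so it differs from the constant path at b by the boundary of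
  -- (c, 0, 0).
  have hi : quasiIso k Q i := by
    constructor
    · rintro x - ⟨⟨a, b, c⟩, h⟩
      exact ⟨a, congrArg Prod.fst h⟩
    · rintro ⟨a, b, c⟩ h
      have h2 : N.d b = 0 := congrArg (fun t => t.2.1) h
      have h3 : a - b - N.d c = 0 := congrArg (fun t => t.2.2) h
      refine ⟨b, h2, (c, 0, 0), ?_⟩
      change (N.d c, N.d 0, c - 0 - N.d 0) = (a, b, c) - (b, b, 0)
      rw [map_zero, sub_zero, sub_zero, ← sub_eq_zero.1 h3]
      exact Prod.ext rfl (Prod.ext (sub_self b).symm (sub_zero c).symm)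
  have : IsIso ((toD k Q).map i) := Localization.inverts _ (quasiIso k Q) i hi
  have hpq : (toD k Q).map p = (toD k Q).map q := by
    rw [← cancel_epi ((toD k Q).map i), ← Functor.map_comp, ← Functor.map_comp]
    rfl
  have h1 : f = H ≫ p := rfl
  have h2 : g = H ≫ q := rfl
  rw [h1, h2, Functor.map_comp, Functor.map_comp, hpq]

/-! ### Torsion -/

/-- The ideal of the elements acting locally nilpotently on the homology of `N`. -/
def torsionIdeal (N : SCpx k Q) : Ideal Q where
  carrier := {a | ∀ x, N.d x = 0 → ∃ (n : ℕ) (y : N.carrier), N.d y = a ^ n • x}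
  zero_mem' x _ := ⟨1, 0, by simp⟩
  add_mem' {a b} ha hb x hx := by
    obtain ⟨n, y, hy⟩ := ha x hx
    obtain ⟨m, z, hz⟩ := hb x hx
    -- Every monomial in the expansion of the power is divisible by a^n or by b^m.
    have h : (a + b) ^ (n + m) ∈ Ideal.span {a ^ n, b ^ m} := by
      have hI := Ideal.add_pow_mem_of_pow_mem_of_le (I := Ideal.span {a ^ n, b ^ m}) (a := a)
        (b := b) (m := n) (n := m) (k := n + m) (Ideal.subset_span (by simp))
        (Ideal.subset_span (by simp)) (by omega)
      exact hI
    obtain ⟨p, q, hpq⟩ := Ideal.mem_span_pair.1 h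
    exact ⟨n + m, p • y + q • z, by
      rw [map_add, map_smul, map_smul, hy, hz, ← hpq, add_smul, mul_smul, mul_smul]⟩
  smul_mem' c {a} ha x hx := by
    obtain ⟨n, y, hy⟩ := ha x hx
    exact ⟨n, c ^ n • y, by rw [map_smul, hy, smul_eq_mul, mul_pow, mul_smul]⟩

theorem mem_torsionIdeal {N : SCpx k Q} {a : Q} : a ∈ torsionIdeal N ↔
    ∀ x, N.d x = 0 → ∃ (n : ℕ) (y : N.carrier), N.d y = a ^ n • x := Iff.rfl

/-- Some power of a^m is a power of a. Radicality lets membership in this ideal be tested on prime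
ideals, so that different generators of the same closed set can be exchanged. -/
theorem torsionIdeal_isRadical (N : SCpx k Q) : (torsionIdeal N).IsRadical := by
  rintro a ⟨m, hm⟩ x hx
  obtain ⟨n, y, hy⟩ := hm x hx
  exact ⟨m * n, y, by rw [hy, pow_mul]⟩

/-! ### Localization -/

variable (g : Q)

/-- The localization of a complex. -/
noncomputable def locCpx (M : SCpx k Q) : SCpx k Q where
  carrier := Localization.Away g ⊗[Q] M.carrier
  par := M.par.lTensor _
  d := M.d.lTensor _
  par_par x := by
    rw [← LinearMap.lTensor_comp_apply, LinearMap.ext (f := M.par ∘ₗ M.par) (g := .id) M.par_par,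
      LinearMap.lTensor_id_apply]
  d_par x := by
    rw [← LinearMap.lTensor_comp_apply, LinearMap.ext (f := M.d ∘ₗ M.par) (g := -(M.par ∘ₗ M.d))
      M.d_par, LinearMap.lTensor_neg, LinearMap.neg_apply, LinearMap.lTensor_comp_apply]
  d_d x := by
    rw [← LinearMap.lTensor_comp_apply, LinearMap.ext (f := M.d ∘ₗ M.d) (g := 0) M.d_d,
      LinearMap.lTensor_zero, LinearMap.zero_apply]

section

variable {g}

/-- The fraction `m / g^n`. -/
noncomputable def locMk {M : Type*} [AddCommGroup M] [Module Q M] (n : ℕ) :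
    M →ₗ[Q] Localization.Away g ⊗[Q] M :=
  TensorProduct.mk Q _ M (IsLocalization.Away.invSelf g ^ n)

variable {M N : Type*} [AddCommGroup M] [Module Q M] [AddCommGroup N] [Module Q N]

theorem locMk_zero (m : M) : locMk (g := g) 0 m = 1 ⊗ₜ m := by simp [locMk]

theorem pow_smul_locMk (n j : ℕ) (m : M) : g ^ j • locMk (g := g) (n + j) m = locMk n m := by
  have h : g ^ j • (IsLocalization.Away.invSelf g ^ j : Localization.Away g) = 1 := by
    rw [Algebra.smul_def, map_pow, ← mul_pow, IsLocalization.Away.mul_invSelf, one_pow]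
  change (g ^ j • ((IsLocalization.Away.invSelf g : Localization.Away g) ^ (n + j))) ⊗ₜ[Q] m = _
  rw [pow_add, ← mul_smul_comm, h, mul_one]
  rfl

theorem locMk_pow_smul (n j : ℕ) (m : M) : locMk (g := g) (n + j) (g ^ j • m) = locMk n m := by
  rw [map_smul, pow_smul_locMk]

/-- The base change to `Localization.Away g` is the localized module at the powers of g, so one
power of g is a common denominator. With `locMk_eq_zero`, this reduces statements about the
localized complex to the complex itself, by clearing denominators. -/
theorem exists_locMk (x : Localization.Away g ⊗[Q] M) : ∃ n m, x = locMk n m := by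
  have := (isLocalizedModule_iff_isBaseChange (.powers g) (Localization.Away g)
    (TensorProduct.mk Q (Localization.Away g) M 1)).2 (TensorProduct.isBaseChange Q M _)
  obtain ⟨⟨m, ⟨_, n, rfl⟩⟩, h⟩ := IsLocalizedModule.surj (.powers g)
    (TensorProduct.mk Q (Localization.Away g) M 1) x
  refine ⟨n, m, ?_⟩
  -- Powers of g act injectively on the localization, so it is enough to compare after clearing the
  -- denominator.
  have h' : g ^ n • x = g ^ n • locMk n m := by
    have h0 := pow_smul_locMk (g := g) 0 n m
    rw [zero_add, locMk_zero] at h0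
    exact Eq.trans h h0.symm
  exact IsLocalizedModule.smul_injective (TensorProduct.mk Q (Localization.Away g) M 1)
    (⟨g ^ n, n, rfl⟩ : Submonoid.powers g) h'

theorem locMk_eq_zero (n : ℕ) (m : M) (h : locMk (g := g) n m = 0) : ∃ j : ℕ, g ^ j • m = 0 := by
  have := (isLocalizedModule_iff_isBaseChange (.powers g) (Localization.Away g)
    (TensorProduct.mk Q (Localization.Away g) M 1)).2 (TensorProduct.isBaseChange Q M _)
  have h' : TensorProduct.mk Q (Localization.Away g) M 1 m = 0 := by
    have := pow_smul_locMk (g := g) 0 n m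
    rw [zero_add, h, smul_zero, locMk_zero] at this
    exact this.symm
  obtain ⟨⟨_, j, rfl⟩, hj⟩ := (IsLocalizedModule.eq_zero_iff (.powers g) _).1 h'
  exact ⟨j, hj⟩

end

variable {g}

/-- The fraction `m / g^n`, in the localization of a complex. -/
noncomputable def locCpxMk {M : SCpx k Q} (n : ℕ) : M.carrier →ₗ[Q] (locCpx g M).carrier :=
  locMk n

section

variable {M : SCpx k Q}

theorem pow_smul_locCpxMk (n j : ℕ) (m : M.carrier) :
    g ^ j • locCpxMk (g := g) (n + j) m = locCpxMk n m := pow_smul_locMk n j m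

theorem locCpxMk_pow_smul (n j : ℕ) (m : M.carrier) :
    locCpxMk (g := g) (n + j) (g ^ j • m) = locCpxMk n m := locMk_pow_smul n j m

theorem exists_locCpxMk (x : (locCpx g M).carrier) : ∃ n m, x = locCpxMk n m := exists_locMk x

theorem locCpxMk_eq_zero (n : ℕ) (m : M.carrier) (h : locCpxMk (g := g) n m = 0) :
    ∃ j : ℕ, g ^ j • m = 0 := locMk_eq_zero n m h

theorem locCpx_d_mk (n : ℕ) (m : M.carrier) :
    (locCpx g M).d (locCpxMk n m) = locCpxMk n (M.d m) := rfl

theorem locCpx_par_mk (n : ℕ) (m : M.carrier) :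
    (locCpx g M).par (locCpxMk n m) = locCpxMk n (M.par m) := rfl

/-- Cycles in a localization come from cycles. -/
theorem exists_locCpxMk_of_d_eq_zero (x : (locCpx g M).carrier)
    (hx : (locCpx g M).d x = 0) : ∃ n m, x = locCpxMk n m ∧ M.d m = 0 := by
  obtain ⟨n, m, rfl⟩ := exists_locCpxMk x
  obtain ⟨j, hj⟩ := locCpxMk_eq_zero n _ hx
  -- The numerator m is a cycle only up to g-torsion. Expanding the fraction by g^j makes it a
  -- genuine cycle.
  exact ⟨n + j, g ^ j • m, (locCpxMk_pow_smul n j m).symm, by rw [map_smul, hj]⟩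

end

variable (g)

/-- The map induced on localizations. -/
noncomputable def locMap {M N : SCpx k Q} (φ : M ⟶ N) : locCpx g M ⟶ locCpx g N where
  toLin := (SCpx.lin φ).lTensor _
  map_par x := by
    obtain ⟨n, m, rfl⟩ := exists_locCpxMk x
    exact congrArg (locCpxMk n) (SCpx.lin_par φ m)
  map_d x := by
    obtain ⟨n, m, rfl⟩ := exists_locCpxMk x
    exact congrArg (locCpxMk n) (SCpx.lin_d φ m)

theorem locMap_mk {M N : SCpx k Q} (φ : M ⟶ N) (n : ℕ) (m : M.carrier) :
    SCpx.lin (locMap g φ) (locCpxMk n m) = locCpxMk n (SCpx.lin φ m) := rfl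

/-- This is exactness of localization, in terms of fractions: an equation between fractions holds
between numerators after multiplication by a power of g, and there the hypothesis on `φ` applies. -/
theorem quasiIso_locMap {M N : SCpx k Q} (φ : M ⟶ N) (h : quasiIso k Q φ) :
    quasiIso k Q (locMap g φ) := by
  constructor
  · rintro x hx ⟨y, hy⟩
    obtain ⟨n, m, rfl, hm⟩ := exists_locCpxMk_of_d_eq_zero x hx
    obtain ⟨l, b, rfl⟩ := exists_locCpxMk y
    rw [locCpx_d_mk, locMap_mk] at hy
    -- The equation d(b)/g^l = φ(m)/g^n is brought to the common denominator g^(n+l).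
    have e : locCpxMk (g := g) (n + l) (N.d (g ^ n • b) - g ^ l • SCpx.lin φ m) = 0 := by
      rw [map_sub, locCpxMk_pow_smul, map_smul, add_comm, locCpxMk_pow_smul, hy, sub_self]
    obtain ⟨j, hj⟩ := locCpxMk_eq_zero _ _ e
    obtain ⟨z, hz⟩ := h.1 (g ^ (l + j) • m) (by rw [map_smul, hm, smul_zero])
      ⟨g ^ j • g ^ n • b, by
        rw [map_smul, map_smul]
        rw [smul_sub, sub_eq_zero, map_smul] at hj
        rw [hj, smul_smul, ← pow_add, add_comm, map_smul]⟩
    refine ⟨locCpxMk (n + (l + j)) z, ?_⟩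
    rw [locCpx_d_mk, hz, locCpxMk_pow_smul]
  · intro y hy
    obtain ⟨n, b, rfl, hb⟩ := exists_locCpxMk_of_d_eq_zero y hy
    obtain ⟨x, hx, z, hz⟩ := h.2 b hb
    refine ⟨locCpxMk n x, by rw [locCpx_d_mk, hx, map_zero], locCpxMk n z, ?_⟩
    rw [locCpx_d_mk, hz, map_sub, locMap_mk]

/-! ### The functor `(Q → Q[1/g]) ⊗ -` -/

section

variable {g} {M : SCpx k Q}

/-- The element `(m, x)` of `(Q → Q[1/g]) ⊗ M`. -/
def cechMk (m : M.carrier) (x : (locCpx g M).carrier) : (cechOne g M).carrier := (m, x)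

/-- The second component of an element of `(Q → Q[1/g]) ⊗ M`. -/
noncomputable def cechSnd : (cechOne g M).carrier →ₗ[Q] (locCpx g M).carrier where
  toFun x := x.2
  map_add' _ _ := rfl
  map_smul' _ _ := rfl

theorem aug_mk (m : M.carrier) (x : (locCpx g M).carrier) :
    SCpx.lin (cechOneAug g M) (cechMk m x) = m := rfl

theorem cechOne_d_mk (m : M.carrier) (x : (locCpx g M).carrier) :
    (cechOne g M).d (cechMk m x) = cechMk (M.d m) (locCpxMk 0 m - (locCpx g M).d x) :=
  Prod.ext rfl (congrArg (fun t => t - (locCpx g M).d x) (locMk_zero m).symm)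

theorem cechOne_par_mk (m : M.carrier) (x : (locCpx g M).carrier) :
    (cechOne g M).par (cechMk m x) = cechMk (M.par m) (-(locCpx g M).par x) := rfl

theorem cechMk_induction {p : (cechOne g M).carrier → Prop} (h : ∀ m x, p (cechMk m x))
    (x : (cechOne g M).carrier) : p x := h x.1 x.2

theorem cechMk_inj {m m' : M.carrier} {x x' : (locCpx g M).carrier}
    (h : cechMk m x = cechMk m' x') : m = m' ∧ x = x' := Prod.ext_iff.1 h

theorem cechMk_zero : cechMk (0 : M.carrier) (0 : (locCpx g M).carrier) = 0 := rfl

theorem cechMk_add (m m' : M.carrier) (x x' : (locCpx g M).carrier) :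
    cechMk m x + cechMk m' x' = cechMk (m + m') (x + x') := rfl

theorem cechMk_sub (m m' : M.carrier) (x x' : (locCpx g M).carrier) :
    cechMk m x - cechMk m' x' = cechMk (m - m') (x - x') := rfl

theorem cechMk_neg (m : M.carrier) (x : (locCpx g M).carrier) :
    -cechMk m x = cechMk (-m) (-x) := rfl

theorem cechMk_smul (q : Q) (m : M.carrier) (x : (locCpx g M).carrier) :
    q • cechMk m x = cechMk (q • m) (q • x) := rfl

end

/-- The map induced by a morphism of complexes on `(Q → Q[1/g]) ⊗ -`. -/
noncomputable def cechOneMap {M N : SCpx k Q} (φ : M ⟶ N) : cechOne g M ⟶ cechOne g N where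
  toLin := (SCpx.lin φ).prodMap (SCpx.lin (locMap g φ))
  map_par x := by
    induction x using cechMk_induction with
    | h m x =>
      change cechMk (SCpx.lin φ (M.par m)) (SCpx.lin (locMap g φ) (-(locCpx g M).par x)) =
        cechMk (N.par (SCpx.lin φ m)) (-(locCpx g N).par (SCpx.lin (locMap g φ) x))
      rw [SCpx.lin_par, map_neg, SCpx.lin_par]
  map_d x := by
    induction x using cechMk_induction with
    | h m x =>
      rw [cechOne_d_mk]
      change cechMk (SCpx.lin φ (M.d m)) (SCpx.lin (locMap g φ) (locCpxMk 0 m - (locCpx g M).d x)) =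
        (cechOne g N).d (cechMk (SCpx.lin φ m) (SCpx.lin (locMap g φ) x))
      rw [SCpx.lin_d, map_sub, SCpx.lin_d, cechOne_d_mk, locMap_mk]

theorem cechOneMap_mk {M N : SCpx k Q} (φ : M ⟶ N) (m : M.carrier) (x : (locCpx g M).carrier) :
    SCpx.lin (cechOneMap g φ) (cechMk m x) = cechMk (SCpx.lin φ m) (SCpx.lin (locMap g φ) x) := rfl

/-- The functor `(Q → Q[1/g]) ⊗ -`. -/
noncomputable def cechFunctor : SCpx k Q ⥤ SCpx k Q where
  obj M := cechOne g M
  map φ := cechOneMap g φ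
  map_id M := SCpx.hom_ext fun x => Prod.ext rfl (LinearMap.lTensor_id_apply _ _ x.2)
  map_comp φ ψ := SCpx.hom_ext fun x => Prod.ext rfl (LinearMap.lTensor_comp_apply _ _ _ x.2)

/-- The complex `cechOne g M` is the shifted cone of M → M[1/g], so this is the five lemma for `φ`
and its localization, carried out as a diagram chase. -/
theorem quasiIso_cechOneMap {M N : SCpx k Q} (φ : M ⟶ N) (h : quasiIso k Q φ) :
    quasiIso k Q (cechOneMap g φ) := by
  have hl := quasiIso_locMap g φ h
  constructor
  · intro x
    induction x using cechMk_induction with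
    | h m x =>
      rintro hx ⟨y, hy⟩
      induction y using cechMk_induction with
      | h n y =>
        rw [cechOne_d_mk, ← cechMk_zero] at hx
        rw [cechOne_d_mk, cechOneMap_mk] at hy
        obtain ⟨hx1, hx2⟩ := cechMk_inj hx
        obtain ⟨hy1, hy2⟩ := cechMk_inj hy
        obtain ⟨z, rfl⟩ := h.1 m hx1 ⟨n, hy1⟩
        -- The primitive `z` of `m` is determined only up to a cycle. The difference of `n` and the
        -- image of `z` is a cycle, and adding to `z` a cycle `a` in the matching class leaves a
        -- defect only in the localized component, where `hl` applies.
        obtain ⟨a, ha, b, hb⟩ := h.2 (n - SCpx.lin φ z) (by rw [map_sub, hy1, SCpx.lin_d, sub_self])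
        obtain ⟨w, hw⟩ := hl.1 (x - locCpxMk 0 z - locCpxMk 0 a)
          (by rw [map_sub, map_sub, locCpx_d_mk, locCpx_d_mk, ha, map_zero, sub_zero,
            ← sub_eq_zero.1 hx2, sub_self])
          ⟨locCpxMk 0 b - y, by
            rw [map_sub, map_sub, map_sub, locMap_mk, locMap_mk, ← hy2, locCpx_d_mk, hb, map_sub,
              map_sub]
            abel⟩
        refine ⟨cechMk (z + a) (-w), ?_⟩
        rw [cechOne_d_mk, map_neg, hw, map_add, map_add, ha, add_zero]
        congr 1
        abel
  · intro y hy
    induction y using cechMk_induction with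
    | h n y =>
      rw [cechOne_d_mk, ← cechMk_zero] at hy
      obtain ⟨hy1, hy2⟩ := cechMk_inj hy
      obtain ⟨m, hm, z, hz⟩ := h.2 n hy1
      -- The fraction m/1 has to be made a boundary, for (m, w) to be a cycle. Its image is the
      -- boundary of y - z/1, so injectivity on localized homology provides w. The second component
      -- is then wrong by a cycle, which `v` corrects.
      obtain ⟨w, hw⟩ := hl.1 (locCpxMk 0 m) (by rw [locCpx_d_mk, hm, map_zero])
        ⟨y - locCpxMk 0 z, by
          rw [map_sub, locCpx_d_mk, hz, ← sub_eq_zero.1 hy2, map_sub, locMap_mk]; abel⟩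
      obtain ⟨v, hv, t, ht⟩ := hl.2 (y - locCpxMk 0 z - SCpx.lin (locMap g φ) w) (by
        rw [map_sub, map_sub, ← SCpx.lin_d, hw, locCpx_d_mk, hz, ← sub_eq_zero.1 hy2, map_sub,
          locMap_mk]
        abel)
      refine ⟨cechMk m (w + v), ?_, cechMk z (-t), ?_⟩
      · rw [cechOne_d_mk, hm, map_add, hw, hv, add_zero, sub_self, cechMk_zero]
      · rw [cechOne_d_mk, map_neg, ht, hz, cechOneMap_mk, cechMk_sub, map_add]
        congr 1
        abel

theorem cechFunctor_inverts :
    (quasiIso k Q).IsInvertedBy (cechFunctor (k := k) g ⋙ toD k Q) := fun _ _ φ hφ =>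
  Localization.inverts (toD k Q) (quasiIso k Q) _ (quasiIso_cechOneMap g φ hφ)

/-- The functor `(Q → Q[1/g]) ⊗ -` on the derived category. -/
noncomputable def cechD : DCat k Q ⥤ DCat k Q :=
  Localization.lift (cechFunctor (k := k) g ⋙ toD k Q) (cechFunctor_inverts g) (toD k Q)

/-- `cechD` is computed by `cechFunctor`. -/
noncomputable def cechDIso : toD k Q ⋙ cechD g ≅ cechFunctor (k := k) g ⋙ toD k Q :=
  Localization.fac (cechFunctor (k := k) g ⋙ toD k Q) (cechFunctor_inverts g) (toD k Q)

/-- The augmentation, as a natural transformation. -/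
noncomputable def cechAug : cechFunctor (k := k) g ⟶ 𝟭 (SCpx k Q) where
  app M := cechOneAug g M
  naturality _ _ _ := rfl

/-- The augmentation, as a natural transformation of functors on the derived category. -/
noncomputable def cechDAug : cechD (k := k) g ⟶ 𝟭 (DCat k Q) :=
  Localization.liftNatTrans (toD k Q) (quasiIso k Q) (toD k Q ⋙ cechD g) (toD k Q) (cechD g)
    (𝟭 (DCat k Q)) ((cechDIso g).hom ≫ Functor.whiskerRight (cechAug g) (toD k Q))

theorem cechDAug_app (M : SCpx k Q) : (cechDAug g).app ((toD k Q).obj M) =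
    (cechDIso g).hom.app M ≫ (toD k Q).map (cechOneAug g M) := by
  unfold cechDAug
  rw [Localization.liftNatTrans_app]
  simp [cechAug]

end Derived

/-! ### Unique lifting along the augmentation of local cohomology. -/

section Lifts

variable {k Q : Type u} [Field k] [CommRing Q] [Algebra k Q] {g : Q}

/-- The action of `Q[1/g]` on the second components in the localization of `(Q → Q[1/g]) ⊗ M`. -/
noncomputable def locCechSnd {M : SCpx k Q} :
    (locCpx g (cechOne g M)).carrier →ₗ[Q] (locCpx g M).carrier :=
  TensorProduct.lift (Algebra.lsmul Q Q (Localization.Away g ⊗[Q] M.carrier) :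
    Localization.Away g →ₐ[Q] _).toLinearMap ∘ₗ cechSnd.lTensor (Localization.Away g)

theorem locCechSnd_mk_mk {M : SCpx k Q} (n j : ℕ) (m w : M.carrier) :
    locCechSnd (g := g) (locCpxMk n (cechMk m (locCpxMk j w))) = locCpxMk (n + j) w := by
  change ((IsLocalization.Away.invSelf g : Localization.Away g) ^ n *
      IsLocalization.Away.invSelf g ^ j) ⊗ₜ[Q] w =
    ((IsLocalization.Away.invSelf g : Localization.Away g) ^ (n + j)) ⊗ₜ[Q] w
  rw [pow_add]

/-- The two augmentations `(Q → Q[1/g])^{⊗2} ⊗ M → (Q → Q[1/g]) ⊗ M` are homotopic. -/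
theorem toD_map_cechOneAug_cechOne (M : SCpx k Q) :
    (toD k Q).map (cechOneAug g (cechOne g M)) = (toD k Q).map (cechOneMap g (cechOneAug g M)) := by
  let i : (locCpx g M).carrier →ₗ[Q] (cechOne g M).carrier :=
    { toFun := fun x => cechMk 0 x
      map_add' := fun x y => by rw [cechMk_add, add_zero]
      map_smul' := fun q x => by rw [RingHom.id_apply, cechMk_smul, smul_zero] }
  have hi : ∀ x, i x = cechMk 0 x := fun _ => rfl
  -- The homotopy multiplies the two copies of Q[1/g] on the summand Q[1/g] ⊗ Q[1/g] ⊗ M, places the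
  -- result in Q[1/g] ⊗ M, and is zero on the three other summands.
  let h : (cechOne g (cechOne g M)).carrier →ₗ[Q] (cechOne g M).carrier := i ∘ₗ locCechSnd ∘ₗ cechSnd
  have hh : ∀ a t, h (cechMk a t) = cechMk 0 (locCechSnd t) := fun _ _ => rfl
  refine toD_map_eq_of_homotopy _ _ h (fun x => ?_) (fun x => ?_)
  · induction x using cechMk_induction with
    | h a t =>
      obtain ⟨n, z, rfl⟩ := exists_locCpxMk t
      induction z using cechMk_induction with
      | h m y =>
        obtain ⟨j, w, rfl⟩ := exists_locCpxMk y
        have e1 : -locCpxMk (g := g) j (M.par w) = locCpxMk j (-M.par w) := (map_neg _ _).symm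
        have e2 : -(cechMk (0 : M.carrier) (-locCpxMk (g := g) (n + j) (M.par w))) =
            cechMk 0 (locCpxMk (g := g) (n + j) (M.par w)) := by
          rw [cechMk_neg, neg_neg, neg_zero]
        rw [cechOne_par_mk, hh, hh, locCpx_par_mk, cechOne_par_mk, locCpx_par_mk, e1, map_neg,
          locCechSnd_mk_mk, locCechSnd_mk_mk, cechOne_par_mk, locCpx_par_mk, map_zero, e2, map_neg,
          neg_neg]
  · induction x using cechMk_induction with
    | h a t =>
      induction a using cechMk_induction with
      | h m y =>
        obtain ⟨l, v, rfl⟩ := exists_locCpxMk y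
        obtain ⟨n, z, rfl⟩ := exists_locCpxMk t
        induction z using cechMk_induction with
        | h m' y =>
          obtain ⟨j, w, rfl⟩ := exists_locCpxMk y
          have e : (cechMk (M.d m') (locCpxMk 0 m' - locCpxMk j (M.d w)) : (cechOne g M).carrier) =
              cechMk (M.d m') (locCpxMk 0 m') - cechMk 0 (locCpxMk j (M.d w)) := by
            rw [cechMk_sub, sub_zero]
          rw [hh, locCechSnd_mk_mk, cechOne_d_mk, cechOne_d_mk, hh, map_sub, locCechSnd_mk_mk,
            locCpx_d_mk, locCpx_d_mk, cechOne_d_mk, locCpx_d_mk, e, map_sub, map_sub,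
            locCechSnd_mk_mk, locCechSnd_mk_mk, aug_mk, cechOneMap_mk, aug_mk, locMap_mk, aug_mk,
            cechMk_add, cechMk_sub, map_zero, map_zero]
          congr 1
          · rw [sub_self, add_zero]
          · rw [zero_add, add_zero]; abel

/-- If g acts locally nilpotently on the homology of `N`, then N[1/g] is acyclic, and the kernel of
the augmentation is a shift of N[1/g]. -/
theorem quasiIso_cechOneAug {N : SCpx k Q} (hN : g ∈ torsionIdeal N) :
    quasiIso k Q (cechOneAug g N) := by
  constructor
  · intro x
    induction x using cechMk_induction with
    | h m x =>
      rintro hx ⟨y, hy⟩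
      rw [aug_mk] at hy
      subst hy
      rw [cechOne_d_mk, ← cechMk_zero] at hx
      have hx2 := (cechMk_inj hx).2
      -- Subtracting the boundary of (y, 0) leaves a cycle of N[1/g]. It is a fraction whose
      -- numerator is a cycle, hence is a boundary after multiplication by a power of g.
      obtain ⟨n, m', hm', hd⟩ := exists_locCpxMk_of_d_eq_zero (x - locCpxMk 0 y) (by
        rw [map_sub, locCpx_d_mk, ← sub_eq_zero.1 hx2, sub_self])
      obtain ⟨j, z, hz⟩ := mem_torsionIdeal.1 hN m' hd
      refine ⟨cechMk y (-locCpxMk (n + j) z), ?_⟩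
      rw [cechOne_d_mk, map_neg, locCpx_d_mk, hz, locCpxMk_pow_smul, ← hm']
      congr 1
      abel
  · intro y hy
    obtain ⟨n, z, hz⟩ := mem_torsionIdeal.1 hN y hy
    refine ⟨cechMk y (locCpxMk n z), ?_, 0, ?_⟩
    · have h := locCpxMk_pow_smul (g := g) 0 n y
      rw [zero_add] at h
      rw [cechOne_d_mk, hy, locCpx_d_mk, hz, h, sub_self, cechMk_zero]
    · rw [aug_mk, map_zero, sub_self]

/-- After inverting g, the map M → M[1/g] is an isomorphism and its cone is acyclic. Concretely, if
(m, w/g^n) is a cycle, then g^n m and dw agree up to g-torsion, and a multiple of (w, 0) bounds a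
power of g times the cycle. -/
theorem mem_torsionIdeal_cechOne_self (M : SCpx k Q) : g ∈ torsionIdeal (cechOne g M) := by
  intro x
  induction x using cechMk_induction with
  | h m x =>
    intro hx
    rw [cechOne_d_mk, ← cechMk_zero] at hx
    obtain ⟨hx1, hx2⟩ := cechMk_inj hx
    obtain ⟨n, w, rfl⟩ := exists_locCpxMk x
    have e : locCpxMk (g := g) n (g ^ n • m - M.d w) = 0 := by
      have h := locCpxMk_pow_smul (g := g) 0 n m
      rw [zero_add] at h
      rw [map_sub, h]
      exact hx2
    obtain ⟨j, hj⟩ := locCpxMk_eq_zero n _ e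
    rw [smul_sub, sub_eq_zero] at hj
    have h2 := pow_smul_locCpxMk (g := g) 0 n w
    rw [zero_add] at h2
    refine ⟨j + n, cechMk (g ^ j • w) 0, ?_⟩
    rw [cechOne_d_mk, map_smul, ← hj, map_smul, ← h2, map_zero, sub_zero, smul_smul, smul_smul,
      ← pow_add, cechMk_smul]

/-- The homology of the cone lies, in the long exact sequence, between those of M and M[1/g], on
both of which `a` is locally nilpotent. The exponents needed for the two outer terms add up. -/
theorem torsionIdeal_le_cechOne (M : SCpx k Q) : torsionIdeal M ≤ torsionIdeal (cechOne g M) := by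
  intro a ha x
  induction x using cechMk_induction with
  | h m x =>
    intro hx
    rw [cechOne_d_mk, ← cechMk_zero] at hx
    obtain ⟨hx1, hx2⟩ := cechMk_inj hx
    obtain ⟨n, y, hy⟩ := mem_torsionIdeal.1 ha m hx1
    obtain ⟨j, w, hw, hdw⟩ := exists_locCpxMk_of_d_eq_zero (a ^ n • x - locCpxMk 0 y) (by
      rw [map_sub, map_smul, locCpx_d_mk, hy, ← sub_eq_zero.1 hx2, map_smul, sub_self])
    obtain ⟨l, z, hz⟩ := mem_torsionIdeal.1 ha w hdw
    refine ⟨l + n, cechMk (a ^ l • y) (-locCpxMk j z), ?_⟩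
    have e : a ^ n • x = locCpxMk j w + locCpxMk 0 y := by rw [← hw, sub_add_cancel]
    rw [cechOne_d_mk, map_neg, locCpx_d_mk, hz, map_smul, hy, cechMk_smul, smul_smul, ← pow_add,
      pow_add a l n, mul_smul _ _ x, e, map_smul, map_smul, smul_add]
    congr 1
    abel

/-- The Čech factor at g makes g locally nilpotent, and further Čech factors preserve this. It shows
that the source of the pairing of local cohomology complexes is torsion, hence that this pairing
lifts uniquely. -/
theorem mem_torsionIdeal_RGam (gs : List Q) (M : SCpx k Q) (hg : g ∈ gs) :
    g ∈ torsionIdeal (RGam gs M) := by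
  induction gs with
  | nil => exact absurd hg List.not_mem_nil
  | cons a gs ih =>
    rcases List.mem_cons.1 hg with rfl | h
    · exact mem_torsionIdeal_cechOne_self _
    · exact torsionIdeal_le_cechOne _ (ih h)

/-- Write Γ for `cechD g` and α for its augmentation. The map α is invertible at `N` by torsion, and
the lift of `φ` is the inverse of α followed by Γ(φ). It is the only one: if `e` lifts `φ`,
naturality gives α ≫ e = Γ(e) ≫ α, and because α at ΓM is Γ(α at M) the right side is Γ(φ). -/
theorem existsUnique_lift_cechOne {N M : SCpx k Q} (hN : g ∈ torsionIdeal N)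
    (φ : (toD k Q).obj N ⟶ (toD k Q).obj M) :
    ∃! e : (toD k Q).obj N ⟶ (toD k Q).obj (cechOne g M),
      e ≫ (toD k Q).map (cechOneAug g M) = φ := by
  have hα : IsIso ((cechDAug g).app ((toD k Q).obj N)) := by
    have h1 : IsIso ((cechDIso (k := k) g).hom.app N) := NatIso.hom_app_isIso _ _
    have h2 := Localization.inverts (toD k Q) (quasiIso k Q) _ (quasiIso_cechOneAug hN)
    exact Eq.mpr (congrArg (fun t => IsIso t) (cechDAug_app g N))
      (@IsIso.comp_isIso _ _ _ _ _ _ _ h1 h2)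
  -- The idempotency of Γ: the augmentation of ΓM and Γ applied to the augmentation of M coincide,
  -- through the canonical isomorphism `cechDIso`.
  have key : (cechDAug g).app ((toD k Q).obj (cechOne g M)) =
      (cechD g).map ((toD k Q).map (cechOneAug g M)) ≫ (cechDIso g).hom.app M :=
    (cechDAug_app g _).trans ((congrArg (fun t => (cechDIso (k := k) g).hom.app _ ≫ t)
      (toD_map_cechOneAug_cechOne M)).trans
        ((cechDIso (k := k) g).hom.naturality (cechOneAug g M)).symm)
  refine ⟨inv ((cechDAug g).app ((toD k Q).obj N)) ≫ (cechD g).map φ ≫ (cechDIso g).hom.app M,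
    ?_, fun e he => ?_⟩
  · have h1 := (cechDAug (k := k) g).naturality φ
    rw [cechDAug_app g M] at h1
    refine (Category.assoc _ _ _).trans ((IsIso.inv_comp_eq _).2 ?_)
    exact (Category.assoc _ _ _).trans h1
  -- Uniqueness: `key` rewrites the augmentation at ΓM as Γ of an augmentation, so that only the
  -- composite of `e` with the augmentation enters.
  · have h2 := (cechDAug (k := k) g).naturality e
    refine (IsIso.eq_inv_comp _).2 (h2.symm.trans ?_)
    refine (congrArg (fun t => (cechD g).map e ≫ t) key).trans ((Category.assoc _ _ _).symm.trans ?_)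
    exact congrArg (fun t => t ≫ (cechDIso (k := k) g).hom.app M)
      (((cechD g).map_comp _ _).symm.trans (congrArg (cechD g).map he))

/-- Morphisms into `M` from a complex with homology supported in `V(gs)` lift uniquely to the local
cohomology complex. -/
theorem exists_isUniqueLift (gs : List Q) {N M : SCpx k Q} (hN : ∀ g ∈ gs, g ∈ torsionIdeal N)
    (φ : (toD k Q).obj N ⟶ (toD k Q).obj M) : ∃ e, IsUniqueLift gs φ e := by
  induction gs with
  | nil =>
    have h1 : (toD k Q).map (RGamAug [] M) = 𝟙 ((toD k Q).obj M) := (toD k Q).map_id M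
    refine ⟨φ, ?_, fun e he => ?_⟩
    · rw [h1]; exact Category.comp_id φ
    · rw [h1] at he; exact (Category.comp_id e).symm.trans he
  | cons g gs ih =>
    obtain ⟨e, he, hu⟩ := ih fun g hg => hN g (List.mem_cons_of_mem _ hg)
    -- The Čech factor at the head of the list is the outermost one, so the lift through the tail
    -- `gs` is lifted once more through it.
    obtain ⟨e', he', hu'⟩ := existsUnique_lift_cechOne (hN g List.mem_cons_self) e
    have h1 : (toD k Q).map (RGamAug (g :: gs) M) =
      (toD k Q).map (cechOneAug g (RGam gs M)) ≫ (toD k Q).map (RGamAug gs M) :=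
        Functor.map_comp _ _ _
    refine ⟨e', ?_, fun e'' h'' => hu' _ (hu _ ?_)⟩
    · rw [h1, ← he, ← he']
      exact (Category.assoc _ _ _).symm
    · rw [h1] at h''
      exact (Category.assoc _ _ _).trans h''

/-- Both morphisms lift the same morphism. In this form uniqueness reduces the commutativity of the
square to its composite with the augmentation. -/
theorem IsUniqueLift.eq {gs : List Q} {N M : SCpx k Q} (hN : ∀ g ∈ gs, g ∈ torsionIdeal N)
    {e e' : (toD k Q).obj N ⟶ (toD k Q).obj (RGam gs M)}
    (h : e ≫ (toD k Q).map (RGamAug gs M) = e' ≫ (toD k Q).map (RGamAug gs M)) : e = e' := by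
  obtain ⟨e₀, -, hu⟩ := exists_isUniqueLift gs hN (e' ≫ (toD k Q).map (RGamAug gs M))
  rw [hu e h, hu e' rfl]

end Lifts

/-! ### Torsion in tensor products over a field. -/

section TensorTorsion

variable {k Q R : Type u} [Field k] [CommRing Q] [Algebra k Q] [CommRing R] [Algebra k R]

/-- Over a field, the identity of a complex is homotopic to a map with values in the cycles. -/
theorem exists_cycle_projection [CharZero k] (M : SCpx k Q) :
    ∃ h : M.carrier →ₗ[k] M.carrier, (∀ x, h (M.par x) = -M.par (h x)) ∧
      ∀ x, M.d (x + M.d (h x) + h (M.d x)) = 0 := by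
  let d : M.carrier →ₗ[k] M.carrier := M.d.restrictScalars k
  obtain ⟨s, hs⟩ := d.rangeRestrict.exists_rightInverse_of_surjective d.range_rangeRestrict
  have hs' : ∀ y : LinearMap.range d, M.d (s y) = y := fun y =>
    congrArg Subtype.val (LinearMap.congr_fun hs y)
  obtain ⟨r, hr⟩ := (LinearMap.range d).subtype.exists_leftInverse_of_injective
    (Submodule.ker_subtype _)
  have hr' : ∀ x, ((r (M.d x) : LinearMap.range d) : M.carrier) = M.d x := fun x =>
    congrArg Subtype.val (LinearMap.congr_fun hr ⟨M.d x, x, rfl⟩)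
  -- Here `s` is a section of d over its image and `r` a retraction onto this image, both existing
  -- because k is a field. Hence d h₀ d = -d, which is exactly what makes the values of id + d h₀ +
  -- h₀ d cycles.
  let h₀ : M.carrier →ₗ[k] M.carrier := -(s ∘ₗ r)
  have e : ∀ x, M.d (h₀ (M.d x)) = -M.d x := fun x => by
    change M.d (-s (r (M.d x))) = _
    rw [map_neg, hs', hr']
  let σ : M.carrier →ₗ[k] M.carrier := M.par.restrictScalars k
  have hσ : ∀ x, σ x = M.par x := fun _ => rfl
  -- The odd component of `h₀`. The relation d h₀ d = -d survives, because conjugation by the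
  -- grading changes the sign of d.
  refine ⟨(2 : k)⁻¹ • (h₀ - σ ∘ₗ h₀ ∘ₗ σ), fun x => ?_, fun x => ?_⟩
  · simp only [LinearMap.smul_apply, LinearMap.sub_apply, LinearMap.comp_apply, hσ, map_sub,
      LinearMap.map_smul_of_tower, M.par_par]
    rw [← smul_neg, neg_sub]
  · rw [map_add, map_add, M.d_d, add_zero]
    have e2 : M.d (h₀ (M.par (M.d x))) = -M.par (M.d x) := by
      rw [← neg_neg (M.par (M.d x)), ← M.d_par, map_neg, map_neg, e]
    simp only [LinearMap.smul_apply, LinearMap.sub_apply, LinearMap.comp_apply, hσ, map_sub,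
      LinearMap.map_smul_of_tower, M.d_par, e, e2, map_neg, M.par_par]
    have h2 : (2 : k)⁻¹ • M.d x + (2 : k)⁻¹ • M.d x = M.d x := by
      rw [← smul_add, ← two_smul k (M.d x), smul_smul, inv_mul_cancel₀ two_ne_zero, one_smul]
    rw [← neg_add', smul_neg, smul_add, neg_neg, h2,
      add_neg_cancel]

/-- A Künneth argument: over a field the identity of each factor is homotopic to a map with values
in the cycles, so every cycle of the tensor product is homologous to a finite sum of tensors of
cycles. On these the hypothesis applies. -/
theorem tmul_mem_torsionIdeal_aux [CharZero k] (M : SCpx k Q) (N : SCpx k R)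
    (A : Q ⊗[k] R) (hA : ∀ m n, M.d m = 0 → N.d n = 0 →
      ∃ j y, (M.tensor N).d y = A ^ j • M.tmul N m n) : A ∈ torsionIdeal (M.tensor N) := by
  obtain ⟨h, hp, hd⟩ := exists_cycle_projection M
  obtain ⟨l, lp, ld⟩ := exists_cycle_projection N
  let H : (M.tensor N).carrier →ₗ[k] (M.tensor N).carrier := TensorProduct.map h LinearMap.id
  -- The operator 1 ⊗ l with its Koszul sign: `l` is odd and passes the first factor. This makes the
  -- mixed terms of dL + Ld cancel.
  let L : (M.tensor N).carrier →ₗ[k] (M.tensor N).carrier :=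
    TensorProduct.map (M.par.restrictScalars k) l
  let P : (M.tensor N).carrier →ₗ[k] (M.tensor N).carrier :=
    TensorProduct.map (LinearMap.id + (M.d.restrictScalars k) ∘ₗ h + h ∘ₗ M.d.restrictScalars k)
      LinearMap.id
  let P' : (M.tensor N).carrier →ₗ[k] (M.tensor N).carrier :=
    TensorProduct.map LinearMap.id
      (LinearMap.id + (N.d.restrictScalars k) ∘ₗ l + l ∘ₗ N.d.restrictScalars k)
  have hH : ∀ m n, H (M.tmul N m n) = M.tmul N (h m) n := fun _ _ => rfl
  have hL : ∀ m n, L (M.tmul N m n) = M.tmul N (M.par m) (l n) := fun _ _ => rfl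
  have hP : ∀ m n, P (M.tmul N m n) = M.tmul N (m + M.d (h m) + h (M.d m)) n := fun _ _ => rfl
  have hP' : ∀ m n, P' (M.tmul N m n) = M.tmul N m (n + N.d (l n) + l (N.d n)) := fun _ _ => rfl
  have ta : ∀ (x y : M.carrier) (n : N.carrier),
    M.tmul N (x + y) n = M.tmul N x n + M.tmul N y n := fun x y n => TensorProduct.add_tmul x y n
  have tn : ∀ (x : M.carrier) (n : N.carrier),
    M.tmul N (-x) n = -M.tmul N x n := fun x n => TensorProduct.neg_tmul x n
  have ta' : ∀ (m : M.carrier) (x y : N.carrier),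
    M.tmul N m (x + y) = M.tmul N m x + M.tmul N m y := fun m x y => TensorProduct.tmul_add m x y
  have e1 : ∀ z, P z = z + (M.tensor N).d (H z) + H ((M.tensor N).d z) := fun z => by
    induction z using SCpx.tensor_induction with
    | zero => simp only [map_zero, add_zero]
    | add x y hx hy => simp only [map_add, hx, hy]; abel
    | tmul m n =>
      rw [hP, hH, SCpx.d_tmul, SCpx.d_tmul, map_add, hH, hH, hp, tn, ta, ta]
      abel
  have e2 : ∀ z, P' z = z + (M.tensor N).d (L z) + L ((M.tensor N).d z) := fun z => by
    induction z using SCpx.tensor_induction with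
    | zero => simp only [map_zero, add_zero]
    | add x y hx hy => simp only [map_add, hx, hy]; abel
    | tmul m n =>
      rw [hP', hL, SCpx.d_tmul, SCpx.d_tmul, map_add, hL, hL, M.d_par, tn, M.par_par, ta', ta']
      abel
  -- The map P' ∘ P takes values in sums of tensors of cycles. For a sum of two elements the
  -- exponents are added, so that a single power of `A` works for both.
  have key : ∀ z, ∃ j y, (M.tensor N).d y = A ^ j • P' (P z) := fun z => by
    induction z using SCpx.tensor_induction with
    | zero => exact ⟨0, 0, by simp only [map_zero, smul_zero]⟩
    | add x y hx hy =>
      obtain ⟨i, a, ha⟩ := hx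
      obtain ⟨j, b, hb⟩ := hy
      refine ⟨i + j, A ^ j • a + A ^ i • b, ?_⟩
      rw [map_add, map_smul, map_smul, ha, hb, map_add, map_add, smul_add, smul_smul, smul_smul,
        ← pow_add, ← pow_add, add_comm j i]
    | tmul m n =>
      rw [hP, hP']
      exact hA _ _ (hd m) (ld n)
  refine mem_torsionIdeal.2 fun z hz => ?_
  obtain ⟨j, y, hy⟩ := key z
  have e3 : P z = z + (M.tensor N).d (H z) := by rw [e1, hz, map_zero, add_zero]
  have e4 : P' (P z) = z + (M.tensor N).d (H z) + (M.tensor N).d (L (P z)) := by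
    rw [e2, e3, map_add (M.tensor N).d, hz, SCpx.d_d, add_zero, map_zero, add_zero]
  refine ⟨j, y - A ^ j • (H z + L (P z)), ?_⟩
  rw [map_sub, hy, e4, map_smul, map_add, ← smul_sub]
  congr 1
  abel

theorem tmul_one_mem_torsionIdeal [CharZero k] {M : SCpx k Q} (N : SCpx k R) {a : Q}
    (ha : a ∈ torsionIdeal M) : a ⊗ₜ[k] (1 : R) ∈ torsionIdeal (M.tensor N) := by
  refine tmul_mem_torsionIdeal_aux M N _ fun m n hm hn => ?_
  obtain ⟨j, y, hy⟩ := mem_torsionIdeal.1 ha m hm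
  refine ⟨j, M.tmul N y n, ?_⟩
  have e : M.tmul N (M.par y) 0 = 0 := TensorProduct.tmul_zero _ _
  rw [SCpx.d_tmul, hn, hy, e, add_zero, Algebra.TensorProduct.tmul_pow, one_pow, SCpx.smul_tmul,
    one_smul]

theorem one_tmul_mem_torsionIdeal [CharZero k] (M : SCpx k Q) {N : SCpx k R} {a : R}
    (ha : a ∈ torsionIdeal N) : (1 : Q) ⊗ₜ[k] a ∈ torsionIdeal (M.tensor N) := by
  refine tmul_mem_torsionIdeal_aux M N _ fun m n hm hn => ?_
  obtain ⟨j, y, hy⟩ := mem_torsionIdeal.1 ha n hn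
  -- The sign on `m` undoes the Koszul sign of 1 ⊗ d.
  refine ⟨j, M.tmul N (M.par m) y, ?_⟩
  have e : M.tmul N 0 y = 0 := TensorProduct.zero_tmul _ _
  rw [SCpx.d_tmul, M.d_par, hm, map_zero, neg_zero, hy, e, zero_add, M.par_par,
    Algebra.TensorProduct.tmul_pow, one_pow, SCpx.smul_tmul, one_smul]

/-- A prime containing the torsion ideal contains all s ⊗ 1 and 1 ⊗ t, so it lies in Z × W, which is
also the zero locus of `r`. Hence each element of `r` vanishes on the zero locus of the torsion
ideal, and belongs to it by radicality. It is applied both to Hochschild complexes and to local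
cohomology complexes. -/
theorem mem_torsionIdeal_tensor [CharZero k] {M : SCpx k Q} {N : SCpx k R} {s : List Q} {t : List R}
    {r : List (Q ⊗[k] R)} {Z : Set (PrimeSpectrum Q)} {W : Set (PrimeSpectrum R)}
    (hs : PrimeSpectrum.zeroLocus {x | x ∈ s} = Z) (ht : PrimeSpectrum.zeroLocus {x | x ∈ t} = W)
    (hr : PrimeSpectrum.zeroLocus {x | x ∈ r} = prodSet k Z W)
    (hM : ∀ a ∈ s, a ∈ torsionIdeal M) (hN : ∀ a ∈ t, a ∈ torsionIdeal N) :
    ∀ a ∈ r, a ∈ torsionIdeal (M.tensor N) := by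
  intro a ha
  rw [← (torsionIdeal_isRadical (M.tensor N)).radical, ← PrimeSpectrum.vanishingIdeal_zeroLocus_eq_radical,
    PrimeSpectrum.mem_vanishingIdeal]
  intro q hq
  have h : q ∈ prodSet k Z W := by
    subst hs ht
    exact ⟨fun x hx => hq (tmul_one_mem_torsionIdeal N (hM x hx)),
      fun x hx => hq (one_tmul_mem_torsionIdeal M (hN x hx))⟩
  rw [← hr] at h
  exact h ha

end TensorTorsion

/-! ### The Hochschild homology of `mf^Z` is supported in `Z`. -/

section HochschildTorsion

variable {k Q : Type u} [Field k] [CommRing Q] [Algebra k Q]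

namespace DGCat

section Length

variable {C : DGCat k Q} {X Y Z : C.Obj}

theorem base_mem_range (a : C.Hom Y X) : base a ∈ LinearMap.range (barIncl 0 X Y) := ⟨_, rfl⟩

theorem snoc_mem_range {n : ℕ} {x : C.Word X Z} (hx : x ∈ LinearMap.range (barIncl n X Z))
    (a : C.Hom Y Z) : snoc x a ∈ LinearMap.range (barIncl (n + 1) X Y) := by
  obtain ⟨x, rfl⟩ := hx
  exact ⟨_, (snoc_barIncl n x a).symm⟩

/-- A form of `word_induction` which remembers the number of letters, as required by the filtration
`hhLength`. -/
theorem length_induction {p : ∀ (n : ℕ) (Y : C.Obj), C.Word X Y → Prop}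
    (hb : ∀ Y (a : C.Hom Y X), p 0 Y (base a))
    (hs : ∀ n Y Z (x : C.Word X Z) (a : C.Hom Y Z), p n Z x → p (n + 1) Y (snoc x a))
    (h0 : ∀ n Y, p n Y 0) (ha : ∀ n Y x y, p n Y x → p n Y y → p n Y (x + y))
    (n : ℕ) (Y : C.Obj) (x : (C.bar n X Y).carrier) : p n Y (barIncl n X Y x) := by
  induction n generalizing Y with
  | zero => simpa [base] using hb Y ((barZero X Y).symm x)
  | succ n ih =>
    refine bar_induction (p := fun x => p (n + 1) Y (barIncl (n + 1) X Y x)) x (fun Z x a => ?_)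
      (by simp only [map_zero]; exact h0 _ _)
      (fun x y hx hy => by simp only [map_add]; exact ha _ _ _ _ hx hy)
    rw [← snoc_barIncl]
    exact hs _ _ _ _ _ (ih Z x)

theorem lmul_barIncl_mem {W : C.Obj} (a : C.Hom X W) (n : ℕ) (x : (C.bar n X Y).carrier) :
    lmul a Y (barIncl n X Y x) ∈ LinearMap.range (barIncl n W Y) := by
  refine length_induction (p := fun n Y x => lmul a Y x ∈ LinearMap.range (barIncl n W Y))
    (fun _ _ => ?_) (fun n _ _ _ _ h => ?_) (fun n _ => ?_) (fun n _ x y hx hy => ?_) n Y x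
  · rw [lmul_base]; exact base_mem_range _
  · rw [lmul_snoc]; exact snoc_mem_range h _
  · rw [map_zero]; exact Submodule.zero_mem _
  · rw [map_add]; exact Submodule.add_mem _ hx hy

theorem wpar_barIncl_mem (n : ℕ) (x : (C.bar n X Y).carrier) :
    wpar Y (barIncl n X Y x) ∈ LinearMap.range (barIncl n X Y) := by
  refine length_induction (p := fun n Y x => wpar Y x ∈ LinearMap.range (barIncl n X Y))
    (fun _ _ => ?_) (fun n _ _ _ _ h => ?_) (fun n _ => ?_) (fun n _ x y hx hy => ?_) n Y x
  · rw [wpar_base]; exact base_mem_range _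
  · rw [wpar_snoc]; exact Submodule.neg_mem _ (snoc_mem_range h _)
  · rw [map_zero]; exact Submodule.zero_mem _
  · rw [map_add]; exact Submodule.add_mem _ hx hy

variable (C) in
/-- The span of the closed words `α₀[α₁|…|αₙ]` with `n < m`. -/
noncomputable def hhLength (m : ℕ) : Submodule Q C.HHSpace :=
  Submodule.span Q {x | ∃ X, ∃ n < m, ∃ w : C.Word X X,
    w ∈ LinearMap.range (barIncl n X X) ∧ x = close X w}

theorem close_mem_hhLength {m n : ℕ} (hn : n < m) {w : C.Word X X}
    (hw : w ∈ LinearMap.range (barIncl n X X)) : close X w ∈ C.hhLength m :=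
  Submodule.subset_span ⟨X, n, hn, w, hw, rfl⟩

/-- The length filtration is increasing and exhaustive, because an element of a direct sum has
finitely many components. -/
theorem exists_mem_hhLength (x : C.HHSpace) : ∃ m, x ∈ C.hhLength m := by
  have mono : ∀ {m m'}, m ≤ m' → C.hhLength m ≤ C.hhLength m' := fun h =>
    Submodule.span_mono fun x ⟨X, n, hn, w⟩ => ⟨X, n, hn.trans_le h, w⟩
  have add : ∀ x y : C.HHSpace, (∃ m, x ∈ C.hhLength m) → (∃ m, y ∈ C.hhLength m) →
      ∃ m, x + y ∈ C.hhLength m := fun x y ⟨m, hm⟩ ⟨n, hn⟩ =>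
    ⟨max m n, Submodule.add_mem _ (mono (le_max_left _ _) hm) (mono (le_max_right _ _) hn)⟩
  refine hh_induction (p := fun x => ∃ m, x ∈ C.hhLength m) x (fun X w => ?_)
    ⟨0, Submodule.zero_mem _⟩ add
  refine word_induction_incl (p := fun w => ∃ m, close X w ∈ C.hhLength m) w
    (fun n w => ⟨n + 1, close_mem_hhLength n.lt_succ_self ⟨w, rfl⟩⟩)
    ⟨0, by rw [map_zero]; exact Submodule.zero_mem _⟩ (fun x y hx hy => ?_)
  rw [map_add]
  exact add _ _ hx hy

/-- The cyclic term multiplies the last letter into the first, which costs one letter; on a word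
with no letter between the brackets it is zero. This is why homotopies compatible with `wd` alone
suffice modulo shorter words. -/
theorem wrap_mem_hhLength {m n : ℕ} (hn : n < m + 1) {w : C.Word X X}
    (hw : w ∈ LinearMap.range (barIncl n X X)) : wrap X w ∈ C.hhLength m := by
  obtain ⟨w, rfl⟩ := hw
  cases n with
  | zero =>
    have : wrap X (base ((barZero X X).symm w)) = 0 := wrap_base _
    simp only [base, LinearMap.comp_apply, LinearEquiv.coe_coe, LinearEquiv.apply_symm_apply] at this
    rw [this]
    exact Submodule.zero_mem _
  | succ n =>
    refine bar_induction (p := fun x => wrap X (barIncl (n + 1) X X x) ∈ C.hhLength m) w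
      (fun Z x a => ?_) (by simp only [map_zero]; exact Submodule.zero_mem _)
      (fun x y hx hy => by simp only [map_add]; exact Submodule.add_mem _ hx hy)
    rw [← snoc_barIncl, wrap_snoc, cyc_apply]
    obtain ⟨y, hy⟩ := wpar_barIncl_mem n x
    refine Submodule.neg_mem _ (close_mem_hhLength (Nat.lt_of_succ_lt_succ hn)
      (Submodule.add_mem _ (lmul_barIncl_mem _ _ _) ?_))
    rw [← hy]
    exact lmul_barIncl_mem _ _ _

end Length

variable [CharZero k] {C : DGCat k Q}

/-- If a power of `a` annihilates every object of `C` up to homotopy, then the homology of the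
Hochschild complex of `C` is `a`-power torsion. -/
theorem mem_torsionIdeal_HH (a : Q)
    (h : ∀ X : C.Obj, ∃ (n : ℕ) (h : C.Hom X X), C.par h = -h ∧ C.d h = a ^ n • C.one X) :
    a ∈ torsionIdeal (HH C) := by
  choose n h hp hd using h
  -- A null-homotopy of a^N on every object X with n X ≤ N. The exponents n X may be unbounded over
  -- all objects, so the value 0 is used at the others. A given element involves finitely many
  -- objects, hence is not affected for large N.
  let t : ℕ → ∀ X : C.Obj, C.Hom X X := fun N X => if n X ≤ N then a ^ (N - n X) • h X else 0
  let T : ℕ → C.HHSpace →ₗ[Q] C.HHSpace := fun N => hhLift fun X => close X ∘ₗ lmul (t N X) X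
  have hT : ∀ N X (w : C.Word X X), T N (close X w) = close X (lmul (t N X) X w) := fun N X w => by
    simp only [T, hhLift_close, LinearMap.comp_apply]
  have tp : ∀ N X, C.par (t N X) = -t N X := fun N X => by
    by_cases hN : n X ≤ N
    · simp only [t, if_pos hN, map_smul, hp, smul_neg]
    · simp only [t, if_neg hN, map_zero, neg_zero]
  have td : ∀ N X, n X ≤ N → C.d (t N X) = a ^ N • C.one X := fun N X hN => by
    simp only [t, if_pos hN, map_smul, hd, smul_smul, ← pow_add, Nat.sub_add_cancel hN]
  have T_mem : ∀ N m, ∀ x ∈ C.hhLength m, T N x ∈ C.hhLength m := fun N m x hx => by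
    refine Submodule.span_induction ?_ ?_ (fun x y _ _ hx hy => ?_) (fun c x _ hx => ?_) hx
    · rintro _ ⟨X, j, hj, _, ⟨w, rfl⟩, rfl⟩
      rw [hT]
      exact close_mem_hhLength hj (lmul_barIncl_mem _ _ _)
    · rw [map_zero]; exact Submodule.zero_mem _
    · rw [map_add]; exact Submodule.add_mem _ hx hy
    · rw [map_smul]; exact Submodule.smul_mem _ _ hx
  have lone : ∀ (X Y : C.Obj) (w : C.Word X Y), lmul (C.one X) Y w = w := fun X Y w => by
    refine word_induction (p := fun Y w => lmul (C.one X) Y w = w) w (fun _ _ => by simp)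
      (fun _ _ x c h => by simp [h]) (fun _ => by simp) fun _ x y hx hy => ?_
    simp only [map_add, hx, hy]
  -- For large N, left multiplication of α₀ by `t N` is a null-homotopy of a^N up to words with
  -- fewer letters.
  have key : ∀ m, ∀ x ∈ C.hhLength (m + 1), ∃ N₀, ∀ N ≥ N₀,
      hhD C (T N x) + T N (hhD C x) - a ^ N • x ∈ C.hhLength m := fun m x hx => by
    refine Submodule.span_induction ?_ ?_ (fun x y _ _ hx hy => ?_) (fun c x _ hx => ?_) hx
    · rintro _ ⟨X, j, hj, _, ⟨w, rfl⟩, rfl⟩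
      refine ⟨n X, fun N hN => ?_⟩
      -- For the part `wd` of the differential, which is a derivation for left multiplication, the
      -- homotopy identity is exact. Only the two cyclic terms survive, and these are shorter.
      have e : hhD C (T N (close X (barIncl j X X w))) + T N (hhD C (close X (barIncl j X X w))) -
          a ^ N • close X (barIncl j X X w) = wrap X (lmul (t N X) X (barIncl j X X w)) +
            T N (wrap X (barIncl j X X w)) := by
        rw [hT, hhD_close, hhD_close, map_add (T N), hT, wd_lmul, td N X hN, tp, lmul_neg, lmul_smul,
          lone, map_add, map_neg, map_smul]
        abel
      rw [e]
      exact Submodule.add_mem _ (wrap_mem_hhLength hj (lmul_barIncl_mem _ _ _))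
        (T_mem _ _ _ (wrap_mem_hhLength hj ⟨w, rfl⟩))
    · refine ⟨0, fun N _ => ?_⟩
      simp only [map_zero, smul_zero, sub_zero, add_zero]
      exact Submodule.zero_mem _
    · obtain ⟨M, hM⟩ := hx
      obtain ⟨M', hM'⟩ := hy
      refine ⟨max M M', fun N hN => ?_⟩
      have := Submodule.add_mem _ (hM N (le_trans (le_max_left _ _) hN))
        (hM' N (le_trans (le_max_right _ _) hN))
      convert this using 1
      simp only [map_add, smul_add]
      abel
    · obtain ⟨M, hM⟩ := hx
      refine ⟨M, fun N hN => ?_⟩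
      have := Submodule.smul_mem _ c (hM N hN)
      convert this using 1
      simp only [map_smul, smul_add, smul_sub]
      rw [smul_comm]
  have main : ∀ m, ∀ x ∈ C.hhLength m, hhD C x = 0 → ∃ n y, hhD C y = a ^ n • x := by
    intro m
    induction m with
    | zero =>
      intro x hx _
      have : C.hhLength 0 = ⊥ := by
        refine Submodule.span_eq_bot.2 ?_
        rintro x ⟨X, n, hn, -⟩
        exact absurd hn (Nat.not_lt_zero _)
      rw [this, Submodule.mem_bot] at hx
      exact ⟨0, 0, by rw [hx, map_zero, smul_zero]⟩
    | succ m ih =>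
      intro x hx hdx
      obtain ⟨N, hN⟩ := key m x hx
      have h1 := hN N le_rfl
      rw [hdx, map_zero, add_zero] at h1
      -- The defect d(Tx) - a^N x is itself a cycle, of smaller length, so by induction a^j times it
      -- is the boundary of some y. Hence a^(j+N) x is the boundary of a^j Tx - y.
      obtain ⟨j, y, hy⟩ := ih _ h1 (by rw [map_sub, hhD_hhD, map_smul, hdx, smul_zero, sub_zero])
      refine ⟨j + N, a ^ j • T N x - y, ?_⟩
      rw [map_sub, map_smul, hy, smul_sub, sub_sub_cancel, smul_smul, pow_add]
  refine mem_torsionIdeal.2 fun x hx => ?_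
  obtain ⟨m, hm⟩ := exists_mem_hhLength x
  exact main m x hm hx

end DGCat

namespace MF

variable {f : Q}

/-- The ideal of those `s` for which multiplication by `s` on `X` is null-homotopic. -/
def nullIdeal (X : MF k Q f) : Ideal Q where
  carrier := {s | ∃ h, hpar X X h = -h ∧ hd X X h = s • LinearMap.id}
  zero_mem' := ⟨0, by rw [map_zero, neg_zero], by rw [map_zero, zero_smul]⟩
  add_mem' := by
    rintro s t ⟨h, h1, h2⟩ ⟨l, l1, l2⟩
    exact ⟨h + l, by rw [map_add, h1, l1, neg_add], by rw [map_add, h2, l2, add_smul]⟩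
  smul_mem' := by
    rintro c s ⟨h, h1, h2⟩
    exact ⟨c • h, by rw [map_smul, h1, smul_neg], by rw [map_smul, h2, smul_smul, smul_eq_mul]⟩

/-- Otherwise some prime contains the null ideal but not `a`. It lies outside the support, so X is
contractible there, and clearing denominators in a contraction gives an element outside this prime
which is null-homotopic on X, a contradiction. -/
theorem mem_radical_nullIdeal (X : MF k Q f) {a : Q} (ha : X.supp ⊆ PrimeSpectrum.zeroLocus {a}) :
    a ∈ X.nullIdeal.radical := by
  rw [← PrimeSpectrum.vanishingIdeal_zeroLocus_eq_radical, PrimeSpectrum.mem_vanishingIdeal]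
  intro p hp
  by_contra hap
  have hc : X.ContractibleAt p := by
    by_contra hc
    exact hap (ha hc rfl)
  -- This is where finite generation and projectivity enter: the contraction over the local ring
  -- comes, up to a factor outside p, from an endomorphism of X.
  obtain ⟨s, hs, h, h1, h2⟩ := X.exists_of_contractibleAt p hc
  have h3 : hpar X X h = -h := LinearMap.ext fun x => by
    rw [hpar_apply, h1, map_neg, X.par_par, LinearMap.neg_apply]
  refine hs (hp ⟨h, h3, LinearMap.ext fun x => ?_⟩)
  rw [hd_apply, h3, LinearMap.neg_apply, sub_neg_eq_add, h2]
  rfl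

/-- Each object has support inside the zero locus of `a`, so a power of `a` is null-homotopic on it.
The exponent depends on the object, which `DGCat.mem_torsionIdeal_HH` permits. -/
theorem mem_torsionIdeal_HH_dg [CharZero k] {Z : Set (PrimeSpectrum Q)} {s : List Q}
    (hs : PrimeSpectrum.zeroLocus {x | x ∈ s} = Z) :
    ∀ a ∈ s, a ∈ torsionIdeal (DGCat.HH (dg k Q f Z)) := fun a ha =>
  DGCat.mem_torsionIdeal_HH a fun X => by
    obtain ⟨n, h, h1, h2⟩ := mem_radical_nullIdeal X.1 (a := a) fun p hp => by
      have h := X.2 hp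
      rw [← hs] at h
      exact Set.singleton_subset_iff.2 (h ha)
    exact ⟨n, h, h1, h2⟩

end MF

end HochschildTorsion

/-! ### Functoriality of the Hochschild complex and invariance under natural isomorphism. -/

section HochschildFunctoriality

variable {k Q R : Type u} [Field k] [CommRing Q] [Algebra k Q] [CommRing R] [Algebra k R]

namespace DGCat

/-- A `Q`-linear dg-functor. -/
structure Functor (C D : DGCat k Q) where
  obj : C.Obj → D.Obj
  map : ∀ {X Y}, C.Hom X Y →ₗ[Q] D.Hom (obj X) (obj Y)
  map_one : ∀ X, map (C.one X) = D.one (obj X)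
  map_comp : ∀ {X Y Z} (a : C.Hom Y Z) (b : C.Hom X Y), map (C.comp a b) = D.comp (map a) (map b)
  par_map : ∀ {X Y} (a : C.Hom X Y), D.par (map a) = map (C.par a)
  d_map : ∀ {X Y} (a : C.Hom X Y), D.d (map a) = map (C.d a)

namespace Functor

variable {C D : DGCat k Q} (F : Functor C D)

theorem map_ksmul {X Y : C.Obj} (c : k) (a : C.Hom X Y) : F.map (c • a) = c • F.map a :=
  LinearMap.map_smul_of_tower _ _ _

/-- The map induced on words. -/
noncomputable def word {X : C.Obj} (Y : C.Obj) : C.Word X Y →ₗ[Q] D.Word (F.obj X) (F.obj Y) :=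
  elim (N := fun Y => D.Word (F.obj X) (F.obj Y)) (fun _ => base ∘ₗ F.map)
    (fun _ _ => LinearMap.mk₂' Q k (fun p a => snoc p.2 (F.map a))
      (fun _ _ _ => by simp) (fun _ _ _ => by simp) (fun _ _ _ => by simp)
      (fun c _ _ => by rw [map_ksmul, map_smul])) Y

@[simp] theorem word_base {X Y : C.Obj} (a : C.Hom Y X) : F.word Y (base a) = base (F.map a) := by
  simp [word]

@[simp] theorem word_snoc {X Y Z : C.Obj} (x : C.Word X Z) (a : C.Hom Y Z) :
    F.word Y (snoc x a) = snoc (F.word Z x) (F.map a) := by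
  simp [word]

variable {X Y Z : C.Obj}

theorem word_wpar (x : C.Word X Y) : F.word Y (wpar Y x) = wpar _ (F.word Y x) := by
  refine word_induction (p := fun Y x => F.word Y (wpar Y x) = wpar _ (F.word Y x)) x
    (fun _ _ => by simp [F.par_map]) (fun _ _ x c h => by simp [h, F.par_map]) (fun _ => by simp)
    fun _ x y hx hy => ?_
  simp only [map_add, hx, hy]

theorem word_merge (x : C.Word X Z) (a : C.Hom Y Z) :
    F.word Y (merge Z x a) = merge _ (F.word Z x) (F.map a) := by
  refine word_cases (p := fun x => F.word Y (merge Z x a) = merge _ (F.word Z x) (F.map a)) x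
    (fun _ => by simp [F.map_comp]) (fun _ x c => by simp [F.map_comp]) (by simp)
    fun x y hx hy => ?_
  simp only [map_add, LinearMap.add_apply, hx, hy]

theorem word_lmul {W : C.Obj} (a : C.Hom X W) (x : C.Word X Y) :
    F.word Y (lmul a Y x) = lmul (F.map a) _ (F.word Y x) := by
  refine word_induction (p := fun Y x => F.word Y (lmul a Y x) = lmul (F.map a) _ (F.word Y x)) x
    (fun _ _ => by simp [F.map_comp]) (fun _ _ x c h => by simp [h]) (fun _ => by simp)
    fun _ x y hx hy => ?_
  simp only [map_add, hx, hy]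

theorem word_wd (x : C.Word X Y) : F.word Y (wd Y x) = wd _ (F.word Y x) := by
  refine word_induction (p := fun Y x => F.word Y (wd Y x) = wd _ (F.word Y x)) x
    (fun _ _ => by simp [F.d_map])
    (fun _ _ x c h => by simp [h, F.d_map, word_merge, word_wpar]) (fun _ => by simp)
    fun _ x y hx hy => ?_
  simp only [map_add, hx, hy]

theorem map_ev (a : C.Hom X Y) : F.map (C.ev a) = D.ev (F.map a) := by
  simp [ev, F.par_map]

theorem map_od (a : C.Hom X Y) : F.map (C.od a) = D.od (F.map a) := by
  simp [od, F.par_map]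

/-- The map induced on Hochschild spaces. -/
noncomputable def hhLin : C.HHSpace →ₗ[Q] D.HHSpace :=
  hhLift fun X => close (F.obj X) ∘ₗ F.word X

@[simp] theorem hhLin_close (x : C.Word X X) :
    F.hhLin (close X x) = close (F.obj X) (F.word X x) := by simp [hhLin]

theorem hhLin_wrap (x : C.Word X X) : F.hhLin (wrap X x) = wrap _ (F.word X x) := by
  refine word_cases (p := fun x => F.hhLin (wrap X x) = wrap _ (F.word X x)) x (fun a => by simp)
    (fun Z x a => ?_) (by simp) (fun x y hx hy => by simp only [map_add, hx, hy])
  simp only [wrap_snoc, map_neg, hhLin_close, word_snoc, cyc_apply, map_add, word_lmul, map_ev,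
    map_od, word_wpar]

/-- The morphism of Hochschild complexes induced by a dg-functor. -/
noncomputable def hhMap [CharZero k] : HH C ⟶ HH D where
  toLin := F.hhLin
  map_par x := by
    refine hh_induction (p := fun x => F.hhLin (hhPar C x) = hhPar D (F.hhLin x)) x
      (fun X x => by simp [word_wpar]) (by simp) (fun x y hx hy => by simp only [map_add, hx, hy])
  map_d x := by
    refine hh_induction (p := fun x => F.hhLin (hhD C x) = hhD D (F.hhLin x)) x
      (fun X x => by simp [word_wd, hhLin_wrap]) (by simp)
      (fun x y hx hy => by simp only [map_add, hx, hy])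

end Functor

section Homotopy

variable {C : DGCat k Q} (G : Functor C C) (η : ∀ X, C.Hom X (G.obj X))
  (θ : ∀ X, C.Hom (G.obj X) X)

/-- The sum of all insertions of a letter `θ` in a word: `α₀[α₁|…|αₙ]` is sent to
`∑ ± α₀[α₁|…|αᵢ|θ|Gαᵢ₊₁|…|Gαₙ]`. -/
noncomputable def insertWord {X : C.Obj} (Y : C.Obj) : C.Word X Y →ₗ[Q] C.Word X (G.obj Y) :=
  elim (N := fun Y => C.Word X (G.obj Y))
    (fun Y => snoc.flip (θ Y) ∘ₗ base ∘ₗ C.par)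
    (fun Y _ => LinearMap.mk₂' Q k
      (fun p a => snoc p.2 (G.map a) - snoc (snoc (wpar _ p.1) (C.par a)) (θ Y))
      (fun _ _ _ => by simp only [map_add, Prod.fst_add, Prod.snd_add, LinearMap.add_apply]; abel)
      (fun _ _ _ => by simp [smul_sub])
      (fun _ _ _ => by simp only [map_add, LinearMap.add_apply]; abel)
      (fun c _ _ => by
        rw [G.map_ksmul, LinearMap.map_smul_of_tower C.par, map_smul, map_smul,
          LinearMap.map_smul_of_tower snoc, LinearMap.smul_apply, smul_sub])) Y

@[simp] theorem insertWord_base {X Y : C.Obj} (a : C.Hom Y X) :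
    insertWord G θ Y (base a) = snoc (wpar Y (base a)) (θ Y) := by
  simp [insertWord]

theorem insertWord_snoc {X Y Z : C.Obj} (x : C.Word X Z) (a : C.Hom Y Z) :
    insertWord G θ Y (snoc x a) = snoc (insertWord G θ Z x) (G.map a) +
      snoc (wpar Y (snoc x a)) (θ Y) := by
  simp [insertWord, sub_eq_add_neg]

variable {G η θ} {X Y Z : C.Obj}

theorem wpar_insertWord (pθ : ∀ X, C.par (θ X) = θ X) (x : C.Word X Y) :
    wpar _ (insertWord G θ Y x) = -insertWord G θ Y (wpar Y x) := by
  refine word_induction (p := fun Y x =>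
    wpar _ (insertWord G θ Y x) = -insertWord G θ Y (wpar Y x)) x
    (fun _ _ => by simp [pθ]) (fun _ _ x c h => ?_) (fun _ => by simp) fun _ x y hx hy => ?_
  · simp only [insertWord_snoc, map_add, wpar_snoc, h, pθ, G.par_map, map_neg, LinearMap.neg_apply,
      wpar_wpar]
    abel
  · simp only [map_add, hx, hy, neg_add]

theorem insertWord_lmul {W : C.Obj} (b : C.Hom X W) (x : C.Word X Y) :
    insertWord G θ Y (lmul b Y x) = lmul (C.par b) _ (insertWord G θ Y x) := by
  refine word_induction (p := fun Y x =>
    insertWord G θ Y (lmul b Y x) = lmul (C.par b) _ (insertWord G θ Y x)) x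
    (fun _ _ => by simp [C.par_comp]) (fun _ _ x c h => ?_) (fun _ => by simp) fun _ x y hx hy => ?_
  · simp only [insertWord_snoc, lmul_snoc, map_add, h, lmul_wpar, wpar_snoc, map_neg,
      LinearMap.neg_apply]
  · simp only [map_add, hx, hy]

/-- Merging before or after the insertion gives different boundary terms. If θ was inserted after
the last letter of `y`, merging joins it with G(a), and θ G(a) = a θ leaves a term which is no
insertion and is subtracted. The insertion at the very end of the merged word is missing and is
added. -/
theorem insertWord_merge (hθ : ∀ {Y Z} (a : C.Hom Y Z), C.comp (θ Z) (G.map a) = C.comp a (θ Y))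
    (y : C.Word X Z) (a : C.Hom Y Z) : insertWord G θ Y (merge Z y a) =
      merge _ (insertWord G θ Z y) (G.map a) + snoc (wpar Y (merge Z y a)) (θ Y) -
        snoc (wpar Z y) (C.comp a (θ Y)) := by
  refine word_cases (p := fun y => insertWord G θ Y (merge Z y a) =
      merge _ (insertWord G θ Z y) (G.map a) + snoc (wpar Y (merge Z y a)) (θ Y) -
        snoc (wpar Z y) (C.comp a (θ Y))) y
    (fun _ => ?_) (fun _ x c => ?_) (by simp) fun x y hx hy => ?_
  · simp only [merge_base, insertWord_base, merge_snoc, hθ]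
    abel
  · simp only [merge_snoc, insertWord_snoc, map_add, LinearMap.add_apply, hθ, G.map_comp]
    abel
  · simp only [map_add, LinearMap.add_apply, hx, hy]; abel

/-- The products of an inserted θ with its left and with its right neighbour cancel telescopically,
by the naturality of θ. Only the insertion next to α₀ leaves a term, namely α₀θ[Gα₁|…|Gαₙ], and η α₀
θ = G(α₀) turns it into the image of the word under G. -/
theorem lmul_insertWord_wd [CharZero k] (pθ : ∀ X, C.par (θ X) = θ X) (dθ : ∀ X, C.d (θ X) = 0)
    (hθ : ∀ {Y Z} (a : C.Hom Y Z), C.comp (θ Z) (G.map a) = C.comp a (θ Y))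
    (hη : ∀ {Y Z} (a : C.Hom Y Z), C.comp (η Z) (C.comp a (θ Y)) = G.map a)
    (x : C.Word X Y) : lmul (η X) _ (wd _ (insertWord G θ Y x) + insertWord G θ Y (wd Y x)) =
      G.word Y x := by
  refine word_induction (p := fun Y x =>
    lmul (η X) _ (wd _ (insertWord G θ Y x) + insertWord G θ Y (wd Y x)) = G.word Y x) x
    (fun _ _ => ?_) (fun Y Z x a h => ?_) (fun _ => by simp) fun _ x y hx hy => ?_
  · simp [dθ, C.d_par, hη]
  · have e : wd _ (insertWord G θ Y (snoc x a)) + insertWord G θ Y (wd Y (snoc x a)) =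
        snoc (wd _ (insertWord G θ Z x) + insertWord G θ Z (wd Z x)) (G.map a) := by
      simp only [insertWord_snoc, map_add, wd_snoc, map_sub, wd_wpar, insertWord_merge hθ, dθ,
        map_zero, wpar_insertWord pθ, wpar_snoc, wpar_wpar, merge_wpar, LinearMap.add_apply,
        map_neg, LinearMap.neg_apply, G.d_map, C.d_par, LinearMap.sub_apply, merge_snoc, wd_wpar,
        C.par_par]
      abel
    rw [e, lmul_snoc, h, G.word_snoc]
  · simp only [map_add] at hx hy ⊢
    rw [← hx, ← hy]
    abel

/-- The cyclic term brings a θ inserted at the end to the front, where θ η = 1 restores the original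
word. For the other insertions it brings some G(a) to the front; since G(a) η = η a, these terms
cancel against the insertions in the cyclic term of x. -/
theorem wrap_lmul_insertWord [CharZero k] (pη : ∀ X, C.par (η X) = η X)
    (pθ : ∀ X, C.par (θ X) = θ X) (hc : ∀ X, C.comp (θ X) (η X) = C.one X)
    (hη : ∀ {Y Z} (a : C.Hom Y Z), C.comp (G.map a) (η Y) = C.comp (η Z) a) (x : C.Word X X) :
    wrap _ (lmul (η X) _ (insertWord G θ X x)) +
      hhLift (fun X => close (G.obj X) ∘ₗ lmul (η X) _ ∘ₗ insertWord G θ X) (wrap X x) =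
        -close X x := by
  have lone : ∀ (X Y : C.Obj) (w : C.Word X Y), lmul (C.one X) Y w = w := fun X Y w => by
    refine word_induction (p := fun Y w => lmul (C.one X) Y w = w) w (fun _ _ => by simp)
      (fun _ _ x c h => by simp [h]) (fun _ => by simp) fun _ x y hx hy => ?_
    simp only [map_add, hx, hy]
  -- The letter θ is even, so its cyclic move carries the full sign of the word; this cancels the
  -- sign operator in `insertWord`.
  have hθ : ∀ {Y : C.Obj} (w : C.Word X Y), cyc (lmul (η X) Y (wpar Y w)) (θ X) = w := fun w => by
    rw [cyc_apply, ev_of_par (pθ X), od_of_par (pθ X), lmul_zero, zero_add, lmul_wpar, wpar_wpar,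
      lmul_lmul, pη, hc, lone]
  refine word_cases (p := fun x => wrap _ (lmul (η X) _ (insertWord G θ X x)) +
      hhLift (fun X => close (G.obj X) ∘ₗ lmul (η X) _ ∘ₗ insertWord G θ X) (wrap X x) =
        -close X x) x (fun a => ?_) (fun Z y a => ?_) (by simp) fun x y hx hy => ?_
  · rw [insertWord_base, lmul_snoc, wrap_snoc, hθ, wrap_base, map_zero, add_zero]
  · have e : cyc (lmul (η X) _ (insertWord G θ Z y)) (G.map a) =
        -lmul (η Z) _ (insertWord G θ Z (cyc y a)) := by
      rw [cyc_apply, cyc_apply, map_add, insertWord_lmul, insertWord_lmul, par_od, par_ev, lmul_wpar,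
        lmul_neg, lmul_lmul, lmul_lmul, pη, wpar_insertWord pθ, map_add, map_neg, map_neg, lmul_lmul,
        lmul_lmul, ← G.map_od, ← G.map_ev, hη, hη, neg_add, neg_neg]
    rw [insertWord_snoc, map_add, map_add, lmul_snoc, lmul_snoc, wrap_snoc, wrap_snoc, hθ, e,
      wrap_snoc, map_neg, map_neg, neg_neg, hhLift_close]
    simp only [LinearMap.comp_apply]
    abel
  · simp only [map_add, neg_add] at hx hy ⊢
    rw [← hx, ← hy]
    abel

/-- An endofunctor isomorphic to the identity induces the identity of the Hochschild complex in
the derived category. -/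
theorem toD_map_hhMap_eq_id [CharZero k] (pη : ∀ X, C.par (η X) = η X) (dη : ∀ X, C.d (η X) = 0)
    (pθ : ∀ X, C.par (θ X) = θ X) (dθ : ∀ X, C.d (θ X) = 0)
    (hc : ∀ X, C.comp (θ X) (η X) = C.one X)
    (hG : ∀ {Y Z} (a : C.Hom Y Z), G.map a = C.comp (η Z) (C.comp a (θ Y))) :
    (toD k Q).map G.hhMap = 𝟙 _ := by
  -- Both naturality relations follow from G(a) = η a θ and θ η = 1. The composite η θ plays no
  -- role.
  have h1 : ∀ {Y Z} (a : C.Hom Y Z), C.comp (θ Z) (G.map a) = C.comp a (θ Y) := fun a => by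
    rw [hG, ← C.comp_assoc, hc, C.one_comp]
  have h2 : ∀ {Y Z} (a : C.Hom Y Z), C.comp (G.map a) (η Y) = C.comp (η Z) a := fun a => by
    rw [hG, C.comp_assoc, C.comp_assoc, hc, C.comp_one]
  -- The homotopy inserts θ in all positions and multiplies α₀ by η. Its anticommutator with `wd`
  -- gives the map induced by G, and with the cyclic term it gives minus the identity.
  refine Eq.trans (toD_map_eq_of_homotopy G.hhMap (𝟙 (HH C)) (hhLift (C := C)
    fun X => close (G.obj X) ∘ₗ lmul (η X) _ ∘ₗ insertWord G θ X) (fun x => ?_) (fun x => ?_))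
    ((toD k Q).map_id _)
  · refine hh_induction (p := fun x => hhLift (C := C)
      (fun X => close (G.obj X) ∘ₗ lmul (η X) _ ∘ₗ insertWord G θ X) (hhPar C x) = -hhPar C (hhLift
      (fun X => close (G.obj X) ∘ₗ lmul (η X) _ ∘ₗ insertWord G θ X) x)) x (fun X x => ?_) (by simp)
      (fun x y hx hy => by simp only [map_add, hx, hy, neg_add])
    simp only [hhPar_close, hhLift_close, LinearMap.comp_apply, lmul_wpar, wpar_insertWord pθ, pη,
      map_neg, neg_neg]
  · refine hh_induction (p := fun x => hhD C (hhLift (C := C)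
      (fun X => close (G.obj X) ∘ₗ lmul (η X) _ ∘ₗ insertWord G θ X) x) + (hhLift
      (fun X => close (G.obj X) ∘ₗ lmul (η X) _ ∘ₗ insertWord G θ X) (hhD C x)) =
        G.hhLin x - x) x (fun X x => ?_) (by simp) (fun x y hx hy => ?_)
    · have e1 := wrap_lmul_insertWord (G := G) pη pθ hc h2 x
      have e2 := lmul_insertWord_wd (η := η) pθ dθ h1 (fun a => (hG a).symm) x
      rw [hhLift_close, hhD_close, LinearMap.comp_apply, LinearMap.comp_apply, hhD_close, map_add,
        hhLift_close, LinearMap.comp_apply, LinearMap.comp_apply, Functor.hhLin_close, ← e2, wd_lmul,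
        dη, pη, lmul_zero, zero_add, sub_eq_add_neg, ← e1, map_add, map_add]
      abel
    · simp only [map_add] at hx hy ⊢
      rw [add_sub_add_comm, ← hx, ← hy]
      abel

end Homotopy

namespace Pairing

variable {C : DGCat k Q} {D : DGCat k R} {E E' : DGCat k (Q ⊗[k] R)}

/-- The composite of a dg-bifunctor and a dg-functor. -/
noncomputable def comp (Φ : Pairing C D E) (F : Functor E E') : Pairing C D E' where
  obj X Y := F.obj (Φ.obj X Y)
  map := Φ.map.compr₂ (F.map.restrictScalars k)
  map_one X Y := (congrArg F.map (Φ.map_one X Y)).trans (F.map_one _)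
  smul_map q r a b := (congrArg F.map (Φ.smul_map q r a b)).trans (map_smul _ _ _)
  par_map a b := (F.par_map _).trans (congrArg F.map (Φ.par_map a b))
  d_map a b := ((F.d_map _).trans (congrArg F.map (Φ.d_map a b))).trans (map_add _ _ _)
  comp_map a b a' b' := ((F.map_comp _ _).symm.trans (congrArg F.map (Φ.comp_map a b a' b'))).trans
    (map_add _ _ _)

variable (Φ : Pairing C D E) (F : Functor E E')

/-- The shuffles and their signs involve only the parities of the letters, which a dg-functor
preserves. -/
theorem word_sh {X X' : C.Obj} {Y Y' : D.Obj} (x : C.Word X X') (y : D.Word Y Y') :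
    F.word _ (Φ.sh X' x Y' y) = (Φ.comp F).sh X' x Y' y := by
  refine word_induction (p := fun X' x => ∀ Y' (y : D.Word Y Y'),
    F.word _ (Φ.sh X' x Y' y) = (Φ.comp F).sh X' x Y' y) x
    (fun X' c Y' y => ?_) (fun X' Z x c ih Y' y => ?_) (fun _ _ _ => by simp; rfl)
    (fun _ x x' hx hx' Y' y => ?_) Y' y
  · rw [sh_base, sh_base]
    refine word_induction (p := fun Y' y =>
      F.word _ (Φ.shBase c Y' y) = (Φ.comp F).shBase c Y' y) y
      (fun Y' d => ?_) (fun Y' V y d ih => ?_) (fun _ => by simp; rfl) (fun _ y y' hy hy' => ?_)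
    · rw [shBase_base, shBase_base, Functor.word_base]; rfl
    · rw [shBase_snoc, shBase_snoc, Functor.word_snoc, ih]; rfl
    · simp only [map_add, hy, hy']; rfl
  · refine word_induction (p := fun Y' y =>
      F.word _ (Φ.sh X' (snoc x c) Y' y) = (Φ.comp F).sh X' (snoc x c) Y' y) y
      (fun Y' d => ?_) (fun Y' V y d ih' => ?_) (fun _ => by simp; rfl) (fun _ y y' hy hy' => ?_)
    · rw [sh_snoc_base, sh_snoc_base, map_add, Functor.word_snoc, Functor.word_snoc, ih, ih]; rfl
    · rw [sh_snoc_snoc, sh_snoc_snoc, map_add, map_add, Functor.word_snoc, Functor.word_snoc,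
        Functor.word_snoc, ih, ih, ih']; rfl
    · simp only [map_add, hy, hy']; rfl
  · simp only [map_add, Pi.add_apply, LinearMap.add_apply, hx, hx']; rfl

/-- This is used with functors that attach or replace connections, to compare bifunctors which
differ only in the connection of their values. -/
theorem kunneth_comp [CharZero k] : Φ.kunneth ≫ F.hhMap = (Φ.comp F).kunneth := by
  ext z
  induction z using SCpx.tensor_induction with
  | zero => rw [map_zero, map_zero]
  | add x y hx hy => rw [map_add, map_add, hx, hy]
  | tmul m n =>
    change F.hhLin (Φ.kun m n) = (Φ.comp F).kun m n
    refine hh_induction₂ (p := fun m n => F.hhLin (Φ.kun m n) = (Φ.comp F).kun m n) m n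
      (fun X x Y y => ?_) (fun _ => by simp) (fun _ => by simp)
      (fun x x' y h h' => ?_) (fun x y y' h h' => ?_)
    · rw [kun_close, kun_close, Functor.hhLin_close, word_sh]; rfl
    · simp only [map_add, LinearMap.add_apply, h, h']
    · simp only [map_add, h, h']

end Pairing

end DGCat

end HochschildFunctoriality

/-! ### The HKR map when each index carries a matrix factorization and a connection. -/

section HKRWithConnections

set_option linter.unusedSectionVars false

open KaehlerDifferential DGCat

variable {k Q : Type u} [Field k] [CommRing Q] [Algebra k Q] {f : Q}

namespace MF

/-- The dg-category with objects indexed by `T`, the object `t` being a matrix factorization `o t`. -/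
noncomputable def dgOn {T : Type (u + 1)} (o : T → MF k Q f) : DGCat k Q where
  Obj := T
  Hom X Y := (o X).P →ₗ[Q] (o Y).P
  one X := LinearMap.id
  comp {X Y Z} := LinearMap.llcomp Q (o X).P (o Y).P (o Z).P
  par {X Y} := hpar (o X) (o Y)
  d {X Y} := hd (o X) (o Y)
  one_comp _ := rfl
  comp_one _ := rfl
  comp_assoc _ _ _ := rfl
  par_par a := by ext; simp
  par_one X := by ext; simp
  par_comp a b := by ext; simp
  d_par a := by ext; simp [MF.δ_par]; abel
  d_d a := by ext; simp [MF.δ_par]; abel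
  d_comp a b := by ext; simp

namespace Indexed

variable {T : Type (u + 1)} {o : T → MF k Q f} (c : ∀ t, (o t).Connection)

variable {X Y Z' : (dgOn o).Obj}

/-- The terms of the HKR map before applying the supertrace: `word c Y (α₀[α₁|…|αₙ])` is the sequence
`N ↦ ∑_{n + i₀ + ⋯ + iₙ = N} (-1)^(i₀ + ⋯ + iₙ) α₀ (δ₁')^i₀ α₁' ⋯ (δₙ')^iₙ₋₁ αₙ' (δ_Y')^iₙ`
of operators on differential forms with coefficients. -/
noncomputable def word {X : (dgOn o).Obj} (Y : (dgOn o).Obj) :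
    (dgOn o).Word X Y →ₗ[Q] (ℕ → ((o Y).V →ₗ[Q] (o X).V)) :=
  elim (N := fun Y : (dgOn o).Obj => ℕ → ((o Y).V →ₗ[Q] (o X).V))
    (fun (Y : (dgOn o).Obj) => LinearMap.pi fun N =>
      LinearMap.lcomp Q (o X).V (S (c Y) ^ N : Module.End Q (o Y).V) ∘ₗ hat (o Y) (o X))
    (fun (Y Z' : (dgOn o).Obj) => app (c Y) (c Z') ∘ₗ LinearMap.snd Q _ _) Y

theorem word_base (a : (o Y).P →ₗ[Q] (o X).P) (N : ℕ) :
    word c Y (base (C := dgOn o) a) N =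
      hat (o Y) (o X) a ∘ₗ (S (c Y) ^ N : Module.End Q (o Y).V) :=
  congrFun (elim_base (C := dgOn o) (N := fun Y : (dgOn o).Obj => ℕ → ((o Y).V →ₗ[Q] (o X).V))
    _ _ a) N

theorem word_base_zero (a : (o Y).P →ₗ[Q] (o X).P) :
    word c Y (base (C := dgOn o) a) 0 = hat (o Y) (o X) a := word_base c a 0

theorem word_base_succ (a : (o Y).P →ₗ[Q] (o X).P) (N : ℕ) :
    word c Y (base (C := dgOn o) a) (N + 1) =
      word c Y (base (C := dgOn o) a) N ∘ₗ S (c Y) := by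
  refine (word_base c a (N + 1)).trans (Eq.trans ?_ (congrArg (fun T => T ∘ₗ S (c Y))
    (word_base c a N)).symm)
  exact congrArg (fun T => hat (o Y) (o X) a ∘ₗ T) (pow_succ (M := Module.End Q (o Y).V) _ _)

theorem word_snoc (x : (dgOn o).Word X Z') (a : (o Y).P →ₗ[Q] (o Z').P) :
    word c Y (snoc (C := dgOn o) x a) = app (c Y) (c Z') (word c Z' x) a :=
  elim_snoc (C := dgOn o) (N := fun Y : (dgOn o).Obj => ℕ → ((o Y).V →ₗ[Q] (o X).V)) _ _ x a

variable [CharZero k]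

/-- The derivative α' has the parity of |α| - 1, which is the degree of α between the brackets, and
the operators `S` are even. Thus the operators of a word have the parity of the word. -/
theorem word_wpar (x : (dgOn o).Word X Y) (N : ℕ) :
    word c Y (wpar Y x) N = opar (o Y) (o X) (word c Y x N) := by
  refine word_induction (p := fun (Y : (dgOn o).Obj) x => ∀ N,
    word c Y (wpar Y x) N = opar (o Y) (o X) (word c Y x N)) x (fun Y a N => ?_)
    (fun Y Z' x a h N => ?_) (fun Y N => ?_) (fun Y x y hx hy N => ?_) N
  · rw [wpar_base]
    change word c Y (base (C := dgOn o) (hpar (o Y) (o X) a)) N = _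
    induction N with
    | zero => exact (word_base_zero c _).trans ((congrArg _ (word_base_zero c a)).trans
        (opar_hat a)).symm
    | succ N ih =>
      refine (word_base_succ c _ N).trans (Eq.trans ?_ (congrArg _ (word_base_succ c a N)).symm)
      rw [opar_comp, opar_S, ← ih]
  · rw [wpar_snoc, map_neg]
    refine Eq.trans (congrArg (fun G => -G) (congrFun (word_snoc c _ _) N))
      (Eq.trans ?_ (congrArg _ (congrFun (word_snoc c x a) N)).symm)
    exact app_opar (c Y) (c Z') h a N
  · rw [map_zero, map_zero]; exact (map_zero (opar (o Y) (o X))).symm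
  · rw [map_add, map_add, map_add, Pi.add_apply, hx, hy]
    exact (map_add (opar (o Y) (o X)) _ _).symm

theorem word_omLin (x : (dgOn o).Word X Y) (N : ℕ) : OmLin (word c Y x N) := by
  refine word_induction (p := fun (Y : (dgOn o).Obj) x => ∀ N, OmLin (word c Y x N)) x
    (fun Y a N => ?_) (fun Y Z' x a h N => ?_) (fun Y N => ?_) (fun Y x y hx hy N => ?_) N
  · induction N with
    | zero => exact (word_base_zero c a).symm ▸ OmLin.hat a
    | succ N ih => exact (word_base_succ c a N).symm ▸ ih.comp (OmLin.S _)
  · exact (congrFun (word_snoc c x a) N).symm ▸ app_omLin _ _ h _ _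
  · rw [map_zero]; exact OmLin.zero
  · rw [map_add]; exact (hx N).add (hy N)


/-- The error term in the compatibility of `word` with the differentials. -/
noncomputable def rem {X : (dgOn o).Obj} (Y : (dgOn o).Obj) :
    (dgOn o).Word X Y →ₗ[Q] (ℕ → ((o Y).V →ₗ[Q] (o X).V)) :=
  elim (N := fun Y : (dgOn o).Obj => ℕ → ((o Y).V →ₗ[Q] (o X).V)) (fun _ => 0)
    (fun (Y Z' : (dgOn o).Obj) => remStep (X := (o X)) (Y := (o Y)) (Z := (o Z')) ∘ₗ word c Z' ∘ₗ
      LinearMap.fst Q _ _) Y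

theorem rem_base (a : (o Y).P →ₗ[Q] (o X).P) : rem c Y (base (C := dgOn o) a) = 0 :=
  elim_base (C := dgOn o) (N := fun Y : (dgOn o).Obj => ℕ → ((o Y).V →ₗ[Q] (o X).V)) _ _ a

theorem rem_snoc (x : (dgOn o).Word X Z') (a : (o Y).P →ₗ[Q] (o Z').P) :
    rem c Y (snoc (C := dgOn o) x a) =
      fun N => opar (o Z') (o X) (word c Z' x N) ∘ₗ hat (o Y) (o Z') a :=
  elim_snoc (C := dgOn o) (N := fun Y : (dgOn o).Obj => ℕ → ((o Y).V →ₗ[Q] (o X).V)) _ _ x a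

/-- In form degree 0 only words without letters between the brackets contribute, and for these the
claim is multiplicativity of the action of morphisms. Otherwise both sides vanish. -/
theorem word_merge_zero (x : (dgOn o).Word X Z') (a : (dgOn o).Hom Y Z') :
    word c Y (merge (C := dgOn o) Z' x a) 0 = word c Z' x 0 ∘ₗ hat (o Y) (o Z') a := by
  refine word_cases (p := fun x => word c Y (merge (C := dgOn o) Z' x a) 0 =
    word c Z' x 0 ∘ₗ hat (o Y) (o Z') a) x (fun b => ?_) (fun W x b => ?_) ?_ (fun x y hx hy => ?_)
  · rw [merge_base]
    refine (word_base_zero c _).trans (Eq.trans (hat_comp b a) ?_)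
    exact congrArg (fun T => T ∘ₗ hat (o Y) (o Z') a) (word_base_zero c b).symm
  · rw [merge_snoc]
    refine (congrFun (word_snoc c x _) 0).trans (Eq.trans ?_
      (congrArg (fun T => T ∘ₗ hat (o Y) (o Z') a) (congrFun (word_snoc c x b) 0)).symm)
    exact (LinearMap.zero_comp _).symm
  · rw [map_zero, map_zero]; exact (LinearMap.zero_comp _).symm
  · rw [map_add, map_add, LinearMap.add_apply, map_add, Pi.add_apply, hx, hy]
    exact (LinearMap.add_comp _ _ _).symm

/-- The Leibniz rule for the derivative of a product of two letters, as a recursion in the form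
degree. It is the condition on the merged words under which `idn_snoc` carries the differential
identity over to a longer word. -/
theorem word_merge_succ (y : (dgOn o).Word X Z') (a : (dgOn o).Hom Y Z') (N : ℕ) :
    word c Y (merge Z' (wpar Z' y) a) (N + 1) + rem c Z' y N ∘ₗ prime (c Y) (c Z') a +
        word c Z' (wpar Z' y) N ∘ₗ S (c Z') ∘ₗ hat (o Y) (o Z') a =
      word c Y (merge Z' (wpar Z' y) a) N ∘ₗ S (c Y) +
        word c Z' (wpar Z' y) (N + 1) ∘ₗ hat (o Y) (o Z') a := by
  refine word_cases (p := fun y =>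
    word c Y (merge Z' (wpar Z' y) a) (N + 1) + rem c Z' y N ∘ₗ prime (c Y) (c Z') a +
        word c Z' (wpar Z' y) N ∘ₗ S (c Z') ∘ₗ hat (o Y) (o Z') a =
      word c Y (merge Z' (wpar Z' y) a) N ∘ₗ S (c Y) +
        word c Z' (wpar Z' y) (N + 1) ∘ₗ hat (o Y) (o Z') a) y (fun b => ?_) (fun W z b => ?_) ?_
    (fun x y hx hy => ?_)
  · have e1 := word_base_succ c (X := X) (Y := Y) ((dgOn o).comp ((dgOn o).par b) a) N
    have e2 := word_base_succ c (X := X) (Y := Z') ((dgOn o).par b) N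
    have e3 := congrFun (rem_base c b) N
    rw [wpar_base, merge_base, e1, e2, e3]
    simp only [Pi.zero_apply, LinearMap.zero_comp, LinearMap.comp_assoc]
    module
  · have e1 := congrFun (word_snoc c (wpar W z) ((dgOn o).comp ((dgOn o).par b) a))
    have e2 := congrFun (word_snoc c (wpar W z) ((dgOn o).par b))
    have e3 : ∀ N, rem c Z' (snoc z b) N = _ := congrFun (rem_snoc c z b)
    have e4 : ∀ N, word c Y (merge Z' (wpar Z' (snoc z b)) a) N = 
        -app (c Y) (c W) (word c W (wpar W z)) (hpar (o Z') (o W) b ∘ₗ a) N := fun N => by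
      rw [wpar_snoc, map_neg, LinearMap.neg_apply, merge_snoc, map_neg, Pi.neg_apply, e1]
      rfl
    have e5 : ∀ N, word c Z' (wpar Z' (snoc z b)) N = 
        -app (c Z') (c W) (word c W (wpar W z)) (hpar (o Z') (o W) b) N := fun N => by
      rw [wpar_snoc, map_neg, Pi.neg_apply, e2]
      rfl
    rw [e4, e4, e5, e5, e3, ← word_wpar]
    exact merge_seq (c Y) (c Z') (c W) _ b a N
  · simp only [map_zero, LinearMap.zero_apply, Pi.zero_apply, LinearMap.zero_comp]
    module
  · simp only [map_add, LinearMap.add_apply, Pi.add_apply, LinearMap.add_comp]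
    refine Eq.trans ?_ ((congrArg₂ (fun s t => s + t) hx hy).trans ?_)
    · abel
    · abel

/-- The chain map property before taking supertraces, proved one letter at a time. The commutator
with δ disappears under the supertrace, the factor N in front of df changes 1/N! into 1/(N-1)!, and
the error term `rem` is matched by the cyclic part of the Hochschild differential. -/
theorem word_wd (x : (dgOn o).Word X Y) : Idn (word c Y x) (word c Y (wd Y x)) (rem c Y x) := by
  refine word_induction (p := fun (Y : (dgOn o).Obj) x =>
    Idn (word c Y x) (word c Y (wd Y x)) (rem c Y x)) x (fun Y a => ?_)
    (fun Y Z' x a h => ?_) (fun Y => ?_) (fun Y x y hx hy => ?_)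
  · rw [wd_base]
    refine (rem_base c a).symm ▸ ?_
    exact idn_base (c Y) _ _ a (word_base_zero c a) (word_base_succ c a)
      (word_omLin c (base (C := dgOn o) a)) (word_base_zero c _) (word_base_succ c _)
  · have e : rem c Y (snoc x a) = fun N => word c Z' (wpar Z' x) N ∘ₗ hat (o Y) (o Z') a := by
      funext N
      rw [word_wpar]
      exact congrFun (rem_snoc c x a) N
    rw [e]
    refine idn_snoc (c Y) (c Z') (word c Z' x) (word c Z' (wpar Z' x)) (word c Z' (wd Z' x))
      (rem c Z' x) (word c Y (merge Z' (wpar Z' x) a)) _ _ (word c Y (snoc (wd Z' x) a))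
      (word c Y (snoc (wpar Z' x) ((dgOn o).d a))) a (word_wpar c x) (word_omLin c x) h
      (word_snoc c x a) (word_snoc c _ a) (word_snoc c _ _) (fun N => ?_) (word_merge_zero c _ a)
      (word_merge_succ c x a)
    rw [wd_snoc, map_sub, map_add]
    rfl
  · intro N
    simp only [map_zero, Pi.zero_apply, LinearMap.comp_zero, LinearMap.zero_comp, smul_zero]
    module
  · intro N
    simp only [map_add, Pi.add_apply, LinearMap.comp_add, LinearMap.add_comp]
    rw [hx N, hy N]
    module

/-- Each derivative and each `S` raises the form degree by one. Hence the N-th supertrace is an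
N-form, and the HKR series may be truncated at `Forms.bound`. -/
theorem raises_word (x : (dgOn o).Word X Y) (N : ℕ) : Raises N (word c Y x N) := by
  refine word_induction (p := fun (Y : (dgOn o).Obj) x => ∀ N, Raises N (word c Y x N)) x
    (fun Y a N => ?_) (fun Y Z' x a h N => ?_) (fun Y N => ?_) (fun Y x y hx hy N => ?_) N
  · induction N with
    | zero => exact (word_base_zero c a).symm ▸ raises_hat a
    | succ N ih =>
      exact (word_base_succ c a N).symm ▸ (add_comm N 1 ▸ ih.comp (raises_S _) :
        Raises (N + 1) (word c Y (base (C := dgOn o) a) N ∘ₗ S (c Y)))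
  · exact (congrFun (word_snoc c x a) N).symm ▸ raises_app _ _ h _ _
  · rw [map_zero]; exact Raises.zero
  · rw [map_add]; exact (hx N).add (hy N)

/-- The term of degree `N` of the HKR map. -/
noncomputable def hkrTerm (N : ℕ) (X : (dgOn o).Obj) :
    (dgOn o).Word X X →ₗ[Q] Forms k Q :=
  algebraMap k Q ((N.factorial : k)⁻¹) • ((o X).str ∘ₗ LinearMap.proj N ∘ₗ word c X)

theorem hkrTerm_apply (N : ℕ) (x : (dgOn o).Word X X) :
    hkrTerm c N X x = algebraMap k Q ((N.factorial : k)⁻¹) • (o X).str (word c X x N) := rfl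

variable [Module.Finite Q Ω[Q⁄k]]

theorem str_word_eq_zero (N : ℕ) (hN : Forms.bound k Q ≤ N) (x : (dgOn o).Word X X) :
    (o X).str (word c X x N) = 0 := Forms.eq_zero hN (str_mem (raises_word c x N))

/-- The terms of large degree of the HKR map vanish. -/
theorem hkrTerm_eq_zero (N : ℕ) (hN : Forms.bound k Q ≤ N) (x : (dgOn o).Word X X) :
    hkrTerm c N X x = 0 := by
  rw [hkrTerm_apply, str_word_eq_zero c N hN, smul_zero]

/-- The linear map underlying the HKR map:
`α₀[α₁|…|αₙ] ↦ ∑_{i₀, …, iₙ} (-1)^(i₀ + ⋯ + iₙ) / (n + i₀ + ⋯ + iₙ)!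
  str (α₀ (δ₁')^i₀ α₁' ⋯ (δₙ')^iₙ₋₁ αₙ' (δ₀')^iₙ)`. -/
noncomputable def hkrLin : (dgOn o).HHSpace →ₗ[Q] Forms k Q :=
  hhLift fun X => ∑ N ∈ Finset.range (Forms.bound k Q), hkrTerm c N X

theorem hkrLin_close (x : (dgOn o).Word X X) : hkrLin c (close X x) =
    ∑ N ∈ Finset.range (Forms.bound k Q), hkrTerm c N X x := by
  unfold hkrLin
  rw [hhLift_close, LinearMap.sum_apply]

theorem hkrLin_par (x : (dgOn o).HHSpace) :
    hkrLin c (hhPar _ x) = Forms.sgn (hkrLin c x) := by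
  refine hh_induction (p := fun x => hkrLin c (hhPar _ x) = Forms.sgn (hkrLin c x)) x
    (fun X x => ?_) (by simp) (fun x y hx hy => by simp only [map_add, hx, hy])
  rw [hhPar_close, hkrLin_close, hkrLin_close, map_sum]
  refine Finset.sum_congr rfl fun N _ => ?_
  rw [hkrTerm_apply, hkrTerm_apply, word_wpar, str_opar, map_smul]

theorem word_lmul {W : (dgOn o).Obj} (a : (dgOn o).Hom X W) (x : (dgOn o).Word X Y)
    (N : ℕ) : word c Y (lmul a Y x) N = hat (o X) (o W) a ∘ₗ word c Y x N := by
  refine word_induction (p := fun (Y : (dgOn o).Obj) x => ∀ N,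
    word c Y (lmul a Y x) N = hat (o X) (o W) a ∘ₗ word c Y x N) x
    (fun Y b N => ?_) (fun Y Z' x b h N => ?_) (fun Y N => ?_) (fun Y x y hx hy N => ?_) N
  · rw [lmul_base]
    induction N with
    | zero => exact (word_base_zero c _).trans ((hat_comp a b).trans
        (congrArg (fun T => hat (o X) (o W) a ∘ₗ T) (word_base_zero c b).symm))
    | succ N ih =>
      refine (word_base_succ c _ N).trans (Eq.trans ?_
        (congrArg (fun T => hat (o X) (o W) a ∘ₗ T) (word_base_succ c b N).symm))
      exact (congrArg (fun T => T ∘ₗ S (c Y)) ih).trans (LinearMap.comp_assoc _ _ _)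
  · rw [lmul_snoc]
    refine (congrFun (word_snoc c _ b) N).trans (Eq.trans ?_
        (congrArg (fun T => hat (o X) (o W) a ∘ₗ T) (congrFun (word_snoc c x b) N).symm))
    induction N with
    | zero => exact (LinearMap.comp_zero _).symm
    | succ N ih =>
      refine (app_succ (c Y) (c Z') _ b N).trans (Eq.trans ?_
        (congrArg (fun T => hat (o X) (o W) a ∘ₗ T) (app_succ (c Y) (c Z') _ b N).symm))
      refine (congrArg₂ (fun T T' => T ∘ₗ prime (c Y) (c Z') b + T' ∘ₗ S (c Y)) (h N)
        ih).trans ?_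
      rw [LinearMap.comp_add]; rfl
  · rw [map_zero, map_zero]; exact (LinearMap.comp_zero _).symm
  · rw [map_add, map_add, map_add, Pi.add_apply, hx, hy]
    exact (LinearMap.comp_add _ _ _).symm

/-- Supertraces of supercommutators vanish, so the last letter can be moved from the front of the
operator product back to its end. The odd and even components in `cyc` are those of `str_comm`. It
follows that the cyclic term cancels the error term `rem` in the differential. -/
theorem hkrTerm_cyc (x : (dgOn o).Word X Y) (a : (dgOn o).Hom X Y) (N : ℕ) :
    hkrTerm c N Y (cyc x a) =
      algebraMap k Q ((N.factorial : k)⁻¹) • (o X).str (rem c X (snoc x a) N) := by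
  have e : word c Y (cyc x a) N = hat (o X) (o Y) (hod (o X) (o Y) a) ∘ₗ opar (o Y) (o X)
      (opar (o Y) (o X) (word c Y x N)) + hat (o X) (o Y) (hev (o X) (o Y) a) ∘ₗ
        (opar (o Y) (o X) (word c Y x N)) := by
    rw [cyc_apply, map_add, Pi.add_apply, word_lmul, word_lmul, word_wpar, opar_opar]
    rfl
  have e2 : rem c X (snoc x a) N = opar (o Y) (o X) (word c Y x N) ∘ₗ hat (o X) (o Y) a :=
    congrFun (rem_snoc c x a) N
  rw [hkrTerm_apply, e, e2]
  exact congrArg _ (str_comm _ _).symm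

theorem hkrLin_wrap (x : (dgOn o).Word X X) : hkrLin c (wrap X x) =
    -∑ N ∈ Finset.range (Forms.bound k Q),
      algebraMap k Q ((N.factorial : k)⁻¹) • (o X).str (rem c X x N) := by
  refine word_cases (p := fun x => hkrLin c (wrap X x) =
    -∑ N ∈ Finset.range (Forms.bound k Q),
      algebraMap k Q ((N.factorial : k)⁻¹) • (o X).str (rem c X x N)) x (fun a => ?_)
    (fun Z' x a => ?_) ?_ (fun x y hx hy => ?_)
  · have e : rem c X (base a) = 0 := rem_base c a
    rw [wrap_base, map_zero, e]
    simp
  · rw [wrap_snoc, map_neg, hkrLin_close]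
    simp only [hkrTerm_cyc]
  · simp
  · simp only [map_add, hx, hy, Pi.add_apply, smul_add, Finset.sum_add_distrib]
    abel

theorem hkrTerm_wd (x : (dgOn o).Word X X) (N : ℕ) : hkrTerm c N X (wd X x) =
    -(if N = 0 then 0 else Forms.one (D k Q f) * hkrTerm c (N - 1) X x) +
      algebraMap k Q ((N.factorial : k)⁻¹) • (o X).str (rem c X x N) := by
  rw [hkrTerm_apply, str_idn (word_wd c x), smul_add, smul_neg]
  congr 2
  cases N with
  | zero => simp
  | succ N =>
    -- The factor N + 1 comes from moving df past the powers of δ' in the identity `Idn`;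
    -- characteristic 0 is used to divide.
    have e : algebraMap k Q (((N + 1).factorial : k)⁻¹) * ((N + 1 : ℕ) : Q) =
        algebraMap k Q ((N.factorial : k)⁻¹) := by
      rw [← map_natCast (algebraMap k Q), ← map_mul, Nat.factorial_succ]
      congr 1
      have h1 : ((N + 1 : ℕ) : k) ≠ 0 := Nat.cast_ne_zero.2 (Nat.succ_ne_zero N)
      have h2 : (N.factorial : k) ≠ 0 := Nat.cast_ne_zero.2 (Nat.factorial_ne_zero N)
      rw [Nat.cast_mul]
      field_simp
    rw [smul_smul, e, if_neg (Nat.succ_ne_zero N), Nat.add_sub_cancel, hkrTerm_apply,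
      mul_smul_comm]

theorem hkrLin_d (x : (dgOn o).HHSpace) :
    hkrLin c (hhD _ x) = -(Forms.one (D k Q f) * hkrLin c x) := by
  refine hh_induction (p := fun x => hkrLin c (hhD _ x) =
    -(Forms.one (D k Q f) * hkrLin c x)) x (fun X x => ?_) (by simp)
    (fun x y hx hy => by simp only [map_add, hx, hy, mul_add]; abel)
  have key : ∀ m, ∑ N ∈ Finset.range m, (if N = 0 then 0 else
      Forms.one (D k Q f) * hkrTerm c (N - 1) X x) =
      ∑ N ∈ Finset.range (m - 1), Forms.one (D k Q f) * hkrTerm c N X x := by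
    intro m
    cases m with
    | zero => simp
    | succ m => rw [Finset.sum_range_succ']; simp
  -- The shift of degree by df loses the last term of the truncated sum. It is harmless because that
  -- term, multiplied by df, is a form of degree `Forms.bound`.
  have key2 : ∑ N ∈ Finset.range (Forms.bound k Q - 1), Forms.one (D k Q f) * hkrTerm c N X x =
      ∑ N ∈ Finset.range (Forms.bound k Q), Forms.one (D k Q f) * hkrTerm c N X x := by
    generalize hm : Forms.bound k Q = m
    cases m with
    | zero => simp
    | succ m =>
      rw [Nat.add_sub_cancel, Finset.sum_range_succ]
      have h : Forms.one (D k Q f) * (o X).str (word c X x m) = 0 :=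
        Forms.eq_zero (N := 1 + m) (by omega)
          (Forms.mul_mem (Forms.one_mem _) (str_mem (raises_word c x m)))
      rw [hkrTerm_apply, mul_smul_comm, h, smul_zero, add_zero]
  rw [hhD_close, map_add, hkrLin_wrap, hkrLin_close, hkrLin_close, Finset.mul_sum, ← key2, ← key]
  simp only [hkrTerm_wd, Finset.sum_add_distrib, Finset.sum_neg_distrib]
  abel

/-- The HKR map `HH(mf^Z(Q, f)) → (Ω^•, -df)`, for a choice of connections. -/
noncomputable def hkr  :
    HH (dgOn o) ⟶ Forms.cpx k f where
  toLin := ULift.moduleEquiv.symm.toLinearMap ∘ₗ hkrLin c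
  map_par x := congrArg ULift.up (hkrLin_par c x)
  map_d x := congrArg ULift.up ((hkrLin_d c x).trans rfl)

end Indexed

end MF

end HKRWithConnections

/-! ### The tensor product of two connections. -/

section ProductConnection

open KaehlerDifferential

variable {k Q R T : Type u} [Field k] [CommRing Q] [Algebra k Q] [CommRing R] [Algebra k R]
  [CommRing T] [Algebra k T]

namespace Forms

/-- The map on differential forms of degree one induced by a homomorphism of algebras. -/
noncomputable def kmap (φ : Q →ₐ[k] T) : Ω[Q⁄k] →ₗ[k] Ω[T⁄k] :=
  letI := φ.toRingHom.toAlgebra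
  haveI : IsScalarTower k Q T := .of_algebraMap_eq' φ.comp_algebraMap.symm
  (KaehlerDifferential.map k k Q T).restrictScalars k

theorem map_one_kmap (φ : Q →ₐ[k] T) (η : Ω[Q⁄k]) : map φ (one η) = one (kmap φ η) := by
  let _ := φ.toRingHom.toAlgebra
  have : IsScalarTower k Q T := .of_algebraMap_eq' φ.comp_algebraMap.symm
  exact ExteriorAlgebra.lift_ι_apply Q _ _ η

theorem kmap_smul (φ : Q →ₐ[k] T) (q : Q) (η : Ω[Q⁄k]) : kmap φ (q • η) = φ q • kmap φ η := by
  let _ := φ.toRingHom.toAlgebra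
  have : IsScalarTower k Q T := .of_algebraMap_eq' φ.comp_algebraMap.symm
  refine (_root_.map_smul (KaehlerDifferential.map k k Q T) q η).trans ?_
  exact (algebraMap_smul T q (KaehlerDifferential.map k k Q T η)).symm

theorem kmap_D (φ : Q →ₐ[k] T) (q : Q) : kmap φ (D k Q q) = D k T (φ q) := by
  let _ := φ.toRingHom.toAlgebra
  have : IsScalarTower k Q T := .of_algebraMap_eq' φ.comp_algebraMap.symm
  exact KaehlerDifferential.map_D k k Q T q

end Forms

namespace MF

variable {f : Q} {g : R}

theorem smul_tmul_left (X : MF k Q f) (Y : MF k R g) (q : Q) (x : X.P) (y : Y.P) :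
    X.tmul Y (q • x) y = (q ⊗ₜ[k] (1 : R)) • X.tmul Y x y := by
  rw [smul_tmul, one_smul]

theorem smul_tmul_right (X : MF k Q f) (Y : MF k R g) (r : R) (x : X.P) (y : Y.P) :
    X.tmul Y x (r • y) = ((1 : Q) ⊗ₜ[k] r) • X.tmul Y x y := by
  rw [smul_tmul, one_smul]

variable {X : MF k Q f} {Y : MF k R g}

variable (X Y) in
/-- The map `(η ⊗ x, y) ↦ η ⊗ (x ⊗ y)`. -/
noncomputable def kinsL : Ω[Q⁄k] ⊗[Q] X.P →+ Y.P →+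
    Ω[(Q ⊗[k] R)⁄k] ⊗[Q ⊗[k] R] (X.tensor Y).P :=
  TensorProduct.liftAddHom
    (AddMonoidHom.mk' (fun η => AddMonoidHom.mk' (fun x => AddMonoidHom.mk'
      (fun y => Forms.kmap Algebra.TensorProduct.includeLeft η ⊗ₜ X.tmul Y x y)
      (fun y y' => by rw [tmul_add, TensorProduct.tmul_add]))
      (fun x x' => by ext y; simp [TensorProduct.tmul_add]))
      (fun η η' => by ext x y; simp [TensorProduct.add_tmul]))
    (fun q η x => by
      ext y
      simp only [AddMonoidHom.mk'_apply, Forms.kmap_smul, smul_tmul_left,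
        Algebra.TensorProduct.includeLeft_apply, TensorProduct.smul_tmul])

theorem kinsL_tmul (η : Ω[Q⁄k]) (x : X.P) (y : Y.P) : kinsL X Y (η ⊗ₜ x) y =
    Forms.kmap Algebra.TensorProduct.includeLeft η ⊗ₜ X.tmul Y x y := rfl

variable (X Y) in
/-- The map `(x, η ⊗ y) ↦ η ⊗ (x ⊗ y)`. -/
noncomputable def kinsR : Ω[R⁄k] ⊗[R] Y.P →+ X.P →+
    Ω[(Q ⊗[k] R)⁄k] ⊗[Q ⊗[k] R] (X.tensor Y).P :=
  TensorProduct.liftAddHom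
    (AddMonoidHom.mk' (fun η => AddMonoidHom.mk' (fun y => AddMonoidHom.mk'
      (fun x => Forms.kmap Algebra.TensorProduct.includeRight η ⊗ₜ X.tmul Y x y)
      (fun y y' => by rw [add_tmul, TensorProduct.tmul_add]))
      (fun x x' => by ext y; simp [TensorProduct.tmul_add]))
      (fun η η' => by ext x y; simp [TensorProduct.add_tmul]))
    (fun q η x => by
      ext y
      simp only [AddMonoidHom.mk'_apply, Forms.kmap_smul, smul_tmul_right,
        Algebra.TensorProduct.includeRight_apply, TensorProduct.smul_tmul])

theorem kinsR_tmul (η : Ω[R⁄k]) (x : X.P) (y : Y.P) : kinsR X Y (η ⊗ₜ y) x =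
    Forms.kmap Algebra.TensorProduct.includeRight η ⊗ₜ X.tmul Y x y := rfl

theorem kinsL_smul (q : Q) (r : R) (t : Ω[Q⁄k] ⊗[Q] X.P) (y : Y.P) :
    kinsL X Y (q • t) (r • y) = (q ⊗ₜ[k] r) • kinsL X Y t y := by
  induction t using TensorProduct.induction_on with
  | zero => simp
  | add x y hx hy => simp only [smul_add, map_add, AddMonoidHom.add_apply, hx, hy]
  | tmul η x =>
    rw [← TensorProduct.tmul_smul, kinsL_tmul, kinsL_tmul, ← smul_tmul, TensorProduct.tmul_smul]

theorem kinsR_smul (q : Q) (r : R) (t : Ω[R⁄k] ⊗[R] Y.P) (x : X.P) :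
    kinsR X Y (r • t) (q • x) = (q ⊗ₜ[k] r) • kinsR X Y t x := by
  induction t using TensorProduct.induction_on with
  | zero => simp
  | add x y hx hy => simp only [smul_add, map_add, AddMonoidHom.add_apply, hx, hy]
  | tmul η x =>
    rw [← TensorProduct.tmul_smul, kinsR_tmul, kinsR_tmul, ← smul_tmul, TensorProduct.tmul_smul]

/-- Scalars of k may be moved through either tensor factor. This is what makes the formula for the
product connection k-bilinear, although its two halves are linear over different rings. -/
theorem algebraMap_tmul_one_smul {M : Type*} [AddCommGroup M] [Module k M] [Module (Q ⊗[k] R) M]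
    [IsScalarTower k (Q ⊗[k] R) M] (c : k) (m : M) :
    (algebraMap k Q c ⊗ₜ[k] (1 : R)) • m = c • m := algebraMap_smul (Q ⊗[k] R) c m

theorem one_tmul_algebraMap_smul {M : Type*} [AddCommGroup M] [Module k M] [Module (Q ⊗[k] R) M]
    [IsScalarTower k (Q ⊗[k] R) M] (c : k) (m : M) :
    ((1 : Q) ⊗ₜ[k] algebraMap k R c) • m = c • m := by
  rw [← algebraMap_tmul_one_smul (Q := Q) (R := R), Algebra.algebraMap_eq_smul_one,
    Algebra.algebraMap_eq_smul_one, TensorProduct.tmul_smul, TensorProduct.smul_tmul']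

theorem lTensor_par_kinsL (t : Ω[Q⁄k] ⊗[Q] X.P) (y : Y.P) :
    (X.tensor Y).par.lTensor _ (kinsL X Y t y) = kinsL X Y (X.par.lTensor _ t) (Y.par y) := by
  induction t using TensorProduct.induction_on with
  | zero => simp
  | add x y hx hy => simp only [map_add, AddMonoidHom.add_apply, hx, hy]
  | tmul η x => rfl

theorem lTensor_par_kinsR (t : Ω[R⁄k] ⊗[R] Y.P) (x : X.P) :
    (X.tensor Y).par.lTensor _ (kinsR X Y t x) = kinsR X Y (Y.par.lTensor _ t) (X.par x) := by
  induction t using TensorProduct.induction_on with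
  | zero => simp
  | add x y hx hy => simp only [map_add, AddMonoidHom.add_apply, hx, hy]
  | tmul η x => rfl

/-- The linear map underlying the tensor product of connections. -/
noncomputable def prodNab (cX : X.Connection) (cY : Y.Connection) :
    (X.tensor Y).P →ₗ[k] Ω[(Q ⊗[k] R)⁄k] ⊗[Q ⊗[k] R] (X.tensor Y).P :=
  TensorProduct.lift (LinearMap.mk₂ k
    -- No sign is needed in the second summand: the sign of 1 ⊗ ∇ passing x cancels the sign of
    -- moving the resulting one-form to the left of x.
    (fun x y => kinsL X Y (cX.nab x) y + kinsR X Y (cY.nab y) x)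
    (fun x x' y => by simp only [map_add, AddMonoidHom.add_apply]; abel)
    (fun c x y => by
      have h1 := kinsL_smul (algebraMap k Q c) 1 (cX.nab x) y
      have h2 := kinsR_smul (algebraMap k Q c) 1 (cY.nab y) x
      simp only [algebraMap_smul, one_smul, algebraMap_tmul_one_smul] at h1 h2
      rw [_root_.map_smul, h1, h2, smul_add])
    (fun x y y' => by simp only [map_add, AddMonoidHom.add_apply]; abel)
    (fun c x y => by
      have h1 := kinsL_smul 1 (algebraMap k R c) (cX.nab x) y
      have h2 := kinsR_smul 1 (algebraMap k R c) (cY.nab y) x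
      simp only [algebraMap_smul, one_smul, one_tmul_algebraMap_smul] at h1 h2
      rw [h1, _root_.map_smul, h2, smul_add]))

theorem prodNab_tmul (cX : X.Connection) (cY : Y.Connection) (x : X.P) (y : Y.P) :
    prodNab cX cY (X.tmul Y x y) = kinsL X Y (cX.nab x) y + kinsR X Y (cY.nab y) x := rfl

/-- The tensor product of connections. -/
noncomputable def prodConn (cX : X.Connection) (cY : Y.Connection) : (X.tensor Y).Connection where
  nab := prodNab cX cY
  leibniz a p := by
    induction a with
    | zero => simp
    | add a b ha hb =>
      rw [add_smul, map_add, ha, hb, map_add, TensorProduct.add_tmul, add_smul]; abel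
    | tmul q r =>
      induction p using tensor_induction with
      | zero => simp
      | add x y hx hy =>
        rw [smul_add, map_add, hx, hy, map_add, TensorProduct.tmul_add, smul_add]; abel
      | tmul x y =>
        -- The Leibniz rule for q ⊗ r = (q ⊗ 1)(1 ⊗ r) splits the differential into the parts
        -- produced by the two connections.
        have e : D k (Q ⊗[k] R) (q ⊗ₜ r) = (q ⊗ₜ[k] (1 : R)) • D k (Q ⊗[k] R) ((1 : Q) ⊗ₜ r) +
            ((1 : Q) ⊗ₜ[k] r) • D k (Q ⊗[k] R) (q ⊗ₜ[k] (1 : R)) := by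
          rw [← Derivation.leibniz, Algebra.TensorProduct.tmul_mul_tmul, one_mul, mul_one]
        have hl : kinsL X Y (D k Q q ⊗ₜ x) (r • y) =
            (((1 : Q) ⊗ₜ[k] r) • D k (Q ⊗[k] R) (q ⊗ₜ[k] (1 : R))) ⊗ₜ X.tmul Y x y := by
          rw [kinsL_tmul, smul_tmul_right, Forms.kmap_D, TensorProduct.smul_tmul]; rfl
        have hr : kinsR X Y (D k R r ⊗ₜ y) (q • x) =
            ((q ⊗ₜ[k] (1 : R)) • D k (Q ⊗[k] R) ((1 : Q) ⊗ₜ[k] r)) ⊗ₜ X.tmul Y x y := by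
          rw [kinsR_tmul, smul_tmul_left, Forms.kmap_D, TensorProduct.smul_tmul]; rfl
        rw [smul_tmul, prodNab_tmul, prodNab_tmul, cX.leibniz, cY.leibniz, map_add, map_add,
          AddMonoidHom.add_apply, AddMonoidHom.add_apply, kinsL_smul, kinsR_smul, hl, hr, e,
          TensorProduct.add_tmul, smul_add]
        abel
  nab_par p := by
    induction p using tensor_induction with
    | zero => simp
    | add x y hx hy => rw [map_add, map_add, hx, hy, map_add, map_add]
    | tmul x y =>
      rw [par_tmul, prodNab_tmul, prodNab_tmul, cX.nab_par, cY.nab_par, map_add, lTensor_par_kinsL,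
        lTensor_par_kinsR]

end MF

end ProductConnection


/-! ### Parity components and the external product of forms with coefficients. -/

section Box

open KaehlerDifferential

variable {k Q R : Type u} [Field k] [CommRing Q] [Algebra k Q] [CommRing R] [Algebra k R]

/-- The projection onto the even part of a module with an involution. -/
noncomputable def evenPart (k : Type u) {Q : Type u} [Field k] [CommRing Q] [Algebra k Q]
    {M : Type*} [AddCommGroup M] [Module Q M] (σ : M →ₗ[Q] M) : M →ₗ[Q] M :=
  (algebraMap k Q 2⁻¹) • (LinearMap.id + σ)

/-- The projection onto the odd part of a module with an involution. -/
noncomputable def oddPart (k : Type u) {Q : Type u} [Field k] [CommRing Q] [Algebra k Q]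
    {M : Type*} [AddCommGroup M] [Module Q M] (σ : M →ₗ[Q] M) : M →ₗ[Q] M :=
  (algebraMap k Q 2⁻¹) • (LinearMap.id - σ)

section

variable {M N : Type*} [AddCommGroup M] [Module Q M] [AddCommGroup N] [Module Q N]
  {σ : M →ₗ[Q] M} {τ : N →ₗ[Q] N}

theorem half_smul_add [CharZero k] (x : M) : algebraMap k Q 2⁻¹ • (x + x) = x := by
  rw [← two_smul Q x, smul_smul, ← map_ofNat (algebraMap k Q) 2, ← map_mul,
    inv_mul_cancel₀ two_ne_zero, map_one, one_smul]

theorem evenPart_add_oddPart [CharZero k] (x : M) : evenPart k σ x + oddPart k σ x = x := by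
  simp only [evenPart, oddPart, LinearMap.smul_apply, LinearMap.add_apply, LinearMap.sub_apply,
    LinearMap.id_apply, ← smul_add]
  rw [add_add_sub_cancel, half_smul_add]

theorem evenPart_sub_oddPart [CharZero k] (x : M) : evenPart k σ x - oddPart k σ x = σ x := by
  simp only [evenPart, oddPart, LinearMap.smul_apply, LinearMap.add_apply, LinearMap.sub_apply,
    LinearMap.id_apply, ← smul_sub]
  rw [add_sub_sub_cancel, half_smul_add]

theorem apply_evenPart (hσ : ∀ x, σ (σ x) = x) (x : M) : σ (evenPart k σ x) = evenPart k σ x := by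
  simp [evenPart, hσ, add_comm]

theorem apply_oddPart (hσ : ∀ x, σ (σ x) = x) (x : M) : σ (oddPart k σ x) = -oddPart k σ x := by
  simp [oddPart, hσ, ← smul_neg]

theorem evenPart_apply (hσ : ∀ x, σ (σ x) = x) (x : M) : evenPart k σ (σ x) = evenPart k σ x := by
  simp [evenPart, hσ, add_comm]

theorem oddPart_apply (hσ : ∀ x, σ (σ x) = x) (x : M) : oddPart k σ (σ x) = -oddPart k σ x := by
  simp [oddPart, hσ, ← smul_neg]

theorem evenPart_of_eq [CharZero k] {x : M} (h : σ x = x) : evenPart k σ x = x := by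
  simpa [evenPart, h] using half_smul_add (k := k) x

theorem oddPart_of_eq {x : M} (h : σ x = x) : oddPart k σ x = 0 := by
  simp [oddPart, h]

theorem evenPart_of_eq_neg {x : M} (h : σ x = -x) : evenPart k σ x = 0 := by
  simp [evenPart, h]

theorem oddPart_of_eq_neg [CharZero k] {x : M} (h : σ x = -x) : oddPart k σ x = x := by
  simpa [oddPart, h] using half_smul_add (k := k) x

theorem map_evenPart {F : M →ₗ[Q] N} (h : ∀ x, F (σ x) = τ (F x)) (x : M) :
    F (evenPart k σ x) = evenPart k τ (F x) := by
  simp [evenPart, h]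

theorem map_oddPart {F : M →ₗ[Q] N} (h : ∀ x, F (σ x) = τ (F x)) (x : M) :
    F (oddPart k σ x) = oddPart k τ (F x) := by
  simp [oddPart, h]

theorem map_evenPart_of_neg {F : M →ₗ[Q] N} (h : ∀ x, F (σ x) = -τ (F x)) (x : M) :
    F (evenPart k σ x) = oddPart k τ (F x) := by
  simp [evenPart, oddPart, h, sub_eq_add_neg]

theorem map_oddPart_of_neg {F : M →ₗ[Q] N} (h : ∀ x, F (σ x) = -τ (F x)) (x : M) :
    F (oddPart k σ x) = evenPart k τ (F x) := by
  simp [evenPart, oddPart, h, sub_eq_add_neg]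

end

namespace Forms

/-- The map from the forms on `Q` to the forms on `Q ⊗ R`. -/
noncomputable abbrev fstMap (k Q R : Type u) [Field k] [CommRing Q] [Algebra k Q] [CommRing R]
    [Algebra k R] : Forms k Q →ₐ[k] Forms k (Q ⊗[k] R) :=
  map Algebra.TensorProduct.includeLeft

/-- The map from the forms on `R` to the forms on `Q ⊗ R`. -/
noncomputable abbrev sndMap (k Q R : Type u) [Field k] [CommRing Q] [Algebra k Q] [CommRing R]
    [Algebra k R] : Forms k R →ₐ[k] Forms k (Q ⊗[k] R) :=
  map Algebra.TensorProduct.includeRight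

theorem fstMap_smul (q : Q) (ω : Forms k Q) :
    fstMap k Q R (q • ω) = (q ⊗ₜ[k] (1 : R)) • fstMap k Q R ω := map_smul _ q ω

theorem sndMap_smul (r : R) (ω : Forms k R) :
    sndMap k Q R (r • ω) = ((1 : Q) ⊗ₜ[k] r) • sndMap k Q R ω := map_smul _ r ω

theorem fstMap_one (η : Ω[Q⁄k]) : fstMap k Q R (one η) =
    one (kmap Algebra.TensorProduct.includeLeft η) := map_one_kmap _ η

theorem sndMap_one (η : Ω[R⁄k]) : sndMap k Q R (one η) =
    one (kmap Algebra.TensorProduct.includeRight η) := map_one_kmap _ η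

end Forms

namespace MF

variable {f : Q} {g : R} {X : MF k Q f} {Y : MF k R g}

/-- Induction on forms with coefficients in `P`. -/
theorem V_induction {p : X.V → Prop} (v : X.V) (h1 : ∀ x, p (1 ⊗ₜ x))
    (hl : ∀ η v, p v → p (X.lw (Forms.one η) v)) (ha : ∀ v w, p v → p w → p (v + w)) : p v := by
  induction v using TensorProduct.induction_on with
  | zero => simpa using h1 0
  | add x y hx hy => exact ha _ _ hx hy
  | tmul ω x =>
    induction ω using Forms.induction_left with
    | h1 q =>
      rw [Algebra.algebraMap_eq_smul_one, TensorProduct.smul_tmul]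
      exact h1 _
    | hm η ω h => rw [← lw_tmul]; exact hl _ _ h
    | ha a b ha' hb => rw [TensorProduct.add_tmul]; exact ha _ _ ha' hb

variable (X Y) in
/-- The map `η ⊗ y ↦ (ω ∧ η) ⊗ (x ⊗ y)`. -/
noncomputable def mu0Aux (ω : Forms k Q) (x : X.P) : Y.V →+ (X.tensor Y).V :=
  TensorProduct.liftAddHom
    (AddMonoidHom.mk' (fun η => AddMonoidHom.mk'
      (fun y => ((Forms.fstMap k Q R ω * Forms.sndMap k Q R η) ⊗ₜ X.tmul Y x y : (X.tensor Y).V))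
      (fun y y' => by rw [tmul_add, TensorProduct.tmul_add]))
      (fun η η' => by ext y; simp [mul_add, TensorProduct.add_tmul]))
    (fun r η y => by
      simp only [AddMonoidHom.mk'_apply, Forms.sndMap_smul, smul_tmul_right, mul_smul_comm,
        TensorProduct.smul_tmul])

theorem mu0Aux_tmul (ω : Forms k Q) (x : X.P) (η : Forms k R) (y : Y.P) :
    mu0Aux X Y ω x (η ⊗ₜ y) =
      (Forms.fstMap k Q R ω * Forms.sndMap k Q R η) ⊗ₜ X.tmul Y x y := rfl

theorem mu0Aux_add_right (ω : Forms k Q) (x x' : X.P) (w : Y.V) :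
    mu0Aux X Y ω (x + x') w = mu0Aux X Y ω x w + mu0Aux X Y ω x' w := by
  induction w using TensorProduct.induction_on with
  | zero => rw [map_zero, map_zero, map_zero, add_zero]
  | add v w hv hw => rw [map_add, map_add, map_add, hv, hw]; abel
  | tmul η y => rw [mu0Aux_tmul, mu0Aux_tmul, mu0Aux_tmul, add_tmul, TensorProduct.tmul_add]

theorem mu0Aux_add_left (ω ω' : Forms k Q) (x : X.P) (w : Y.V) :
    mu0Aux X Y (ω + ω') x w = mu0Aux X Y ω x w + mu0Aux X Y ω' x w := by
  induction w using TensorProduct.induction_on with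
  | zero => rw [map_zero, map_zero, map_zero, add_zero]
  | add v w hv hw => rw [map_add, map_add, map_add, hv, hw]; abel
  | tmul η y =>
    rw [mu0Aux_tmul, mu0Aux_tmul, mu0Aux_tmul, map_add, add_mul, TensorProduct.add_tmul]

theorem mu0Aux_smul (q : Q) (ω : Forms k Q) (x : X.P) (w : Y.V) :
    mu0Aux X Y (q • ω) x w = mu0Aux X Y ω (q • x) w := by
  induction w using TensorProduct.induction_on with
  | zero => rw [map_zero, map_zero]
  | add v w hv hw => rw [map_add, map_add, hv, hw]
  | tmul η y =>
    rw [mu0Aux_tmul, mu0Aux_tmul, Forms.fstMap_smul, smul_tmul_left, smul_mul_assoc,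
      TensorProduct.smul_tmul]

variable (X Y) in
/-- The map `(ω ⊗ x, η ⊗ y) ↦ (ω ∧ η) ⊗ (x ⊗ y)`, without signs. -/
noncomputable def mu0 : X.V →+ Y.V →+ (X.tensor Y).V :=
  TensorProduct.liftAddHom
    (AddMonoidHom.mk' (fun ω => AddMonoidHom.mk' (fun x => mu0Aux X Y ω x)
      (fun x x' => AddMonoidHom.ext (mu0Aux_add_right ω x x')))
      (fun ω ω' => AddMonoidHom.ext fun x => AddMonoidHom.ext (mu0Aux_add_left ω ω' x)))
    (fun q ω x => AddMonoidHom.ext (mu0Aux_smul q ω x))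

theorem mu0_tmul (ω : Forms k Q) (x : X.P) (η : Forms k R) (y : Y.P) :
    mu0 X Y (ω ⊗ₜ x) (η ⊗ₜ y) =
      (Forms.fstMap k Q R ω * Forms.sndMap k Q R η) ⊗ₜ X.tmul Y x y := rfl

variable (X Y) in
/-- The map `(ω ⊗ x, η ⊗ y) ↦ (-1)^(|x| |η|) (ω ∧ η) ⊗ (x ⊗ y)`. -/
noncomputable def mu : X.V →+ Y.V →+ (X.tensor Y).V :=
  (mu0 X Y).comp ((evenPart k X.par).lTensor (Forms k Q)).toAddMonoidHom +
    (AddMonoidHom.compHom'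
      (Forms.sgn.rTensor Y.P : Y.V →ₗ[R] Y.V).toAddMonoidHom).comp
      ((mu0 X Y).comp ((oddPart k X.par).lTensor (Forms k Q)).toAddMonoidHom)

theorem mu_apply (v : X.V) (w : Y.V) : mu X Y v w =
    mu0 X Y ((evenPart k X.par).lTensor (Forms k Q) v) w +
      mu0 X Y ((oddPart k X.par).lTensor (Forms k Q) v) (Forms.sgn.rTensor Y.P w) := rfl

theorem mu_tmul (ω : Forms k Q) (x : X.P) (η : Forms k R) (y : Y.P) :
    mu X Y (ω ⊗ₜ x) (η ⊗ₜ y) =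
      (Forms.fstMap k Q R ω * Forms.sndMap k Q R η) ⊗ₜ X.tmul Y (evenPart k X.par x) y +
      (Forms.fstMap k Q R ω * Forms.sndMap k Q R (Forms.sgn η)) ⊗ₜ
        X.tmul Y (oddPart k X.par x) y := rfl

theorem mu_lw_left (ω : Forms k Q) (v : X.V) (w : Y.V) :
    mu X Y (X.lw ω v) w = (X.tensor Y).lw (Forms.fstMap k Q R ω) (mu X Y v w) := by
  induction v using TensorProduct.induction_on with
  | zero => simp
  | add v v' hx hy => simp only [map_add, AddMonoidHom.add_apply, hx, hy]
  | tmul ζ x =>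
    induction w using TensorProduct.induction_on with
    | zero => simp
    | add v v' hx hy => simp only [map_add, hx, hy]
    | tmul η y => simp only [lw_tmul, mu_tmul, map_add, map_mul, mul_assoc]

/-- Extracting a one-form from the second factor moves it past all of `v`, both the form and the
coefficient. The resulting sign is the total parity of `v`, recorded by `vpar`. -/
theorem mu_lw_right (η : Ω[R⁄k]) (v : X.V) (w : Y.V) :
    mu X Y v (Y.lw (Forms.one η) w) =
      (X.tensor Y).lw (Forms.sndMap k Q R (Forms.one η)) (mu X Y (X.vpar v) w) := by
  induction v using TensorProduct.induction_on with
  | zero => simp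
  | add v v' hx hy => simp only [map_add, AddMonoidHom.add_apply, hx, hy]
  | tmul ω x =>
    induction w using TensorProduct.induction_on with
    | zero => simp
    | add v v' hx hy => simp only [map_add, hx, hy]
    | tmul ζ y =>
      -- Graded commutativity of forms accounts for the sign of the form part. The sign of the
      -- coefficient comes from the definition of `mu`.
      have e : Forms.sndMap k Q R (Forms.one η) * Forms.fstMap k Q R (Forms.sgn ω) =
          Forms.fstMap k Q R ω * Forms.sndMap k Q R (Forms.one η) := by
        rw [Forms.sndMap_one, Forms.one_mul_comm, ← Forms.map_sgn, Forms.sgn_sgn]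
      simp only [lw_tmul, vpar_tmul, mu_tmul, map_add, map_mul, evenPart_apply X.par_par,
        oddPart_apply X.par_par, neg_tmul, TensorProduct.tmul_neg, Forms.sgn_mul, Forms.sgn_one,
        ← mul_assoc, e, map_neg, neg_mul, mul_neg, TensorProduct.neg_tmul]

theorem mu_one_one [CharZero k] (x : X.P) (y : Y.P) :
    mu X Y (1 ⊗ₜ x) (1 ⊗ₜ y) = 1 ⊗ₜ X.tmul Y x y := by
  rw [mu_tmul, Forms.sgn_one_eq, map_one, map_one, mul_one, ← TensorProduct.tmul_add, ← add_tmul,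
    evenPart_add_oddPart]

theorem vpar_mu (v : X.V) (w : Y.V) :
    (X.tensor Y).vpar (mu X Y v w) = mu X Y (X.vpar v) (Y.vpar w) := by
  induction v using TensorProduct.induction_on with
  | zero => simp
  | add v v' hx hy => simp only [map_add, AddMonoidHom.add_apply, hx, hy]
  | tmul ω x =>
    induction w using TensorProduct.induction_on with
    | zero => simp
    | add v v' hx hy => simp only [map_add, hx, hy]
    | tmul ζ y =>
      simp only [vpar_tmul, mu_tmul, map_add, par_tmul, Forms.sgn_mul, ← Forms.map_sgn,
        apply_evenPart X.par_par, apply_oddPart X.par_par, evenPart_apply X.par_par,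
        oddPart_apply X.par_par]

theorem mu_smul (q : Q) (r : R) (v : X.V) (w : Y.V) :
    mu X Y (q • v) (r • w) = (q ⊗ₜ[k] r) • mu X Y v w := by
  have e : (q ⊗ₜ[k] r) = (q ⊗ₜ[k] (1 : R)) * ((1 : Q) ⊗ₜ[k] r) := by
    rw [Algebra.TensorProduct.tmul_mul_tmul, one_mul, mul_one]
  induction v using TensorProduct.induction_on with
  | zero => simp
  | add v v' hx hy => simp only [smul_add, map_add, AddMonoidHom.add_apply, hx, hy]
  | tmul ω x =>
    induction w using TensorProduct.induction_on with
    | zero => simp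
    | add v v' hx hy => simp only [smul_add, map_add, hx, hy]
    | tmul ζ y =>
      simp only [TensorProduct.smul_tmul', mu_tmul, _root_.map_smul, Forms.fstMap_smul,
        Forms.sndMap_smul, smul_mul_smul_comm, smul_add, ← e]

end MF

end Box


/-! ### External tensor products of operators, with Koszul signs. -/

section Box

set_option linter.unusedSectionVars false

open KaehlerDifferential

variable {k Q R : Type u} [Field k] [CommRing Q] [Algebra k Q] [CommRing R] [Algebra k R]

namespace MF

variable {f : Q} {g : R}

section

variable {X Y : MF k Q f}

variable (X Y) in
/-- The sign operator on maps `P → Ω^• ⊗ P'`. -/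
noncomputable def fpar : (X.P →ₗ[Q] Y.V) →ₗ[Q] (X.P →ₗ[Q] Y.V) :=
  LinearMap.lcomp Q Y.V X.par ∘ₗ LinearMap.llcomp Q X.P Y.V Y.V Y.vpar

theorem fpar_apply (F : X.P →ₗ[Q] Y.V) (p : X.P) : fpar X Y F p = Y.vpar (F (X.par p)) := rfl

theorem fpar_fpar (F : X.P →ₗ[Q] Y.V) : fpar X Y (fpar X Y F) = F := by
  ext p; simp [fpar_apply, vpar_vpar]

/-- The extension of a map `P → Ω^• ⊗ P'` to a map `Ω^• ⊗ P → Ω^• ⊗ P'` linear over the forms. -/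
noncomputable def omExt (F : X.P →ₗ[Q] Y.V) : X.V →ₗ[Q] Y.V :=
  ext0 (evenPart k (fpar X Y) F) + ext0 (oddPart k (fpar X Y) F) ∘ₗ Forms.sgn.rTensor X.P

theorem omExt_tmul (F : X.P →ₗ[Q] Y.V) (ω : Forms k Q) (p : X.P) : omExt F (ω ⊗ₜ p) =
    Y.lw ω (evenPart k (fpar X Y) F p) + Y.lw (Forms.sgn ω) (oddPart k (fpar X Y) F p) := rfl

theorem opar_omExt (F : X.P →ₗ[Q] Y.V) : opar X Y (omExt F) = omExt (fpar X Y F) := by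
  ext ω p
  have h1 := LinearMap.congr_fun (apply_evenPart (k := k) (fpar_fpar (X := X) (Y := Y)) F) p
  have h2 := LinearMap.congr_fun (apply_oddPart (k := k) (fpar_fpar (X := X) (Y := Y)) F) p
  rw [fpar_apply] at h1 h2
  simp only [TensorProduct.AlgebraTensorModule.curry_apply, TensorProduct.curry_apply,
    LinearMap.coe_restrictScalars, opar_apply, vpar_tmul, omExt_tmul, map_add, vpar_lw,
    Forms.sgn_sgn, h1, h2, evenPart_apply (k := k) (fpar_fpar (X := X) (Y := Y)) F,
    oddPart_apply (k := k) (fpar_fpar (X := X) (Y := Y)) F, LinearMap.neg_apply]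

theorem OmLin.omExt (F : X.P →ₗ[Q] Y.V) : OmLin (omExt F) := fun η v => by
  rw [opar_omExt]
  induction v using TensorProduct.induction_on with
  | zero => simp
  | add x y hx hy => simp only [map_add, hx, hy]
  | tmul ω p =>
    simp only [lw_tmul, omExt_tmul, evenPart_apply (k := k) (fpar_fpar (X := X) (Y := Y)) F,
      oddPart_apply (k := k) (fpar_fpar (X := X) (Y := Y)) F, Forms.sgn_mul, Forms.sgn_one,
      map_add, map_neg, LinearMap.neg_apply, lw_lw, neg_mul]

theorem omExt_one [CharZero k] (F : X.P →ₗ[Q] Y.V) (p : X.P) : omExt F (1 ⊗ₜ p) = F p := by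
  rw [omExt_tmul, Forms.sgn_one_eq, lw_one, lw_one, ← LinearMap.add_apply, evenPart_add_oddPart]

end

section

variable {X : MF k Q f} {Y : MF k R g}

/-- The linear map on `P ⊗ P'` determined by a biadditive map. -/
noncomputable def pdesc {M : Type*} [AddCommGroup M] [Module (Q ⊗[k] R) M]
    (F : X.P →+ Y.P →+ M) (h : ∀ (q : Q) (r : R) x y, F (q • x) (r • y) = (q ⊗ₜ[k] r) • F x y) :
    (X.tensor Y).P →ₗ[Q ⊗[k] R] M :=
  -- The map descends to the tensor product over k because c ⊗ 1 = 1 ⊗ c acts in the same way from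
  -- both sides.
  have key : ∀ (c : k) x y, F (c • x) y = F x (c • y) := fun c x y => by
    have h1 := h (algebraMap k Q c) 1 x y
    have h2 := h 1 (algebraMap k R c) x y
    rw [algebraMap_smul, one_smul] at h1 h2
    rw [h1, h2, Algebra.algebraMap_eq_smul_one, Algebra.algebraMap_eq_smul_one,
      TensorProduct.tmul_smul, TensorProduct.smul_tmul']
  let G : (X.tensor Y).P →+ M := TensorProduct.liftAddHom F key
  { toFun := G
    map_add' := map_add G
    map_smul' := fun a p => by
      rw [RingHom.id_apply]
      induction a with
      | zero => rw [zero_smul, zero_smul, map_zero]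
      | add a b ha hb => rw [add_smul, map_add, ha, hb, add_smul]
      | tmul q r =>
        induction p using tensor_induction with
        | zero => rw [smul_zero, map_zero, smul_zero]
        | add x y hx hy => rw [smul_add, map_add, hx, hy, map_add, smul_add]
        | tmul x y => exact h q r x y }

end

variable {X X' X'' : MF k Q f} {Y Y' Y'' : MF k R g}

/-- The map `(v, w) ↦ (-1)^(|B| |v|) A v ⊗ B w`. -/
noncomputable def boxV (A : X.V →ₗ[Q] X'.V) (B : Y.V →ₗ[R] Y'.V) :
    X.V →+ Y.V →+ (X'.tensor Y').V :=
  (AddMonoidHom.compHom' B.toAddMonoidHom).comp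
      ((mu X' Y').comp (A ∘ₗ evenPart k X.vpar).toAddMonoidHom) +
    (AddMonoidHom.compHom' (opar Y Y' B).toAddMonoidHom).comp
      ((mu X' Y').comp (A ∘ₗ oddPart k X.vpar).toAddMonoidHom)

theorem boxV_apply (A : X.V →ₗ[Q] X'.V) (B : Y.V →ₗ[R] Y'.V) (v : X.V) (w : Y.V) :
    boxV A B v w = mu X' Y' (A (evenPart k X.vpar v)) (B w) +
      mu X' Y' (A (oddPart k X.vpar v)) (opar Y Y' B w) := rfl

/-- The tensor product of operators on forms with coefficients, with the sign given by the rule of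
signs. -/
noncomputable def box (A : X.V →ₗ[Q] X'.V) (B : Y.V →ₗ[R] Y'.V) :
    (X.tensor Y).V →ₗ[Q ⊗[k] R] (X'.tensor Y').V :=
  -- Only the values on elements without forms are prescribed, and the operator is then extended
  -- linearly over forms. That the Koszul formula `boxV` holds on all products is `box_mu`, for
  -- operators linear over forms.
  omExt (pdesc ((AddMonoidHom.compHom' Y.incl.toAddMonoidHom).comp
      ((boxV A B).comp X.incl.toAddMonoidHom)) fun q r x y => by
    change boxV A B (X.incl (q • x)) (Y.incl (r • y)) =
      (q ⊗ₜ[k] r) • boxV A B (X.incl x) (Y.incl y)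
    simp only [boxV_apply, _root_.map_smul, mu_smul, smul_add])

theorem OmLin.box (A : X.V →ₗ[Q] X'.V) (B : Y.V →ₗ[R] Y'.V) : OmLin (box A B) := OmLin.omExt _

theorem boxV_vpar (A : X.V →ₗ[Q] X'.V) (B : Y.V →ₗ[R] Y'.V) (v : X.V) (w : Y.V) :
    (X'.tensor Y').vpar (boxV A B (X.vpar v) (Y.vpar w)) = boxV (opar X X' A) (opar Y Y' B) v w := by
  simp only [boxV_apply, map_add, vpar_mu, opar_apply, apply_evenPart vpar_vpar,
    apply_oddPart vpar_vpar, evenPart_apply vpar_vpar, oddPart_apply vpar_vpar, vpar_vpar]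

/-- A one-form passes both operators, so it picks up both of their parities. Multiplication by it
also exchanges the even and odd components of `v`, which interchanges the two summands of `boxV`. -/
theorem boxV_lw_left {A : X.V →ₗ[Q] X'.V} (hA : OmLin A) (B : Y.V →ₗ[R] Y'.V) (η : Ω[Q⁄k])
    (v : X.V) (w : Y.V) : boxV A B (X.lw (Forms.one η) v) w =
      (X'.tensor Y').lw (Forms.fstMap k Q R (Forms.one η))
        (boxV (opar X X' A) (opar Y Y' B) v w) := by
  have h : ∀ v, X.lw (Forms.one η) (X.vpar v) = -X.vpar (X.lw (Forms.one η) v) := fun v => by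
    rw [vpar_lw, Forms.sgn_one, map_neg, LinearMap.neg_apply, neg_neg]
  have h1 := map_evenPart_of_neg (k := k) h v
  have h2 := map_oddPart_of_neg (k := k) h v
  rw [boxV_apply, boxV_apply, ← h1, ← h2, hA, hA, mu_lw_left, mu_lw_left, opar_opar, map_add]
  exact add_comm _ _

theorem boxV_lw_right (A : X.V →ₗ[Q] X'.V) {B : Y.V →ₗ[R] Y'.V} (hB : OmLin B) (η : Ω[R⁄k])
    (v : X.V) (w : Y.V) : boxV A B v (Y.lw (Forms.one η) w) =
      (X'.tensor Y').lw (Forms.sndMap k Q R (Forms.one η))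
        (boxV (opar X X' A) (opar Y Y' B) (X.vpar v) w) := by
  rw [boxV_apply, boxV_apply, hB, hB.opar, mu_lw_right, mu_lw_right, opar_opar, ← map_add]
  simp only [opar_apply, apply_evenPart vpar_vpar,
    apply_oddPart vpar_vpar, evenPart_apply vpar_vpar, oddPart_apply vpar_vpar, map_neg, neg_neg]

variable [CharZero k]

theorem box_one (A : X.V →ₗ[Q] X'.V) (B : Y.V →ₗ[R] Y'.V) (x : X.P) (y : Y.P) :
    box A B (1 ⊗ₜ X.tmul Y x y) = boxV A B (1 ⊗ₜ x) (1 ⊗ₜ y) := by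
  unfold box
  rw [omExt_one]
  rfl

/-- Two operators linear over the forms agree if they agree on the elements `x ⊗ y`. -/
theorem tensor_gl_ext {Z : MF k (Q ⊗[k] R) (f ⊗ₜ[k] 1 + 1 ⊗ₜ[k] g)}
    {Φ Ψ : (X.tensor Y).V →ₗ[Q ⊗[k] R] Z.V} (hΦ : OmLin Φ) (hΨ : OmLin Ψ)
    (h : ∀ x y, Φ (mu X Y (1 ⊗ₜ x) (1 ⊗ₜ y)) = Ψ (mu X Y (1 ⊗ₜ x) (1 ⊗ₜ y))) : Φ = Ψ := by
  refine gl_ext hΦ hΨ fun p => ?_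
  induction p using tensor_induction with
  | zero => simp
  | add x y hx hy => simp only [TensorProduct.tmul_add, map_add, hx, hy]
  | tmul x y => rw [← mu_one_one, h]

theorem opar_box (A : X.V →ₗ[Q] X'.V) (B : Y.V →ₗ[R] Y'.V) :
    opar (X.tensor Y) (X'.tensor Y') (box A B) = box (opar X X' A) (opar Y Y' B) :=
  tensor_gl_ext (OmLin.box _ _).opar (OmLin.box _ _) fun x y => by
    have hx := vpar_incl (X := X) x
    have hy := vpar_incl (X := Y) y
    rw [incl_apply, incl_apply] at hx hy
    rw [opar_apply, vpar_mu, hx, hy, mu_one_one, mu_one_one, box_one, box_one, ← hx, ← hy,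
      boxV_vpar]

/-- Both sides are linear over forms in each variable, so it is enough to remove one-forms until
`box_one` applies. The operators must stay general in the induction, because each removed one-form
replaces them by their sign twists. -/
theorem box_mu {A : X.V →ₗ[Q] X'.V} {B : Y.V →ₗ[R] Y'.V} (hA : OmLin A) (hB : OmLin B) (v : X.V)
    (w : Y.V) : box A B (mu X Y v w) = boxV A B v w := by
  induction w using V_induction generalizing A B v with
  | h1 y =>
    induction v using V_induction generalizing A B with
    | h1 x => rw [mu_one_one, box_one]
    | hl η v ih =>
      rw [mu_lw_left, Forms.fstMap_one, OmLin.box, opar_box, ih hA.opar hB.opar, boxV_lw_left hA,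
        Forms.fstMap_one]
    | ha v v' hv hv' =>
      rw [map_add, map_add, AddMonoidHom.add_apply, AddMonoidHom.add_apply, map_add, hv hA hB,
        hv' hA hB]
  | hl η w ih =>
    rw [mu_lw_right, Forms.sndMap_one, OmLin.box, opar_box, ih hA.opar hB.opar, boxV_lw_right A hB,
      Forms.sndMap_one]
  | ha w w' hw hw' => rw [map_add, map_add, map_add, hw hA hB, hw' hA hB]

theorem boxV_add_left (A A' : X.V →ₗ[Q] X'.V) (B : Y.V →ₗ[R] Y'.V) (v : X.V) (w : Y.V) :
    boxV (A + A') B v w = boxV A B v w + boxV A' B v w := by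
  simp only [boxV_apply, LinearMap.add_apply, map_add, AddMonoidHom.add_apply]; abel

theorem boxV_add_right (A : X.V →ₗ[Q] X'.V) (B B' : Y.V →ₗ[R] Y'.V) (v : X.V) (w : Y.V) :
    boxV A (B + B') v w = boxV A B v w + boxV A B' v w := by
  simp only [boxV_apply, LinearMap.add_apply, map_add]; abel

theorem box_add_left (A A' : X.V →ₗ[Q] X'.V) (B : Y.V →ₗ[R] Y'.V) :
    box (A + A') B = box A B + box A' B :=
  tensor_gl_ext (OmLin.box _ _) ((OmLin.box _ _).add (OmLin.box _ _)) fun x y => by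
    simp only [mu_one_one, LinearMap.add_apply, box_one, boxV_add_left]

theorem box_add_right (A : X.V →ₗ[Q] X'.V) (B B' : Y.V →ₗ[R] Y'.V) :
    box A (B + B') = box A B + box A B' :=
  tensor_gl_ext (OmLin.box _ _) ((OmLin.box _ _).add (OmLin.box _ _)) fun x y => by
    simp only [mu_one_one, LinearMap.add_apply, box_one, boxV_add_right]

theorem box_zero_left (B : Y.V →ₗ[R] Y'.V) : box (0 : X.V →ₗ[Q] X'.V) B = 0 :=
  tensor_gl_ext (OmLin.box _ _) OmLin.zero fun x y => by
    rw [mu_one_one, box_one, boxV_apply]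
    simp only [LinearMap.zero_apply, map_zero, AddMonoidHom.zero_apply, add_zero]

theorem box_zero_right (A : X.V →ₗ[Q] X'.V) : box A (0 : Y.V →ₗ[R] Y'.V) = 0 :=
  tensor_gl_ext (OmLin.box _ _) OmLin.zero fun x y => by
    rw [mu_one_one, box_one, boxV_apply]
    simp only [LinearMap.zero_apply, map_zero, add_zero]

/-- The rule (A ⊗ B)(A' ⊗ B') = (-1)^(|B||A'|) AA' ⊗ BB', with no sign since `A'` is even. The
operator `B` need not be homogeneous. -/
theorem box_comp_of_even {A : X'.V →ₗ[Q] X''.V} {B : Y'.V →ₗ[R] Y''.V} {A' : X.V →ₗ[Q] X'.V}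
    {B' : Y.V →ₗ[R] Y'.V} (hA : OmLin A) (hB : OmLin B) (hA' : OmLin A') (hB' : OmLin B')
    (h : opar X X' A' = A') : box A B ∘ₗ box A' B' = box (A ∘ₗ A') (B ∘ₗ B') :=
  tensor_gl_ext ((OmLin.box _ _).comp (OmLin.box _ _)) (OmLin.box _ _) fun x y => by
    have h1 : ∀ v, A' (X.vpar v) = X'.vpar (A' v) := fun v => by
      nth_rewrite 2 [← h]
      rw [opar_apply, vpar_vpar]
    rw [LinearMap.comp_apply, box_mu hA' hB', boxV_apply, map_add, box_mu hA hB, box_mu hA hB,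
      box_mu (hA.comp hA') (hB.comp hB'), boxV_apply, boxV_apply, boxV_apply, map_evenPart h1,
      map_oddPart h1, opar_comp]
    simp only [LinearMap.comp_apply]
    rw [evenPart_of_eq (k := k) (apply_evenPart vpar_vpar _),
      oddPart_of_eq (k := k) (apply_evenPart vpar_vpar _),
      evenPart_of_eq_neg (k := k) (apply_oddPart vpar_vpar _),
      oddPart_of_eq_neg (k := k) (apply_oddPart vpar_vpar _), map_evenPart h1, map_oddPart h1]
    simp

/-- When `A'` is odd, passing it costs the parity of `B`, which for an inhomogeneous operator is
expressed by `opar`. -/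
theorem box_comp_of_odd {A : X'.V →ₗ[Q] X''.V} {B : Y'.V →ₗ[R] Y''.V} {A' : X.V →ₗ[Q] X'.V}
    {B' : Y.V →ₗ[R] Y'.V} (hA : OmLin A) (hB : OmLin B) (hA' : OmLin A') (hB' : OmLin B')
    (h : opar X X' A' = -A') :
    box A B ∘ₗ box A' B' = box (A ∘ₗ A') (opar Y' Y'' B ∘ₗ B') :=
  tensor_gl_ext ((OmLin.box _ _).comp (OmLin.box _ _)) (OmLin.box _ _) fun x y => by
    have h1 : ∀ v, A' (X.vpar v) = -X'.vpar (A' v) := fun v => by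
      rw [← neg_eq_iff_eq_neg, ← LinearMap.neg_apply, ← h, opar_apply, vpar_vpar]
    rw [LinearMap.comp_apply, box_mu hA' hB', boxV_apply, map_add, box_mu hA hB, box_mu hA hB,
      box_mu (hA.comp hA') (hB.opar.comp hB'), boxV_apply, boxV_apply, boxV_apply,
      map_evenPart_of_neg h1, map_oddPart_of_neg h1, opar_comp, opar_opar]
    simp only [LinearMap.comp_apply]
    rw [evenPart_of_eq (k := k) (apply_evenPart vpar_vpar _),
      oddPart_of_eq (k := k) (apply_evenPart vpar_vpar _),
      evenPart_of_eq_neg (k := k) (apply_oddPart vpar_vpar _),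
      oddPart_of_eq_neg (k := k) (apply_oddPart vpar_vpar _), map_evenPart_of_neg h1,
      map_oddPart_of_neg h1]
    simp

end MF

end Box


/-! ### Derivatives on a tensor product with the product connection. -/

section BoxOperators

set_option linter.unusedSectionVars false

open KaehlerDifferential

variable {k Q R : Type u} [Field k] [CommRing Q] [Algebra k Q] [CommRing R] [Algebra k R]

namespace MF

variable {f : Q} {g : R}

section

variable {X X' : MF k Q f}

theorem deriv1_add (cX : X.Connection) (cX' : X'.Connection) (a b : X.P →ₗ[Q] X'.P) (x : X.P) :
    deriv1 cX cX' (a + b) x = deriv1 cX cX' a x + deriv1 cX cX' b x := by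
  simp only [deriv1_apply, LinearMap.add_apply, LinearMap.lTensor_add, map_add]; abel

theorem deriv1_sub (cX : X.Connection) (cX' : X'.Connection) (a b : X.P →ₗ[Q] X'.P) (x : X.P) :
    deriv1 cX cX' (a - b) x = deriv1 cX cX' a x - deriv1 cX cX' b x := by
  simp only [deriv1_apply, LinearMap.sub_apply, LinearMap.lTensor_sub, map_sub]; abel

theorem deriv_apply (cX : X.Connection) (cX' : X'.Connection) (a : X.P →ₗ[Q] X'.P) (x : X.P) :
    deriv cX cX' a x = Forms.one.rTensor X'.P (deriv1 cX cX' a x) := rfl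

theorem hev_sub_hod [CharZero k] (a : X.P →ₗ[Q] X'.P) :
    hev X X' a - hod X X' a = hpar X X' a := evenPart_sub_oddPart (k := k) (σ := hpar X X') a

theorem evenPart_vpar_one_tmul (x : X.P) :
    evenPart k X.vpar (1 ⊗ₜ x) = 1 ⊗ₜ evenPart k X.par x :=
  (map_evenPart (F := X.incl) (fun x => (vpar_incl x).symm) x).symm

theorem oddPart_vpar_one_tmul (x : X.P) :
    oddPart k X.vpar (1 ⊗ₜ x) = 1 ⊗ₜ oddPart k X.par x :=
  (map_oddPart (F := X.incl) (fun x => (vpar_incl x).symm) x).symm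

theorem opar_id : opar X X LinearMap.id = LinearMap.id := by
  ext v; simp [vpar_vpar]

end

variable {X X' : MF k Q f} {Y Y' : MF k R g}

theorem mu_kinsL (t : Ω[Q⁄k] ⊗[Q] X.P) (y : Y.P) [CharZero k] :
    Forms.one.rTensor (X.tensor Y).P (kinsL X Y t y) = mu X Y (Forms.one.rTensor X.P t) (1 ⊗ₜ y) := by
  induction t using TensorProduct.induction_on with
  | zero => simp
  | add x y hx hy => simp only [map_add, AddMonoidHom.add_apply, hx, hy]
  | tmul η x =>
    rw [kinsL_tmul, LinearMap.rTensor_tmul, LinearMap.rTensor_tmul, mu_tmul, Forms.sgn_one_eq,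
      map_one, mul_one, ← TensorProduct.tmul_add, ← add_tmul, evenPart_add_oddPart,
      Forms.fstMap_one]

/-- The external product `mu` introduces the sign of the one-form passing x, while `kinsR` does not;
evaluating the latter at `X.par x` makes up for it. -/
theorem mu_kinsR (t : Ω[R⁄k] ⊗[R] Y.P) (x : X.P) [CharZero k] :
    Forms.one.rTensor (X.tensor Y).P (kinsR X Y t (X.par x)) =
      mu X Y (1 ⊗ₜ x) (Forms.one.rTensor Y.P t) := by
  induction t using TensorProduct.induction_on with
  | zero => simp
  | add x y hx hy => simp only [map_add, AddMonoidHom.add_apply, hx, hy]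
  | tmul η y =>
    rw [kinsR_tmul, LinearMap.rTensor_tmul, LinearMap.rTensor_tmul, mu_tmul, Forms.sgn_one, map_one,
      one_mul, one_mul, map_neg, TensorProduct.neg_tmul, ← TensorProduct.tmul_neg,
      ← TensorProduct.tmul_add, ← neg_tmul, ← add_tmul, ← sub_eq_add_neg, evenPart_sub_oddPart,
      Forms.sndMap_one]

variable [CharZero k]

theorem boxV_id_right (A : X.V →ₗ[Q] X'.V) (v : X.V) (w : Y.V) :
    boxV A LinearMap.id v w = mu X' Y (A v) w := by
  rw [boxV_apply, opar_id, LinearMap.id_apply, ← AddMonoidHom.add_apply, ← map_add, ← map_add,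
    evenPart_add_oddPart]

/-- Both operators are linear over forms, so they are compared on x ⊗ y. There one side distributes
the Koszul sign according to the parity of b, the other according to the parity of x. -/
theorem hat_tmap (a : X.P →ₗ[Q] X'.P) (b : Y.P →ₗ[R] Y'.P) :
    hat (X.tensor Y) (X'.tensor Y') (tmap X X' Y Y' a b) = box (hat X X' a) (hat Y Y' b) :=
  tensor_gl_ext (OmLin.hat _) (OmLin.box _ _) fun x y => by
    have h1 := LinearMap.congr_fun (hev_add_hod b) y
    have h2 := LinearMap.congr_fun (hev_sub_hod b) y
    rw [mu_one_one, hat_one_tmul, box_one, boxV_apply, opar_hat, hat_one_tmul, hat_one_tmul,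
      evenPart_vpar_one_tmul, oddPart_vpar_one_tmul, hat_one_tmul, hat_one_tmul, mu_one_one,
      mu_one_one, ← TensorProduct.tmul_add, ← h1, ← h2, tmap_tmul]
    congr 1
    rw [← evenPart_sub_oddPart (k := k) (σ := X.par) x]
    nth_rewrite 1 [← evenPart_add_oddPart (k := k) (σ := X.par) x]
    simp only [map_add, map_sub, map_neg, sub_eq_add_neg, LinearMap.add_apply, LinearMap.neg_apply, add_tmul,
      tmul_add, neg_tmul, tmul_neg]
    abel

variable (cX : X.Connection) (cX' : X'.Connection) (cY : Y.Connection) (cY' : Y'.Connection)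

theorem lTensor_tmap_kinsL (b : Y.P →ₗ[R] Y'.P) (a : X.P →ₗ[Q] X'.P) (t : Ω[Q⁄k] ⊗[Q] X.P)
    (y : Y.P) : (tmap X X' Y Y' a b).lTensor _ (kinsL X Y t y) =
      kinsL X' Y' (a.lTensor _ t) (hev Y Y' b y) +
        kinsL X' Y' (a.lTensor _ (X.par.lTensor _ t)) (hod Y Y' b y) := by
  induction t using TensorProduct.induction_on with
  | zero => simp
  | add x y hx hy => simp only [map_add, AddMonoidHom.add_apply, hx, hy]; abel
  | tmul η x =>
    rw [kinsL_tmul, LinearMap.lTensor_tmul, tmap_tmul, TensorProduct.tmul_add]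
    rfl

theorem lTensor_tmap_kinsR (b : Y.P →ₗ[R] Y'.P) (a : X.P →ₗ[Q] X'.P) (t : Ω[R⁄k] ⊗[R] Y.P)
    (x : X.P) : (tmap X X' Y Y' a b).lTensor _ (kinsR X Y t x) =
      kinsR X' Y' ((hev Y Y' b).lTensor _ t) (a x) +
        kinsR X' Y' ((hod Y Y' b).lTensor _ t) (a (X.par x)) := by
  induction t using TensorProduct.induction_on with
  | zero => simp
  | add x y hx hy => simp only [map_add, AddMonoidHom.add_apply, hx, hy]; abel
  | tmul η x =>
    rw [kinsR_tmul, LinearMap.lTensor_tmul, tmap_tmul, TensorProduct.tmul_add]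
    rfl

/-- The part of the product connection coming from Y commutes with a ⊗ 1 and drops out of the
derivative. The part coming from X produces the derivative of a. -/
theorem prime_tmap_id (a : X.P →ₗ[Q] X'.P) :
    prime (prodConn cX cY) (prodConn cX' cY) (tmap X X' Y Y a LinearMap.id) =
      box (prime cX cX' a) LinearMap.id :=
  tensor_gl_ext (OmLin.prime _ _ _) (OmLin.box _ _) fun x y => by
    rw [mu_one_one, prime_one_tmul, box_one, boxV_id_right, prime_one_tmul, deriv_apply,
      deriv_apply, ← mu_kinsL]
    congr 1
    have h1 : tmap X X' Y Y a LinearMap.id (X.tmul Y x y) = X'.tmul Y (a x) y := by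
      rw [tmap_tmul, hev_one, hod_one]
      exact (congrArg _ (TensorProduct.tmul_zero _ _)).trans (add_zero _)
    rw [deriv1_apply, deriv1_apply, h1]
    change prodNab cX' cY _ - LinearMap.lTensor _ _ (prodNab cX cY _) = _
    rw [prodNab_tmul, prodNab_tmul, map_add, lTensor_tmap_kinsL, lTensor_tmap_kinsR, hev_one,
      hod_one, LinearMap.lTensor_id, LinearMap.lTensor_zero]
    simp only [LinearMap.id_apply, LinearMap.zero_apply, map_zero, AddMonoidHom.zero_apply, map_sub,
      AddMonoidHom.sub_apply]
    abel

/-- Pure bookkeeping for the sign (-1)^(|b||x|): it turns a decomposition by the parity of b into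
one by the parity of x. -/
theorem biadd_add_sub {L M N : Type*} [AddCommGroup L] [AddCommGroup M] [AddCommGroup N]
    (K : L →+ M →+ N) (s t : L) (a b : M) :
    K s (a + b) + K t (a - b) = K (s + t) a - K (s - t) (-b) := by
  simp only [map_add, map_sub, map_neg, AddMonoidHom.add_apply, AddMonoidHom.sub_apply]
  abel

theorem deriv1_id_tmap (b : Y.P →ₗ[R] Y'.P) (x : X.P) (y : Y.P) :
    deriv1 (prodConn cX cY) (prodConn cX cY') (tmap X X Y Y' LinearMap.id b) (X.tmul Y x y) =
      kinsR X Y' (deriv1 cY cY' (hev Y Y' b) y) x +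
        kinsR X Y' (deriv1 cY cY' (hod Y Y' b) y) (X.par x) := by
  rw [deriv1_apply, deriv1_apply, deriv1_apply]
  change prodNab cX cY' _ - LinearMap.lTensor _ _ (prodNab cX cY _) = _
  rw [tmap_tmul, prodNab_tmul, map_add, prodNab_tmul, prodNab_tmul, map_add, lTensor_tmap_kinsL,
    lTensor_tmap_kinsR, LinearMap.id_apply, LinearMap.id_apply, LinearMap.lTensor_id, cX.nab_par]
  simp only [LinearMap.id_apply, map_sub, AddMonoidHom.sub_apply]
  abel

theorem kinsR_deriv1 (b : Y.P →ₗ[R] Y'.P) (x : X.P) (y : Y.P) :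
    kinsR X Y' (deriv1 cY cY' (hev Y Y' b) y) x +
        kinsR X Y' (deriv1 cY cY' (hod Y Y' b) y) (X.par x) =
      kinsR X Y' (deriv1 cY cY' b y) (X.par (evenPart k X.par x)) -
        kinsR X Y' (deriv1 cY cY' (hpar Y Y' b) y) (X.par (oddPart k X.par x)) := by
  have h2 := evenPart_add_oddPart (k := k) (σ := X.par) x
  have h3 := evenPart_sub_oddPart (k := k) (σ := X.par) x
  have h4 := deriv1_add cY cY' (hev Y Y' b) (hod Y Y' b) y
  have h5 := deriv1_sub cY cY' (hev Y Y' b) (hod Y Y' b) y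
  rw [hev_add_hod] at h4
  rw [hev_sub_hod] at h5
  have e := biadd_add_sub (kinsR X Y') (deriv1 cY cY' (hev Y Y' b) y)
    (deriv1 cY cY' (hod Y Y' b) y) (evenPart k X.par x) (oddPart k X.par x)
  rw [h2, h3, ← h4, ← h5] at e
  rw [e, apply_evenPart X.par_par, apply_oddPart X.par_par]

theorem box_id_prime (b : Y.P →ₗ[R] Y'.P) (x : X.P) (y : Y.P) :
    box LinearMap.id (prime cY cY' b) (1 ⊗ₜ X.tmul Y x y) =
      mu X Y' (1 ⊗ₜ evenPart k X.par x) (Forms.one.rTensor Y'.P (deriv1 cY cY' b y)) -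
      mu X Y' (1 ⊗ₜ oddPart k X.par x)
        (Forms.one.rTensor Y'.P (deriv1 cY cY' (hpar Y Y' b) y)) := by
  rw [box_one, boxV_apply, evenPart_vpar_one_tmul, oddPart_vpar_one_tmul, opar_prime,
    LinearMap.neg_apply, prime_one_tmul, prime_one_tmul, LinearMap.id_apply, LinearMap.id_apply,
    deriv_apply, deriv_apply, map_neg, sub_eq_add_neg]

/-- Connections preserve the grading, so the part coming from X commutes with 1 ⊗ b and drops out.
The remaining signs are distributed by the parity of b on one side and by that of x on the other;
`kinsR_deriv1` converts between them. -/
theorem prime_id_tmap (b : Y.P →ₗ[R] Y'.P) :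
    prime (prodConn cX cY) (prodConn cX cY') (tmap X X Y Y' LinearMap.id b) =
      box LinearMap.id (prime cY cY' b) :=
  tensor_gl_ext (OmLin.prime _ _ _) (OmLin.box _ _) fun x y => by
    rw [mu_one_one, prime_one_tmul, box_id_prime, ← mu_kinsR, ← mu_kinsR, ← map_sub,
      deriv_apply, deriv1_id_tmap, kinsR_deriv1]

theorem box_neg_left (A : X.V →ₗ[Q] X'.V) (B : Y.V →ₗ[R] Y'.V) : box (-A) B = -box A B :=
  tensor_gl_ext (OmLin.box _ _) (OmLin.box _ _).neg fun x y => by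
    rw [mu_one_one, LinearMap.neg_apply, box_one, box_one, boxV_apply, boxV_apply]
    simp only [LinearMap.neg_apply, map_neg, AddMonoidHom.neg_apply, neg_add]

theorem box_neg_right (A : X.V →ₗ[Q] X'.V) (B : Y.V →ₗ[R] Y'.V) : box A (-B) = -box A B :=
  tensor_gl_ext (OmLin.box _ _) (OmLin.box _ _).neg fun x y => by
    rw [mu_one_one, LinearMap.neg_apply, box_one, box_one, boxV_apply, boxV_apply]
    simp only [LinearMap.neg_apply, opar_neg, map_neg, neg_add]

/-- The differential of X ⊗ Y is δ ⊗ 1 + 1 ⊗ δ, and for the product connection each summand is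
differentiated in its own factor. The two resulting operators are even and commute, which is the
origin of the binomial coefficients below. -/
theorem S_prodConn : S (prodConn cX cY) = box (S cX) LinearMap.id + box LinearMap.id (S cY) := by
  have h2 : hod Y Y Y.δ = Y.δ := oddPart_of_eq_neg (k := k) (σ := hpar Y Y) (hpar_δ Y)
  have h3 : hev Y Y Y.δ = 0 := evenPart_of_eq_neg (k := k) (σ := hpar Y Y) (hpar_δ Y)
  have h : (X.tensor Y).δ =
      tmap X X Y Y X.δ LinearMap.id + tmap X X Y Y LinearMap.id Y.δ := tensor_hom_ext fun x y => by
    rw [LinearMap.add_apply, tmap_tmul, tmap_tmul, h2, h3, hev_one, hod_one, δ_tmul]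
    exact congrArg₂ (· + ·) ((add_zero _).symm.trans
      (congrArg _ (TensorProduct.tmul_zero _ _).symm))
      ((zero_add _).symm.trans (congrArg (· + _) (TensorProduct.tmul_zero _ _).symm))
  have e : prime (prodConn cX cY) (prodConn cX cY) (X.tensor Y).δ =
      box (prime cX cX X.δ) LinearMap.id + box LinearMap.id (prime cY cY Y.δ) := by
    rw [← prime_tmap_id cX cX cY, ← prime_id_tmap cX cY cY, ← map_add, ← h]
  rw [S, S, S, box_neg_left, box_neg_right, e]
  exact LinearMap.ext fun v => neg_add _ _

/-- The sequence `N ↦ ∑_{i + j = N} N! / (i! j!) Gᵢ ⊗ Hⱼ`. -/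
noncomputable def boxSeq (G : ℕ → (X.V →ₗ[Q] X'.V)) (H : ℕ → (Y.V →ₗ[R] Y'.V)) (N : ℕ) :
    (X.tensor Y).V →ₗ[Q ⊗[k] R] (X'.tensor Y').V :=
  ∑ ij ∈ Finset.HasAntidiagonal.antidiagonal N, N.choose ij.1 • box (G ij.1) (H ij.2)

theorem boxSeq_zero (G : ℕ → (X.V →ₗ[Q] X'.V)) (H : ℕ → (Y.V →ₗ[R] Y'.V)) :
    boxSeq G H 0 = box (G 0) (H 0) := by
  simp [boxSeq]

theorem boxSeq_zero_left (H : ℕ → (Y.V →ₗ[R] Y'.V)) (N : ℕ) :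
    boxSeq (0 : ℕ → (X.V →ₗ[Q] X'.V)) H N = 0 :=
  Finset.sum_eq_zero fun ij _ => by
    rw [Pi.zero_apply, box_zero_left, smul_zero]

theorem boxSeq_zero_right (G : ℕ → (X.V →ₗ[Q] X'.V)) (N : ℕ) :
    boxSeq G (0 : ℕ → (Y.V →ₗ[R] Y'.V)) N = 0 :=
  Finset.sum_eq_zero fun ij _ => by
    rw [Pi.zero_apply, box_zero_right, smul_zero]

theorem boxSeq_add_left (G G' : ℕ → (X.V →ₗ[Q] X'.V)) (H : ℕ → (Y.V →ₗ[R] Y'.V)) (N : ℕ) :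
    boxSeq (G + G') H N = boxSeq G H N + boxSeq G' H N := by
  simp only [boxSeq, Pi.add_apply, box_add_left, smul_add, Finset.sum_add_distrib]

theorem boxSeq_add_right (G : ℕ → (X.V →ₗ[Q] X'.V)) (H H' : ℕ → (Y.V →ₗ[R] Y'.V)) (N : ℕ) :
    boxSeq G (H + H') N = boxSeq G H N + boxSeq G H' N := by
  simp only [boxSeq, Pi.add_apply, box_add_right, smul_add, Finset.sum_add_distrib]

/-- Pascal's rule: a step from N to N + 1 is taken either in the first sequence or in the second. -/
theorem boxSeq_succ (G : ℕ → (X.V →ₗ[Q] X'.V)) (H : ℕ → (Y.V →ₗ[R] Y'.V)) (N : ℕ) :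
    boxSeq G H (N + 1) = boxSeq (fun N => G (N + 1)) H N + boxSeq G (fun N => H (N + 1)) N := by
  refine (Finset.sum_antidiagonal_choose_succ_nsmul (fun i j => box (G i) (H j)) N).trans ?_
  refine (add_comm _ _).trans ?_
  refine congrArg₂ (· + ·) (Finset.sum_congr rfl fun ij h => ?_) rfl
  rw [Finset.HasAntidiagonal.mem_antidiagonal] at h
  -- Pascal's rule produces the binomial coefficient indexed by the second entry of the pair in this
  -- sum; `boxSeq` uses the first.
  rw [Nat.choose_symm_of_eq_add h.symm]

end MF

end BoxOperators


/-! ### The operators attached to a shuffle product. -/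

section BoxWords

set_option linter.unusedSectionVars false

open KaehlerDifferential DGCat

variable {k Q R : Type u} [Field k] [CommRing Q] [Algebra k Q] [CommRing R] [Algebra k R]
  [CharZero k]

namespace MF

variable {f : Q} {g : R}

section

variable {X X' X'' : MF k Q f} {Y Y' Y'' : MF k R g}

theorem boxSeq_comp {A : ℕ → (X'.V →ₗ[Q] X''.V)} {B : ℕ → (Y'.V →ₗ[R] Y''.V)}
    {A' : ℕ → (X.V →ₗ[Q] X''.V)} {B' : ℕ → (Y.V →ₗ[R] Y''.V)}
    (C : (X.tensor Y).V →ₗ[Q ⊗[k] R] (X'.tensor Y').V)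
    (h : ∀ i j, box (A i) (B j) ∘ₗ C = box (A' i) (B' j)) (N : ℕ) :
    boxSeq A B N ∘ₗ C = boxSeq A' B' N := LinearMap.ext fun v => by
  rw [LinearMap.comp_apply, boxSeq, boxSeq, LinearMap.sum_apply, LinearMap.sum_apply]
  refine Finset.sum_congr rfl fun ij _ => ?_
  rw [← h]
  rfl

/-- The operators `S` are even, so no sign arises when they are distributed over the two factors. -/
theorem boxSeq_comp_S (cX : X.Connection) (cY : Y.Connection) {A : ℕ → (X.V →ₗ[Q] X'.V)}
    {B : ℕ → (Y.V →ₗ[R] Y'.V)} (hA : ∀ N, OmLin (A N)) (hB : ∀ N, OmLin (B N)) (N : ℕ) :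
    boxSeq A B N ∘ₗ S (prodConn cX cY) =
      boxSeq (fun N => A N ∘ₗ S cX) B N + boxSeq A (fun N => B N ∘ₗ S cY) N := by
  rw [S_prodConn, LinearMap.comp_add]
  refine congrArg₂ (· + ·) (boxSeq_comp _ (fun i j => ?_) N) (boxSeq_comp _ (fun i j => ?_) N)
  · exact box_comp_of_even (hA i) (hB j) (OmLin.S _) OmLin.id (opar_S _)
  · exact box_comp_of_even (hA i) (hB j) OmLin.id (OmLin.S _) opar_id

/-- The recursion satisfied by `boxSeq G H` when `G` and `H` satisfy recursions
`G (N + 1) = G' N - G N δ'` and `H (N + 1) = H' N - H N δ'`. -/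
theorem boxSeq_rec (cX : X.Connection) (cY : Y.Connection) {G G' : ℕ → (X.V →ₗ[Q] X'.V)}
    {H H' : ℕ → (Y.V →ₗ[R] Y'.V)} (hG : ∀ N, OmLin (G N)) (hH : ∀ N, OmLin (H N))
    (eG : ∀ N, G (N + 1) = G' N + G N ∘ₗ S cX) (eH : ∀ N, H (N + 1) = H' N + H N ∘ₗ S cY) (N : ℕ) :
    boxSeq G H (N + 1) =
      boxSeq G' H N + boxSeq G H' N + boxSeq G H N ∘ₗ S (prodConn cX cY) := by
  have e1 : (fun N => G (N + 1)) = G' + fun N => G N ∘ₗ S cX := funext eG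
  have e2 : (fun N => H (N + 1)) = H' + fun N => H N ∘ₗ S cY := funext eH
  rw [boxSeq_succ, e1, e2, boxSeq_add_left, boxSeq_add_right, boxSeq_comp_S cX cY hG hH]
  exact add_add_add_comm _ _ _ _

theorem boxSeq_comp_prime_right (cX : X.Connection) (cY : Y.Connection) (cY' : Y'.Connection)
    {A : ℕ → (X.V →ₗ[Q] X'.V)} {B : ℕ → (Y'.V →ₗ[R] Y''.V)} (hA : ∀ N, OmLin (A N))
    (hB : ∀ N, OmLin (B N)) (b : Y.P →ₗ[R] Y'.P) (N : ℕ) :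
    boxSeq A B N ∘ₗ prime (prodConn cX cY) (prodConn cX cY') (tmap X X Y Y' LinearMap.id b) =
      boxSeq A (fun N => B N ∘ₗ prime cY cY' b) N := by
  rw [prime_id_tmap]
  exact boxSeq_comp _ (fun i j =>
    box_comp_of_even (hA i) (hB j) OmLin.id (OmLin.prime _ _ _) opar_id) N

/-- The derivative of a ⊗ 1 passes the operators `B`. It is even when a is odd, and then costs
nothing; it is odd when a is even, and then costs the parity of `B`. These are the two terms of
`Pairing.shLast`, with `opar` in the place of `wpar`. -/
theorem boxSeq_comp_prime_left (cX : X.Connection) (cX' : X'.Connection) (cY : Y.Connection)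
    {A : ℕ → (X'.V →ₗ[Q] X''.V)} {B : ℕ → (Y.V →ₗ[R] Y'.V)} (hA : ∀ N, OmLin (A N))
    (hB : ∀ N, OmLin (B N)) (a : X.P →ₗ[Q] X'.P) (N : ℕ) :
    boxSeq A B N ∘ₗ prime (prodConn cX cY) (prodConn cX' cY)
        (tmap X X' Y Y (hod X X' a) LinearMap.id) +
      boxSeq A (fun N => opar Y Y' (B N)) N ∘ₗ prime (prodConn cX cY) (prodConn cX' cY)
        (tmap X X' Y Y (hev X X' a) LinearMap.id) =
      boxSeq (fun N => A N ∘ₗ prime cX cX' a) B N := by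
  have h1 : opar X X' (prime cX cX' (hod X X' a)) = prime cX cX' (hod X X' a) := by
    rw [opar_prime, hpar_hod, map_neg]; exact LinearMap.ext fun v => neg_neg _
  have h2 : opar X X' (prime cX cX' (hev X X' a)) = -prime cX cX' (hev X X' a) := by
    rw [opar_prime, hpar_hev]
  have e : (fun N => A N ∘ₗ prime cX cX' a) = (fun N => A N ∘ₗ prime cX cX' (hod X X' a)) +
      fun N => A N ∘ₗ prime cX cX' (hev X X' a) := funext fun N => by
    rw [Pi.add_apply, ← LinearMap.comp_add, ← map_add, add_comm, hev_add_hod]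
  rw [prime_tmap_id, prime_tmap_id, e, boxSeq_add_left]
  refine congrArg₂ (· + ·) (boxSeq_comp _ (fun i j => ?_) N) (boxSeq_comp _ (fun i j => ?_) N)
  · exact box_comp_of_even (hA i) (hB j) (OmLin.prime _ _ _) OmLin.id h1
  · refine (box_comp_of_odd (hA i) (hB j).opar (OmLin.prime _ _ _) OmLin.id h2).trans ?_
    rw [opar_opar]
    rfl

theorem boxSeq_rec_base_base (cX : X.Connection) (cY : Y.Connection) {G : ℕ → (X.V →ₗ[Q] X'.V)}
    {H : ℕ → (Y.V →ₗ[R] Y'.V)} (hG : ∀ N, OmLin (G N)) (hH : ∀ N, OmLin (H N))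
    (eG : ∀ N, G (N + 1) = G N ∘ₗ S cX) (eH : ∀ N, H (N + 1) = H N ∘ₗ S cY) (N : ℕ) :
    boxSeq G H (N + 1) = boxSeq G H N ∘ₗ S (prodConn cX cY) := by
  have e := boxSeq_rec cX cY (G' := 0) (H' := 0) hG hH (fun N => (eG N).trans (zero_add _).symm)
    (fun N => (eH N).trans (zero_add _).symm) N
  rw [boxSeq_zero_left, boxSeq_zero_right, add_zero] at e
  exact e.trans (zero_add _)

theorem boxSeq_rec_base_snoc (cX : X.Connection) (cY : Y.Connection) (cV : Y''.Connection)
    {G : ℕ → (X.V →ₗ[Q] X'.V)} {H : ℕ → (Y.V →ₗ[R] Y'.V)} {B : ℕ → (Y''.V →ₗ[R] Y'.V)}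
    (hG : ∀ N, OmLin (G N)) (hH : ∀ N, OmLin (H N)) (hB : ∀ N, OmLin (B N)) (b : Y.P →ₗ[R] Y''.P)
    (eG : ∀ N, G (N + 1) = G N ∘ₗ S cX)
    (eH : ∀ N, H (N + 1) = B N ∘ₗ prime cY cV b + H N ∘ₗ S cY) (N : ℕ) :
    boxSeq G H (N + 1) =
      boxSeq G B N ∘ₗ prime (prodConn cX cY) (prodConn cX cV) (tmap X X Y Y'' LinearMap.id b) +
        boxSeq G H N ∘ₗ S (prodConn cX cY) := by
  have e := boxSeq_rec cX cY (G' := 0) hG hH (fun N => (eG N).trans (zero_add _).symm) eH N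
  rw [boxSeq_zero_left] at e
  rw [boxSeq_comp_prime_right _ _ _ hG hB]
  exact e.trans (congrArg (· + _) (zero_add _))

theorem boxSeq_rec_snoc_base (cX : X.Connection) (cY : Y.Connection) (cU : X''.Connection)
    {G : ℕ → (X.V →ₗ[Q] X'.V)} {H : ℕ → (Y.V →ₗ[R] Y'.V)} {A : ℕ → (X''.V →ₗ[Q] X'.V)}
    (hG : ∀ N, OmLin (G N)) (hH : ∀ N, OmLin (H N)) (hA : ∀ N, OmLin (A N)) (a : X.P →ₗ[Q] X''.P)
    (eG : ∀ N, G (N + 1) = A N ∘ₗ prime cX cU a + G N ∘ₗ S cX)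
    (eH : ∀ N, H (N + 1) = H N ∘ₗ S cY) (N : ℕ) :
    boxSeq G H (N + 1) =
      (boxSeq A H N ∘ₗ prime (prodConn cX cY) (prodConn cU cY)
          (tmap X X'' Y Y (hod X X'' a) LinearMap.id) +
        boxSeq A (fun N => opar Y Y' (H N)) N ∘ₗ prime (prodConn cX cY) (prodConn cU cY)
          (tmap X X'' Y Y (hev X X'' a) LinearMap.id)) +
        boxSeq G H N ∘ₗ S (prodConn cX cY) := by
  have e := boxSeq_rec cX cY (H' := 0) hG hH eG (fun N => (eH N).trans (zero_add _).symm) N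
  rw [boxSeq_zero_right] at e
  rw [boxSeq_comp_prime_left _ _ _ hA hH]
  exact e.trans (congrArg (· + _) (add_zero _))

/-- The rightmost factor of an operator product is either the derivative of the last letter of one
of the two words, or a factor `S` of the last object. The first kind reproduces the terms of
`Pairing.sh_snoc_snoc`, the second is the common tail of the recursion. -/
theorem boxSeq_rec_snoc_snoc (cX : X.Connection) (cY : Y.Connection) (cU : X''.Connection)
    (cV : Y''.Connection) {G : ℕ → (X.V →ₗ[Q] X'.V)} {H : ℕ → (Y.V →ₗ[R] Y'.V)}
    {A : ℕ → (X''.V →ₗ[Q] X'.V)} {B : ℕ → (Y''.V →ₗ[R] Y'.V)} (hG : ∀ N, OmLin (G N))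
    (hH : ∀ N, OmLin (H N)) (hA : ∀ N, OmLin (A N)) (hB : ∀ N, OmLin (B N)) (a : X.P →ₗ[Q] X''.P)
    (b : Y.P →ₗ[R] Y''.P) (eG : ∀ N, G (N + 1) = A N ∘ₗ prime cX cU a + G N ∘ₗ S cX)
    (eH : ∀ N, H (N + 1) = B N ∘ₗ prime cY cV b + H N ∘ₗ S cY) (N : ℕ) :
    boxSeq G H (N + 1) =
      (boxSeq G B N ∘ₗ prime (prodConn cX cY) (prodConn cX cV) (tmap X X Y Y'' LinearMap.id b) +
        (boxSeq A H N ∘ₗ prime (prodConn cX cY) (prodConn cU cY)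
          (tmap X X'' Y Y (hod X X'' a) LinearMap.id) +
        boxSeq A (fun N => opar Y Y' (H N)) N ∘ₗ prime (prodConn cX cY) (prodConn cU cY)
          (tmap X X'' Y Y (hev X X'' a) LinearMap.id))) +
        boxSeq G H N ∘ₗ S (prodConn cX cY) := by
  have e := boxSeq_rec cX cY hG hH eG eH N
  rw [boxSeq_comp_prime_left _ _ _ hA hH, boxSeq_comp_prime_right _ _ _ hG hB]
  exact e.trans (congrArg (· + _) (add_comm _ _))

theorem eq_of_rec {M : Type*} {U V : ℕ → M} (F : ℕ → M → M) (h0 : U 0 = V 0)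
    (hU : ∀ N, U (N + 1) = F N (U N)) (hV : ∀ N, V (N + 1) = F N (V N)) (N : ℕ) : U N = V N := by
  induction N with
  | zero => exact h0
  | succ N ih => rw [hU, hV, ih]

end

theorem word_snoc_succ {Z : Set (PrimeSpectrum Q)} (c : ∀ X : MF k Q f, X.Connection)
    {X Y Z' : (dg k Q f Z).Obj} (x : (dg k Q f Z).Word X Z') (a : (dg k Q f Z).Hom Y Z') (N : ℕ) :
    word c Y (snoc x a) (N + 1) =
      word c Z' x N ∘ₗ prime (c Y.1) (c Z'.1) a + word c Y (snoc x a) N ∘ₗ S (c Y.1) := by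
  have h := congrFun (word_snoc c x a)
  refine (h (N + 1)).trans ((app_succ _ _ _ _ N).trans ?_)
  exact congrArg (fun T => _ + T ∘ₗ S (c Y.1)) (h N).symm

theorem word_snoc_zero {Z : Set (PrimeSpectrum Q)} (c : ∀ X : MF k Q f, X.Connection)
    {X Y Z' : (dg k Q f Z).Obj} (x : (dg k Q f Z).Word X Z') (a : (dg k Q f Z).Hom Y Z') :
    word c Y (snoc x a) 0 = 0 := congrFun (word_snoc c x a) 0

namespace Indexed

variable {T : Type (u + 1)} {o : T → MF k Q f} (c : ∀ t, (o t).Connection)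

theorem word_snoc_succ {X Y Z' : (dgOn o).Obj} (x : (dgOn o).Word X Z') (a : (dgOn o).Hom Y Z')
    (N : ℕ) : word c Y (snoc x a) (N + 1) =
      word c Z' x N ∘ₗ prime (c Y) (c Z') a + word c Y (snoc x a) N ∘ₗ S (c Y) := by
  have h := congrFun (word_snoc c x a)
  refine (h (N + 1)).trans ((app_succ _ _ _ _ N).trans ?_)
  exact congrArg (fun T => _ + T ∘ₗ S (c Y)) (h N).symm

theorem word_snoc_zero {X Y Z' : (dgOn o).Obj} (x : (dgOn o).Word X Z') (a : (dgOn o).Hom Y Z') :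
    word c Y (snoc x a) 0 = 0 := congrFun (word_snoc c x a) 0

end Indexed

/-- Matrix factorizations with a connection. -/
abbrev WithConn (k Q : Type u) [Field k] [CommRing Q] [Algebra k Q] (f : Q) : Type (u + 1) :=
  Σ X : MF k Q f, X.Connection

/-- The underlying matrix factorization. -/
abbrev WithConn.mf (X : WithConn k Q f) : MF k Q f := X.1

/-- The dg-category of matrix factorizations with a connection; the connections play no role for the
morphisms. -/
noncomputable abbrev dgConn (k Q : Type u) [Field k] [CommRing Q] [Algebra k Q] (f : Q) :
    DGCat k Q := dgOn (WithConn.mf (k := k) (Q := Q) (f := f))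

/-- The tautological choice of connections. -/
def tautConn (t : WithConn k Q f) : t.mf.Connection := t.2

variable {Z : Set (PrimeSpectrum Q)} {W : Set (PrimeSpectrum R)}

/-- The tensor product of matrix factorizations, endowed with the tensor product of connections. -/
noncomputable def pairingConn (Z : Set (PrimeSpectrum Q)) (W : Set (PrimeSpectrum R))
    (cQ : ∀ X : MF k Q f, X.Connection) (cR : ∀ Y : MF k R g, Y.Connection) :
    DGCat.Pairing (dg k Q f Z) (dg k R g W)
      (dgConn k (Q ⊗[k] R) (f ⊗ₜ[k] 1 + 1 ⊗ₜ[k] g)) where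
  obj X Y := ⟨X.1.tensor Y.1, prodConn (cQ X.1) (cR Y.1)⟩
  map {X X' Y Y'} := tmap X.1 X'.1 Y.1 Y'.1
  map_one _ _ := tmap_one
  smul_map q r a b := tmap_smul q r a b
  par_map a b := hpar_tmap a b
  d_map a b := hd_tmap a b
  comp_map a b a' b' := tmap_comp a b a' b'

variable (cQ : ∀ X : MF k Q f, X.Connection) (cR : ∀ Y : MF k R g, Y.Connection)

/-- The sequence of operators of a word in tensor products of matrix factorizations. -/
noncomputable def wordConn {X : (dg k Q f Z).Obj} {Y : (dg k R g W).Obj} (X' : (dg k Q f Z).Obj)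
    (Y' : (dg k R g W).Obj)
    (z : (dgConn k (Q ⊗[k] R) (f ⊗ₜ[k] 1 + 1 ⊗ₜ[k] g)).Word
      ((pairingConn Z W cQ cR).obj X Y) ((pairingConn Z W cQ cR).obj X' Y')) :
    ℕ → ((X'.1.tensor Y'.1).V →ₗ[Q ⊗[k] R] (X.1.tensor Y.1).V) :=
  Indexed.word (o := WithConn.mf) tautConn ((pairingConn Z W cQ cR).obj X' Y') z

section

variable {X X' Z' : (dg k Q f Z).Obj} {Y Y' V : (dg k R g W).Obj}

theorem wordConn_add (z z' : (dgConn k (Q ⊗[k] R) (f ⊗ₜ[k] 1 + 1 ⊗ₜ[k] g)).Word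
      ((pairingConn Z W cQ cR).obj X Y) ((pairingConn Z W cQ cR).obj X' Y')) :
    wordConn cQ cR X' Y' (z + z') = wordConn cQ cR X' Y' z + wordConn cQ cR X' Y' z' :=
  map_add (Indexed.word (o := WithConn.mf) tautConn ((pairingConn Z W cQ cR).obj X' Y')) z z'

theorem wordConn_zero : wordConn cQ cR X' Y' (0 : (dgConn k (Q ⊗[k] R) _).Word
      ((pairingConn Z W cQ cR).obj X Y) ((pairingConn Z W cQ cR).obj X' Y')) = 0 :=
  map_zero (Indexed.word (o := WithConn.mf) tautConn ((pairingConn Z W cQ cR).obj X' Y'))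

theorem wordConn_base_zero (a : X'.1.P →ₗ[Q] X.1.P) (b : Y'.1.P →ₗ[R] Y.1.P) :
    wordConn cQ cR X' Y' (base ((pairingConn Z W cQ cR).map (X := X') (X' := X) (Y := Y') (Y' := Y)
      a b)) 0 = box (hat X'.1 X.1 a) (hat Y'.1 Y.1 b) :=
  (Indexed.word_base_zero tautConn _).trans (hat_tmap a b)

theorem wordConn_base_succ (a : X'.1.P →ₗ[Q] X.1.P) (b : Y'.1.P →ₗ[R] Y.1.P) (N : ℕ) :
    wordConn cQ cR X' Y' (base ((pairingConn Z W cQ cR).map (X := X') (X' := X) (Y := Y') (Y' := Y)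
      a b)) (N + 1) =
    wordConn cQ cR X' Y' (base ((pairingConn Z W cQ cR).map (X := X') (X' := X) (Y := Y') (Y' := Y)
      a b)) N ∘ₗ S (prodConn (cQ X'.1) (cR Y'.1)) :=
  Indexed.word_base_succ tautConn _ N

theorem wordConn_snoc_zero (z : (dgConn k (Q ⊗[k] R) (f ⊗ₜ[k] 1 + 1 ⊗ₜ[k] g)).Word
      ((pairingConn Z W cQ cR).obj X Y) ((pairingConn Z W cQ cR).obj Z' V))
    (a : X'.1.P →ₗ[Q] Z'.1.P) (b : Y'.1.P →ₗ[R] V.1.P) :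
    wordConn cQ cR X' Y' (snoc z ((pairingConn Z W cQ cR).map (X := X') (X' := Z') (Y := Y')
      (Y' := V) a b)) 0 = 0 := Indexed.word_snoc_zero tautConn _ _

theorem wordConn_snoc_succ (z : (dgConn k (Q ⊗[k] R) (f ⊗ₜ[k] 1 + 1 ⊗ₜ[k] g)).Word
      ((pairingConn Z W cQ cR).obj X Y) ((pairingConn Z W cQ cR).obj Z' V))
    (a : X'.1.P →ₗ[Q] Z'.1.P) (b : Y'.1.P →ₗ[R] V.1.P) (N : ℕ) :
    wordConn cQ cR X' Y' (snoc z ((pairingConn Z W cQ cR).map (X := X') (X' := Z') (Y := Y')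
      (Y' := V) a b)) (N + 1) = wordConn cQ cR Z' V z N ∘ₗ
        prime (prodConn (cQ X'.1) (cR Y'.1)) (prodConn (cQ Z'.1) (cR V.1))
          (tmap X'.1 Z'.1 Y'.1 V.1 a b) +
      wordConn cQ cR X' Y' (snoc z ((pairingConn Z W cQ cR).map (X := X') (X' := Z') (Y := Y')
        (Y' := V) a b)) N ∘ₗ S (prodConn (cQ X'.1) (cR Y'.1)) :=
  Indexed.word_snoc_succ tautConn _ _ N

/-- The first word has no letters between its brackets, so there is only one shuffle. Both sequences
start with the same value and satisfy the same recursion in the form degree. -/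
theorem wordConn_shBase (a : (dg k Q f Z).Hom X' X) (y : (dg k R g W).Word Y Y') :
    wordConn cQ cR X' Y' ((pairingConn Z W cQ cR).shBase a Y' y) =
      boxSeq (word cQ X' (base a)) (word cR Y' y) := by
  refine word_induction (p := fun Y' y =>
    wordConn cQ cR X' Y' ((pairingConn Z W cQ cR).shBase a Y' y) =
    boxSeq (word cQ X' (base a)) (word cR Y' y)) y (fun Y' b => funext fun N => ?_)
    (fun Y' V y b h => funext fun N => ?_) (fun Y' => funext fun N => ?_)
    (fun Y' y y' hy hy' => funext fun N => ?_)
  · rw [Pairing.shBase_base]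
    refine eq_of_rec (fun _ u => u ∘ₗ S (prodConn (cQ X'.1) (cR Y'.1))) ?_
      (wordConn_base_succ cQ cR a b) (boxSeq_rec_base_base _ _ (word_omLin cQ (base a))
        (word_omLin cR (base b)) (word_base_succ cQ a) (word_base_succ cR b)) N
    refine (wordConn_base_zero cQ cR a b).trans ((congrArg₂ box (word_base_zero cQ a).symm
      (word_base_zero cR b).symm).trans (boxSeq_zero _ _).symm)
  · rw [Pairing.shBase_snoc]
    refine eq_of_rec (fun N u => _ + u ∘ₗ S (prodConn (cQ X'.1) (cR Y'.1))) ?_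
      (fun N => (wordConn_snoc_succ cQ cR _ LinearMap.id b N).trans ?_)
      (boxSeq_rec_base_snoc _ _ _ (word_omLin cQ (base a))
        (word_omLin cR (snoc y b)) (word_omLin cR y) b (word_base_succ cQ a)
          (word_snoc_succ cR y b)) N
    · refine (wordConn_snoc_zero cQ cR _ LinearMap.id b).trans ((box_zero_right _).symm.trans
        ((congrArg (box _) (word_snoc_zero cR y b).symm).trans (boxSeq_zero _ _).symm))
    · rw [h]
  · rw [map_zero, map_zero, wordConn_zero]
    exact (boxSeq_zero_right _ N).symm
  · rw [map_add, map_add, wordConn_add, hy, hy']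
    exact (boxSeq_add_right _ _ _ N).symm

/-- The recursion satisfied by the sequence of operators of a word whose last letter has been
appended: `A` comes from the last letter, `s` is the square of the connection. -/
def IsRec {A M N : Type*} [CommRing A] [AddCommGroup M] [Module A M] [AddCommGroup N] [Module A N]
    (s : M →ₗ[A] M) (B U : ℕ → (M →ₗ[A] N)) : Prop :=
  U 0 = 0 ∧ ∀ n, U (n + 1) = B n + U n ∘ₗ s

section

variable {A M N : Type*} [CommRing A] [AddCommGroup M] [Module A M] [AddCommGroup N] [Module A N]
  {s : M →ₗ[A] M} {B B' U U' : ℕ → (M →ₗ[A] N)}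

theorem IsRec.add (h : IsRec s B U) (h' : IsRec s B' U') : IsRec s (B + B') (U + U') := by
  refine ⟨by rw [Pi.add_apply, h.1, h'.1, add_zero], fun n => ?_⟩
  rw [Pi.add_apply, h.2, h'.2, Pi.add_apply, Pi.add_apply, LinearMap.add_comp, add_add_add_comm]

/-- Equality of operator sequences is thereby reduced to equality of the contributions of the last
letters, which involve shorter words only. -/
theorem IsRec.unique (h : IsRec s B U) (h' : IsRec s B' U') (e : B = B') : U = U' :=
  funext fun n => eq_of_rec (fun n u => B n + u ∘ₗ s) (h.1.trans h'.1.symm) h.2 (e ▸ h'.2) n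

end

theorem wordConn_snoc_isRec (z : (dgConn k (Q ⊗[k] R) (f ⊗ₜ[k] 1 + 1 ⊗ₜ[k] g)).Word
      ((pairingConn Z W cQ cR).obj X Y) ((pairingConn Z W cQ cR).obj Z' V))
    (a : X'.1.P →ₗ[Q] Z'.1.P) (b : Y'.1.P →ₗ[R] V.1.P) :
    IsRec (S (prodConn (cQ X'.1) (cR Y'.1))) (fun N => wordConn cQ cR Z' V z N ∘ₗ
        prime (prodConn (cQ X'.1) (cR Y'.1)) (prodConn (cQ Z'.1) (cR V.1))
          (tmap X'.1 Z'.1 Y'.1 V.1 a b))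
      (wordConn cQ cR X' Y' (snoc z ((pairingConn Z W cQ cR).map (X := X') (X' := Z') (Y := Y')
        (Y' := V) a b))) :=
  ⟨wordConn_snoc_zero cQ cR z a b, wordConn_snoc_succ cQ cR z a b⟩

theorem boxSeq_isRec_snoc_base (x : (dg k Q f Z).Word X Z') (a : (dg k Q f Z).Hom X' Z')
    (b : (dg k R g W).Hom Y' Y) :
    IsRec (S (prodConn (cQ X'.1) (cR Y'.1)))
      ((fun N => boxSeq (word cQ Z' x) (word cR Y' (base b)) N ∘ₗ
          prime (prodConn (cQ X'.1) (cR Y'.1)) (prodConn (cQ Z'.1) (cR Y'.1))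
            (tmap X'.1 Z'.1 Y'.1 Y'.1 (hod X'.1 Z'.1 a) LinearMap.id)) +
        fun N => boxSeq (word cQ Z' x) (fun N => opar Y'.1 Y.1 (word cR Y' (base b) N)) N ∘ₗ
          prime (prodConn (cQ X'.1) (cR Y'.1)) (prodConn (cQ Z'.1) (cR Y'.1))
            (tmap X'.1 Z'.1 Y'.1 Y'.1 (hev X'.1 Z'.1 a) LinearMap.id))
      (boxSeq (word cQ X' (snoc x a)) (word cR Y' (base b))) :=
  ⟨(boxSeq_zero _ _).trans ((congrArg (fun T => box T _) (word_snoc_zero cQ x a)).trans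
    (box_zero_left _)), boxSeq_rec_snoc_base _ _ _ (word_omLin cQ (snoc x a))
      (word_omLin cR (base b)) (word_omLin cQ x) a (word_snoc_succ cQ x a) (word_base_succ cR b)⟩

theorem boxSeq_isRec_snoc_snoc (x : (dg k Q f Z).Word X Z') (a : (dg k Q f Z).Hom X' Z')
    (y : (dg k R g W).Word Y V) (b : (dg k R g W).Hom Y' V) :
    IsRec (S (prodConn (cQ X'.1) (cR Y'.1)))
      ((fun N => boxSeq (word cQ X' (snoc x a)) (word cR V y) N ∘ₗ
          prime (prodConn (cQ X'.1) (cR Y'.1)) (prodConn (cQ X'.1) (cR V.1))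
            (tmap X'.1 X'.1 Y'.1 V.1 LinearMap.id b)) +
        ((fun N => boxSeq (word cQ Z' x) (word cR Y' (snoc y b)) N ∘ₗ
          prime (prodConn (cQ X'.1) (cR Y'.1)) (prodConn (cQ Z'.1) (cR Y'.1))
            (tmap X'.1 Z'.1 Y'.1 Y'.1 (hod X'.1 Z'.1 a) LinearMap.id)) +
        fun N => boxSeq (word cQ Z' x) (fun N => opar Y'.1 Y.1 (word cR Y' (snoc y b) N)) N ∘ₗ
          prime (prodConn (cQ X'.1) (cR Y'.1)) (prodConn (cQ Z'.1) (cR Y'.1))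
            (tmap X'.1 Z'.1 Y'.1 Y'.1 (hev X'.1 Z'.1 a) LinearMap.id)))
      (boxSeq (word cQ X' (snoc x a)) (word cR Y' (snoc y b))) :=
  ⟨(boxSeq_zero _ _).trans ((congrArg (fun T => box T _) (word_snoc_zero cQ x a)).trans
    (box_zero_left _)), boxSeq_rec_snoc_snoc _ _ _ _ (word_omLin cQ (snoc x a))
      (word_omLin cR (snoc y b)) (word_omLin cQ x) (word_omLin cR y) a b (word_snoc_succ cQ x a)
          (word_snoc_succ cR y b)⟩

theorem word_wpar_seq (y : (dg k R g W).Word Y Y') :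
    word cR Y' (wpar Y' y) = fun N => opar Y'.1 Y.1 (word cR Y' y N) :=
  funext fun N => word_wpar cR y N

theorem wordConn_snoc_base (x : (dg k Q f Z).Word X Z') (a : (dg k Q f Z).Hom X' Z')
    (b : (dg k R g W).Hom Y' Y) {z₁ z₂ : (dgConn k (Q ⊗[k] R) (f ⊗ₜ[k] 1 + 1 ⊗ₜ[k] g)).Word
      ((pairingConn Z W cQ cR).obj X Y) ((pairingConn Z W cQ cR).obj Z' Y')}
    (h₁ : wordConn cQ cR Z' Y' z₁ = boxSeq (word cQ Z' x) (word cR Y' (base b)))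
    (h₂ : wordConn cQ cR Z' Y' z₂ = boxSeq (word cQ Z' x) (word cR Y' (wpar Y' (base b)))) :
    wordConn cQ cR X' Y'
      (snoc z₁ ((pairingConn Z W cQ cR).map (X := X') (X' := Z') (Y := Y') (Y' := Y')
        (hod X'.1 Z'.1 a) LinearMap.id) +
      snoc z₂ ((pairingConn Z W cQ cR).map (X := X') (X' := Z') (Y := Y') (Y' := Y')
        (hev X'.1 Z'.1 a) LinearMap.id)) =
      boxSeq (word cQ X' (snoc x a)) (word cR Y' (base b)) := by
  refine (wordConn_add cQ cR _ _).trans (IsRec.unique ((wordConn_snoc_isRec cQ cR z₁ _ _).add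
    (wordConn_snoc_isRec cQ cR z₂ _ _)) (boxSeq_isRec_snoc_base cQ cR x a b) ?_)
  rw [h₁, h₂, word_wpar_seq]

theorem wordConn_snoc_snoc (x : (dg k Q f Z).Word X Z') (a : (dg k Q f Z).Hom X' Z')
    (y : (dg k R g W).Word Y V) (b : (dg k R g W).Hom Y' V)
    {z₀ : (dgConn k (Q ⊗[k] R) (f ⊗ₜ[k] 1 + 1 ⊗ₜ[k] g)).Word
      ((pairingConn Z W cQ cR).obj X Y) ((pairingConn Z W cQ cR).obj X' V)}
    {z₁ z₂ : (dgConn k (Q ⊗[k] R) (f ⊗ₜ[k] 1 + 1 ⊗ₜ[k] g)).Word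
      ((pairingConn Z W cQ cR).obj X Y) ((pairingConn Z W cQ cR).obj Z' Y')}
    (h₀ : wordConn cQ cR X' V z₀ = boxSeq (word cQ X' (snoc x a)) (word cR V y))
    (h₁ : wordConn cQ cR Z' Y' z₁ = boxSeq (word cQ Z' x) (word cR Y' (snoc y b)))
    (h₂ : wordConn cQ cR Z' Y' z₂ = boxSeq (word cQ Z' x) (word cR Y' (wpar Y' (snoc y b)))) :
    wordConn cQ cR X' Y'
      (snoc z₀ ((pairingConn Z W cQ cR).map (X := X') (X' := X') (Y := Y') (Y' := V)
        LinearMap.id b) +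
      (snoc z₁ ((pairingConn Z W cQ cR).map (X := X') (X' := Z') (Y := Y') (Y' := Y')
        (hod X'.1 Z'.1 a) LinearMap.id) +
      snoc z₂ ((pairingConn Z W cQ cR).map (X := X') (X' := Z') (Y := Y') (Y' := Y')
        (hev X'.1 Z'.1 a) LinearMap.id))) =
      boxSeq (word cQ X' (snoc x a)) (word cR Y' (snoc y b)) := by
  refine ((wordConn_add cQ cR _ _).trans (congrArg (_ + ·) (wordConn_add cQ cR _ _))).trans
    (IsRec.unique ((wordConn_snoc_isRec cQ cR z₀ _ _).add
    ((wordConn_snoc_isRec cQ cR z₁ _ _).add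
    (wordConn_snoc_isRec cQ cR z₂ _ _))) (boxSeq_isRec_snoc_snoc cQ cR x a y b) ?_)
  rw [h₀, h₁, h₂, word_wpar_seq]

/-- The combinatorial heart of multiplicativity, by induction on both words. The last letter of a
shuffle is that of the first or of the second word, and this matches the recursion of `boxSeq` given
by Pascal's rule and the product connection. -/
theorem wordConn_sh (x : (dg k Q f Z).Word X X') (y : (dg k R g W).Word Y Y') :
    wordConn cQ cR X' Y' ((pairingConn Z W cQ cR).sh X' x Y' y) =
      boxSeq (word cQ X' x) (word cR Y' y) := by
  refine word_induction (p := fun X' x => ∀ Y' (y : (dg k R g W).Word Y Y'),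
    wordConn cQ cR X' Y' ((pairingConn Z W cQ cR).sh X' x Y' y) =
    boxSeq (word cQ X' x) (word cR Y' y)) x (fun X' a Y' y => ?_)
    (fun X' U x a ih Y' y => ?_) (fun X' Y' y => funext fun N => ?_)
    (fun X' x x' hx hx' Y' y => funext fun N => ?_) Y' y
  · rw [Pairing.sh_base]
    exact wordConn_shBase cQ cR a y
  · refine word_induction (p := fun Y' y =>
      wordConn cQ cR X' Y' ((pairingConn Z W cQ cR).sh X' (snoc x a) Y' y) =
      boxSeq (word cQ X' (snoc x a)) (word cR Y' y)) y (fun Y' b => ?_) (fun Y' V y b ih2 => ?_)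
      (fun Y' => funext fun N => ?_)
      (fun Y' y y' hy hy' => funext fun N => ?_)
    · rw [Pairing.sh_snoc_base, ← wpar_base]
      exact wordConn_snoc_base cQ cR x a b (ih Y' (base b)) (ih Y' (wpar Y' (base b)))
    · rw [Pairing.sh_snoc_snoc]
      exact wordConn_snoc_snoc cQ cR x a y b ih2 (ih Y' (snoc y b)) (ih Y' (wpar Y' (snoc y b)))
    · rw [map_zero, map_zero, wordConn_zero]
      exact (boxSeq_zero_right _ N).symm
    · rw [map_add, map_add, wordConn_add, hy, hy']
      exact (boxSeq_add_right _ _ _ N).symm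
  · rw [map_zero, map_zero]
    exact (congrFun (wordConn_zero cQ cR) N).trans (boxSeq_zero_left _ N).symm
  · rw [map_add, map_add, Pi.add_apply, LinearMap.add_apply, wordConn_add, hx, hx']
    exact (boxSeq_add_left _ _ _ N).symm

end

end MF

end BoxWords


/-! ### Multiplicativity of the supertrace. -/

section Trace

set_option linter.unusedSectionVars false

open KaehlerDifferential DGCat

variable {k Q R : Type u} [Field k] [CommRing Q] [Algebra k Q] [CommRing R] [Algebra k R]

namespace MF

variable {f : Q} {g : R}

section

variable {X : MF k Q f} {Y : MF k R g}

/-- The trace may be computed in an arbitrary dual basis. -/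
theorem tr_eq_sum {ι : Type*} [Fintype ι] (e : ι → X.P) (φ : ι → (X.P →ₗ[Q] Q))
    (he : ∀ x, ∑ i, φ i x • e i = x) (Ψ : X.P →ₗ[Q] X.V) : tr Ψ = ∑ i, ctr (φ i) (Ψ (e i)) := by
  have h1 : ∀ j, Ψ (X.dualE j) = ∑ i, φ i (X.dualE j) • Ψ (e i) := fun j => by
    nth_rewrite 1 [← he (X.dualE j)]
    rw [map_sum]
    simp only [map_smul]
  have h2 : ∀ i, φ i = ∑ j, φ i (X.dualE j) • X.dualF j := fun i => LinearMap.ext fun x => by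
    nth_rewrite 1 [← dual_sum x]
    rw [map_sum, LinearMap.sum_apply]
    simp only [map_smul, LinearMap.smul_apply, smul_eq_mul, mul_comm]
  have h3 : ∀ i, ctr (φ i) (Ψ (e i)) =
      ∑ j, φ i (X.dualE j) • ctr (X.dualF j) (Ψ (e i)) := fun i => by
    nth_rewrite 1 [h2 i]
    exact ctr_sum_smul _ _ _ _
  unfold tr
  simp only [h1, h3, map_sum, map_smul]
  exact Finset.sum_comm

/-- The tensor product of linear forms on matrix factorizations. -/
noncomputable def tform (φ : X.P →ₗ[Q] Q) (ψ : Y.P →ₗ[R] R) :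
    (X.tensor Y).P →ₗ[Q ⊗[k] R] (Q ⊗[k] R) := extForm φ ψ

theorem dual_sum_tensor (x : (X.tensor Y).P) :
    ∑ ij : Fin X.dualN × Fin Y.dualN, tform (X.dualF ij.1) (Y.dualF ij.2) x •
      X.tmul Y (X.dualE ij.1) (Y.dualE ij.2) = x :=
  ext_dualBasis X.dualE X.dualF dual_sum Y.dualE Y.dualF dual_sum x

/-- The trace of the tensor product is defined by a dual basis unrelated to those of the factors.
Independence of the basis allows the product basis, in which traces factor. -/
theorem str_tensor_eq_sum (Φ : (X.tensor Y).V →ₗ[Q ⊗[k] R] (X.tensor Y).V) :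
    (X.tensor Y).str Φ = ∑ ij : Fin X.dualN × Fin Y.dualN,
      ctr (X := X.tensor Y) (tform (X.dualF ij.1) (Y.dualF ij.2))
        ((Φ ∘ₗ (X.tensor Y).incl ∘ₗ (X.tensor Y).par) (X.tmul Y (X.dualE ij.1) (Y.dualE ij.2))) :=
  tr_eq_sum (X := X.tensor Y) (fun ij : Fin X.dualN × Fin Y.dualN =>
    X.tmul Y (X.dualE ij.1) (Y.dualE ij.2)) (fun ij => tform (X.dualF ij.1) (Y.dualF ij.2))
    dual_sum_tensor _

theorem tform_tmul (φ : X.P →ₗ[Q] Q) (ψ : Y.P →ₗ[R] R) (x : X.P) (y : Y.P) :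
    tform φ ψ (X.tmul Y x y) = φ x ⊗ₜ[k] ψ y := rfl

theorem ctr_mu0 (φ : X.P →ₗ[Q] Q) (ψ : Y.P →ₗ[R] R) (v : X.V) (w : Y.V) :
    ctr (X := X.tensor Y) (tform φ ψ) (mu0 X Y v w) =
      Forms.fstMap k Q R (ctr φ v) * Forms.sndMap k Q R (ctr ψ w) := by
  induction v using TensorProduct.induction_on with
  | zero => simp
  | add x y hx hy => simp only [map_add, AddMonoidHom.add_apply, hx, hy, add_mul]
  | tmul ω x =>
    induction w using TensorProduct.induction_on with
    | zero => simp
    | add x y hx hy => simp only [map_add, hx, hy, mul_add]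
    | tmul η y =>
      rw [mu0_tmul, ctr_tmul, ctr_tmul, ctr_tmul, Forms.fstMap_smul, Forms.sndMap_smul,
        smul_mul_smul_comm, Algebra.TensorProduct.tmul_mul_tmul, one_mul, mul_one, tform_tmul]

theorem ctr_mu (φ : X.P →ₗ[Q] Q) (ψ : Y.P →ₗ[R] R) (v : X.V) (w : Y.V) :
    ctr (X := X.tensor Y) (tform φ ψ) (mu X Y v w) =
      Forms.fstMap k Q R (ctr φ ((evenPart k X.par).lTensor (Forms k Q) v)) *
          Forms.sndMap k Q R (ctr ψ w) +
        Forms.fstMap k Q R (ctr φ ((oddPart k X.par).lTensor (Forms k Q) v)) *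
          Forms.sndMap k Q R (Forms.sgn (ctr ψ w)) := by
  rw [mu_apply, map_add, ctr_mu0, ctr_mu0, ctr_sgn]

/-- In the product basis the double sum factors. Splitting the first coefficient by parity records
the sign with which the form of the second factor passes it. -/
theorem tr_mu (Φ : X.P →ₗ[Q] X.V) (Ψ : Y.P →ₗ[R] Y.V) :
    ∑ ij : Fin X.dualN × Fin Y.dualN, ctr (X := X.tensor Y) (tform (X.dualF ij.1) (Y.dualF ij.2))
      (mu X Y (Φ (X.dualE ij.1)) (Ψ (Y.dualE ij.2))) =
    Forms.fstMap k Q R (tr ((evenPart k X.par).lTensor (Forms k Q) ∘ₗ Φ)) *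
        Forms.sndMap k Q R (tr Ψ) +
      Forms.fstMap k Q R (tr ((oddPart k X.par).lTensor (Forms k Q) ∘ₗ Φ)) *
        Forms.sndMap k Q R (Forms.sgn (tr Ψ)) := by
  simp only [ctr_mu, Finset.sum_add_distrib, tr, LinearMap.comp_apply, map_sum,
    Finset.sum_mul_sum, Fintype.sum_prod_type]

variable [CharZero k]

theorem str_eq_parts (A : X.V →ₗ[Q] X.V) : X.str A =
    tr (A ∘ₗ X.incl ∘ₗ evenPart k X.par) - tr (A ∘ₗ X.incl ∘ₗ oddPart k X.par) := by
  rw [str_apply, tr, tr, tr, ← Finset.sum_sub_distrib]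
  refine Finset.sum_congr rfl fun i _ => ?_
  rw [← map_sub, LinearMap.comp_apply, LinearMap.comp_apply, LinearMap.comp_apply,
    LinearMap.comp_apply, LinearMap.comp_apply, LinearMap.comp_apply, ← map_sub, ← map_sub,
    evenPart_sub_oddPart]

theorem box_incl_par_tmul (A : X.V →ₗ[Q] X.V) (B : Y.V →ₗ[R] Y.V) (x : X.P) (y : Y.P) :
    (box A B ∘ₗ (X.tensor Y).incl ∘ₗ (X.tensor Y).par) (X.tmul Y x y) =
      mu X Y ((A ∘ₗ X.incl ∘ₗ evenPart k X.par) x) ((B ∘ₗ Y.incl ∘ₗ Y.par) y) -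
        mu X Y ((A ∘ₗ X.incl ∘ₗ oddPart k X.par) x)
          ((opar Y Y B ∘ₗ Y.incl ∘ₗ Y.par) y) := by
  refine (congrArg (fun z => box A B (1 ⊗ₜ z)) (par_tmul X Y x y)).trans ?_
  rw [box_one, boxV_apply, evenPart_vpar_one_tmul, oddPart_vpar_one_tmul, evenPart_apply X.par_par,
    oddPart_apply X.par_par, TensorProduct.tmul_neg, map_neg, map_neg, AddMonoidHom.neg_apply,
    ← sub_eq_add_neg]
  rfl

theorem tr_zero : tr (0 : X.P →ₗ[Q] X.V) = 0 := Finset.sum_eq_zero fun _ _ => map_zero _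

/-- By cyclicity of the trace, a projection applied to the coefficients can be moved to the
argument. There the even and odd projections are orthogonal idempotents, so the mixed terms vanish.
-/
theorem tr_parts (A : X.V →ₗ[Q] X.V) :
    tr ((evenPart k X.par).lTensor (Forms k Q) ∘ₗ A ∘ₗ X.incl ∘ₗ evenPart k X.par) =
        tr (A ∘ₗ X.incl ∘ₗ evenPart k X.par) ∧
      tr ((oddPart k X.par).lTensor (Forms k Q) ∘ₗ A ∘ₗ X.incl ∘ₗ evenPart k X.par) = 0 ∧
      tr ((evenPart k X.par).lTensor (Forms k Q) ∘ₗ A ∘ₗ X.incl ∘ₗ oddPart k X.par) = 0 ∧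
      tr ((oddPart k X.par).lTensor (Forms k Q) ∘ₗ A ∘ₗ X.incl ∘ₗ oddPart k X.par) =
        tr (A ∘ₗ X.incl ∘ₗ oddPart k X.par) := by
  have e1 : evenPart k X.par ∘ₗ evenPart k X.par = evenPart k X.par := LinearMap.ext fun x =>
    evenPart_of_eq (apply_evenPart X.par_par x)
  have e2 : oddPart k X.par ∘ₗ evenPart k X.par = 0 := LinearMap.ext fun x =>
    oddPart_of_eq (apply_evenPart X.par_par x)
  have e3 : evenPart k X.par ∘ₗ oddPart k X.par = 0 := LinearMap.ext fun x =>
    evenPart_of_eq_neg (apply_oddPart X.par_par x)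
  have e4 : oddPart k X.par ∘ₗ oddPart k X.par = oddPart k X.par := LinearMap.ext fun x =>
    oddPart_of_eq_neg (apply_oddPart X.par_par x)
  have t : ∀ a b : X.P →ₗ[Q] X.P, tr (b.lTensor (Forms k Q) ∘ₗ A ∘ₗ X.incl ∘ₗ a) =
      tr (A ∘ₗ X.incl ∘ₗ a ∘ₗ b) := fun a b => (tr_comm (A ∘ₗ X.incl ∘ₗ a) b).symm
  refine ⟨?_, ?_, ?_, ?_⟩
  · rw [t, e1]
  · rw [t, e3, LinearMap.comp_zero, LinearMap.comp_zero, tr_zero]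
  · rw [t, e2, LinearMap.comp_zero, LinearMap.comp_zero, tr_zero]
  · rw [t, e4]

/-- The supertrace is multiplicative. -/
theorem str_box (A : X.V →ₗ[Q] X.V) (B : Y.V →ₗ[R] Y.V) :
    (X.tensor Y).str (box A B) =
      Forms.fstMap k Q R (X.str A) * Forms.sndMap k Q R (Y.str B) := by
  obtain ⟨h1, h2, h3, h4⟩ := tr_parts A
  rw [str_tensor_eq_sum]
  simp only [box_incl_par_tmul, map_sub, Finset.sum_sub_distrib]
  -- On the odd part of X there are two signs of the form attached to `B`, one from the Koszul rule
  -- for operators and one from the external product. They cancel, and the even and odd traces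
  -- recombine into the supertrace of `A`.
  rw [tr_mu, tr_mu, h1, h2, h3, h4, map_zero, zero_mul, zero_mul, add_zero, zero_add, ← str_apply,
    ← str_apply, str_opar, Forms.sgn_sgn, ← sub_mul, ← map_sub, ← str_eq_parts]

end

end MF

end Trace


/-! ### Multiplicativity of the HKR maps and change of connection. -/

section Multiplicativity

set_option linter.unusedSectionVars false

open KaehlerDifferential DGCat

/-- A Cauchy product of finite sums whose truncation bounds are unrelated. Beyond `c` only the
vanishing of whole antidiagonal sums is required, so the bound for forms on Q ⊗ R need not be
compared with those for Q and R. -/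
theorem sum_range_antidiagonal {S : Type*} [Semiring S] (p q : ℕ → S) {a b c : ℕ}
    (hp : ∀ i, a ≤ i → p i = 0) (hq : ∀ i, b ≤ i → q i = 0)
    (hc : ∀ N, c ≤ N → ∑ ij ∈ Finset.HasAntidiagonal.antidiagonal N, p ij.1 * q ij.2 = 0) :
    ∑ N ∈ Finset.range c, ∑ ij ∈ Finset.HasAntidiagonal.antidiagonal N, p ij.1 * q ij.2 =
      (∑ i ∈ Finset.range a, p i) * ∑ j ∈ Finset.range b, q j := by
  have h1 : ∀ N, ∑ ij ∈ Finset.HasAntidiagonal.antidiagonal N, p ij.1 * q ij.2 =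
      ∑ ij ∈ (Finset.range a ×ˢ Finset.range b) with ij.1 + ij.2 = N, p ij.1 * q ij.2 := fun N => by
    refine (Finset.sum_subset (fun ij h => ?_) (fun ij h h' => ?_)).symm
    · rw [Finset.mem_filter] at h
      exact Finset.HasAntidiagonal.mem_antidiagonal.2 h.2
    · rw [Finset.HasAntidiagonal.mem_antidiagonal] at h
      by_cases ha : a ≤ ij.1
      · rw [hp _ ha, zero_mul]
      · have hb : b ≤ ij.2 := by
          by_contra hb
          exact h' (Finset.mem_filter.2 ⟨Finset.mem_product.2
            ⟨Finset.mem_range.2 (not_le.1 ha), Finset.mem_range.2 (not_le.1 hb)⟩, h⟩)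
        rw [hq _ hb, mul_zero]
  -- The range is enlarged until it contains i + j for all i < a and j < b; the added terms vanish
  -- by `hc`.
  have h2 : ∑ N ∈ Finset.range c, ∑ ij ∈ Finset.HasAntidiagonal.antidiagonal N, p ij.1 * q ij.2 =
      ∑ N ∈ Finset.range (a + b + c), ∑ ij ∈ Finset.HasAntidiagonal.antidiagonal N,
        p ij.1 * q ij.2 :=
    Finset.sum_subset (Finset.range_subset_range.2 (Nat.le_add_left _ _)) fun N _ h =>
      hc N (not_lt.1 fun h' => h (Finset.mem_range.2 h'))
  rw [h2, Finset.sum_congr rfl fun N _ => h1 N, Finset.sum_fiberwise_of_maps_to fun ij h => ?_,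
    Finset.sum_mul_sum, Finset.sum_product]
  rw [Finset.mem_product, Finset.mem_range, Finset.mem_range] at h
  exact Finset.mem_range.2 (by omega)

variable {k Q R : Type u} [Field k] [CommRing Q] [Algebra k Q] [CommRing R] [Algebra k R]
  [CharZero k]

namespace MF

variable {f : Q} {g : R}

section

variable {X : MF k Q f} {Y : MF k R g}

theorem str_boxSeq (A : ℕ → (X.V →ₗ[Q] X.V)) (B : ℕ → (Y.V →ₗ[R] Y.V)) (N : ℕ) :
    (X.tensor Y).str (boxSeq A B N) = ∑ ij ∈ Finset.HasAntidiagonal.antidiagonal N,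
      N.choose ij.1 • (Forms.fstMap k Q R (X.str (A ij.1)) *
        Forms.sndMap k Q R (Y.str (B ij.2))) := by
  unfold boxSeq
  rw [map_sum]
  refine Finset.sum_congr rfl fun ij _ => ?_
  rw [← str_box]
  exact map_nsmul ((X.tensor Y).str) _ _

/-- The supertraces of `boxSeq A B`, divided by factorials, are the products of those of `A` and
`B`. -/
theorem factorial_smul_str_boxSeq (A : ℕ → (X.V →ₗ[Q] X.V)) (B : ℕ → (Y.V →ₗ[R] Y.V)) (N : ℕ) :
    algebraMap k (Q ⊗[k] R) ((N.factorial : k)⁻¹) • (X.tensor Y).str (boxSeq A B N) =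
      ∑ ij ∈ Finset.HasAntidiagonal.antidiagonal N,
        Forms.fstMap k Q R (algebraMap k Q ((ij.1.factorial : k)⁻¹) • X.str (A ij.1)) *
          Forms.sndMap k Q R (algebraMap k R ((ij.2.factorial : k)⁻¹) • Y.str (B ij.2)) := by
  rw [str_boxSeq, Finset.smul_sum]
  refine Finset.sum_congr rfl fun ij h => ?_
  rw [Finset.HasAntidiagonal.mem_antidiagonal] at h
  subst h
  -- Dividing the binomial coefficient by (i + j)! leaves 1/(i! j!), the coefficients of the two
  -- separate HKR series.
  have h1 : ((ij.1 + ij.2).factorial : k)⁻¹ * ((ij.1 + ij.2).choose ij.1 : k) =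
      (ij.1.factorial : k)⁻¹ * (ij.2.factorial : k)⁻¹ := by
    have := Nat.add_choose_mul_factorial_mul_factorial ij.1 ij.2
    have h2 : ((ij.1 + ij.2).factorial : k) ≠ 0 := Nat.cast_ne_zero.2 (Nat.factorial_ne_zero _)
    have h3 : (ij.1.factorial : k) ≠ 0 := Nat.cast_ne_zero.2 (Nat.factorial_ne_zero _)
    have h4 : (ij.2.factorial : k) ≠ 0 := Nat.cast_ne_zero.2 (Nat.factorial_ne_zero _)
    field_simp
    exact_mod_cast (by rw [← this, Nat.choose_symm_add])
  simp only [algebraMap_smul]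
  rw [← Nat.cast_smul_eq_nsmul k, smul_smul, h1, _root_.map_smul, _root_.map_smul,
    smul_mul_smul_comm]

end

variable {Z : Set (PrimeSpectrum Q)} {W : Set (PrimeSpectrum R)}
  (cQ : ∀ X : MF k Q f, X.Connection) (cR : ∀ Y : MF k R g, Y.Connection)

theorem hkrTerm_sh {X : (dg k Q f Z).Obj} {Y : (dg k R g W).Obj} (x : (dg k Q f Z).Word X X)
    (y : (dg k R g W).Word Y Y) (N : ℕ) :
    Indexed.hkrTerm (o := WithConn.mf) tautConn N ((pairingConn Z W cQ cR).obj X Y)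
      ((pairingConn Z W cQ cR).sh X x Y y) =
      ∑ ij ∈ Finset.HasAntidiagonal.antidiagonal N,
        Forms.fstMap k Q R (hkrTerm cQ ij.1 X x) * Forms.sndMap k Q R (hkrTerm cR ij.2 Y y) :=
  (congrArg (fun G : ℕ → _ => algebraMap k (Q ⊗[k] R) ((N.factorial : k)⁻¹) •
    (X.1.tensor Y.1).str (G N)) (wordConn_sh cQ cR x y)).trans (factorial_smul_str_boxSeq _ _ N)

/-- The dg-functor endowing matrix factorizations with chosen connections. -/
noncomputable def toConn (Z : Set (PrimeSpectrum Q)) (c : ∀ X : MF k Q f, X.Connection) :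
    Functor (dg k Q f Z) (dgConn k Q f) where
  obj X := ⟨X.1, c X.1⟩
  map := LinearMap.id
  map_one _ := rfl
  map_comp _ _ := rfl
  par_map _ := rfl
  d_map _ := rfl

/-- The dg-functor replacing the connections by chosen ones. -/
noncomputable def replaceConn (c : ∀ X : MF k Q f, X.Connection) :
    Functor (dgConn k Q f) (dgConn k Q f) where
  obj X := ⟨X.1, c X.1⟩
  map := LinearMap.id
  map_one _ := rfl
  map_comp _ _ := rfl
  par_map _ := rfl
  d_map _ := rfl

/-- Connections do not enter into the morphisms, so the identity map of the underlying matrix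
factorization is a natural isomorphism from this functor to the identity. This is the independence
of the HKR map from connections, in the form that is needed. -/
theorem toD_map_replaceConn (c : ∀ X : MF k Q f, X.Connection) :
    (toD k Q).map (replaceConn c).hhMap = 𝟙 _ :=
  toD_map_hhMap_eq_id (C := dgConn k Q f) (G := replaceConn c)
    (η := fun X => (LinearMap.id : X.1.P →ₗ[Q] X.1.P))
    (θ := fun X => (LinearMap.id : X.1.P →ₗ[Q] X.1.P))
    (fun X => (dgConn k Q f).par_one X) (fun X => (dgConn k Q f).d_one X)
    (fun X => (dgConn k Q f).par_one X) (fun X => (dgConn k Q f).d_one X) (fun _ => rfl)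
    fun _ => rfl

/-- Once the connection is overwritten by `c`, it no longer matters that the tensor product first
carried the product connection. -/
theorem pairingConn_comp_replaceConn
    (c : ∀ X : MF k (Q ⊗[k] R) (f ⊗ₜ[k] (1 : R) + (1 : Q) ⊗ₜ[k] g), X.Connection) :
    (pairingConn Z W cQ cR).comp (replaceConn c) =
      (pairing Z W).comp (toConn (prodSet k Z W) c) := rfl

theorem word_toConn (c : ∀ X : MF k Q f, X.Connection) {X Y : (dg k Q f Z).Obj}
    (x : (dg k Q f Z).Word X Y) (N : ℕ) :
    Indexed.word (o := WithConn.mf) tautConn ((toConn Z c).obj Y) ((toConn Z c).word Y x) N =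
      word c Y x N := by
  refine word_induction (p := fun Y x => ∀ N, Indexed.word (o := WithConn.mf) tautConn
    ((toConn Z c).obj Y) ((toConn Z c).word Y x) N = word c Y x N) x
    (fun Y a N => ?_) (fun Y Z' x a h N => ?_) (fun Y N => ?_) (fun Y x y hx hy N => ?_) N
  · rw [Functor.word_base]
    exact (Indexed.word_base _ _ _).trans (word_base c a N).symm
  · rw [Functor.word_snoc]
    refine (congrFun (Indexed.word_snoc (o := WithConn.mf) tautConn _ _) N).trans
      (Eq.trans ?_ (congrFun (word_snoc c x a) N).symm)
    exact congrArg (fun G => app (c Y.1) (c Z'.1) G a N) (funext h)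
  · rw [map_zero, map_zero, map_zero]; rfl
  · rw [map_add, map_add, map_add, Pi.add_apply, hx, hy]; rfl

variable [Module.Finite Q Ω[Q⁄k]] [Module.Finite R Ω[R⁄k]]
  [Module.Finite (Q ⊗[k] R) Ω[(Q ⊗[k] R)⁄k]]

theorem hkrLin_sh {X : (dg k Q f Z).Obj} {Y : (dg k R g W).Obj} (x : (dg k Q f Z).Word X X)
    (y : (dg k R g W).Word Y Y) :
    Indexed.hkrLin (o := WithConn.mf) tautConn (close _ ((pairingConn Z W cQ cR).sh X x Y y)) =
      Forms.fstMap k Q R (hkrLin Z cQ (close X x)) *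
        Forms.sndMap k Q R (hkrLin W cR (close Y y)) := by
  rw [Indexed.hkrLin_close, hkrLin_close, hkrLin_close, map_sum, map_sum]
  refine (Finset.sum_congr rfl fun N _ => hkrTerm_sh cQ cR x y N).trans ?_
  refine sum_range_antidiagonal (fun i => Forms.fstMap k Q R (hkrTerm cQ i X x))
    (fun j => Forms.sndMap k Q R (hkrTerm cR j Y y)) (fun i h => ?_) (fun j h => ?_) fun N h => ?_
  · rw [hkrTerm_eq_zero cQ i h, map_zero]
  · rw [hkrTerm_eq_zero cR j h, map_zero]
  -- The antidiagonal sum is itself a term of the HKR map over Q ⊗ R, so it vanishes beyond the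
  -- bound there.
  · rw [← hkrTerm_sh]
    exact Indexed.hkrTerm_eq_zero _ N h _

theorem hkrLin_kun (x : (dg k Q f Z).HHSpace) (y : (dg k R g W).HHSpace) :
    Indexed.hkrLin (o := WithConn.mf) tautConn ((pairingConn Z W cQ cR).kun x y) =
      Forms.fstMap k Q R (hkrLin Z cQ x) * Forms.sndMap k Q R (hkrLin W cR y) := by
  refine Pairing.hh_induction₂ (p := fun x y =>
    Indexed.hkrLin (o := WithConn.mf) tautConn ((pairingConn Z W cQ cR).kun x y) =
      Forms.fstMap k Q R (hkrLin Z cQ x) * Forms.sndMap k Q R (hkrLin W cR y)) x y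
    (fun X x Y y => ?_) (fun y => by simp) (fun x => by simp) (fun x x' y h h' => ?_)
    (fun x y y' h h' => ?_)
  · rw [Pairing.kun_close, hkrLin_sh]
  · rw [map_add, LinearMap.add_apply, map_add, h, h', map_add, map_add, add_mul]
  · rw [map_add, map_add, h, h', map_add, map_add, mul_add]

/-- The HKR maps for the tensor products of connections are multiplicative. -/
theorem kunneth_hkr_pairingConn : (pairingConn Z W cQ cR).kunneth ≫
      Indexed.hkr (o := WithConn.mf) tautConn =
    SCpx.tensorMap (hkr Z cQ) (hkr W cR) ≫ Forms.wedge k f g := by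
  ext x
  induction x using SCpx.tensor_induction with
  | zero => rw [map_zero, map_zero]
  | add x y hx hy => rw [map_add, map_add, hx, hy]
  | tmul m n => exact congrArg ULift.up (hkrLin_kun cQ cR m n)

theorem hkrTerm_toConn (c : ∀ X : MF k Q f, X.Connection) {X : (dg k Q f Z).Obj}
    (x : (dg k Q f Z).Word X X) (N : ℕ) : Indexed.hkrTerm (o := WithConn.mf) tautConn N
      ((toConn Z c).obj X) ((toConn Z c).word X x) = hkrTerm c N X x :=
  congrArg (fun T => algebraMap k Q ((N.factorial : k)⁻¹) • X.1.str T) (word_toConn c x N)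

theorem hkrLin_toConn (c : ∀ X : MF k Q f, X.Connection) (x : (dg k Q f Z).HHSpace) :
    hkrLin Z c x = Indexed.hkrLin (o := WithConn.mf) tautConn ((toConn Z c).hhLin x) := by
  refine hh_induction (p := fun x => hkrLin Z c x =
    Indexed.hkrLin (o := WithConn.mf) tautConn ((toConn Z c).hhLin x)) x
    (fun X x => ?_) (by rw [map_zero, map_zero, map_zero])
    (fun x y hx hy => by rw [map_add, map_add, map_add, hx, hy])
  rw [Functor.hhLin_close, hkrLin_close, Indexed.hkrLin_close]
  exact Finset.sum_congr rfl fun N _ => (hkrTerm_toConn c x N).symm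

/-- The HKR map for any choice of connections factors through the tautological one, so that all
choices can be compared inside `dgConn`. -/
theorem hkr_eq_toConn (c : ∀ X : MF k Q f, X.Connection) :
    hkr Z c = (toConn Z c).hhMap ≫ Indexed.hkr (o := WithConn.mf) tautConn := by
  ext x
  exact congrArg ULift.up (hkrLin_toConn c x)

/-- The HKR maps are multiplicative in the derived category, for arbitrary connections. -/
theorem toD_map_starTilde_hkr
    (c : ∀ X : MF k (Q ⊗[k] R) (f ⊗ₜ[k] (1 : R) + (1 : Q) ⊗ₜ[k] g), X.Connection) :
    (toD k (Q ⊗[k] R)).map (starTilde f g Z W ≫ hkr (prodSet k Z W) c) =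
      (toD k (Q ⊗[k] R)).map
        (SCpx.tensorMap (hkr Z cQ) (hkr W cR) ≫ Forms.wedge k f g) := by
  -- The bifunctor sending (X, Y) to X ⊗ Y with the connection `c` is reached in two ways: by
  -- attaching `c` to the tensor product, or by overwriting the product connection. The second step
  -- of the latter route is the identity in the derived category.
  have e1 : starTilde f g Z W ≫ (toConn (prodSet k Z W) c).hhMap =
      ((pairing Z W).comp (toConn (prodSet k Z W) c)).kunneth :=
    (pairing Z W).kunneth_comp _
  have e2 : (pairingConn Z W cQ cR).kunneth ≫ (replaceConn c).hhMap =
      ((pairingConn Z W cQ cR).comp (replaceConn c)).kunneth :=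
    (pairingConn Z W cQ cR).kunneth_comp _
  have e3 : ((pairing Z W).comp (toConn (prodSet k Z W) c)).kunneth =
      ((pairingConn Z W cQ cR).comp (replaceConn c)).kunneth :=
    by rw [pairingConn_comp_replaceConn]
  have e := (e1.trans e3).trans e2.symm
  rw [hkr_eq_toConn, ← Category.assoc, e, ← kunneth_hkr_pairingConn, Category.assoc,
    CategoryTheory.Functor.map_comp, CategoryTheory.Functor.map_comp, toD_map_replaceConn,
    Category.id_comp, CategoryTheory.Functor.map_comp]

end MF

end Multiplicativity


/-! ### Compatibility with the derived tensor product, and the square. -/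

section Square

variable {k Q R : Type u} [Field k] [CommRing Q] [Algebra k Q] [CommRing R] [Algebra k R]
  [CharZero k]

theorem derivedTensorIso_naturality {M M' : SCpx k Q} {N N' : SCpx k R} (a : M ⟶ M') (b : N ⟶ N') :
    (derivedTensor k Q R).map (Prod.mkHom ((toD k Q).map a) ((toD k R).map b)) ≫
        (derivedTensorIso M' N').hom =
      (derivedTensorIso M N).hom ≫ (toD k (Q ⊗[k] R)).map (SCpx.tensorMap a b) :=
  (Localization.fac (tensorFunctor k Q R ⋙ toD k (Q ⊗[k] R)) tensorFunctor_inverts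
    ((toD k Q).prod (toD k R))).hom.naturality (X := (M, N)) (Y := (M', N')) (Prod.mkHom a b)

/-- The composite of lifts along augmentations with the derived tensor product of augmentations. -/
theorem derivedTensor_map_lift {M M' : SCpx k Q} {N N' : SCpx k R} {s : List Q} {t : List R}
    {a : M ⟶ M'} {b : N ⟶ N'} {ε : (toD k Q).obj M ⟶ (toD k Q).obj (RGam s M')}
    {ε' : (toD k R).obj N ⟶ (toD k R).obj (RGam t N')}
    (h : ε ≫ (toD k Q).map (RGamAug s M') = (toD k Q).map a)
    (h' : ε' ≫ (toD k R).map (RGamAug t N') = (toD k R).map b) :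
    (derivedTensor k Q R).map (Prod.mkHom ε ε') ≫ (derivedTensorIso (RGam s M') (RGam t N')).hom ≫
        (toD k (Q ⊗[k] R)).map (SCpx.tensorMap (RGamAug s M') (RGamAug t N')) =
      (derivedTensorIso M N).hom ≫ (toD k (Q ⊗[k] R)).map (SCpx.tensorMap a b) := by
  rw [← derivedTensorIso_naturality, ← derivedTensorIso_naturality, ← Category.assoc,
    ← Functor.map_comp, ← h, ← h']
  rfl

end Square

end MFHKR

theorem mainTheorem5 {k Q R : Type u} [Field k] [CharZero k]
    [CommRing Q] [Algebra k Q] [Algebra.EssFiniteType k Q] [Algebra.FormallySmooth k Q]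
    [CommRing R] [Algebra k R] [Algebra.EssFiniteType k R] [Algebra.FormallySmooth k R]
    (f : Q) (g : R) (Z : Set (PrimeSpectrum Q)) (W : Set (PrimeSpectrum R))
    (hZ : IsClosed Z) (hW : IsClosed W) (s : List Q) (t : List R) (r : List (Q ⊗[k] R))
    (hs : PrimeSpectrum.zeroLocus {x | x ∈ s} = Z) (ht : PrimeSpectrum.zeroLocus {x | x ∈ t} = W)
    (hr : PrimeSpectrum.zeroLocus {x | x ∈ r} = MFHKR.prodSet k Z W)
    (cQ : ∀ X : MFHKR.MF k Q f, X.Connection) (cR : ∀ Y : MFHKR.MF k R g, Y.Connection)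
    (cQR : ∀ X : MFHKR.MF k (Q ⊗[k] R) (f ⊗ₜ[k] (1 : R) + (1 : Q) ⊗ₜ[k] g), X.Connection) :
    ∃ εQ εR εQR w,
      MFHKR.IsUniqueLift s ((MFHKR.toD k Q).map (MFHKR.MF.hkr Z cQ)) εQ ∧
      MFHKR.IsUniqueLift t ((MFHKR.toD k R).map (MFHKR.MF.hkr W cR)) εR ∧
      MFHKR.IsUniqueLift r
        ((MFHKR.toD k (Q ⊗[k] R)).map (MFHKR.MF.hkr (MFHKR.prodSet k Z W) cQR)) εQR ∧
      MFHKR.IsUniqueLift r ((MFHKR.toD k (Q ⊗[k] R)).map (MFHKR.wedgeGam s t f g)) w ∧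
      (MFHKR.derivedTensor k Q R).map (Prod.mkHom εQ εR) ≫
          (MFHKR.derivedTensorIso
            (MFHKR.RGam s (MFHKR.Forms.cpx k f)) (MFHKR.RGam t (MFHKR.Forms.cpx k g))).hom ≫ w =
        (MFHKR.derivedTensorIso
            (MFHKR.DGCat.HH (MFHKR.MF.dg k Q f Z)) (MFHKR.DGCat.HH (MFHKR.MF.dg k R g W))).hom ≫
          (MFHKR.toD k (Q ⊗[k] R)).map (MFHKR.starTilde f g Z W) ≫ εQR := by
  have torsQ := MFHKR.MF.mem_torsionIdeal_HH_dg (k := k) (f := f) hs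
  have torsR := MFHKR.MF.mem_torsionIdeal_HH_dg (k := k) (f := g) ht
  obtain ⟨εQ, hQ⟩ := MFHKR.exists_isUniqueLift s torsQ ((MFHKR.toD k Q).map (MFHKR.MF.hkr Z cQ))
  obtain ⟨εR, hR⟩ := MFHKR.exists_isUniqueLift t torsR ((MFHKR.toD k R).map (MFHKR.MF.hkr W cR))
  obtain ⟨εQR, hQR⟩ := MFHKR.exists_isUniqueLift r (MFHKR.MF.mem_torsionIdeal_HH_dg hr)
    ((MFHKR.toD k (Q ⊗[k] R)).map (MFHKR.MF.hkr (MFHKR.prodSet k Z W) cQR))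
  -- Here the source is the tensor product of two local cohomology complexes, which is torsion for
  -- both sets of generators by construction, hence along Z × W.
  obtain ⟨w, hw⟩ := MFHKR.exists_isUniqueLift r (MFHKR.mem_torsionIdeal_tensor hs ht hr
    (fun a ha => MFHKR.mem_torsionIdeal_RGam s (MFHKR.Forms.cpx k f) ha)
    (fun a ha => MFHKR.mem_torsionIdeal_RGam t (MFHKR.Forms.cpx k g) ha))
    ((MFHKR.toD k (Q ⊗[k] R)).map (MFHKR.wedgeGam s t f g))
  refine ⟨εQ, εR, εQR, w, hQ, hR, hQR, hw, ?_⟩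
  -- The source is replaced by the tensor product of the Hochschild complexes themselves, an honest
  -- complex, to which the torsion criterion applies.
  rw [← Iso.inv_comp_eq]
  -- Its homology is torsion along Z × W, so it is enough to compare the two composites with the
  -- augmentation. There they become the product of the two HKR maps followed by the product of
  -- forms, and the HKR map of the shuffle product; these agree for all choices of connections.
  refine MFHKR.IsUniqueLift.eq (MFHKR.mem_torsionIdeal_tensor hs ht hr torsQ torsR) ?_
  rw [Category.assoc, Category.assoc, Category.assoc, Category.assoc, hw.1, hQR.1,
    Iso.inv_comp_eq, ← Functor.map_comp, MFHKR.MF.toD_map_starTilde_hkr cQ cR cQR,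
    MFHKR.wedgeGam, Functor.map_comp, Functor.map_comp, ← Category.assoc, ← Category.assoc,
    ← Category.assoc, Category.assoc ((MFHKR.derivedTensor k Q R).map _),
    MFHKR.derivedTensor_map_lift hQ.1 hR.1]
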